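/- Let $x=(x^0,\dots,x^3)\in\mathbb R^4$ with metric $\eta=\mathrm{diag}(-1,1,1,1)$, $\square=\eta^{mn}\partial_m\partial_n$, let $\sigma^0=-1$ and let $\sigma^1,\sigma^2,\sigma^3$ be the Pauli matrices, $\varepsilon^{12}=1=-\varepsilon^{21}$, $\varepsilon_{\alpha\beta}=-\varepsilon^{\alpha\beta}$ (and likewise for dotted indices). Let $\theta_a^{\alpha},\bar\theta_a^{\dot\alpha}$ ($a=1,2$; $\alpha,\dot\alpha=1,2$) be eight anticommuting variables. A two-point function (distribution) $F(z_1,z_2)$, $z_a=(x_a,\theta_a,\bar\theta_a)$, is a finite expansion in the $\theta_a,\bar\theta_a$ whose coefficients are complex-valued smooth functions (distributions) of $(x_1,x_2)\in\mathbb R^4\times\mathbb R^4$. On the variable $z_a$ put $$Q_\alpha=\frac{\partial}{\partial\theta^\alpha}-i\sigma^m_{\alpha\dot\alpha}\bar\theta^{\dot\alpha}\partial_m,\qquad \bar Q_{\dot\alpha}=-\frac{\partial}{\partial\bar\theta^{\dot\alpha}}+i\theta^\alpha\sigma^m_{\alpha\dot\alpha}\partial_m ,$$ and on the first variable $z_1$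 $$D_\alpha=\frac{\partial}{\partial\theta^\alpha}+i\sigma^m_{\alpha\dot\alpha}\bar\theta^{\dot\alpha}\partial_m,\qquad \bar D_{\dot\alpha}=-\frac{\partial}{\partial\bar\theta^{\dot\alpha}}-i\theta^\alpha\sigma^m_{\alpha\dot\alpha}\partial_m ,$$ $D^2=\varepsilon^{\alpha\beta}D_\beta D_\alpha$, $\bar D^2=\varepsilon^{\dot\alpha\dot\beta}\bar D_{\dot\alpha}\bar D_{\dot\beta}$, $D^\alpha\bar D^2D_\alpha=\varepsilon^{\alpha\beta}D_\beta\bar D^2D_\alpha$. Call $F$ invariant if $(Q_1+Q_2)_\alpha F=0=(\bar Q_1+\bar Q_2)_{\dot\alpha}F$ for all $\alpha,\dot\alpha$ (the indices $1,2$ on $Q$ indicating the variable acted on) and if $F$ is unchanged by simultaneous restricted Lorentz transformations of both points, i.e. by the action of $A\in SL(2,\mathbb C)$ on $x_a$ through $x_m\sigma^m\mapsto A\,x_m\sigma^m A^\dagger$ and on $\theta_a,\bar\theta_a$ through the corresponding spinor representations. Lorentz invariance of a function or distribution on $\mathbb R^4$ means invariance under these transformations of $x$. Let $\delta(\theta_1-\theta_2)\delta(\bar\theta_1-\bar\theta_2)=(\theta_1-\theta_2)^2(\bar\theta_1-\bar\theta_2)^2$,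 with $\zeta^2=\varepsilon_{\alpha\beta}\zeta^\alpha\zeta^\beta$ and $\bar\zeta^2=\varepsilon_{\dot\alpha\dot\beta}\bar\zeta^{\dot\beta}\bar\zeta^{\dot\alpha}$, and $$P_c=\frac{D^2\bar D^2}{16\,\square},\quad P_a=\frac{\bar D^2D^2}{16\,\square},\quad P_T=-\frac{D^\alpha\bar D^2D_\alpha}{8\,\square},\quad P_+=\frac{D^2}{4\,\square^{1/2}},\quad P_-=\frac{\bar D^2}{4\,\square^{1/2}},$$ where the denominators are understood as acting on $G_i$: for $i=c,a,T$, $\square^{-1}G_i$ stands for any Lorentz-invariant solution $H_i$ of $\square H_i=G_i$, and $\square^{-1/2}G_\pm$ is a formal notation for an arbitrary Lorentz-invariant $H_\pm$. **Theorem 1.** A two-point function (distribution) $F(z_1,z_2)$ is invariant if and only if $$F=\sum_{i=c,a,T,+,-}P_i\,\delta(\theta_1-\theta_2)\,\delta(\bar\theta_1-\bar\theta_2)\,G_i(x_1-x_2)$$ with Lorentz-invariant functions (distributions) $G_c,G_a,G_T,G_+,G_-$ on $\mathbb R^4$ (for $i=\pm$: $H_\pm$) of the same class (smooth functions, respectively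 distributions). (The constant solution is included: it is the term $i=c$ with $H_c$ constant.) Moreover, for every Lorentz-invariant function (distribution) $G$ on $\mathbb R^4$, the equation $\square H=G$ has a Lorentz-invariant solution $H$ of the same class, so that the terms $i=c,a,T$ are defined for every $G_i$. -/

import Mathlib

open scoped Distributions TensorProduct ContDiff

noncomputable section

namespace SuperTwoPoint

/-! ### Minkowski space, Pauli matrices, Lorentz transformations -/

/-- Points `x = (x⁰, x¹, x², x³)`. -/
abbrev Spacetime : Type := Fin 4 → ℝ

/-- The space of pairs `(x₁, x₂)`. -/
abbrev Spacetime2 : Type := Spacetime × Spacetime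

/-- The diagonal of the Minkowski metric `diag(-1, 1, 1, 1)`. -/
def eta (m : Fin 4) : ℂ := if m = 0 then -1 else 1

/-- The matrices `σ^m_{α α̇}` (Wess-Bagger convention, `σ⁰ = -1`). -/
def sigma : Fin 4 → Matrix (Fin 2) (Fin 2) ℂ :=
  ![!![-1, 0; 0, -1], !![0, 1; 1, 0], !![0, -Complex.I; Complex.I, 0], !![1, 0; 0, -1]]

/-- The antisymmetric symbol `ε^{αβ}` (dotted and undotted), `ε^{12} = 1`; the symbol with lower
indices is `ε_{αβ} = -ε^{αβ}`. -/
def eps : Matrix (Fin 2) (Fin 2) ℂ := !![0, 1; -1, 0]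

/-- The Hermitian matrix `x_m σ^m = x⁰ + x¹σ¹ + x²σ² + x³σ³` of a point. -/
def toHerm : Spacetime →ₗ[ℝ] Matrix (Fin 2) (Fin 2) ℂ where
  toFun x := !![(x 0 : ℂ) + x 3, x 1 - x 2 * Complex.I; x 1 + x 2 * Complex.I, x 0 - x 3]
  map_add' x y := by
    ext i j; fin_cases i <;> fin_cases j <;> simp <;> ring
  map_smul' c x := by
    ext i j; fin_cases i <;> fin_cases j <;> simp <;> ring

/-- The point of a Hermitian matrix. -/
def ofHerm : Matrix (Fin 2) (Fin 2) ℂ →ₗ[ℝ] Spacetime where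
  toFun Y := ![((Y 0 0).re + (Y 1 1).re) / 2, (Y 1 0).re, (Y 1 0).im,
    ((Y 0 0).re - (Y 1 1).re) / 2]
  map_add' x y := by
    ext i; fin_cases i <;> simp <;> ring
  map_smul' c x := by
    ext i; fin_cases i <;> simp <;> ring

lemma ofHerm_toHerm (x : Spacetime) : ofHerm (toHerm x) = x := by
  ext i; fin_cases i <;> simp [ofHerm, toHerm]

lemma toHerm_ofHerm (Y : Matrix (Fin 2) (Fin 2) ℂ) (hY : Y.conjTranspose = Y) :
    toHerm (ofHerm Y) = Y := by
  have h00 := congrArg Complex.im (congrFun (congrFun hY 0) 0)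
  have h11 := congrArg Complex.im (congrFun (congrFun hY 1) 1)
  have h01 := congrFun (congrFun hY 0) 1
  simp only [Matrix.conjTranspose_apply] at h00 h11 h01
  have hr := congrArg Complex.re h01
  have hi := congrArg Complex.im h01
  simp only [Complex.star_def, Complex.conj_re, Complex.conj_im] at h00 h11 hr hi
  ext i j
  fin_cases i <;> fin_cases j <;> apply Complex.ext <;> simp [toHerm, ofHerm] <;> linarith

lemma toHerm_conjTranspose (x : Spacetime) : (toHerm x).conjTranspose = toHerm x := by
  ext i j
  fin_cases i <;> fin_cases j <;> apply Complex.ext <;> simp [toHerm]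

/-- The spin cover `SL(2, ℂ)` of the restricted Lorentz group. -/
abbrev SL2C : Type := Matrix.SpecialLinearGroup (Fin 2) ℂ

/-- The Lorentz transformation `Λ(A)`: `x ↦ A x A†` on Hermitian matrices, as a linear map. -/
def lorentzLin (A : SL2C) : Spacetime →ₗ[ℝ] Spacetime where
  toFun x := ofHerm (A.1 * toHerm x * A.1.conjTranspose)
  map_add' x y := by simp [mul_add, add_mul]
  map_smul' c x := by simp

lemma lorentzLin_mul (A B : SL2C) (x : Spacetime) :
    lorentzLin A (lorentzLin B x) = lorentzLin (A * B) x := by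
  have h : (B.1 * toHerm x * B.1.conjTranspose).conjTranspose
      = B.1 * toHerm x * B.1.conjTranspose := by
    simp [Matrix.conjTranspose_mul, toHerm_conjTranspose, mul_assoc]
  change ofHerm (A.1 * toHerm (ofHerm (B.1 * toHerm x * B.1.conjTranspose)) * A.1.conjTranspose) = _
  rw [toHerm_ofHerm _ h]
  simp [lorentzLin, Matrix.conjTranspose_mul, mul_assoc]

lemma lorentzLin_one (x : Spacetime) : lorentzLin 1 x = x := by
  simp [lorentzLin, ofHerm_toHerm]

/-- The Lorentz transformation `Λ(A)` of space-time. -/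
def lorentz (A : SL2C) : Spacetime ≃L[ℝ] Spacetime :=
  LinearEquiv.toContinuousLinearEquiv
    (LinearEquiv.ofLinearMap (lorentzLin A) (lorentzLin A⁻¹)
      (LinearMap.ext fun x => by simp [lorentzLin_mul, lorentzLin_one])
      (LinearMap.ext fun x => by simp [lorentzLin_mul, lorentzLin_one]))

/-- The simultaneous Lorentz transformation of two points. -/
def lorentz2 (A : SL2C) : Spacetime2 ≃L[ℝ] Spacetime2 :=
  (lorentz A).prodCongr (lorentz A)

/-! ### Smooth functions -/

/-- Complex-valued smooth functions on `E`. -/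
def Smooth (E : Type) [NormedAddCommGroup E] [NormedSpace ℝ E] : Submodule ℂ (E → ℂ) where
  carrier := {f | ContDiff ℝ ∞ f}
  add_mem' {f g} (hf : ContDiff ℝ ∞ f) (hg : ContDiff ℝ ∞ g) :=
    show ContDiff ℝ ∞ (f + g) from hf.add hg
  zero_mem' := show ContDiff ℝ ∞ (fun _ : E => (0 : ℂ)) from contDiff_const
  smul_mem' c f (hf : ContDiff ℝ ∞ f) := show ContDiff ℝ ∞ (c • f) from hf.const_smul c

section SmoothOps

variable {E E' : Type} [NormedAddCommGroup E] [NormedSpace ℝ E]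
  [NormedAddCommGroup E'] [NormedSpace ℝ E']

/-- The derivative of a smooth function in the direction `v`. -/
def smoothDeriv (v : E) : Module.End ℂ (Smooth E) where
  toFun f := ⟨fun x => fderiv ℝ f.1 x v, by
    have h : ContDiff ℝ ∞ f.1 := f.2
    exact (h.fderiv_right (m := ∞) (by simp)).clm_apply contDiff_const⟩
  map_add' f g := by
    have hf : Differentiable ℝ f.1 := ContDiff.differentiable (n := ∞) f.2 (by simp)
    have hg : Differentiable ℝ g.1 := ContDiff.differentiable (n := ∞) g.2 (by simp)
    ext x
    simp [fderiv_add (hf x) (hg x)]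
  map_smul' c f := by
    have hf : Differentiable ℝ f.1 := ContDiff.differentiable (n := ∞) f.2 (by simp)
    ext x
    simp [fderiv_const_smul (hf x) c]

/-- The pullback `f ↦ f ∘ L` of smooth functions along a linear map. -/
def smoothComp (L : E →L[ℝ] E') : Smooth E' →ₗ[ℂ] Smooth E where
  toFun f := ⟨fun x => f.1 (L x), ContDiff.comp (g := f.1) (n := ∞) f.2 L.contDiff⟩
  map_add' _ _ := rfl
  map_smul' _ _ := rfl

end SmoothOps

/-! ### Distributions -/

/-- Complex-valued distributions on `E`. -/
abbrev ScalarDist (E : Type) [NormedAddCommGroup E] [NormedSpace ℝ E] : Type :=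
  𝓓'((⊤ : TopologicalSpace.Opens E), ℂ)

/-- Real-valued test functions on `E`. -/
abbrev Test (E : Type) [NormedAddCommGroup E] [NormedSpace ℝ E] : Type :=
  𝓓((⊤ : TopologicalSpace.Opens E), ℝ)

section DistOps

variable {E : Type} [NormedAddCommGroup E] [NormedSpace ℝ E]

/-- The distributional derivative in the direction `v`. -/
def distDeriv (v : E) : Module.End ℂ (ScalarDist E) where
  toFun T := Distribution.lineDerivCLM v T
  map_add' S T := map_add _ S T
  map_smul' c T := by
    ext φ
    simp [Distribution.lineDerivCLM_apply]

open ContDiffMapSupportedIn in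
/-- `φ ↦ φ ∘ e` on test functions, for a linear homeomorphism `e`. -/
def testComp (e : E ≃L[ℝ] E) : Test E →L[ℝ] Test E :=
  TestFunction.limitCLM ℝ
    (fun φ => ⟨fun x => φ (e x), φ.contDiff.comp e.contDiff,
      φ.hasCompactSupport.comp_homeomorph e.toHomeomorph, fun _ _ => trivial⟩)
    (fun K _ => TestFunction.ofSupportedInCLM ℝ
        (K := ⟨e ⁻¹' K, e.toHomeomorph.isCompact_preimage.2 K.isCompact⟩)
        (fun _ _ => trivial) ∘L
      ContDiffMapSupportedIn.mkCLM (𝕜 := ℝ) (fun φ x => φ (e x))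
        (fun _ _ _ => rfl) (fun _ _ _ => rfl)
        (fun φ => φ.contDiff.comp e.contDiff)
        (fun φ x hx => φ.zero_on_compl hx)
        (fun i _ => ⟨{i}, ‖(e : E →L[ℝ] E)‖ ^ i, by positivity, fun φ x _ => by
          have h := ContinuousLinearMap.iteratedFDeriv_comp_right (e : E →L[ℝ] E)
            (f := φ) φ.contDiff x (i := i) (by exact_mod_cast le_top)
          have h' : (fun x => φ (e x)) = φ ∘ (e : E →L[ℝ] E) := rfl
          rw [h', h]
          refine (ContinuousMultilinearMap.norm_compContinuousLinearMap_le _ _).trans ?_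
          rw [mul_comm]
          simp only [Finset.prod_const, Finset.card_univ, Fintype.card_fin, Finset.sup_singleton]
          exact mul_le_mul_of_nonneg_left (norm_iteratedFDeriv_apply_le_seminorm_top ℝ)
            (by positivity)⟩))
    (fun _ _ _ => rfl)

/-- The pullback `T ∘ e` of a distribution along a volume preserving linear homeomorphism `e`
(so that there is no Jacobian): `(T ∘ e)(φ) = T(φ ∘ e⁻¹)`. -/
def distComp (e : E ≃L[ℝ] E) : ScalarDist E →ₗ[ℂ] ScalarDist E where
  toFun T := (testComp e.symm).precompCompactConvergenceCLM _ T
  map_add' S T := map_add _ S T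
  map_smul' c T := by ext φ; rfl

end DistOps

/-! Integration of test functions over the second point. -/

section Marginal

open MeasureTheory

/-- The derivative with respect to the first point, as a linear function of the full derivative. -/
def restrictFst (F : Type) [NormedAddCommGroup F] [NormedSpace ℝ F] :
    (Spacetime2 →L[ℝ] F) →L[ℝ] (Spacetime →L[ℝ] F) :=
  (ContinuousLinearMap.compL ℝ Spacetime Spacetime2 F).flip
    (ContinuousLinearMap.inl ℝ Spacetime Spacetime)

lemma norm_restrictFst_le (F : Type) [NormedAddCommGroup F] [NormedSpace ℝ F] :
    ‖restrictFst F‖ ≤ 1 := by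
  refine ContinuousLinearMap.opNorm_le_bound _ zero_le_one fun l => ?_
  refine (ContinuousLinearMap.opNorm_comp_le l _).trans ?_
  rw [one_mul]
  exact mul_le_of_le_one_right (norm_nonneg _) (ContinuousLinearMap.norm_inl_le_one ℝ _ _)

lemma hasFDerivAt_marginal {F : Type} [NormedAddCommGroup F] [NormedSpace ℝ F] {K : Set Spacetime2}
    (hK : IsCompact K) (g : Spacetime2 → F) (hg : ContDiff ℝ 1 g)
    (hs : ∀ z, z ∉ K → g z = 0) (hs' : ∀ z, z ∉ K → fderiv ℝ g z = 0) (x : Spacetime) :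
    HasFDerivAt (fun x => ∫ y, g (x, y)) (∫ y, restrictFst F (fderiv ℝ g (x, y))) x := by
  have hK2 : IsCompact (Prod.snd '' K) := hK.image continuous_snd
  have hc : Continuous (fderiv ℝ g) := hg.continuous_fderiv (by simp)
  obtain ⟨C, hC⟩ := (hK.image (hc.norm)).bddAbove
  have hCb : ∀ z, ‖fderiv ℝ g z‖ ≤ max C 0 := by
    intro z
    by_cases hz : z ∈ K
    · exact (hC ⟨z, hz, rfl⟩).trans (le_max_left _ _)
    · rw [hs' z hz, norm_zero]; exact le_max_right _ _
  refine hasFDerivAt_integral_of_dominated_of_fderiv_le (s := Set.univ)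
    (bound := (Prod.snd '' K).indicator fun _ => max C 0) Filter.univ_mem ?_ ?_ ?_ ?_ ?_ ?_
    (F' := fun x y => restrictFst F (fderiv ℝ g (x, y)))
  · exact Filter.Eventually.of_forall fun x =>
      (hg.continuous.comp (by fun_prop)).aestronglyMeasurable
  · refine Continuous.integrable_of_hasCompactSupport (hg.continuous.comp (by fun_prop)) ?_
    refine HasCompactSupport.intro hK2 fun y hy => hs _ fun h => hy ⟨(x, y), h, rfl⟩
  · exact ((restrictFst F).continuous.comp (hc.comp (by fun_prop))).aestronglyMeasurable
  · refine Filter.Eventually.of_forall fun y x _ => ?_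
    by_cases hy : y ∈ Prod.snd '' K
    · rw [Set.indicator_of_mem hy]
      exact ((restrictFst F).le_of_opNorm_le (norm_restrictFst_le F) _).trans
        (by rw [one_mul]; exact hCb _)
    · rw [Set.indicator_of_notMem hy, hs' _ fun h => hy ⟨_, h, rfl⟩]
      simp
  · exact (integrable_indicator_iff hK2.measurableSet).2
      (integrableOn_const hK2.measure_lt_top.ne)
  · refine Filter.Eventually.of_forall fun y x _ => ?_
    exact ((hg.differentiable (by simp) (x, y)).hasFDerivAt).comp x (hasFDerivAt_prodMk_left x y)

lemma marginal_bound {K : Set Spacetime2} (hK : IsCompact K) (n : ℕ) :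
    ∀ (F : Type) [NormedAddCommGroup F] [NormedSpace ℝ F] (g : Spacetime2 → F),
      ContDiff ℝ ∞ g → (∀ z, z ∉ K → g z = 0) →
      ContDiff ℝ n (fun x => ∫ y, g (x, y)) ∧ ∀ C : ℝ, (∀ z, ‖iteratedFDeriv ℝ n g z‖ ≤ C) →
        ∀ x, ‖iteratedFDeriv ℝ n (fun x => ∫ y, g (x, y)) x‖
          ≤ volume.real (Prod.snd '' K) * C := by
  have hK2 : IsCompact (Prod.snd '' K) := hK.image continuous_snd
  have hd : ∀ (F : Type) [NormedAddCommGroup F] [NormedSpace ℝ F] (g : Spacetime2 → F),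
      (∀ z, z ∉ K → g z = 0) → ∀ z, z ∉ K → fderiv ℝ g z = 0 := by
    intro F _ _ g hs z hz
    have h : g =ᶠ[nhds z] fun _ => 0 :=
      Filter.mem_of_superset (hK.isClosed.isOpen_compl.mem_nhds hz) fun w hw => hs w hw
    rw [h.fderiv_eq]
    simp
  induction n with
  | zero =>
    intro F _ _ g hg hs
    have hcont : Continuous fun x => ∫ y, g (x, y) :=
      continuous_iff_continuousAt.2 fun x =>
        (hasFDerivAt_marginal hK g (hg.of_le (by simp)) hs (hd F g hs) x).continuousAt
    refine ⟨by simpa using hcont, fun C hC x => ?_⟩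
    simp only [norm_iteratedFDeriv_zero] at hC ⊢
    have h1 : ∫ y, g (x, y) = ∫ y in Prod.snd '' K, g (x, y) :=
      (setIntegral_eq_integral_of_forall_compl_eq_zero (s := Prod.snd '' K)
        (f := fun y => g (x, y)) fun y hy => hs (x, y) fun h => hy ⟨(x, y), h, rfl⟩).symm
    rw [h1, mul_comm]
    exact norm_setIntegral_le_of_norm_le_const hK2.measure_lt_top fun y _ => hC _
  | succ n ih =>
    intro F _ _ g hg hs
    have hg1 : ContDiff ℝ ∞ (fderiv ℝ g) := hg.fderiv_right (by simp)
    have hF : ∀ x, HasFDerivAt (fun x => ∫ y, g (x, y))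
        (∫ y, restrictFst F (fderiv ℝ g (x, y))) x :=
      hasFDerivAt_marginal hK g (hg.of_le (by simp)) hs (hd F g hs)
    have hF' : (fderiv ℝ fun x => ∫ y, g (x, y))
        = fun x => ∫ y, restrictFst F (fderiv ℝ g (x, y)) := funext fun x => (hF x).fderiv
    obtain ⟨ih1, ih2⟩ := ih _ (fun z => restrictFst F (fderiv ℝ g z))
      ((restrictFst F).contDiff.comp hg1) (fun z hz => by simp [hd F g hs z hz])
    constructor
    · rw [show ((n + 1 : ℕ) : WithTop ℕ∞) = (n : WithTop ℕ∞) + 1 by simp, contDiff_succ_iff_fderiv]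
      refine ⟨fun x => (hF x).differentiableAt, by simp, ?_⟩
      rw [hF']; exact ih1
    · intro C hC x
      rw [← norm_iteratedFDeriv_fderiv, hF']
      refine ih2 C (fun z => ?_) x
      have h := (restrictFst F).norm_iteratedFDeriv_comp_left (f := fderiv ℝ g) (x := z)
        (n := n) hg1.contDiffAt (by exact_mod_cast le_top)
      refine (h.trans ?_).trans (hC z)
      rw [← norm_iteratedFDeriv_fderiv]
      exact mul_le_of_le_one_left (norm_nonneg _) (norm_restrictFst_le F)

lemma contDiff_marginal (g : Spacetime2 → ℝ) (hg : ContDiff ℝ ∞ g) (hs : HasCompactSupport g) :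
    ContDiff ℝ ∞ fun x => ∫ y, g (x, y) :=
  contDiff_infty.2 fun n => (marginal_bound hs n ℝ g hg fun _ hz => image_eq_zero_of_notMem_tsupport hz).1

lemma marginal_eq_zero {K : Set Spacetime2} (g : Spacetime2 → ℝ) (hs : ∀ z, z ∉ K → g z = 0)
    (x : Spacetime) (hx : x ∉ Prod.fst '' K) : ∫ y, g (x, y) = 0 := by
  simp [fun y => hs (x, y) fun h => hx ⟨_, h, rfl⟩]

lemma integrable_slice (g : Spacetime2 → ℝ) (hg : Continuous g) (hs : HasCompactSupport g)
    (x : Spacetime) : Integrable fun y => g (x, y) :=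
  Continuous.integrable_of_hasCompactSupport (hg.comp (by fun_prop))
    (HasCompactSupport.intro (hs.isCompact.image continuous_snd) fun y hy =>
      image_eq_zero_of_notMem_tsupport fun h => hy ⟨(x, y), h, rfl⟩)

/-- The projection of a compact set to the first point. -/
def fstImage (K : TopologicalSpace.Compacts Spacetime2) : TopologicalSpace.Compacts Spacetime :=
  ⟨Prod.fst '' (K : Set Spacetime2), K.isCompact.image continuous_fst⟩

open ContDiffMapSupportedIn in
/-- `φ ↦ (x ↦ ∫ φ(x, y) dy)` on test functions supported in `K`. -/
def testMarginalIn (K : TopologicalSpace.Compacts Spacetime2) :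
    𝓓_{K}(Spacetime2, ℝ) →L[ℝ]
      𝓓_{fstImage K}(Spacetime, ℝ) :=
  letI Φ : 𝓓_{K}(Spacetime2, ℝ) →ₗ[ℝ]
      𝓓_{fstImage K}(Spacetime, ℝ) :=
    { toFun := fun φ => ⟨fun x => ∫ y, φ (x, y),
        contDiff_marginal φ φ.contDiff φ.hasCompactSupport,
        fun x hx => marginal_eq_zero φ (fun _ hz => φ.zero_on_compl hz) x hx⟩
      map_add' := fun φ ψ => ContDiffMapSupportedIn.ext fun x =>
        integral_add (integrable_slice φ φ.continuous φ.hasCompactSupport x)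
          (integrable_slice ψ ψ.continuous ψ.hasCompactSupport x)
      map_smul' := fun c φ => ContDiffMapSupportedIn.ext fun x => integral_const_mul c _ }
  { toLinearMap := Φ
    cont := show Continuous Φ by
      refine WithSeminorms.continuous_of_isBounded (ContDiffMapSupportedIn.withSeminorms ℝ ..)
        (ContDiffMapSupportedIn.withSeminorms ℝ ..) _ (.of_real fun i => ?_)
      refine ⟨{i}, volume.real (Prod.snd '' (K : Set Spacetime2)), fun φ => ?_⟩
      rw [Finset.sup_singleton]
      exact ((Φ φ).seminorm_top_le_iff ℝ (mul_nonneg measureReal_nonneg (apply_nonneg _ _)) i).2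
        fun x _ => (marginal_bound K.isCompact i ℝ φ φ.contDiff
          fun _ hz => φ.zero_on_compl hz).2 _
            (fun z => norm_iteratedFDeriv_apply_le_seminorm_top ℝ) x }

/-- `φ ↦ (x ↦ ∫ φ(x, y) dy)` on test functions. -/
def testMarginal : Test Spacetime2 →L[ℝ] Test Spacetime :=
  TestFunction.limitCLM ℝ
    (fun φ => ⟨fun x => ∫ y, φ (x, y), contDiff_marginal φ φ.contDiff φ.hasCompactSupport,
      HasCompactSupport.intro (φ.hasCompactSupport.isCompact.image continuous_fst)
        (marginal_eq_zero φ fun _ hz => image_eq_zero_of_notMem_tsupport hz), fun _ _ => trivial⟩)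
    (fun K _ => TestFunction.ofSupportedInCLM ℝ (fun _ _ => trivial) ∘L testMarginalIn K)
    (fun _ _ _ => rfl)

/-- The map `(x, y) ↦ (x + y, y)`. -/
def shear : Spacetime2 ≃L[ℝ] Spacetime2 :=
  LinearEquiv.toContinuousLinearEquiv
    { toFun := fun z => (z.1 + z.2, z.2)
      invFun := fun z => (z.1 - z.2, z.2)
      map_add' := fun z w => by ext <;> simp; ring
      map_smul' := fun c z => by ext <;> simp
      left_inv := fun z => by simp
      right_inv := fun z => by simp }

/-- The distribution `G(x₁ - x₂)` of two points:
`φ ↦ G(ψ)` with `ψ(x) = ∫ φ(x + y, y) dy`. -/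
def distDiff : ScalarDist Spacetime →ₗ[ℂ] ScalarDist Spacetime2 where
  toFun G := (testMarginal ∘L testComp shear).precompCompactConvergenceCLM _ G
  map_add' S T := map_add _ S T
  map_smul' c T := by ext φ; rfl

lemma distDiff_apply (G : ScalarDist Spacetime) (φ : Test Spacetime2) (ψ : Test Spacetime)
    (h : ∀ x, ψ x = ∫ y, φ (x + y, y)) : distDiff G φ = G ψ := by
  have : ψ = testMarginal (testComp shear φ) := TestFunction.ext h
  rw [this]; rfl

end Marginal

/-! ### The Grassmann algebra of `θ₁, θ̄₁, θ₂, θ̄₂` -/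

/-- Labels of the odd coordinates: `(a, inl α)` stands for `θ_a^α` and `(a, inr α̇)` for `θ̄_a^α̇`;
here `a = 0` is the first and `a = 1` the second point. -/
abbrev OddIndex : Type := Fin 2 × (Fin 2 ⊕ Fin 2)

/-- The complex Grassmann algebra generated by the eight odd coordinates. -/
abbrev Grassmann : Type := ExteriorAlgebra ℂ (OddIndex → ℂ)

/-- The generators of the Grassmann algebra. -/
def gen (i : OddIndex) : Grassmann := ExteriorAlgebra.ι ℂ (Pi.single i 1)

/-- `θ_a^α` -/
def theta (a α : Fin 2) : Grassmann := gen (a, Sum.inl α)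

/-- `θ̄_a^α̇` -/
def thetaBar (a α : Fin 2) : Grassmann := gen (a, Sum.inr α)

/-- `ζ² = ζ^α ζ_α = ε_{αβ} ζ^α ζ^β` for `ζ = θ₁ - θ₂`, which is the `δ`-function `δ(θ₁ - θ₂)`. -/
def deltaTheta : Grassmann :=
  ∑ α, ∑ β, (-eps α β) • ((theta 0 α - theta 1 α) * (theta 0 β - theta 1 β))

/-- `ζ̄² = ζ̄_α̇ ζ̄^α̇ = ε_{α̇β̇} ζ̄^β̇ ζ̄^α̇` for `ζ̄ = θ̄₁ - θ̄₂`, which is the `δ`-function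
`δ(θ̄₁ - θ̄₂)`. -/
def deltaThetaBar : Grassmann :=
  ∑ α, ∑ β, (-eps α β) • ((thetaBar 0 β - thetaBar 1 β) * (thetaBar 0 α - thetaBar 1 α))

/-- The linear substitution `θ_a^α ↦ ∑_β (A⁻¹)_β^α θ_a^β`, `θ̄_a^α̇ ↦ ∑_β̇ conj((A⁻¹)_β^α) θ̄_a^β̇` on
the span of the odd coordinates. -/
def spinLin (A : SL2C) : (OddIndex → ℂ) →ₗ[ℂ] (OddIndex → ℂ) where
  toFun v i := match i with
    | (a, Sum.inl β) => ∑ α, (A⁻¹).1 β α * v (a, Sum.inl α)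
    | (a, Sum.inr β) => ∑ α, star ((A⁻¹).1 β α) * v (a, Sum.inr α)
  map_add' v w := by
    ext ⟨a, β | β⟩ <;> simp [mul_add, Finset.sum_add_distrib]
  map_smul' c v := by
    ext ⟨a, β | β⟩ <;> simp <;> ring

/-! ### Coefficients

A superfield is an expansion in the odd coordinates whose coefficients are functions or
distributions in `x₁, x₂`. The following structure collects the operations on coefficients. It is
only used for the two instances `smoothOps` and `distOps` below. -/

/-- Operations on coefficients depending on one point (`W`) and on two points (`V`). -/
structure CoeffOps (W V : Type) [AddCommGroup W] [Module ℂ W] [AddCommGroup V] [Module ℂ V] where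
  /-- `∂/∂x^m` -/
  d : Fin 4 → Module.End ℂ W
  /-- `∂/∂x_a^m` -/
  d2 : Fin 2 → Fin 4 → Module.End ℂ V
  /-- `f(x) ↦ f(Λ(A) x)` -/
  act : SL2C → Module.End ℂ W
  /-- `f(x₁, x₂) ↦ f(Λ(A) x₁, Λ(A) x₂)` -/
  act2 : SL2C → Module.End ℂ V
  /-- `f(x) ↦ f(x₁ - x₂)` -/
  diff : W →ₗ[ℂ] V

/-- The unit vector of the coordinate `x^m`. -/
def unit (m : Fin 4) : Spacetime := Pi.single m 1

/-- The unit vector of the coordinate `x_a^m`. -/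
def unit2 (a : Fin 2) (m : Fin 4) : Spacetime2 := if a = 0 then (unit m, 0) else (0, unit m)

/-- Smooth functions as coefficients. -/
def smoothOps : CoeffOps (Smooth Spacetime) (Smooth Spacetime2) where
  d m := smoothDeriv (unit m)
  d2 a m := smoothDeriv (unit2 a m)
  act A := smoothComp (lorentz A : Spacetime →L[ℝ] Spacetime)
  act2 A := smoothComp (lorentz2 A : Spacetime2 →L[ℝ] Spacetime2)
  diff := smoothComp
    (ContinuousLinearMap.fst ℝ Spacetime Spacetime - ContinuousLinearMap.snd ℝ Spacetime Spacetime)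

/-- Distributions as coefficients. -/
def distOps : CoeffOps (ScalarDist Spacetime) (ScalarDist Spacetime2) where
  d m := distDeriv (unit m)
  d2 a m := distDeriv (unit2 a m)
  act A := distComp (lorentz A)
  act2 A := distComp (lorentz2 A)
  diff := distDiff

/-! ### Superfields of two points -/

section Superfield

variable {W V : Type} [AddCommGroup W] [Module ℂ W] [AddCommGroup V] [Module ℂ V]

variable (V) in
/-- Superfields `F(z₁, z₂)` of two points with coefficients in `V`. -/
abbrev Superfield : Type := Grassmann ⊗[ℂ] V

variable (V) in
/-- Left multiplication by an element of the Grassmann algebra. -/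
def mulOp (g : Grassmann) : Module.End ℂ (Superfield V) := (LinearMap.mulLeft ℂ g).rTensor V

variable (V) in
/-- The left derivative with respect to an odd coordinate. -/
def oddDeriv (i : OddIndex) : Module.End ℂ (Superfield V) :=
  (CliffordAlgebra.contractLeft (LinearMap.proj i : Module.Dual ℂ (OddIndex → ℂ)) :
    Grassmann →ₗ[ℂ] Grassmann).rTensor V

/-- `∂/∂x_a^m` on superfields. -/
def evenDeriv (c : CoeffOps W V) (a : Fin 2) (m : Fin 4) : Module.End ℂ (Superfield V) :=
  (c.d2 a m).lTensor Grassmann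

/-- `Q_α = ∂_α - i σ^m_{αα̇} θ̄^α̇ ∂_m` acting on the variable `z_a`. -/
def Q (c : CoeffOps W V) (a α : Fin 2) : Module.End ℂ (Superfield V) :=
  oddDeriv V (a, Sum.inl α) -
    Complex.I • ∑ m, ∑ β, sigma m α β • (mulOp V (thetaBar a β) * evenDeriv c a m)

/-- `Q̄_α̇ = -∂̄_α̇ + i θ^α σ^m_{αα̇} ∂_m` acting on the variable `z_a`. -/
def QBar (c : CoeffOps W V) (a α : Fin 2) : Module.End ℂ (Superfield V) :=
  -oddDeriv V (a, Sum.inr α) +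
    Complex.I • ∑ m, ∑ β, sigma m β α • (mulOp V (theta a β) * evenDeriv c a m)

/-- The covariant derivative `D_α = ∂_α + i σ^m_{αα̇} θ̄^α̇ ∂_m` in the first variable `z₁`. -/
def D (c : CoeffOps W V) (α : Fin 2) : Module.End ℂ (Superfield V) :=
  oddDeriv V (0, Sum.inl α) +
    Complex.I • ∑ m, ∑ β, sigma m α β • (mulOp V (thetaBar 0 β) * evenDeriv c 0 m)

/-- The covariant derivative `D̄_α̇ = -∂̄_α̇ - i θ^α σ^m_{αα̇} ∂_m` in the first variable `z₁`. -/
def DBar (c : CoeffOps W V) (α : Fin 2) : Module.End ℂ (Superfield V) :=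
  -oddDeriv V (0, Sum.inr α) -
    Complex.I • ∑ m, ∑ β, sigma m β α • (mulOp V (theta 0 β) * evenDeriv c 0 m)

/-- `D² = D^α D_α = ε^{αβ} D_β D_α` -/
def DSq (c : CoeffOps W V) : Module.End ℂ (Superfield V) :=
  ∑ α, ∑ β, eps α β • (D c β * D c α)

/-- `D̄² = D̄_α̇ D̄^α̇ = ε^{α̇β̇} D̄_α̇ D̄_β̇` -/
def DBarSq (c : CoeffOps W V) : Module.End ℂ (Superfield V) :=
  ∑ α, ∑ β, eps α β • (DBar c α * DBar c β)

/-- `D^α D̄² D_α = ε^{αβ} D_β D̄² D_α` -/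
def DDBarSqD (c : CoeffOps W V) : Module.End ℂ (Superfield V) :=
  ∑ α, ∑ β, eps α β • (D c β * DBarSq c * D c α)

/-- The simultaneous Lorentz transformation of `(x_a, θ_a, θ̄_a)`, `a = 1, 2`, on superfields. -/
def superLorentz (c : CoeffOps W V) (A : SL2C) : Module.End ℂ (Superfield V) :=
  TensorProduct.map (ExteriorAlgebra.map (spinLin A)).toLinearMap (c.act2 A)

/-- Invariance of a two-point superfield under simultaneous supersymmetry transformations,
`(Q₁ + Q₂) F = 0 = (Q̄₁ + Q̄₂) F`, and under simultaneous Lorentz transformations. -/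
structure IsInvariant (c : CoeffOps W V) (F : Superfield V) : Prop where
  susy : ∀ α, (Q c 0 α + Q c 1 α) F = 0
  susyBar : ∀ α, (QBar c 0 α + QBar c 1 α) F = 0
  lorentz : ∀ A, superLorentz c A F = F

/-- Lorentz invariance of a function or distribution of one point `x`. -/
def IsLorentzInvariant (c : CoeffOps W V) (G : W) : Prop := ∀ A, c.act A G = G

/-- The d'Alembertian `□ = η^{mn} ∂_m ∂_n`. -/
def box (c : CoeffOps W V) : Module.End ℂ W := ∑ m, eta m • (c.d m * c.d m)

/-- `δ(θ₁ - θ₂) δ(θ̄₁ - θ̄₂) G(x₁ - x₂)` -/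
def deltaKernel (c : CoeffOps W V) (G : W) : Superfield V :=
  (deltaTheta * deltaThetaBar) ⊗ₜ[ℂ] c.diff G

/-- `H = □⁻¹ G`: `H` is a Lorentz invariant solution of `□ H = G`. -/
def IsBoxInverse (c : CoeffOps W V) (G H : W) : Prop := IsLorentzInvariant c H ∧ box c H = G

/-- `F = P_c δ(θ₁ - θ₂) δ(θ̄₁ - θ̄₂) G(x₁ - x₂)` with `P_c = D² D̄² / (16 □)`. -/
def IsPc (c : CoeffOps W V) (G : W) (F : Superfield V) : Prop :=
  ∃ H, IsBoxInverse c G H ∧ F = (1 / 16 : ℂ) • (DSq c * DBarSq c) (deltaKernel c H)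

/-- `F = P_a δ(θ₁ - θ₂) δ(θ̄₁ - θ̄₂) G(x₁ - x₂)` with `P_a = D̄² D² / (16 □)`. -/
def IsPa (c : CoeffOps W V) (G : W) (F : Superfield V) : Prop :=
  ∃ H, IsBoxInverse c G H ∧ F = (1 / 16 : ℂ) • (DBarSq c * DSq c) (deltaKernel c H)

/-- `F = P_T δ(θ₁ - θ₂) δ(θ̄₁ - θ̄₂) G(x₁ - x₂)` with `P_T = - D^α D̄² D_α / (8 □)`. -/
def IsPT (c : CoeffOps W V) (G : W) (F : Superfield V) : Prop :=
  ∃ H, IsBoxInverse c G H ∧ F = (-1 / 8 : ℂ) • DDBarSqD c (deltaKernel c H)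

/-- `P_+ δ(θ₁ - θ₂) δ(θ̄₁ - θ̄₂) G(x₁ - x₂)` with `P_+ = D² / (4 □^{1/2})`, as a function of
`H = □^{-1/2} G`. -/
def PPlus (c : CoeffOps W V) (H : W) : Superfield V := (1 / 4 : ℂ) • DSq c (deltaKernel c H)

/-- `P_- δ(θ₁ - θ₂) δ(θ̄₁ - θ̄₂) G(x₁ - x₂)` with `P_- = D̄² / (4 □^{1/2})`, as a function of
`H = □^{-1/2} G`. -/
def PMinus (c : CoeffOps W V) (H : W) : Superfield V := (1 / 4 : ℂ) • DBarSq c (deltaKernel c H)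

end Superfield

end SuperTwoPoint

end

noncomputable section

namespace SuperTwoPoint

/-! ### Parametric integrals -/

section Parametric

open MeasureTheory

variable {E : Type} [NormedAddCommGroup E] [NormedSpace ℝ E] [FiniteDimensional ℝ E]

/-! Algebra. The total charges contain ∂/∂θ₂ and ∂/∂θ̄₂, so up to sign they satisfy with θ₂, θ̄₂ the
anticommutation relations of derivatives, and an invariant F is determined by its part at θ₂ = θ̄₂ =
0 (`susy_eq_zero`). The anticommutator of the two kinds of charges is the total translation, hence
the components of F depend on x₁ - x₂ only (`Good.comp_translation`). The element -1 of SL(2,ℂ)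
fixes every x and reverses every odd coordinate, so components of odd degree vanish
(`Good.comp_odd`). There remain four scalars, u in degree 0, p at θθ, q at θ̄θ̄, f in top degree,
and one vector w at θθ̄.

The vector is the gradient of an invariant K (`Good.exists_slash1_eq`). With L_mn = x_m ∂_n - x_n
∂_m, the cyclic sum of ∂_k L_mn vanishes identically; combined with infinitesimal covariance this
says that w is curl-free, so a potential exists. Its defect of invariance is a homomorphism from
SL(2,ℂ) to the additive group of constants, and such a homomorphism is zero (`SL2C_hom_eq_zero`).

Thus F is encoded in five invariants, to be matched with the five kernels. In the slots (u, w, f)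
the kernel of P_c has the components (H, -i∂H, -□H), that of P_a has (H, i∂H, -□H), and that of P_T
has (-2H, 0, -2□H); the kernels of P_+ and P_- vanish there and supply q and p. The linear system is
solved by H_T = T, H_c = u/2 + T + iK/2 and H_a = u/2 + T - iK/2, provided that □T = -(f + □u)/4.
This is the step which needs invariant solutions of the wave equation (`Good.exists_kernels`).
Conversely, the kernels are invariant because δ(θ₁ - θ₂) δ(θ̄₁ - θ̄₂) H(x₁ - x₂) is, and because D
and D̄ anticommute with all charges and are Lorentz covariant.

The wave equation for smooth functions. If k solves (x·∂ + 4)k = G and is invariant, then the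
one-form x_m k is closed, and its potential H satisfies □H = x·∂k + 4k = G (`smooth_exists_box`).

The wave equation for distributions (`dist_exists_box`). A rotation invariant distribution sees a
test function only through its integrals over spheres. It therefore descends to the (t, r)-plane,
where f(t, |x|) becomes a multiple of r f(t, r), the wave operator becomes ∂_r² - ∂_t² by Darboux's
equation, and boost invariance becomes one second order equation, stated through `boostOp`. In light
cone coordinates p, q a solution of the plane wave equation is found by taking primitives. It
violates the boost condition by a function of p plus a function of q, and both are removed by
solutions of the homogeneous wave equation; this uses that distributions can be divided by p and by
q.

The structure `Good` lists what the algebraic part needs to know about coefficients;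
`good_smoothOps` and `good_dist` supply it. Flow arguments for distributions rest on
`ScalarDist.hasDerivAt`, differentiation of T(Φ_τ) for a smooth family of test functions with a
common compact support. -/

lemma hasFDerivAt_integral_param {G : Type} [NormedAddCommGroup G] [NormedSpace ℝ G]
    (F : ℝ × E → G) (hF : ContDiff ℝ 1 F) (a b : ℝ) (x : E) :
    HasFDerivAt (fun x => ∫ τ in a..b, F (τ, x))
      (∫ τ in a..b, (fderiv ℝ F (τ, x)).comp (ContinuousLinearMap.inr ℝ ℝ E)) x := by
  have hc : Continuous fun z => (fderiv ℝ F z).comp (ContinuousLinearMap.inr ℝ ℝ E) :=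
    (hF.continuous_fderiv (by simp)).clm_comp continuous_const
  have : ProperSpace E := FiniteDimensional.proper ℝ E
  obtain ⟨C, hC⟩ := ((isCompact_uIcc (a := a) (b := b)).prod
    (isCompact_closedBall x 1)).exists_bound_of_continuousOn hc.continuousOn
  refine (intervalIntegral.hasFDerivAt_integral_of_dominated_of_fderiv_le (𝕜 := ℝ)
    (s := Metric.ball x 1) (bound := fun _ => C) (F := fun x τ => F (τ, x))
    (F' := fun x τ => (fderiv ℝ F (τ, x)).comp (ContinuousLinearMap.inr ℝ ℝ E))
    (Metric.ball_mem_nhds x one_pos) ?_ ?_ ?_ ?_ ?_ ?_)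
  · exact Filter.Eventually.of_forall fun x =>
      (hF.continuous.comp (by fun_prop)).aestronglyMeasurable
  · exact (hF.continuous.comp (by fun_prop)).intervalIntegrable _ _
  · exact (hc.comp (by fun_prop : Continuous fun τ : ℝ => (τ, x))).aestronglyMeasurable
  · refine Filter.Eventually.of_forall fun τ hτ y hy => hC (τ, y) ⟨?_, Metric.ball_subset_closedBall hy⟩
    exact Set.uIoc_subset_uIcc hτ
  · exact intervalIntegrable_const
  · refine Filter.Eventually.of_forall fun τ _ y _ => ?_
    exact ((hF.differentiable (by simp) (τ, y)).hasFDerivAt).comp y (hasFDerivAt_prodMk_right τ y)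

/-- The target space is quantified inside the induction because the derivative is again such an
integral, with values in a space of linear maps. Restricting a derivative to the E-directions has
norm at most 1, so bounds pass through without loss. -/
lemma integral_param_aux (a b : ℝ) (n : ℕ) :
    ∀ (G : Type) [NormedAddCommGroup G] [NormedSpace ℝ G] (F : ℝ × E → G),
      ContDiff ℝ ∞ F →
      ContDiff ℝ n (fun x => ∫ τ in a..b, F (τ, x)) ∧ ∀ (C : ℝ) (x : E),
        (∀ τ ∈ Set.uIcc a b, ‖iteratedFDeriv ℝ n F (τ, x)‖ ≤ C) →
        ‖iteratedFDeriv ℝ n (fun x => ∫ τ in a..b, F (τ, x)) x‖ ≤ C * |b - a| := by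
  induction n with
  | zero =>
    intro G _ _ F hF
    refine ⟨?_, fun C x hC => ?_⟩
    · have : Continuous fun x => ∫ τ in a..b, F (τ, x) := continuous_iff_continuousAt.2 fun x =>
        (hasFDerivAt_integral_param F (hF.of_le (by simp)) a b x).continuousAt
      simpa using this
    · simp only [norm_iteratedFDeriv_zero] at hC ⊢
      exact intervalIntegral.norm_integral_le_of_norm_le_const fun τ hτ =>
        hC τ (Set.uIoc_subset_uIcc hτ)
  | succ n ih =>
    intro G _ _ F hF
    let R : ((ℝ × E) →L[ℝ] G) →L[ℝ] (E →L[ℝ] G) :=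
      (ContinuousLinearMap.compL ℝ E (ℝ × E) G).flip (ContinuousLinearMap.inr ℝ ℝ E)
    have hR : ‖R‖ ≤ 1 := by
      refine ContinuousLinearMap.opNorm_le_bound _ zero_le_one fun l => ?_
      refine (ContinuousLinearMap.opNorm_comp_le l _).trans ?_
      rw [one_mul]
      exact mul_le_of_le_one_right (norm_nonneg _) (ContinuousLinearMap.norm_inr_le_one ℝ _ _)
    have hF1 : ContDiff ℝ ∞ (fderiv ℝ F) := hF.fderiv_right (by simp)
    have hd : ∀ x, HasFDerivAt (fun x => ∫ τ in a..b, F (τ, x))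
        (∫ τ in a..b, R (fderiv ℝ F (τ, x))) x :=
      hasFDerivAt_integral_param F (hF.of_le (by simp)) a b
    have hd' : (fderiv ℝ fun x => ∫ τ in a..b, F (τ, x))
        = fun x => ∫ τ in a..b, R (fderiv ℝ F (τ, x)) := funext fun x => (hd x).fderiv
    obtain ⟨ih1, ih2⟩ := ih _ (fun z => R (fderiv ℝ F z)) (R.contDiff.comp hF1)
    constructor
    · rw [show ((n + 1 : ℕ) : WithTop ℕ∞) = (n : WithTop ℕ∞) + 1 by simp, contDiff_succ_iff_fderiv]
      refine ⟨fun x => (hd x).differentiableAt, by simp, ?_⟩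
      rw [hd']; exact ih1
    · intro C x hC
      rw [← norm_iteratedFDeriv_fderiv, hd']
      refine ih2 C x fun τ hτ => ?_
      have h := R.norm_iteratedFDeriv_comp_left (f := fderiv ℝ F) (x := (τ, x))
        (n := n) hF1.contDiffAt (by exact_mod_cast le_top)
      refine (h.trans ?_).trans (hC τ hτ)
      rw [← norm_iteratedFDeriv_fderiv]
      exact mul_le_of_le_one_left (norm_nonneg _) hR

lemma contDiff_integral_param {G : Type} [NormedAddCommGroup G] [NormedSpace ℝ G]
    {F : ℝ × E → G} (hF : ContDiff ℝ ∞ F) (a b : ℝ) :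
    ContDiff ℝ ∞ fun x => ∫ τ in a..b, F (τ, x) :=
  contDiff_infty.2 fun n => (integral_param_aux a b n G F hF).1

lemma norm_iteratedFDeriv_integral_param_le {G : Type} [NormedAddCommGroup G] [NormedSpace ℝ G]
    {F : ℝ × E → G} (hF : ContDiff ℝ ∞ F) (a b : ℝ) (n : ℕ) {C : ℝ} {x : E}
    (hC : ∀ τ ∈ Set.uIcc a b, ‖iteratedFDeriv ℝ n F (τ, x)‖ ≤ C) :
    ‖iteratedFDeriv ℝ n (fun x => ∫ τ in a..b, F (τ, x)) x‖ ≤ C * |b - a| :=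
  (integral_param_aux a b n G F hF).2 C x hC

/-- The variable upper limit enters smoothly as well. -/
lemma contDiff_integral_param_upper {G : Type} [NormedAddCommGroup G] [NormedSpace ℝ G]
    {F : ℝ × E → G} (hF : ContDiff ℝ ∞ F) :
    ContDiff ℝ ∞ fun z : ℝ × E => ∫ τ in (0 : ℝ)..z.1, F (τ, z.2) := by
  -- The substitution τ = z.1 σ moves the variable limit into the integrand and leaves an integral
  -- with fixed limits and a larger parameter space.
  have h : (fun z : ℝ × E => ∫ τ in (0 : ℝ)..z.1, F (τ, z.2))
      = fun z => z.1 • ∫ σ in (0 : ℝ)..1, F (z.1 * σ, z.2) := by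
    funext z
    have := intervalIntegral.smul_integral_comp_mul_left (a := 0) (b := 1)
      (fun τ => F (τ, z.2)) z.1
    simpa using this.symm
  rw [h]
  refine contDiff_fst.smul (contDiff_integral_param
    (F := fun w : ℝ × (ℝ × E) => F (w.2.1 * w.1, w.2.2)) ?_ 0 1)
  fun_prop

end Parametric

/-! ### Bounds for test functions and distributions -/

section Bounds

open ContDiffMapSupportedIn

variable {E E' : Type} [NormedAddCommGroup E] [NormedSpace ℝ E]
  [NormedAddCommGroup E'] [NormedSpace ℝ E']

/-- A smooth function with compact support as a test function. -/
def mkTest (f : E → ℝ) (hf : ContDiff ℝ ∞ f) (hs : HasCompactSupport f) : Test E :=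
  ⟨f, hf, hs, fun _ _ => trivial⟩

@[simp] lemma mkTest_apply (f : E → ℝ) (hf : ContDiff ℝ ∞ f) (hs : HasCompactSupport f) (x : E) :
    mkTest f hf hs x = f x := rfl

lemma Test.contDiff (φ : Test E) : ContDiff ℝ ∞ φ := TestFunction.contDiff φ

/-- `φ` vanishes outside of `K`. -/
def SuppIn (K : Set E) (φ : Test E) : Prop := ∀ x, x ∉ K → φ x = 0

/-- All derivatives of `φ` of order at most `N` are bounded by `M`. -/
def DerivLE (N : ℕ) (M : ℝ) (φ : Test E) : Prop := ∀ i ≤ N, ∀ x, ‖iteratedFDeriv ℝ i φ x‖ ≤ M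

lemma Test.exists_suppIn (φ : Test E) : ∃ K : Set E, IsCompact K ∧ SuppIn K φ :=
  ⟨tsupport φ, φ.hasCompactSupport, fun _ hx => image_eq_zero_of_notMem_tsupport hx⟩

/-- A functional on test functions which is locally of finite order. -/
def IsLocallyBounded (L : Test E →ₗ[ℝ] ℂ) : Prop :=
  ∀ K : Set E, IsCompact K → ∃ (N : ℕ) (C : ℝ), ∀ φ, SuppIn K φ → ∀ M, DerivLE N M φ → ‖L φ‖ ≤ C * M

/-- Continuity on test functions supported in K means a bound by finitely many derivative seminorms;
N is the largest order among them. Together with `mkDist` this replaces the topology of test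
functions by explicit estimates. -/
lemma ScalarDist.isLocallyBounded (T : ScalarDist E) :
    ∀ K : Set E, IsCompact K → ∃ (N : ℕ) (C : ℝ), 0 ≤ C ∧
      ∀ φ, SuppIn K φ → ∀ M, DerivLE N M φ → ‖T φ‖ ≤ C * M := by
  intro K hK
  let K' : TopologicalSpace.Compacts E := ⟨K, hK⟩
  let Tl : Test E →L[ℝ] ℂ := T
  let l : 𝓓_{K'}(E, ℝ) →L[ℝ] ℂ := Tl.comp (TestFunction.ofSupportedInCLM ℝ (fun _ _ => trivial))
  obtain ⟨s, C, -, hC⟩ := Seminorm.bound_of_continuous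
    (ContDiffMapSupportedIn.withSeminorms ℝ E ℝ ⊤ K')
    ((normSeminorm ℝ ℂ).comp l.toLinearMap) (continuous_norm.comp l.continuous)
  refine ⟨s.sup id, C, C.2, fun φ hφ M hM => ?_⟩
  let φ' : 𝓓_{K'}(E, ℝ) := ⟨φ, φ.contDiff, fun x hx => hφ x hx⟩
  have h1 : T φ = l φ' := rfl
  have h2 := hC φ'
  rw [h1]
  have hM0 : 0 ≤ M := (norm_nonneg _).trans (hM 0 (Nat.zero_le _) 0)
  refine h2.trans ?_
  change (C : ℝ) * (s.sup (ContDiffMapSupportedIn.seminorm ℝ E ℝ ⊤ K')) φ' ≤ _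
  refine mul_le_mul_of_nonneg_left ?_ C.2
  refine Seminorm.finset_sup_apply_le hM0 fun i hi => ?_
  exact (ContDiffMapSupportedIn.seminorm_top_le_iff ℝ hM0 i φ').2
    fun x _ => hM i (Finset.le_sup (f := id) hi) x

/-- A distribution from a functional which is locally of finite order. -/
def mkDist (L : Test E →ₗ[ℝ] ℂ) (hL : IsLocallyBounded L) : ScalarDist E :=
  show Test E →L[ℝ] ℂ from
  { toLinearMap := L
    cont := by
      change Continuous L
      rw [TestFunction.continuous_iff_continuous_comp]
      intro K _
      obtain ⟨N, C, hC⟩ := hL K K.isCompact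
      let j : 𝓓_{K}(E, ℝ) →L[ℝ] Test E := TestFunction.ofSupportedInCLM ℝ (fun _ _ => trivial)
      let l : 𝓓_{K}(E, ℝ) →ₗ[ℝ] ℂ := L ∘ₗ j.toLinearMap
      change Continuous l
      refine WithSeminorms.continuous_normedSpace_rng ℂ
        (ContDiffMapSupportedIn.withSeminorms ℝ E ℝ ⊤ K) l
        ⟨Finset.Iic N, ⟨max C 0, le_max_right _ _⟩, fun φ => ?_⟩
      change ‖l φ‖ ≤ max C 0 * ((Finset.Iic N).sup (ContDiffMapSupportedIn.seminorm ℝ E ℝ ⊤ K)) φ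
      have h0 : 0 ≤ ((Finset.Iic N).sup (ContDiffMapSupportedIn.seminorm ℝ E ℝ ⊤ K)) φ :=
        apply_nonneg _ _
      refine (hC _ (fun x hx => φ.zero_on_compl hx) _ fun i hi x => ?_).trans
        (mul_le_mul_of_nonneg_right (le_max_left _ _) h0)
      exact (norm_iteratedFDeriv_apply_le_seminorm_top ℝ).trans
        (Seminorm.le_finset_sup_apply (Finset.mem_Iic.2 hi)) }

/-- A linear operator on test functions which is continuous in the sense of local bounds. -/
structure IsBoundedOp (O : Test E →ₗ[ℝ] Test E') : Prop where
  bound : ∀ K : Set E, IsCompact K → ∃ K' : Set E', IsCompact K' ∧ (∀ φ, SuppIn K φ → SuppIn K' (O φ)) ∧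
    ∀ n : ℕ, ∃ (N : ℕ) (C : ℝ), ∀ φ, SuppIn K φ → ∀ M, DerivLE N M φ → DerivLE n (C * M) (O φ)

/-- The transpose of an operator on test functions. -/
def distTranspose (O : Test E →ₗ[ℝ] Test E') (hO : IsBoundedOp O) (T : ScalarDist E') :
    ScalarDist E :=
  mkDist ((show Test E' →L[ℝ] ℂ from T).toLinearMap ∘ₗ O) (by
    intro K hK
    obtain ⟨K', hK', h1, h2⟩ := hO.bound K hK
    obtain ⟨n, C, hC0, hC⟩ := T.isLocallyBounded K' hK'
    obtain ⟨N, D, hD⟩ := h2 n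
    refine ⟨N, C * D, fun φ hφ M hM => ?_⟩
    rw [mul_assoc]
    exact hC _ (h1 φ hφ) _ (hD φ hφ M hM))

@[simp] lemma distTranspose_apply (O : Test E →ₗ[ℝ] Test E') (hO : IsBoundedOp O)
    (T : ScalarDist E') (φ : Test E) : distTranspose O hO T φ = T (O φ) := rfl

end Bounds

/-! ### Operators on test functions given by parametric integrals -/

section ParamOp

variable {E E' E'' : Type} [NormedAddCommGroup E] [NormedSpace ℝ E]
  [NormedAddCommGroup E'] [NormedSpace ℝ E'] [NormedAddCommGroup E''] [NormedSpace ℝ E'']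

lemma natCast_le_infty (n : ℕ) : (n : WithTop ℕ∞) ≤ ∞ := by exact_mod_cast le_top

lemma exists_iteratedFDeriv_le_on {X Y : Type} [NormedAddCommGroup X] [NormedSpace ℝ X]
    [NormedAddCommGroup Y] [NormedSpace ℝ Y] {f : X → Y} (hf : ContDiff ℝ ∞ f) {S : Set X}
    (hS : IsCompact S) (n : ℕ) :
    ∃ C : ℝ, 1 ≤ C ∧ ∀ i ≤ n, ∀ x ∈ S, ‖iteratedFDeriv ℝ i f x‖ ≤ C := by
  have h : ∀ i : ℕ, ∃ C : ℝ, ∀ x ∈ S, ‖iteratedFDeriv ℝ i f x‖ ≤ C := fun i =>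
    hS.exists_bound_of_continuousOn
      (hf.continuous_iteratedFDeriv (m := i) (by exact_mod_cast le_top)).continuousOn
  choose C hC using h
  refine ⟨1 + ∑ i ∈ Finset.range (n + 1), |C i|, ?_, fun i hi x hx => ?_⟩
  · have : 0 ≤ ∑ i ∈ Finset.range (n + 1), |C i| := Finset.sum_nonneg fun _ _ => abs_nonneg _
    linarith
  · have h1 : |C i| ≤ ∑ i ∈ Finset.range (n + 1), |C i| :=
      Finset.single_le_sum (f := fun i => |C i|) (fun _ _ => abs_nonneg _)
        (Finset.mem_range.2 (Nat.lt_succ_of_le hi))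
    linarith [hC i x hx, le_abs_self (C i)]

lemma iteratedFDeriv_eq_zero_of_compl {X Y : Type} [NormedAddCommGroup X] [NormedSpace ℝ X]
    [NormedAddCommGroup Y] [NormedSpace ℝ Y] {f : X → Y} {K : Set X} (hK : IsClosed K)
    (hf : ∀ x, x ∉ K → f x = 0) (i : ℕ) {x : X} (hx : x ∉ K) : iteratedFDeriv ℝ i f x = 0 := by
  have h : f =ᶠ[nhds x] fun _ => 0 :=
    Filter.eventually_of_mem (hK.isOpen_compl.mem_nhds hx) hf
  rw [(h.iteratedFDeriv ℝ i).eq_of_nhds]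
  have := congrFun (iteratedFDeriv_fun_zero (𝕜 := ℝ) (E := X) (F := Y) (n := i)) x
  exact this

lemma DerivLE.nonneg {N : ℕ} {M : ℝ} {φ : Test E} (h : DerivLE N M φ) : 0 ≤ M :=
  (norm_nonneg _).trans (h 0 (Nat.zero_le _) 0)

lemma IsBoundedOp.comp {O : Test E →ₗ[ℝ] Test E'} {P : Test E' →ₗ[ℝ] Test E''}
    (hP : IsBoundedOp P) (hO : IsBoundedOp O) : IsBoundedOp (P ∘ₗ O) := by
  refine ⟨fun K hK => ?_⟩
  obtain ⟨K', hK', h1, h2⟩ := hO.bound K hK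
  obtain ⟨K'', hK'', h3, h4⟩ := hP.bound K' hK'
  refine ⟨K'', hK'', fun φ hφ => h3 _ (h1 _ hφ), fun n => ?_⟩
  obtain ⟨N, C, hC⟩ := h4 n
  obtain ⟨N', C', hC'⟩ := h2 N
  refine ⟨N', C * C', fun φ hφ M hM => ?_⟩
  rw [mul_assoc]
  exact hC _ (h1 _ hφ) _ (hC' _ hφ _ hM)

lemma SuppIn.mono {K K' : Set E} (h : K ⊆ K') {φ : Test E} (hφ : SuppIn K φ) : SuppIn K' φ :=
  fun x hx => hφ x fun h' => hx (h h')

lemma IsBoundedOp.add {O P : Test E →ₗ[ℝ] Test E'} (hO : IsBoundedOp O) (hP : IsBoundedOp P) :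
    IsBoundedOp (O + P) := by
  refine ⟨fun K hK => ?_⟩
  obtain ⟨K', hK', h1, h2⟩ := hO.bound K hK
  obtain ⟨K'', hK'', h3, h4⟩ := hP.bound K hK
  refine ⟨K' ∪ K'', hK'.union hK'', fun φ hφ x hx => ?_, fun n => ?_⟩
  · have hx' := not_or.1 hx
    change O φ x + P φ x = 0
    rw [h1 φ hφ x hx'.1, h3 φ hφ x hx'.2, add_zero]
  obtain ⟨N, C, hC⟩ := h4 n
  obtain ⟨N', C', hC'⟩ := h2 n
  refine ⟨max N N', C' + C, fun φ hφ M hM i hi x => ?_⟩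
  have e : (⇑((O + P) φ) : E' → ℝ) = ⇑(O φ) + ⇑(P φ) := rfl
  rw [e, iteratedFDeriv_add ((O φ).contDiff.of_le (by exact_mod_cast le_top))
    ((P φ).contDiff.of_le (by exact_mod_cast le_top)), add_mul]
  refine (norm_add_le _ _).trans (add_le_add ?_ ?_)
  · exact hC' φ hφ M (fun j hj => hM j (hj.trans (le_max_right _ _))) i hi x
  · exact hC φ hφ M (fun j hj => hM j (hj.trans (le_max_left _ _))) i hi x

lemma IsBoundedOp.neg {O : Test E →ₗ[ℝ] Test E'} (hO : IsBoundedOp O) :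
    IsBoundedOp (-O) := by
  refine ⟨fun K hK => ?_⟩
  obtain ⟨K', hK', h1, h2⟩ := hO.bound K hK
  refine ⟨K', hK', fun φ hφ x hx => ?_, fun n => ?_⟩
  · change -(O φ x) = 0
    rw [h1 φ hφ x hx, neg_zero]
  obtain ⟨N', C', hC'⟩ := h2 n
  refine ⟨N', C', fun φ hφ M hM i hi x => ?_⟩
  have e : (⇑((-O) φ) : E' → ℝ) = -⇑(O φ) := rfl
  rw [e, iteratedFDeriv_neg, Pi.neg_apply, norm_neg]
  exact hC' φ hφ M hM i hi x

/-- The condition on `w`, `m` under which `φ ↦ ∫ w φ ∘ m` preserves compact supports. -/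
def ProperData (a b : ℝ) (w : ℝ × E' → ℝ) (m : ℝ × E' → E) : Prop :=
  ∀ K : Set E, IsCompact K → ∃ K' : Set E', IsCompact K' ∧
    ∀ τ ∈ Set.uIcc a b, ∀ x, w (τ, x) ≠ 0 → m (τ, x) ∈ K → x ∈ K'

set_option linter.unusedSectionVars false in
lemma ProperData.integral_eq_zero {a b : ℝ} {w : ℝ × E' → ℝ} {m : ℝ × E' → E} {K : Set E}
    {K' : Set E'} (h : ∀ τ ∈ Set.uIcc a b, ∀ x, w (τ, x) ≠ 0 → m (τ, x) ∈ K → x ∈ K')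
    {φ : E → ℝ} (hφ : ∀ x, x ∉ K → φ x = 0) {x : E'} (hx : x ∉ K') :
    ∫ τ in a..b, w (τ, x) * φ (m (τ, x)) = 0 := by
  rw [intervalIntegral.integral_congr (g := fun _ => 0), intervalIntegral.integral_zero]
  intro τ hτ
  by_cases h1 : w (τ, x) = 0
  · simp [h1]
  · have h2 : m (τ, x) ∉ K := fun h2 => hx (h τ hτ x h1 h2)
    simp [hφ _ h2]

variable [FiniteDimensional ℝ E']

/-- The operator `φ ↦ (x ↦ ∫_a^b w(τ, x) φ(m(τ, x)) dτ)` on test functions. -/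
def paramOp (a b : ℝ) (w : ℝ × E' → ℝ) (m : ℝ × E' → E) (hw : ContDiff ℝ ∞ w)
    (hm : ContDiff ℝ ∞ m) (hp : ProperData a b w m) : Test E →ₗ[ℝ] Test E' where
  toFun φ := mkTest (fun x => ∫ τ in a..b, w (τ, x) * φ (m (τ, x)))
    (contDiff_integral_param (F := fun z => w z * φ (m z)) (hw.mul (φ.contDiff.comp hm)) a b) (by
      obtain ⟨K, hK, hφ⟩ := φ.exists_suppIn
      obtain ⟨K', hK', h⟩ := hp K hK
      exact HasCompactSupport.intro hK' fun x hx => ProperData.integral_eq_zero h hφ hx)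
  map_add' φ ψ := by
    ext x
    change ∫ τ in a..b, w (τ, x) * (φ (m (τ, x)) + ψ (m (τ, x))) =
      (∫ τ in a..b, w (τ, x) * φ (m (τ, x))) + ∫ τ in a..b, w (τ, x) * ψ (m (τ, x))
    have hc : ∀ φ : Test E, Continuous fun τ => w (τ, x) * φ (m (τ, x)) := fun φ =>
      (hw.mul (φ.contDiff.comp hm)).continuous.comp (by fun_prop : Continuous fun τ : ℝ => (τ, x))
    rw [← intervalIntegral.integral_add ((hc φ).intervalIntegrable _ _)
      ((hc ψ).intervalIntegrable _ _)]
    simp only [mul_add]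
  map_smul' c φ := by
    ext x
    change ∫ τ in a..b, w (τ, x) * (c * φ (m (τ, x))) =
      c * ∫ τ in a..b, w (τ, x) * φ (m (τ, x))
    rw [← intervalIntegral.integral_const_mul]
    simp only [mul_left_comm]

@[simp] lemma paramOp_apply (a b : ℝ) (w : ℝ × E' → ℝ) (m : ℝ × E' → E) (hw : ContDiff ℝ ∞ w)
    (hm : ContDiff ℝ ∞ m) (hp : ProperData a b w m) (φ : Test E) (x : E') :
    paramOp a b w m hw hm hp φ x = ∫ τ in a..b, w (τ, x) * φ (m (τ, x)) := rfl

/-- Leibniz' rule for the product and the composition estimate for φ ∘ m. The bound B for the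
derivatives of m is taken to be at least 1, so that its powers dominate all orders at once. -/
lemma exists_norm_iteratedFDeriv_mul_comp_le {X : Type} [NormedAddCommGroup X] [NormedSpace ℝ X]
    {w : X → ℝ} {m : X → E} (hw : ContDiff ℝ ∞ w) (hm : ContDiff ℝ ∞ m) {S : Set X}
    (hS : IsCompact S) (n : ℕ) :
    ∃ C : ℝ, 0 ≤ C ∧ ∀ φ : Test E, ∀ M, DerivLE n M φ → ∀ i ≤ n, ∀ z ∈ S,
      ‖iteratedFDeriv ℝ i (fun z => w z * φ (m z)) z‖ ≤ C * M := by
  obtain ⟨A, hA1, hA⟩ := exists_iteratedFDeriv_le_on hw hS n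
  obtain ⟨B, hB1, hB⟩ := exists_iteratedFDeriv_le_on hm hS n
  refine ⟨2 ^ n * A * (n.factorial * B ^ n), by positivity, fun φ M hM i hi z hz => ?_⟩
  have hM0 := hM.nonneg
  have h1 := norm_iteratedFDeriv_mul_le (𝕜 := ℝ) (f := w) (g := fun z => φ (m z)) (n := i) (N := ∞)
    hw (φ.contDiff.comp hm) z (by exact_mod_cast le_top)
  refine h1.trans ?_
  have h2 : ∀ j ∈ Finset.range (i + 1), (i.choose j : ℝ) * ‖iteratedFDeriv ℝ j w z‖ *
      ‖iteratedFDeriv ℝ (i - j) (fun z => φ (m z)) z‖ ≤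
      (i.choose j : ℝ) * (A * (n.factorial * M * B ^ n)) := by
    intro j hj
    have hj' : j ≤ i := Nat.lt_succ_iff.1 (Finset.mem_range.1 hj)
    rw [mul_assoc]
    refine mul_le_mul_of_nonneg_left ?_ (by positivity)
    refine mul_le_mul (hA j (hj'.trans hi) z hz) ?_ (norm_nonneg _) (by positivity)
    have h3 := norm_iteratedFDeriv_comp_le (𝕜 := ℝ) (g := φ) (f := m) (N := ∞)
      φ.contDiff hm (n := i - j) (natCast_le_infty _) z (C := M) (D := B)
      (fun k hk => hM k (by omega) _) (fun k hk1 hk =>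
        (hB k (by omega) z hz).trans (le_self_pow₀ hB1 (by omega)))
    refine h3.trans ?_
    have e1 : ((i - j).factorial : ℝ) ≤ n.factorial := by
      exact_mod_cast Nat.factorial_le (by omega)
    have e2 : B ^ (i - j) ≤ B ^ n := pow_le_pow_right₀ hB1 (by omega)
    gcongr
  refine (Finset.sum_le_sum h2).trans ?_
  rw [← Finset.sum_mul]
  have h4 : (∑ j ∈ Finset.range (i + 1), (i.choose j : ℝ)) = 2 ^ i := by
    exact_mod_cast Nat.sum_range_choose i
  rw [h4]
  have e2 : (2 : ℝ) ^ i ≤ 2 ^ n := pow_le_pow_right₀ (by norm_num) hi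
  calc (2:ℝ) ^ i * (A * (n.factorial * M * B ^ n)) ≤ 2 ^ n * (A * (n.factorial * M * B ^ n)) := by
        gcongr
    _ = _ := by ring

lemma paramOp_isBounded (a b : ℝ) (w : ℝ × E' → ℝ) (m : ℝ × E' → E) (hw : ContDiff ℝ ∞ w)
    (hm : ContDiff ℝ ∞ m) (hp : ProperData a b w m) : IsBoundedOp (paramOp a b w m hw hm hp) := by
  refine ⟨fun K hK => ?_⟩
  obtain ⟨K', hK', h⟩ := hp K hK
  have hz : ∀ φ, SuppIn K φ → SuppIn K' (paramOp a b w m hw hm hp φ) := fun φ hφ x hx =>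
    ProperData.integral_eq_zero h hφ hx
  refine ⟨K', hK', hz, fun n => ?_⟩
  obtain ⟨C, hC0, hC⟩ := exists_norm_iteratedFDeriv_mul_comp_le hw hm
    ((isCompact_uIcc (a := a) (b := b)).prod hK') n
  refine ⟨n, C * |b - a|, fun φ hφ M hM i hi x => ?_⟩
  have hM0 := hM.nonneg
  by_cases hx : x ∈ K'
  · rw [mul_right_comm]
    exact norm_iteratedFDeriv_integral_param_le (F := fun z => w z * φ (m z))
      (hw.mul (φ.contDiff.comp hm)) a b i fun τ hτ => hC φ M hM i hi (τ, x) ⟨hτ, hx⟩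
  · rw [iteratedFDeriv_eq_zero_of_compl hK'.isClosed (hz φ hφ) i hx, norm_zero]
    positivity

/-- The operator `φ ↦ w · (φ ∘ m)` on test functions. -/
def mulCompOp (w : E' → ℝ) (m : E' → E) (hw : ContDiff ℝ ∞ w) (hm : ContDiff ℝ ∞ m)
    (hp : ∀ K : Set E, IsCompact K → ∃ K' : Set E', IsCompact K' ∧
      ∀ x, w x ≠ 0 → m x ∈ K → x ∈ K') : Test E →ₗ[ℝ] Test E' :=
  -- The integral over [0, 1] is a dummy: the integrand does not depend on τ. In this way all
  -- estimates are inherited from `paramOp`.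
  paramOp 0 1 (fun z => w z.2) (fun z => m z.2) (hw.comp contDiff_snd) (hm.comp contDiff_snd)
    fun K hK => (hp K hK).imp fun _ h => ⟨h.1, fun _ _ => h.2⟩

@[simp] lemma mulCompOp_apply (w : E' → ℝ) (m : E' → E) (hw : ContDiff ℝ ∞ w) (hm : ContDiff ℝ ∞ m)
    (hp) (φ : Test E) (x : E') : mulCompOp w m hw hm hp φ x = w x * φ (m x) := by
  have h : mulCompOp w m hw hm hp φ x = ∫ _τ in (0 : ℝ)..1, w x * φ (m x) := rfl
  rw [h]
  simp

lemma mulCompOp_isBounded (w : E' → ℝ) (m : E' → E) (hw : ContDiff ℝ ∞ w) (hm : ContDiff ℝ ∞ m)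
    (hp) : IsBoundedOp (mulCompOp w m hw hm hp) := paramOp_isBounded ..

end ParamOp

/-! ### Differentiation under a distribution -/

section Derivative

variable {E : Type} [NormedAddCommGroup E] [NormedSpace ℝ E]

/-- A smooth family of test functions supported in a fixed compact set. -/
structure TestFamily (E : Type) [NormedAddCommGroup E] [NormedSpace ℝ E] where
  /-- the family as a function -/
  toFun : ℝ × E → ℝ
  smooth : ContDiff ℝ ∞ toFun
  /-- the common support -/
  K : Set E
  compact : IsCompact K
  supp : ∀ τ x, x ∉ K → toFun (τ, x) = 0

namespace TestFamily

/-- The member of the family with parameter `τ`. -/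
def at' (Φ : TestFamily E) (τ : ℝ) : Test E :=
  mkTest (fun x => Φ.toFun (τ, x)) (Φ.smooth.comp (by fun_prop))
    (HasCompactSupport.intro Φ.compact (Φ.supp τ))

lemma supp_at (Φ : TestFamily E) (τ : ℝ) : SuppIn Φ.K (Φ.at' τ) := Φ.supp τ

/-- The derivative with respect to the parameter. -/
def deriv (Φ : TestFamily E) : TestFamily E where
  toFun z := fderiv ℝ Φ.toFun z (1, 0)
  smooth := (Φ.smooth.fderiv_right (m := ∞) (by simp)).clm_apply contDiff_const
  K := Φ.K
  compact := Φ.compact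
  supp τ x hx := by
    have h : Φ.toFun =ᶠ[nhds (τ, x)] fun _ => 0 := by
      refine Filter.eventually_of_mem ((Φ.compact.isClosed.isOpen_compl.preimage
        continuous_snd).mem_nhds (show (τ, x) ∈ Prod.snd ⁻¹' Φ.Kᶜ from hx)) fun z hz => Φ.supp _ _ hz
    rw [h.fderiv_eq]; simp

lemma hasDerivAt (Φ : TestFamily E) (τ : ℝ) (x : E) :
    HasDerivAt (fun τ => Φ.toFun (τ, x)) (Φ.deriv.toFun (τ, x)) τ := by
  have h := (Φ.smooth.differentiable (by simp) (τ, x)).hasFDerivAt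
  exact h.comp_hasDerivAt τ ((hasDerivAt_id τ).prodMk (hasDerivAt_const τ x))

lemma deriv_at_eq (Φ : TestFamily E) {τ : ℝ} {ψ : Test E}
    (h : ∀ x, HasDerivAt (fun τ => Φ.toFun (τ, x)) (ψ x) τ) : Φ.deriv.at' τ = ψ := by
  ext x
  exact (Φ.hasDerivAt τ x).unique (h x)

/-- The second order Taylor remainder, divided by `h²`. -/
lemma taylor (Φ : TestFamily E) (τ h : ℝ) (x : E) :
    Φ.toFun (τ + h, x) - Φ.toFun (τ, x) - h * Φ.deriv.toFun (τ, x) =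
      h ^ 2 * ∫ σ in (0:ℝ)..1, (1 - σ) * Φ.deriv.deriv.toFun (τ + σ * h, x) := by
  -- The Taylor formula with integral remainder is the fundamental theorem of calculus for (1 - σ) h
  -- Φ'(τ + σh) + Φ(τ + σh).
  have h1 : ∀ σ : ℝ, HasDerivAt (fun σ => (1 - σ) * h * Φ.deriv.toFun (τ + σ * h, x) +
      Φ.toFun (τ + σ * h, x)) (h ^ 2 * ((1 - σ) * Φ.deriv.deriv.toFun (τ + σ * h, x))) σ := by
    intro σ
    have e0 : HasDerivAt (fun σ : ℝ => τ + σ * h) h σ := by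
      simpa using ((hasDerivAt_id σ).mul_const h).const_add τ
    have e1 := (Φ.hasDerivAt (τ + σ * h) x).comp σ e0
    have e2 := (Φ.deriv.hasDerivAt (τ + σ * h) x).comp σ e0
    have e3 : HasDerivAt (fun σ : ℝ => (1 - σ) * h) (-h) σ := by
      simpa using ((hasDerivAt_id σ).const_sub 1).mul_const h
    have e4 := (e3.mul e2).add e1
    exact e4.congr_deriv (by simp only [Function.comp]; ring)
  have hc : Continuous fun σ : ℝ => h ^ 2 * ((1 - σ) * Φ.deriv.deriv.toFun (τ + σ * h, x)) := by
    have := Φ.deriv.deriv.smooth.continuous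
    fun_prop
  rw [← intervalIntegral.integral_const_mul,
    intervalIntegral.integral_eq_sub_of_hasDerivAt (fun σ _ => h1 σ) (hc.intervalIntegrable _ _)]
  simp
  ring

/-- The remainder is h² I(h, x) with I jointly smooth. Hence its x-derivatives up to order N are
bounded uniformly for |h| ≤ 1 on the compact common support, and they vanish elsewhere. -/
lemma exists_derivLE_taylor [FiniteDimensional ℝ E] (Φ : TestFamily E) (τ : ℝ) (N : ℕ) : ∃ C : ℝ, 0 ≤ C ∧
    ∀ h : ℝ, |h| ≤ 1 → DerivLE N (C * h ^ 2) (Φ.at' (τ + h) - Φ.at' τ - h • Φ.deriv.at' τ) := by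
  let F : ℝ × (ℝ × E) → ℝ := fun z => (1 - z.1) * Φ.deriv.deriv.toFun (τ + z.1 * z.2.1, z.2.2)
  have hF : ContDiff ℝ ∞ F := by
    have := Φ.deriv.deriv.smooth
    refine ContDiff.mul (by fun_prop) (this.comp (by fun_prop))
  let I : ℝ × E → ℝ := fun y => ∫ σ in (0:ℝ)..1, F (σ, y)
  have hI : ContDiff ℝ ∞ I := contDiff_integral_param hF 0 1
  obtain ⟨C, hC1, hC⟩ := exists_iteratedFDeriv_le_on hI
    ((isCompact_Icc (a := (-1:ℝ)) (b := 1)).prod Φ.compact) N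
  refine ⟨C, by positivity, fun h hh i hi x => ?_⟩
  have e : (⇑(Φ.at' (τ + h) - Φ.at' τ - h • Φ.deriv.at' τ) : E → ℝ) =
      fun x => h ^ 2 • I (h, x) := by
    funext x; exact Φ.taylor τ h x
  have hz : ∀ x, x ∉ Φ.K → I (h, x) = 0 := by
    intro x hx
    simp only [I, F, Φ.deriv.deriv.supp _ x hx, mul_zero, intervalIntegral.integral_zero]
  have hh' : h ∈ Set.Icc (-1:ℝ) 1 := abs_le.1 hh
  have hIh : ContDiff ℝ ∞ fun x => I (h, x) := hI.comp (by fun_prop)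
  rw [e, iteratedFDeriv_const_smul_apply' (hIh.contDiffAt.of_le (by exact_mod_cast le_top)), norm_smul,
    Real.norm_of_nonneg (sq_nonneg h), mul_comm]
  refine mul_le_mul_of_nonneg_right ?_ (sq_nonneg h)
  by_cases hx : x ∈ Φ.K
  -- The x-derivatives at fixed h are restrictions of total derivatives of I along the inclusion x ↦
  -- (0, x), which has norm at most 1, after a translation by (h, 0).
  · have e2 : (fun x => I (h, x)) = fun x => (fun y => I (y + (h, 0)))
        (ContinuousLinearMap.inr ℝ ℝ E x) := by
      funext x; simp
    have e3 := ContinuousLinearMap.iteratedFDeriv_comp_right (ContinuousLinearMap.inr ℝ ℝ E)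
      (f := fun y => I (y + (h, 0))) (hI.comp (by fun_prop)) x (i := i) (by exact_mod_cast le_top)
    rw [e2]
    refine (le_of_eq (congrArg norm e3)).trans ?_
    refine (ContinuousMultilinearMap.norm_compContinuousLinearMap_le _ _).trans ?_
    rw [iteratedFDeriv_comp_add_right]
    have e4 : (∏ _i : Fin i, ‖ContinuousLinearMap.inr ℝ ℝ E‖) ≤ 1 :=
      Finset.prod_le_one (fun _ _ => norm_nonneg _)
        fun _ _ => ContinuousLinearMap.norm_inr_le_one ℝ _ _
    refine (mul_le_of_le_one_right (norm_nonneg _) e4).trans ?_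
    have e5 : ContinuousLinearMap.inr ℝ ℝ E x + (h, 0) = (h, x) := by simp
    rw [e5]
    exact hC i hi _ ⟨hh', hx⟩
  · rw [iteratedFDeriv_eq_zero_of_compl Φ.compact.isClosed hz i hx, norm_zero]
    positivity

end TestFamily

lemma ScalarDist.map_smul_real (T : ScalarDist E) (c : ℝ) (φ : Test E) : T (c • φ) = c • T φ :=
  map_smul (show Test E →L[ℝ] ℂ from T) c φ

lemma ScalarDist.map_add' (T : ScalarDist E) (φ ψ : Test E) : T (φ + ψ) = T φ + T ψ :=
  map_add (show Test E →L[ℝ] ℂ from T) φ ψ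

lemma ScalarDist.map_sub' (T : ScalarDist E) (φ ψ : Test E) : T (φ - ψ) = T φ - T ψ :=
  map_sub (show Test E →L[ℝ] ℂ from T) φ ψ

lemma ScalarDist.map_zero' (T : ScalarDist E) : T 0 = 0 :=
  map_zero (show Test E →L[ℝ] ℂ from T)

lemma SuppIn.sub {K : Set E} {φ ψ : Test E} (hφ : SuppIn K φ) (hψ : SuppIn K ψ) :
    SuppIn K (φ - ψ) := fun x hx => by
  change φ x - ψ x = 0
  rw [hφ x hx, hψ x hx, sub_zero]

lemma SuppIn.add {K : Set E} {φ ψ : Test E} (hφ : SuppIn K φ) (hψ : SuppIn K ψ) :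
    SuppIn K (φ + ψ) := fun x hx => by
  change φ x + ψ x = 0
  rw [hφ x hx, hψ x hx, add_zero]

lemma SuppIn.smul {K : Set E} {φ : Test E} (c : ℝ) (hφ : SuppIn K φ) :
    SuppIn K (c • φ) := fun x hx => by
  change c * φ x = 0
  rw [hφ x hx, mul_zero]

/-- On the common support T has finite order N, and the Taylor remainder is O(h²) in all derivatives
up to order N. It follows that a distribution which annihilates the generator of a flow is constant
along the flow. -/
theorem ScalarDist.hasDerivAt [FiniteDimensional ℝ E] (T : ScalarDist E) (Φ : TestFamily E) (τ : ℝ) :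
    HasDerivAt (fun τ => T (Φ.at' τ)) (T (Φ.deriv.at' τ)) τ := by
  obtain ⟨N, C, hC0, hC⟩ := T.isLocallyBounded Φ.K Φ.compact
  obtain ⟨D, hD0, hD⟩ := Φ.exists_derivLE_taylor τ N
  rw [hasDerivAt_iff_isLittleO_nhds_zero]
  have hb : (fun h : ℝ => T (Φ.at' (τ + h)) - T (Φ.at' τ) - h • T (Φ.deriv.at' τ))
      =O[nhds 0] fun h : ℝ => h ^ 2 := by
    refine Asymptotics.IsBigO.of_bound (C * D) ?_
    filter_upwards [Metric.closedBall_mem_nhds (0:ℝ) one_pos] with h hh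
    have hh' : |h| ≤ 1 := by simpa using hh
    have e : T (Φ.at' (τ + h)) - T (Φ.at' τ) - h • T (Φ.deriv.at' τ) =
        T (Φ.at' (τ + h) - Φ.at' τ - h • Φ.deriv.at' τ) := by
      rw [T.map_sub', T.map_sub', T.map_smul_real]
    rw [e, Real.norm_of_nonneg (sq_nonneg h), mul_assoc]
    exact hC _ (((Φ.supp_at _).sub (Φ.supp_at _)).sub ((Φ.deriv.supp_at _).smul h)) _ (hD h hh')
  exact hb.trans_isLittleO (Asymptotics.isLittleO_pow_id one_lt_two)

lemma ScalarDist.eq_of_deriv_eq_zero [FiniteDimensional ℝ E] (T : ScalarDist E) (Φ : TestFamily E)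
    (h : ∀ τ, T (Φ.deriv.at' τ) = 0) (a b : ℝ) : T (Φ.at' a) = T (Φ.at' b) :=
  is_const_of_deriv_eq_zero (f := fun τ => T (Φ.at' τ))
    (fun τ => (T.hasDerivAt Φ τ).differentiableAt)
    (fun τ => by rw [(T.hasDerivAt Φ τ).deriv, h]) a b

/-- Every test function lives in some ball, and compatibility makes the value independent of the
chosen ball. This turns constructions whose truncation depends on the support of the test function
into a single distribution. -/
lemma ScalarDist.exists_glue (T : ℕ → ScalarDist E)
    (h : ∀ m n : ℕ, m ≤ n → ∀ φ, SuppIn (Metric.closedBall (0:E) m) φ → T m φ = T n φ) :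
    ∃ S : ScalarDist E, ∀ (n : ℕ) φ, SuppIn (Metric.closedBall (0:E) n) φ → S φ = T n φ := by
  have hs : ∀ K : Set E, IsCompact K → ∃ n : ℕ, K ⊆ Metric.closedBall 0 n := by
    intro K hK
    obtain ⟨r, hr⟩ := hK.isBounded.subset_closedBall 0
    obtain ⟨n, hn⟩ := exists_nat_ge r
    exact ⟨n, hr.trans (Metric.closedBall_subset_closedBall hn)⟩
  have hs' : ∀ φ : Test E, ∃ n : ℕ, SuppIn (Metric.closedBall (0:E) n) φ := by
    intro φ
    obtain ⟨K, hK, hφ⟩ := φ.exists_suppIn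
    obtain ⟨n, hn⟩ := hs K hK
    exact ⟨n, hφ.mono hn⟩
  choose r hr using hs'
  have key : ∀ (n : ℕ) φ, SuppIn (Metric.closedBall (0:E) n) φ → T (r φ) φ = T n φ := by
    intro n φ hφ
    rcases le_total n (r φ) with hn | hn
    · exact (h _ _ hn φ hφ).symm
    · exact h _ _ hn φ (hr φ)
  have up : ∀ m n : ℕ, m ≤ n → ∀ φ, SuppIn (Metric.closedBall (0:E) m) φ →
      SuppIn (Metric.closedBall (0:E) n) φ := fun m n hmn φ hφ =>
    hφ.mono (Metric.closedBall_subset_closedBall (by exact_mod_cast hmn))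
  let L : Test E →ₗ[ℝ] ℂ :=
    { toFun := fun φ => T (r φ) φ
      map_add' := fun φ ψ => by
        have h1 := up _ (max (r φ) (r ψ)) (le_max_left _ _) φ (hr φ)
        have h2 := up _ (max (r φ) (r ψ)) (le_max_right _ _) ψ (hr ψ)
        rw [key _ _ h1, key _ _ h2, key _ _ (h1.add h2), ScalarDist.map_add']
      map_smul' := fun c φ => by
        rw [key _ _ ((hr φ).smul c), ScalarDist.map_smul_real]; rfl }
  refine ⟨mkDist L fun K hK => ?_, fun n φ hφ => key n φ hφ⟩
  obtain ⟨n, hn⟩ := hs K hK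
  obtain ⟨N, C, hC0, hC⟩ := (T n).isLocallyBounded K hK
  refine ⟨N, C, fun φ hφ M hM => ?_⟩
  change ‖T (r φ) φ‖ ≤ _
  rw [key n φ (hφ.mono hn)]
  exact hC φ hφ M hM

end Derivative

/-! ### Directional derivatives of test functions -/

section TDeriv

variable {E E' : Type} [NormedAddCommGroup E] [NormedSpace ℝ E]
  [NormedAddCommGroup E'] [NormedSpace ℝ E']

/-- The directional derivative of test functions. -/
def tderiv (v : E) : Test E →ₗ[ℝ] Test E where
  toFun φ := mkTest (fun x => fderiv ℝ φ x v)
    ((φ.contDiff.fderiv_right (m := ∞) (by simp)).clm_apply contDiff_const)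
    (φ.hasCompactSupport.fderiv_apply ℝ v)
  map_add' φ ψ := by
    ext x
    have h : fderiv ℝ (φ + ψ : E → ℝ) x = fderiv ℝ φ x + fderiv ℝ ψ x :=
      fderiv_add (φ.contDiff.differentiable (by simp) x) (ψ.contDiff.differentiable (by simp) x)
    exact congrArg (fun l : E →L[ℝ] ℝ => l v) h
  map_smul' c φ := by
    ext x
    have h : fderiv ℝ (c • φ : E → ℝ) x = c • fderiv ℝ φ x :=
      fderiv_const_smul (φ.contDiff.differentiable (by simp) x) c
    exact congrArg (fun l : E →L[ℝ] ℝ => l v) h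

lemma tderiv_apply (v : E) (φ : Test E) (x : E) : tderiv v φ x = fderiv ℝ φ x v := rfl

lemma Test.hasFDerivAt (φ : Test E) (x : E) : HasFDerivAt φ (fderiv ℝ φ x) x :=
  (φ.contDiff.differentiable (by simp) x).hasFDerivAt

lemma tderiv_eq_of_hasDerivAt {v : E} {φ : Test E} {x : E} {c : ℝ}
    (h : HasDerivAt (fun s : ℝ => φ (x + s • v)) c 0) : tderiv v φ x = c := by
  have h1 : HasDerivAt (fun s : ℝ => x + s • v) v 0 := by
    simpa using ((hasDerivAt_id (0:ℝ)).smul_const v).const_add x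
  have h2 : HasFDerivAt φ (fderiv ℝ φ x) (x + (0:ℝ) • v) := by simpa using φ.hasFDerivAt x
  exact (h2.comp_hasDerivAt (0:ℝ) h1).unique h

lemma Test.hasDerivAt_comp (φ : Test E) {f : ℝ → E} {v : E} {s : ℝ} (hf : HasDerivAt f v s) :
    HasDerivAt (fun s => φ (f s)) (tderiv v φ (f s)) s :=
  (φ.hasFDerivAt (f s)).comp_hasDerivAt s hf

lemma tderiv_add_dir (v w : E) (φ : Test E) : tderiv (v + w) φ = tderiv v φ + tderiv w φ := by
  ext x; exact map_add (fderiv ℝ φ x) v w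

lemma tderiv_smul_dir (c : ℝ) (v : E) (φ : Test E) : tderiv (c • v) φ = c • tderiv v φ := by
  ext x; exact map_smul (fderiv ℝ φ x) c v

lemma SuppIn.tderiv {K : Set E} (hK : IsClosed K) {φ : Test E} (h : SuppIn K φ) (v : E) :
    SuppIn K (tderiv v φ) := by
  intro x hx
  have : (φ : E → ℝ) =ᶠ[nhds x] fun _ => 0 :=
    Filter.eventually_of_mem (hK.isOpen_compl.mem_nhds hx) h
  rw [tderiv_apply, this.fderiv_eq]; simp

lemma tderiv_comm (v w : E) (φ : Test E) : tderiv v (tderiv w φ) = tderiv w (tderiv v φ) := by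
  ext x
  have hs : IsSymmSndFDerivAt ℝ φ x := (φ.contDiff.contDiffAt).isSymmSndFDerivAt (by
    simpa [minSmoothness_of_isRCLikeNormedField] using natCast_le_infty 2)
  have hd : ∀ v w : E, tderiv v (tderiv w φ) x = fderiv ℝ (fderiv ℝ φ) x v w := by
    intro v w
    have h1 : HasFDerivAt (fderiv ℝ φ) (fderiv ℝ (fderiv ℝ φ) x) x :=
      ((φ.contDiff.fderiv_right (m := ∞) (by simp)).differentiable (by simp) x).hasFDerivAt
    have h2 := h1.clm_apply (hasFDerivAt_const w x)
    have h3 : fderiv ℝ (tderiv w φ) x = _ := h2.fderiv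
    rw [tderiv_apply, h3]
    simp
  rw [hd, hd, hs.eq]

lemma distDeriv_apply (v : E) (T : ScalarDist E) (φ : Test E) :
    distDeriv v T φ = -T (tderiv v φ) := by
  have h : TestFunction.lineDerivCLM ℝ v φ = tderiv v φ := by
    ext x
    rw [TestFunction.lineDerivCLM_apply]
    exact (φ.hasFDerivAt x).hasLineDerivAt v |>.lineDeriv
  change Distribution.lineDerivCLM v T φ = _
  rw [Distribution.lineDerivCLM_apply, h]

lemma distDeriv_comm (v w : E) (T : ScalarDist E) :
    distDeriv v (distDeriv w T) = distDeriv w (distDeriv v T) := by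
  ext φ
  simp only [distDeriv_apply, tderiv_comm]

lemma distDeriv_add_dir (v w : E) (T : ScalarDist E) :
    distDeriv (v + w) T = distDeriv v T + distDeriv w T := by
  ext φ
  change _ = distDeriv v T φ + distDeriv w T φ
  rw [distDeriv_apply, distDeriv_apply, distDeriv_apply, tderiv_add_dir, T.map_add']
  ring

lemma distDeriv_smul_dir (c : ℝ) (v : E) (T : ScalarDist E) :
    distDeriv (c • v) T = (c : ℂ) • distDeriv v T := by
  ext φ
  change _ = (c : ℂ) • distDeriv v T φ
  rw [distDeriv_apply, distDeriv_apply, tderiv_smul_dir, T.map_smul_real]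
  simp

lemma distDeriv_eq_zero_iff {v : E} {T : ScalarDist E} :
    distDeriv v T = 0 ↔ ∀ φ, T (tderiv v φ) = 0 := by
  constructor
  · intro h φ
    have h1 := distDeriv_apply v T φ
    rw [h] at h1
    exact neg_eq_zero.1 h1.symm
  · intro h
    ext φ
    rw [distDeriv_apply, h, neg_zero]
    rfl

variable [FiniteDimensional ℝ E']

lemma tderiv_paramOp {a b : ℝ} {w : ℝ × E' → ℝ} {m : ℝ × E' → E} {hw : ContDiff ℝ ∞ w}
    {hm : ContDiff ℝ ∞ m} {hp : ProperData a b w m} (v : E') (x : E') {w' : ℝ → ℝ} {u : ℝ → E}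
    (hw' : ∀ τ, HasDerivAt (fun s : ℝ => w (τ, x + s • v)) (w' τ) 0)
    (hm' : ∀ τ, HasDerivAt (fun s : ℝ => m (τ, x + s • v)) (u τ) 0) (φ : Test E) :
    tderiv v (paramOp a b w m hw hm hp φ) x =
      ∫ τ in a..b, (w' τ * φ (m (τ, x)) + w (τ, x) * tderiv (u τ) φ (m (τ, x))) := by
  have hF : ContDiff ℝ ∞ fun z => w z * φ (m z) := hw.mul (φ.contDiff.comp hm)
  have h1 := hasFDerivAt_integral_param (fun z => w z * φ (m z)) (hF.of_le (by simp)) a b x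
  have h2 : tderiv v (paramOp a b w m hw hm hp φ) x = (∫ τ in a..b,
      (fderiv ℝ (fun z => w z * φ (m z)) (τ, x)).comp (ContinuousLinearMap.inr ℝ ℝ E')) v := by
    rw [tderiv_apply]
    exact congrArg (fun l : E' →L[ℝ] ℝ => l v) h1.fderiv
  rw [h2, ContinuousLinearMap.intervalIntegral_apply]
  · refine intervalIntegral.integral_congr fun τ _ => ?_
    have h3 : HasDerivAt (fun s : ℝ => ((τ, x + s • v) : ℝ × E')) (0, v) 0 := by
      refine (hasDerivAt_const _ _).prodMk ?_
      simpa using ((hasDerivAt_id (0:ℝ)).smul_const v).const_add x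
    have h4 : HasFDerivAt (fun z => w z * φ (m z)) (fderiv ℝ (fun z => w z * φ (m z)) (τ, x))
        (τ, x + (0:ℝ) • v) := by
      simpa using (hF.differentiable (by simp) (τ, x)).hasFDerivAt
    have h5 := h4.comp_hasDerivAt (0:ℝ) h3
    have h6 := (hw' τ).mul (φ.hasDerivAt_comp (hm' τ))
    have h7 := h5.unique h6
    simpa using h7
  · exact (((hF.continuous_fderiv (by simp)).comp (by fun_prop : Continuous fun τ : ℝ => (τ, x))).clm_comp
      continuous_const).intervalIntegrable _ _

lemma tderiv_paramOp_of_invariant {a b : ℝ} {w : ℝ × E' → ℝ} {m : ℝ × E' → E} {hw : ContDiff ℝ ∞ w}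
    {hm : ContDiff ℝ ∞ m} {hp : ProperData a b w m} (v : E') (u : E)
    (hw' : ∀ τ x (s : ℝ), w (τ, x + s • v) = w (τ, x))
    (hm' : ∀ τ x (s : ℝ), m (τ, x + s • v) = m (τ, x) + s • u) (φ : Test E) :
    tderiv v (paramOp a b w m hw hm hp φ) = paramOp a b w m hw hm hp (tderiv u φ) := by
  ext x
  rw [tderiv_paramOp v x (w' := fun _ => 0) (u := fun _ => u)]
  · simp
  · intro τ; simp only [hw']; exact hasDerivAt_const _ _
  · intro τ; simp only [hm']
    simpa using ((hasDerivAt_id (0:ℝ)).smul_const u).const_add (m (τ, x))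

end TDeriv

/-! ### Primitives of distributions -/

section Primitive

variable {E : Type} [NormedAddCommGroup E] [NormedSpace ℝ E] [FiniteDimensional ℝ E]

set_option linter.unusedSectionVars false in
lemma properData_translation (a b : ℝ) (w : ℝ × E → ℝ) (e : E) :
    ProperData a b w fun z => z.2 + z.1 • e := by
  intro K hK
  refine ⟨(fun z : E × ℝ => z.1 - z.2 • e) '' (K ×ˢ Set.uIcc a b),
    (hK.prod isCompact_uIcc).image (by fun_prop), fun τ hτ x _ hx => ?_⟩
  exact ⟨(x + τ • e, τ), ⟨hx, hτ⟩, by simp⟩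

/-- A smooth step function. -/
def step (s : ℝ) : ℝ := Real.smoothTransition s

lemma step_contDiff : ContDiff ℝ ∞ step := Real.smoothTransition.contDiff
lemma step_of_nonpos {s : ℝ} (h : s ≤ 0) : step s = 0 := Real.smoothTransition.zero_of_nonpos h
lemma step_of_one_le {s : ℝ} (h : 1 ≤ s) : step s = 1 := Real.smoothTransition.one_of_one_le h

lemma deriv_step_contDiff : ContDiff ℝ ∞ (deriv step) := by
  have h := step_contDiff
  rw [contDiff_infty_iff_deriv] at h
  exact h.2

lemma hasDerivAt_step (s : ℝ) : HasDerivAt step (deriv step s) s :=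
  (step_contDiff.differentiable (by simp) s).hasDerivAt

lemma deriv_step_eq_zero {s : ℝ} (h : s ∉ Set.Icc (0:ℝ) 1) : deriv step s = 0 := by
  rw [Set.mem_Icc, not_and_or, not_le, not_le] at h
  rcases h with h | h
  · have : step =ᶠ[nhds s] fun _ => 0 := by
      filter_upwards [Iio_mem_nhds h] with t ht using step_of_nonpos (le_of_lt ht)
    rw [this.deriv_eq]; simp
  · have : step =ᶠ[nhds s] fun _ => 1 := by
      filter_upwards [Ioi_mem_nhds h] with t ht using step_of_one_le (le_of_lt ht)
    rw [this.deriv_eq]; simp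

lemma integral_deriv_step : ∫ s, deriv step s = 1 := by
  have h : Function.support (deriv step) ⊆ Set.Ioc (-1) 2 := by
    intro s hs
    by_contra h
    refine hs (deriv_step_eq_zero fun h' => h ⟨?_, ?_⟩)
    · linarith [h'.1]
    · linarith [h'.2]
  rw [← intervalIntegral.integral_eq_integral_of_support_subset h,
    intervalIntegral.integral_eq_sub_of_hasDerivAt (fun s _ => hasDerivAt_step s)
      (deriv_step_contDiff.continuous.intervalIntegrable _ _),
    step_of_one_le (by norm_num), step_of_nonpos (by norm_num), sub_zero]

variable (l : E →L[ℝ] ℝ) (e : E)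

/-- Integration along the lines in direction `e`, from `-∞` on the left and to `∞` on the right. -/
def primOp (a : ℝ) : Test E →ₗ[ℝ] Test E :=
  -- The first weight vanishes for l ≥ 1 and the second for l ≤ 0. If l e = 1 and φ lives in |l| ≤
  -- A, then for a = A + 1 the truncated integrals therefore agree, where they matter, with those
  -- over the half lines.
  paramOp (-a) 0 (fun z => 1 - step (l z.2)) (fun z => z.2 + z.1 • e)
      (contDiff_const.sub (step_contDiff.comp (by fun_prop))) (by fun_prop)
      (properData_translation _ _ _ e) -
    paramOp 0 a (fun z => step (l z.2)) (fun z => z.2 + z.1 • e)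
      (step_contDiff.comp (by fun_prop)) (by fun_prop) (properData_translation _ _ _ e)

lemma primOp_isBounded (a : ℝ) : IsBoundedOp (primOp l e a) := by
  unfold primOp
  rw [sub_eq_add_neg]
  exact (paramOp_isBounded ..).add (paramOp_isBounded ..).neg

lemma primOp_apply (a : ℝ) (φ : Test E) (x : E) : primOp l e a φ x =
    (1 - step (l x)) * (∫ τ in (-a)..0, φ (x + τ • e)) - step (l x) * ∫ τ in (0:ℝ)..a, φ (x + τ • e) := by
  rw [← intervalIntegral.integral_const_mul, ← intervalIntegral.integral_const_mul]
  rfl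

variable {l e}

set_option linter.unusedSectionVars false in
lemma integral_tderiv_line (φ : Test E) (x : E) (a b : ℝ) :
    ∫ τ in a..b, tderiv e φ (x + τ • e) = φ (x + b • e) - φ (x + a • e) := by
  have h : ∀ τ : ℝ, HasDerivAt (fun τ : ℝ => φ (x + τ • e)) (tderiv e φ (x + τ • e)) τ := fun τ =>
    φ.hasDerivAt_comp (by simpa using ((hasDerivAt_id τ).smul_const e).const_add x)
  refine intervalIntegral.integral_eq_sub_of_hasDerivAt (fun τ _ => h τ)
    (((tderiv e φ).contDiff.continuous.comp (by fun_prop)).intervalIntegrable _ _)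

/-- Integration of ∂_e φ along the two segments gives φ(x) with weights adding up to 1, and two far
endpoint values. Wherever the weight of an endpoint is non-zero, that endpoint lies outside the
support; the margin 1 covers the transition zone of the step function. -/
lemma primOp_tderiv (hle : l e = 1) {A : ℝ} {φ : Test E}
    (hφ : ∀ x, A < |l x| → φ x = 0) : primOp l e (A + 1) (tderiv e φ) = φ := by
  ext x
  rw [primOp_apply, integral_tderiv_line, integral_tderiv_line]
  simp only [zero_smul, add_zero]
  have h1 : (1 - step (l x)) * φ (x + (-(A + 1)) • e) = 0 := by
    rcases le_or_gt 1 (l x) with h | h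
    · rw [step_of_one_le h]; simp
    · rw [hφ, mul_zero]
      refine lt_abs.2 (Or.inr ?_)
      simp [hle]; linarith
  have h2 : step (l x) * φ (x + (A + 1) • e) = 0 := by
    rcases le_or_gt (l x) 0 with h | h
    · rw [step_of_nonpos h]; simp
    · rw [hφ, mul_zero]
      refine lt_abs.2 (Or.inl ?_)
      simp [hle]; linarith
  linear_combination -h1 - h2

lemma primOp_eq_of_le (hle : l e = 1) {A B : ℝ} (hAB : A ≤ B) {φ : Test E}
    (hφ : ∀ x, A < |l x| → φ x = 0) : primOp l e (A + 1) φ = primOp l e (B + 1) φ := by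
  ext x
  have hc : Continuous fun τ : ℝ => φ (x + τ • e) := φ.contDiff.continuous.comp (by fun_prop)
  rw [primOp_apply, primOp_apply, ← intervalIntegral.integral_add_adjacent_intervals
    (hc.intervalIntegrable (-(B + 1)) (-(A + 1))) (hc.intervalIntegrable _ 0),
    ← intervalIntegral.integral_add_adjacent_intervals
    (hc.intervalIntegrable 0 (A + 1)) (hc.intervalIntegrable _ (B + 1))]
  have h1 : (1 - step (l x)) * ∫ τ in (-(B + 1))..(-(A + 1)), φ (x + τ • e) = 0 := by
    rcases le_or_gt 1 (l x) with h | h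
    · rw [step_of_one_le h]; simp
    · rw [intervalIntegral.integral_congr (g := fun _ => 0)]
      · simp
      · intro τ hτ
        rw [Set.uIcc_of_le (by linarith)] at hτ
        refine hφ _ (lt_abs.2 (Or.inr ?_))
        simp [hle]; linarith [hτ.2]
  have h2 : step (l x) * ∫ τ in (A + 1)..(B + 1), φ (x + τ • e) = 0 := by
    rcases le_or_gt (l x) 0 with h | h
    · rw [step_of_nonpos h]; simp
    · rw [intervalIntegral.integral_congr (g := fun _ => 0)]
      · simp
      · intro τ hτ
        rw [Set.uIcc_of_le (by linarith)] at hτ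
        refine hφ _ (lt_abs.2 (Or.inl ?_))
        simp [hle]; linarith [hτ.1]
  linear_combination -h1 + h2

lemma tderiv_primOp_of_ker {v : E} (hv : l v = 0) (a : ℝ) (φ : Test E) :
    tderiv v (primOp l e a φ) = primOp l e a (tderiv v φ) := by
  unfold primOp
  rw [LinearMap.sub_apply, LinearMap.sub_apply, map_sub, tderiv_paramOp_of_invariant v v,
    tderiv_paramOp_of_invariant v v]
  all_goals intro τ x s
  · simp [hv]
  · exact add_right_comm _ _ _
  · simp [hv]
  · exact add_right_comm _ _ _

/-- Averaging along the lines in direction `e`. -/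
lemma tderiv_primOp (hle : l e = 1) {A : ℝ} {φ : Test E}
    (hφ : ∀ x, A < |l x| → φ x = 0) (x : E) : tderiv e (primOp l e (A + 1) φ) x =
      φ x - deriv step (l x) * ∫ τ : ℝ, φ (x + τ • e) := by
  have hs : HasDerivAt (fun s : ℝ => step (l (x + s • e))) (deriv step (l x)) 0 := by
    have h1 : HasDerivAt (fun s : ℝ => l (x + s • e)) 1 0 := by
      simp only [map_add, map_smul, hle, smul_eq_mul, mul_one]
      simpa using (hasDerivAt_id (0:ℝ)).const_add (l x)
    have h2 : HasDerivAt step (deriv step (l x)) (l (x + (0:ℝ) • e)) := by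
      simpa using hasDerivAt_step (l x)
    exact (h2.comp (0:ℝ) h1).congr_deriv (mul_one _)
  have hm : ∀ τ : ℝ, HasDerivAt (fun s : ℝ => x + s • e + τ • e) e 0 := by
    intro τ
    simpa using (((hasDerivAt_id (0:ℝ)).smul_const e).const_add x).add_const (τ • e)
  have hc : ∀ φ : Test E, Continuous fun τ : ℝ => φ (x + τ • e) := fun φ =>
    φ.contDiff.continuous.comp (by fun_prop)
  -- This accounts for the derivative falling on φ. The derivative falling on the two weights
  -- produces step' times the sum of both integrals, that is, the integral over the whole line.
  have h0 := congrArg (fun ψ : Test E => ψ x) (primOp_tderiv hle hφ)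
  simp only [primOp_apply] at h0
  have hint : ∀ (c d : ℝ) (p q : ℝ) (ψ χ : Test E),
      ∫ τ in p..q, (c * ψ (x + τ • e) + d * χ (x + τ • e)) =
        c * (∫ τ in p..q, ψ (x + τ • e)) + d * ∫ τ in p..q, χ (x + τ • e) := by
    intro c d p q ψ χ
    rw [intervalIntegral.integral_add (((hc ψ).const_mul c).intervalIntegrable _ _)
      (((hc χ).const_mul d).intervalIntegrable _ _), intervalIntegral.integral_const_mul,
      intervalIntegral.integral_const_mul]
  unfold primOp
  rw [LinearMap.sub_apply, map_sub]
  change tderiv e _ x - tderiv e _ x = _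
  rw [tderiv_paramOp e x (w' := fun _ => -deriv step (l x)) (u := fun _ => e)
      (fun τ => by simpa using hs.const_sub 1) hm,
    tderiv_paramOp e x (w' := fun _ => deriv step (l x)) (u := fun _ => e) (fun τ => hs) hm]
  dsimp only
  rw [hint, hint]
  have h3 : deriv step (l x) * ∫ τ : ℝ, φ (x + τ • e) = deriv step (l x) *
      ((∫ τ in (-(A+1))..0, φ (x + τ • e)) + ∫ τ in (0:ℝ)..(A+1), φ (x + τ • e)) := by
    by_cases hx : l x ∈ Set.Icc (0:ℝ) 1
    · rw [intervalIntegral.integral_add_adjacent_intervals ((hc φ).intervalIntegrable _ _)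
        ((hc φ).intervalIntegrable _ _)]
      -- At l x = 1 the endpoint τ = -(A + 1) reaches l = -A, where φ need not vanish; there the
      -- factor step' is zero by continuity.
      by_cases h' : l x = 1
      · rw [h']
        have : deriv step 1 = 0 := by
          have hcl : IsClosed {s : ℝ | deriv step s = 0} :=
            isClosed_eq deriv_step_contDiff.continuous continuous_const
          have hsub : Set.Ioi (1:ℝ) ⊆ {s : ℝ | deriv step s = 0} := fun s hs =>
            deriv_step_eq_zero fun h => absurd h.2 (not_le.2 hs)
          have := closure_minimal hsub hcl
          rw [closure_Ioi] at this
          exact this (Set.mem_Ici.2 le_rfl)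
        rw [this]; simp
      · have hlt : l x < 1 := lt_of_le_of_ne hx.2 h'
        rw [intervalIntegral.integral_eq_integral_of_support_subset]
        intro τ hτ
        by_contra hc'
        refine hτ (hφ _ ?_)
        simp only [map_add, map_smul, hle, smul_eq_mul, mul_one]
        rw [Set.mem_Ioc, not_and_or, not_lt, not_le] at hc'
        rcases hc' with h | h
        · exact lt_abs.2 (Or.inr (by linarith))
        · exact lt_abs.2 (Or.inl (by linarith [hx.1]))
    · rw [deriv_step_eq_zero hx]; simp
  linear_combination h0 + h3

/-- Primitives of distributions. -/
theorem ScalarDist.exists_primitive (hle : l e = 1) (T : ScalarDist E) : ∃ U : ScalarDist E,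
    distDeriv e U = T ∧ ∀ v, l v = 0 → distDeriv v T = 0 → distDeriv v U = 0 := by
  obtain ⟨c, hc⟩ := exists_nat_ge ‖l‖
  have hsupp : ∀ (n : ℕ) (φ : Test E), SuppIn (Metric.closedBall (0:E) n) φ →
      ∀ x, (c * n : ℝ) < |l x| → φ x = 0 := by
    intro n φ hφ x hx
    refine hφ x fun hx' => ?_
    have h1 : ‖x‖ ≤ n := by simpa using hx'
    have h2 : |l x| ≤ ‖l‖ * ‖x‖ := l.le_opNorm x
    have h3 : ‖l‖ * ‖x‖ ≤ c * n := by gcongr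
    linarith
  -- On the ball of radius n one has |l| ≤ c n, so this truncation suffices for test functions
  -- supported there. The sign compensates the one in ∂_e U (φ) = -U(∂_e φ).
  let U : ℕ → ScalarDist E := fun n =>
    -distTranspose (primOp l e (c * n + 1)) (primOp_isBounded _ _ _) T
  have hU : ∀ n φ, U n φ = -T (primOp l e (c * n + 1) φ) := fun n φ => rfl
  obtain ⟨S, hS⟩ := ScalarDist.exists_glue U (by
    intro m n hmn φ hφ
    have hmn' : (c * m : ℝ) ≤ c * n := by gcongr
    rw [hU, hU, primOp_eq_of_le hle hmn' (hsupp m φ hφ)])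
  have hb : ∀ φ : Test E, ∃ n : ℕ, SuppIn (Metric.closedBall (0:E) n) φ := by
    intro φ
    obtain ⟨K, hK, hφ⟩ := φ.exists_suppIn
    obtain ⟨r, hr⟩ := hK.isBounded.subset_closedBall 0
    obtain ⟨n, hn⟩ := exists_nat_ge r
    exact ⟨n, hφ.mono (hr.trans (Metric.closedBall_subset_closedBall hn))⟩
  refine ⟨S, ?_, fun v hv hT => ?_⟩
  · ext φ
    obtain ⟨n, hn⟩ := hb φ
    rw [distDeriv_apply, hS n _ (hn.tderiv Metric.isClosed_closedBall e), hU, neg_neg,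
      primOp_tderiv hle (hsupp n φ hn)]
  · rw [distDeriv_eq_zero_iff]
    intro φ
    obtain ⟨n, hn⟩ := hb φ
    rw [hS n _ (hn.tderiv Metric.isClosed_closedBall v), hU, ← tderiv_primOp_of_ker hv,
      distDeriv_eq_zero_iff.1 hT, neg_zero]

/-- Redistributing φ along each line with the weight step' ∘ l of integral 1 changes it only by ∂_e
of a test function. -/
lemma ScalarDist.apply_eq_of_distDeriv_eq_zero (hle : l e = 1) {T : ScalarDist E}
    (hT : distDeriv e T = 0) (φ : Test E) :
    ∃ ψ : Test E, (∀ x, ψ x = deriv step (l x) * ∫ τ : ℝ, φ (x + τ • e)) ∧ T φ = T ψ := by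
  obtain ⟨K, hK, hφ⟩ := φ.exists_suppIn
  obtain ⟨A, hA⟩ := (hK.image l.continuous).isBounded.exists_norm_le
  have hφ' : ∀ x, A < |l x| → φ x = 0 := fun x hx => hφ x fun hx' =>
    absurd (hA _ ⟨x, hx', rfl⟩) (not_le.2 hx)
  refine ⟨φ - tderiv e (primOp l e (A + 1) φ), fun x => ?_, ?_⟩
  · change φ x - tderiv e _ x = _
    rw [tderiv_primOp hle hφ']; ring
  · rw [T.map_sub', distDeriv_eq_zero_iff.1 hT, sub_zero]

end Primitive

/-! ### Multiplication of distributions by linear functions, and division -/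

section Division

variable {E : Type} [NormedAddCommGroup E] [NormedSpace ℝ E] [FiniteDimensional ℝ E]

/-- Multiplication of test functions by a smooth function. -/
def mulTest (w : E → ℝ) (hw : ContDiff ℝ ∞ w) : Test E →ₗ[ℝ] Test E :=
  mulCompOp w id hw contDiff_id fun K hK => ⟨K, hK, fun _ _ h => h⟩

@[simp] lemma mulTest_apply (w : E → ℝ) (hw : ContDiff ℝ ∞ w) (φ : Test E) (x : E) :
    mulTest w hw φ x = w x * φ x := mulCompOp_apply ..

/-- Multiplication of distributions by a smooth function. -/
def mulDist (w : E → ℝ) (hw : ContDiff ℝ ∞ w) : Module.End ℂ (ScalarDist E) where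
  toFun T := distTranspose (mulTest w hw) (mulCompOp_isBounded ..) T
  map_add' S T := by ext φ; rfl
  map_smul' c T := by ext φ; rfl

@[simp] lemma mulDist_apply (w : E → ℝ) (hw : ContDiff ℝ ∞ w) (T : ScalarDist E) (φ : Test E) :
    mulDist w hw T φ = T (mulTest w hw φ) := rfl

lemma tderiv_mulTest (w : E → ℝ) (hw : ContDiff ℝ ∞ w) (v : E) (φ : Test E) (x : E) :
    tderiv v (mulTest w hw φ) x = fderiv ℝ w x v * φ x + w x * tderiv v φ x := by
  have h : HasFDerivAt (mulTest w hw φ) (w x • fderiv ℝ φ x + φ x • fderiv ℝ w x) x := by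
    have := ((hw.differentiable (by simp) x).hasFDerivAt).mul (φ.hasFDerivAt x)
    refine this.congr_of_eventuallyEq (Filter.Eventually.of_forall fun y => ?_)
    simp
  rw [tderiv_apply, h.fderiv, tderiv_apply]
  simp; ring

lemma distDeriv_mulDist (w : E → ℝ) (hw : ContDiff ℝ ∞ w) (v : E) (T : ScalarDist E) :
    distDeriv v (mulDist w hw T) = mulDist w hw (distDeriv v T) +
      mulDist (fun x => fderiv ℝ w x v)
        ((hw.fderiv_right (m := ∞) (by simp)).clm_apply contDiff_const) T := by
  ext φ
  change _ = mulDist w hw (distDeriv v T) φ + mulDist _ _ T φ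
  rw [distDeriv_apply, mulDist_apply, mulDist_apply, mulDist_apply, distDeriv_apply]
  have h : mulTest w hw (tderiv v φ) = tderiv v (mulTest w hw φ) - mulTest (fun x => fderiv ℝ w x v)
        ((hw.fderiv_right (m := ∞) (by simp)).clm_apply contDiff_const) φ := by
    ext x
    change _ = tderiv v (mulTest w hw φ) x - _
    rw [tderiv_mulTest, mulTest_apply, mulTest_apply]; ring
  rw [h, T.map_sub']; ring

/-- A smooth cutoff function which is `1` near `0`. -/
def cutoff (s : ℝ) : ℝ :=
  (⟨1, 2, one_pos, one_lt_two⟩ : ContDiffBump (0:ℝ)) s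

lemma cutoff_contDiff : ContDiff ℝ ∞ cutoff := ContDiffBump.contDiff _

lemma cutoff_eq_one {s : ℝ} (h : |s| ≤ 1) : cutoff s = 1 :=
  ContDiffBump.one_of_mem_closedBall _ (by simpa using h)

lemma cutoff_eq_zero {s : ℝ} (h : 2 ≤ |s|) : cutoff s = 0 :=
  ContDiffBump.zero_of_le_dist _ (by simpa using h)

lemma contDiff_one_sub_cutoff_div : ContDiff ℝ ∞ fun s => (1 - cutoff s) / s := by
  refine contDiff_iff_contDiffAt.2 fun s => ?_
  by_cases hs : s = 0
  · subst hs
    have : (fun s => (1 - cutoff s) / s) =ᶠ[nhds 0] fun _ => 0 := by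
      filter_upwards [Metric.closedBall_mem_nhds (0:ℝ) one_pos] with s hs
      rw [cutoff_eq_one (by simpa using hs)]; simp
    exact contDiffAt_const.congr_of_eventuallyEq this
  · exact ((contDiff_const.sub cutoff_contDiff).contDiffAt).div contDiffAt_id hs

variable {l : E →L[ℝ] ℝ} {e : E}

set_option linter.unusedSectionVars false in
variable (l e) in
lemma properData_retract : ProperData 0 1 (fun z : ℝ × E => cutoff (l z.2))
    (fun z => z.2 + ((z.1 - 1) * l z.2) • e) := by
  intro K hK
  refine ⟨(fun p : E × ℝ × ℝ => p.1 - ((p.2.1 - 1) * p.2.2) • e) ''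
    (K ×ˢ (Set.uIcc 0 1 ×ˢ Set.Icc (-2) 2)),
    (hK.prod (isCompact_uIcc.prod isCompact_Icc)).image (by fun_prop), fun τ hτ x hw hx => ?_⟩
  refine ⟨(x + ((τ - 1) * l x) • e, τ, l x), ⟨hx, hτ, ?_⟩, by simp⟩
  by_contra h
  refine hw (cutoff_eq_zero ?_)
  by_contra h'
  exact h (abs_le.1 (le_of_lt (not_le.1 h')))

/-- Distributions can be divided by linear functions. -/
theorem ScalarDist.exists_div (hle : l e = 1) (T : ScalarDist E) : ∃ F : ScalarDist E,
    mulDist l l.contDiff F = T ∧ ∀ v, l v = 0 → distDeriv v T = 0 → distDeriv v F = 0 := by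
  -- P(∂_e φ) is the cutoff times the Hadamard quotient (φ(x) - φ(x - l(x) e)) / l(x), which is
  -- smooth across l = 0. Away from the hyperplane plain division by l, in the form of w, takes
  -- over. The cutoff keeps supports compact, since the retraction onto the hyperplane is not
  -- proper.
  let P : Test E →ₗ[ℝ] Test E := paramOp 0 1 (fun z : ℝ × E => cutoff (l z.2))
    (fun z => z.2 + ((z.1 - 1) * l z.2) • e) (cutoff_contDiff.comp (by fun_prop)) (by fun_prop)
    (properData_retract l e)
  have hP : IsBoundedOp P := paramOp_isBounded ..
  let w : E → ℝ := fun x => (1 - cutoff (l x)) / l x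
  have hw : ContDiff ℝ ∞ w := contDiff_one_sub_cutoff_div.comp l.contDiff
  let F : ScalarDist E := mulDist w hw T - distDeriv e (distTranspose P hP T)
  have hF : ∀ φ, F φ = T (P (tderiv e φ) + mulTest w hw φ) := by
    intro φ
    change mulDist w hw T φ - distDeriv e (distTranspose P hP T) φ = _
    rw [distDeriv_apply, distTranspose_apply, T.map_add', mulDist_apply]; ring
  refine ⟨F, ?_, fun v hv hT => ?_⟩
  · ext φ
    rw [mulDist_apply, hF]
    congr 1
    ext x
    change P (tderiv e (mulTest l l.contDiff φ)) x + mulTest w hw (mulTest l l.contDiff φ) x = φ x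
    have h1 : P (tderiv e (mulTest l l.contDiff φ)) x = cutoff (l x) * φ x := by
      -- For l φ instead of φ the integrand is an exact τ-derivative, which is why P ∘ ∂_e inverts
      -- multiplication by l up to the cutoff.
      have hd : ∀ τ : ℝ, HasDerivAt (fun τ : ℝ => τ * φ (x + ((τ - 1) * l x) • e))
          (tderiv e (mulTest l l.contDiff φ) (x + ((τ - 1) * l x) • e)) τ := by
        intro τ
        have h2 : HasDerivAt (fun τ : ℝ => x + ((τ - 1) * l x) • e) (l x • e) τ := by
          simpa using ((((hasDerivAt_id τ).sub_const 1).mul_const (l x)).smul_const e).const_add x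
        have h3 := (hasDerivAt_id τ).mul (Test.hasDerivAt_comp φ h2)
        refine h3.congr_deriv ?_
        rw [tderiv_mulTest, tderiv_smul_dir, ContinuousLinearMap.fderiv]
        simp only [map_add, map_smul, smul_eq_mul, hle, id]
        change _ + τ * (l x * _) = _
        ring
      have h4 : P (tderiv e (mulTest l l.contDiff φ)) x = ∫ τ in (0:ℝ)..1, cutoff (l x) *
        tderiv e (mulTest l l.contDiff φ) (x + ((τ - 1) * l x) • e) := rfl
      rw [h4, intervalIntegral.integral_const_mul,
        intervalIntegral.integral_eq_sub_of_hasDerivAt (fun τ _ => hd τ)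
        (((tderiv e (mulTest l l.contDiff φ)).contDiff.continuous.comp
          (by fun_prop)).intervalIntegrable _ _)]
      simp
    rw [h1, mulTest_apply, mulTest_apply]
    by_cases h : l x = 0
    · rw [h, cutoff_eq_one (by simp)]; simp
    · simp only [w]; field_simp; ring
  · rw [distDeriv_eq_zero_iff]
    intro φ
    have h1 : P (tderiv e (tderiv v φ)) + mulTest w hw (tderiv v φ) =
        tderiv v (P (tderiv e φ) + mulTest w hw φ) := by
      rw [map_add, tderiv_comm]
      congr 1
      · exact (tderiv_paramOp_of_invariant v v (by simp [hv])
          (fun τ x s => by simp only [map_add, map_smul, hv, smul_zero, add_zero]; abel) _).symm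
      · ext x
        have h2 : fderiv ℝ w x v = 0 := by
          have h3 : HasFDerivAt w (fderiv ℝ w x) (x + (0:ℝ) • v) := by
            simpa using (hw.differentiable (by simp) x).hasFDerivAt
          have h4 : HasDerivAt (fun s : ℝ => x + s • v) v 0 := by
            simpa using ((hasDerivAt_id (0:ℝ)).smul_const v).const_add x
          have h5 := h3.comp_hasDerivAt (0:ℝ) h4
          have h6 : (w ∘ fun s : ℝ => x + s • v) = fun _ => w x := by
            funext s; simp [w, hv]
          rw [h6] at h5
          exact h5.unique (hasDerivAt_const _ _)
        rw [tderiv_mulTest, mulTest_apply, h2]; ring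
    rw [hF, h1, distDeriv_eq_zero_iff.1 hT]

end Division

/-! ### Distributions depending on the difference of two points -/

section Difference

open MeasureTheory

/-- A bump function of integral `1`. -/
def unitBump (y : Spacetime) : ℝ := ∏ m, deriv step (y m)

lemma unitBump_contDiff : ContDiff ℝ ∞ unitBump := by
  unfold unitBump
  exact contDiff_prod fun m _ => deriv_step_contDiff.comp (by fun_prop)

lemma integral_unitBump : ∫ y, unitBump y = 1 := by
  unfold unitBump
  rw [integral_fintype_prod_volume_eq_prod (fun _ : Fin 4 => deriv step)]
  simp [integral_deriv_step]

lemma unitBump_ne_zero {y : Spacetime} (h : unitBump y ≠ 0) : y ∈ Set.Icc (0 : Spacetime) 1 := by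
  have h1 : ∀ m, y m ∈ Set.Icc (0:ℝ) 1 := fun m => by
    by_contra hm
    exact h (Finset.prod_eq_zero (Finset.mem_univ m) (deriv_step_eq_zero hm))
  exact ⟨fun m => (h1 m).1, fun m => (h1 m).2⟩

/-- `ψ ↦ ψ(x₁ - x₂) ρ(x₂)` for a bump function `ρ` of integral one. -/
def liftTest : Test Spacetime →ₗ[ℝ] Test Spacetime2 :=
  mulCompOp (fun p => unitBump p.2) (fun p => p.1 - p.2) (unitBump_contDiff.comp contDiff_snd)
    (by fun_prop) fun K hK => by
      refine ⟨(fun p : Spacetime × Spacetime => (p.1 + p.2, p.2)) '' (K ×ˢ Set.Icc 0 1),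
        (hK.prod isCompact_Icc).image (by fun_prop), fun x hw hx => ?_⟩
      exact ⟨(x.1 - x.2, x.2), ⟨hx, unitBump_ne_zero hw⟩, by simp⟩

@[simp] lemma liftTest_apply (ψ : Test Spacetime) (p : Spacetime2) :
    liftTest ψ p = unitBump p.2 * ψ (p.1 - p.2) := mulCompOp_apply ..

lemma liftTest_isBounded : IsBoundedOp liftTest := mulCompOp_isBounded ..

lemma distDiff_liftTest (G : ScalarDist Spacetime) (ψ : Test Spacetime) :
    distDiff G (liftTest ψ) = G ψ := by
  refine distDiff_apply G _ ψ fun x => ?_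
  simp only [liftTest_apply, add_sub_cancel_right]
  rw [integral_mul_const, integral_unitBump, one_mul]

lemma distDiff_injective : Function.Injective distDiff := by
  intro G H h
  ext ψ
  rw [← distDiff_liftTest G, h, distDiff_liftTest]

/-- `∫ φ(x + y, y) dy` -/
def marg (φ : Test Spacetime2) : Test Spacetime := testMarginal (testComp shear φ)

lemma marg_apply (φ : Test Spacetime2) (x : Spacetime) : marg φ x = ∫ y, φ (x + y, y) := rfl

lemma distDiff_eq (G : ScalarDist Spacetime) (φ : Test Spacetime2) :
    distDiff G φ = G (marg φ) := rfl

lemma marg_tderiv_fst (v : Spacetime) (φ : Test Spacetime2) :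
    marg (tderiv (v, 0) φ) = tderiv v (marg φ) := by
  ext x
  let χ : Test Spacetime2 := testComp shear φ
  have hs := χ.hasCompactSupport
  have h := hasFDerivAt_marginal (K := tsupport χ) hs.isCompact χ (χ.contDiff.of_le (by simp))
    (fun z hz => image_eq_zero_of_notMem_tsupport hz)
    (fun z hz => image_eq_zero_of_notMem_tsupport fun h => hz (tsupport_fderiv_subset ℝ h)) x
  have h1 : tderiv v (marg φ) x = (∫ y, restrictFst ℝ (fderiv ℝ χ (x, y))) v := by
    rw [tderiv_apply]
    exact congrArg (fun l : Spacetime →L[ℝ] ℝ => l v) h.fderiv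
  rw [h1, marg_apply, ContinuousLinearMap.integral_apply]
  · refine integral_congr_ae (Filter.Eventually.of_forall fun y => ?_)
    have h2 : HasFDerivAt χ ((fderiv ℝ φ (shear (x, y))).comp (shear : Spacetime2 →L[ℝ] Spacetime2))
      (x, y) := (φ.hasFDerivAt (shear (x, y))).comp (x, y) shear.hasFDerivAt
    change fderiv ℝ φ (x + y, y) (v, 0) = restrictFst ℝ (fderiv ℝ χ (x, y)) v
    rw [h2.fderiv]
    change _ = fderiv ℝ φ (x + y, y) (v + 0, 0)
    rw [add_zero]
  · refine Continuous.integrable_of_hasCompactSupport ((restrictFst ℝ).continuous.comp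
      ((χ.contDiff.continuous_fderiv (by simp)).comp (by fun_prop))) ?_
    refine HasCompactSupport.intro (hs.isCompact.image continuous_snd) fun y hy => ?_
    have : fderiv ℝ χ (x, y) = 0 := image_eq_zero_of_notMem_tsupport fun h =>
      hy ⟨(x, y), tsupport_fderiv_subset ℝ h, rfl⟩
    simp [this]

/-- Along the diagonal the derivative acts on the integration variable y, and the integral of a
derivative of a compactly supported function vanishes. -/
lemma marg_tderiv_diag (v : Spacetime) (φ : Test Spacetime2) : marg (tderiv (v, v) φ) = 0 := by
  ext x
  let f : Spacetime → ℝ := fun y => φ (x + y, y)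
  have hf : ∀ y, HasFDerivAt f ((fderiv ℝ φ (x + y, y)).comp
      ((ContinuousLinearMap.id ℝ Spacetime).prod (ContinuousLinearMap.id ℝ Spacetime))) y := by
    intro y
    have hq : HasFDerivAt (fun y => (x + y, y)) ((ContinuousLinearMap.id ℝ Spacetime).prod
        (ContinuousLinearMap.id ℝ Spacetime)) y :=
      ((hasFDerivAt_id y).const_add x).prodMk (hasFDerivAt_id y)
    exact HasFDerivAt.comp (g := φ) y (Test.hasFDerivAt φ (x + y, y)) hq
  have hz : ∀ y, y ∉ Prod.snd '' (tsupport φ) → ∀ x, (x, y) ∉ tsupport φ := fun y hy x h =>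
    hy ⟨_, h, rfl⟩
  have hK := φ.hasCompactSupport.isCompact.image continuous_snd
  have hc : Continuous fun y => φ (x + y, y) := φ.contDiff.continuous.comp (by fun_prop)
  have hc' : Continuous fun y => tderiv (v, v) φ (x + y, y) :=
    (tderiv (v, v) φ).contDiff.continuous.comp (by fun_prop)
  have h0 : ∀ y, fderiv ℝ f y v = tderiv (v, v) φ (x + y, y) := fun y => by
    rw [(hf y).fderiv]; rfl
  have h := integral_mul_fderiv_eq_neg_fderiv_mul_of_integrable (μ := (volume : Measure Spacetime))
    (f := fun _ : Spacetime => (1:ℝ)) (g := f) (v := v) (𝕜 := ℝ) (by simp) (by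
      simp only [h0, one_mul]
      exact hc'.integrable_of_hasCompactSupport (HasCompactSupport.intro hK fun y hy => by
        rw [tderiv_apply, image_eq_zero_of_notMem_tsupport (f := fderiv ℝ φ) fun h =>
          hz y hy _ (tsupport_fderiv_subset ℝ h)]; rfl)) (by
      simp only [one_mul]
      exact hc.integrable_of_hasCompactSupport (HasCompactSupport.intro hK fun y hy =>
        image_eq_zero_of_notMem_tsupport (hz y hy _))) (fun _ _ => differentiableAt_const _)
      (fun y _ => (hf y).differentiableAt)
  simp only [h0, one_mul] at h
  rw [marg_apply, h]
  simp

lemma distDeriv_distDiff_fst (v : Spacetime) (G : ScalarDist Spacetime) :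
    distDeriv (v, 0) (distDiff G) = distDiff (distDeriv v G) := by
  ext φ
  rw [distDeriv_apply, distDiff_eq, distDiff_eq, distDeriv_apply, marg_tderiv_fst]

lemma distDeriv_distDiff_diag (v : Spacetime) (G : ScalarDist Spacetime) :
    distDeriv (v, v) (distDiff G) = 0 := by
  rw [distDeriv_eq_zero_iff]
  intro φ
  rw [distDiff_eq, marg_tderiv_diag, G.map_zero']

lemma distDeriv_distDiff_snd (v : Spacetime) (G : ScalarDist Spacetime) :
    distDeriv (0, v) (distDiff G) = -distDiff (distDeriv v G) := by
  have h := distDeriv_distDiff_diag v G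
  have h1 : ((v, v) : Spacetime2) = (v, 0) + (0, v) := by simp
  rw [h1, distDeriv_add_dir, distDeriv_distDiff_fst] at h
  exact (neg_eq_of_add_eq_zero_right h).symm

/-- `ScalarDist.apply_eq_of_distDeriv_eq_zero` is applied in the diagonal directions one after
another. Each step trades the dependence along one direction for a fixed bump factor. When S is
everything, I depends on the difference of the points only. -/
lemma exists_averaged (T : ScalarDist Spacetime2)
    (hT : ∀ m, distDeriv ((unit m, unit m) : Spacetime2) T = 0) (φ : Test Spacetime2)
    (S : Finset (Fin 4)) : ∃ (ψ : Test Spacetime2) (I : Spacetime2 → ℝ), T φ = T ψ ∧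
      (∀ p, ψ p = (∏ m ∈ S, deriv step (p.2 m)) * I p) ∧
      ∀ m ∈ S, ∀ p (s : ℝ), I (p + s • (unit m, unit m)) = I p := by
  induction S using Finset.induction_on with
  | empty => exact ⟨φ, φ, rfl, by simp, by simp⟩
  | insert k S hk ih =>
    obtain ⟨ψ, I, h1, h2, h3⟩ := ih
    let l : Spacetime2 →L[ℝ] ℝ := (ContinuousLinearMap.proj k).comp (ContinuousLinearMap.snd ℝ _ _)
    have hl : ∀ p, l p = p.2 k := fun p => rfl
    obtain ⟨χ, h4, h5⟩ := ScalarDist.apply_eq_of_distDeriv_eq_zero (l := l)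
      (e := ((unit k, unit k) : Spacetime2)) (by simp [hl, unit]) (hT k) ψ
    refine ⟨χ, fun p => ∫ τ : ℝ, I (p + τ • (unit k, unit k)), h1.trans h5, fun p => ?_, ?_⟩
    · rw [h4, Finset.prod_insert hk, hl, mul_assoc]
      congr 1
      rw [← integral_const_mul]
      refine integral_congr_ae (Filter.Eventually.of_forall fun τ => ?_)
      dsimp only
      rw [h2]
      congr 1
      refine Finset.prod_congr rfl fun m hm => ?_
      have : m ≠ k := fun h => hk (h ▸ hm)
      simp [unit, this]
    · intro m hm p s
      rcases Finset.mem_insert.1 hm with rfl | hm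
      · have h6 : ∀ τ : ℝ, p + s • (unit m, unit m) + τ • ((unit m, unit m) : Spacetime2) =
          p + (s + τ) • (unit m, unit m) := fun τ => by rw [add_smul, add_assoc]
        simp only [h6]
        exact integral_add_left_eq_self (fun τ : ℝ => I (p + τ • (unit m, unit m))) s
      · refine integral_congr_ae (Filter.Eventually.of_forall fun τ => ?_)
        dsimp only
        rw [add_right_comm, h3 m hm]

/-- A translation invariant distribution of two points depends only on the difference. -/
theorem exists_distDiff_eq (T : ScalarDist Spacetime2)
    (hT : ∀ m, distDeriv ((unit m, unit m) : Spacetime2) T = 0) : ∃ G, distDiff G = T := by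
  -- The choice is forced by `distDiff_liftTest`. Then T - distDiff G is translation invariant and
  -- annihilates the range of `liftTest`, and averaging moves every test function into that range.
  let G := distTranspose liftTest liftTest_isBounded T
  refine ⟨G, ?_⟩
  have hU : ∀ m, distDeriv ((unit m, unit m) : Spacetime2) (T - distDiff G) = 0 := fun m => by
    rw [map_sub, hT, distDeriv_distDiff_diag, sub_zero]
  refine (sub_eq_zero.1 ?_).symm
  ext φ
  obtain ⟨ψ, I, h1, h2, h3⟩ := exists_averaged _ hU φ Finset.univ
  have hI : ∀ p, I p = I (p.1 - p.2, 0) := by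
    intro p
    have h4 : p = (p.1 - p.2, 0) + p.2 0 • (unit 0, unit 0) + p.2 1 • (unit 1, unit 1) +
        p.2 2 • (unit 2, unit 2) + p.2 3 • (unit 3, unit 3) := by
      ext i <;> fin_cases i <;> simp [unit]
    conv_lhs => rw [h4]
    rw [h3 3 (Finset.mem_univ _), h3 2 (Finset.mem_univ _), h3 1 (Finset.mem_univ _),
      h3 0 (Finset.mem_univ _)]
  obtain ⟨y, hy⟩ : ∃ y, unitBump y ≠ 0 := by
    by_contra h
    push Not at h
    have := integral_unitBump
    simp [h] at this
  -- The factor I is not known to be smooth; it is recovered as a test function from ψ on the slice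
  -- x₂ = y, where the bump does not vanish.
  let χ : Test Spacetime := mkTest (fun x => (unitBump y)⁻¹ * ψ (x + y, y))
    (contDiff_const.mul (ψ.contDiff.comp (by fun_prop))) (by
      refine HasCompactSupport.intro (K := (fun p : Spacetime2 => p.1 - p.2) '' tsupport ψ)
        (ψ.hasCompactSupport.isCompact.image (by fun_prop)) fun x hx => ?_
      rw [image_eq_zero_of_notMem_tsupport fun h => hx ⟨_, h, by simp⟩, mul_zero])
  have hψ : ψ = liftTest χ := by
    ext p
    rw [liftTest_apply, mkTest_apply, h2, h2, hI, hI (_, y)]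
    change unitBump p.2 * _ = _ * (_ * (unitBump y * _))
    simp only [add_sub_cancel_right]
    field_simp
  rw [h1, hψ]
  change T (liftTest χ) - distDiff G (liftTest χ) = 0
  rw [distDiff_liftTest]
  exact sub_self _

end Difference

/-! ### The Lorentz group -/

section LorentzGroup

/-- The real Minkowski metric. -/
def etaR (m : Fin 4) : ℝ := if m = 0 then -1 else 1

lemma eta_eq (m : Fin 4) : eta m = (etaR m : ℂ) := by
  unfold eta etaR; split_ifs <;> simp

lemma lorentz_apply (A : SL2C) (x : Spacetime) :
    lorentz A x = ofHerm (A.1 * toHerm x * A.1.conjTranspose) := rfl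

lemma toHerm_lorentz (A : SL2C) (x : Spacetime) :
    toHerm (lorentz A x) = A.1 * toHerm x * A.1.conjTranspose := by
  rw [lorentz_apply, toHerm_ofHerm]
  simp [Matrix.conjTranspose_mul, toHerm_conjTranspose, mul_assoc]

lemma lorentz_mul (A B : SL2C) (x : Spacetime) : lorentz A (lorentz B x) = lorentz (A * B) x :=
  lorentzLin_mul A B x

lemma lorentz_one (x : Spacetime) : lorentz 1 x = x := lorentzLin_one x

lemma lorentz_symm (A : SL2C) (x : Spacetime) : (lorentz A).symm x = lorentz A⁻¹ x := rfl

lemma lorentz_neg_one (x : Spacetime) : lorentz (-1) x = x := by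
  rw [lorentz_apply]; simp [ofHerm_toHerm]

/-- The matrix of a Lorentz transformation. -/
def lorentzMatrix (A : SL2C) : Matrix (Fin 4) (Fin 4) ℝ :=
  LinearMap.toMatrix' (lorentz A : Spacetime →ₗ[ℝ] Spacetime)

lemma lorentzMatrix_apply (A : SL2C) (n m : Fin 4) : lorentzMatrix A n m = lorentz A (unit m) n := by
  unfold lorentzMatrix unit
  rw [LinearMap.toMatrix'_apply]
  rfl

/-- The Minkowski square. -/
def mink (x y : Spacetime) : ℝ := ∑ m, etaR m * (x m * y m)

/-- This is why SL(2,ℂ) preserves the metric: conjugation by A multiplies the determinant by |det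
A|² = 1. -/
lemma det_toHerm (x : Spacetime) : (toHerm x).det = -(mink x x : ℂ) := by
  rw [Matrix.det_fin_two]
  simp [toHerm, mink, Fin.sum_univ_four, etaR]
  linear_combination (x 2 : ℂ) ^ 2 * Complex.I_sq

lemma mink_lorentz_self (A : SL2C) (x : Spacetime) : mink (lorentz A x) (lorentz A x) = mink x x := by
  have h := det_toHerm (lorentz A x)
  rw [toHerm_lorentz, Matrix.det_mul, Matrix.det_mul, Matrix.det_conjTranspose, A.2, det_toHerm] at h
  simp at h
  exact_mod_cast h.symm

lemma mink_add_self (x y : Spacetime) : mink (x + y) (x + y) = mink x x + 2 * mink x y + mink y y := by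
  simp [mink, Fin.sum_univ_four]; ring

lemma mink_lorentz (A : SL2C) (x y : Spacetime) : mink (lorentz A x) (lorentz A y) = mink x y := by
  have h := mink_lorentz_self A (x + y)
  rw [map_add, mink_add_self, mink_add_self, mink_lorentz_self, mink_lorentz_self] at h
  linarith

lemma lorentzMatrix_transpose_mul (A : SL2C) :
    (lorentzMatrix A).transpose * Matrix.diagonal etaR * lorentzMatrix A = Matrix.diagonal etaR := by
  ext i j
  have h := mink_lorentz A (unit i) (unit j)
  rw [Matrix.mul_apply]
  simp only [Matrix.mul_diagonal, Matrix.transpose_apply, lorentzMatrix_apply]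
  have h2 : mink (unit i) (unit j) = Matrix.diagonal etaR i j := by
    simp only [mink, unit, Matrix.diagonal_apply, Pi.single_apply, mul_ite, mul_one, mul_zero]
    fin_cases i <;> fin_cases j <;> simp
  rw [← h2, ← h]
  refine Finset.sum_congr rfl fun m _ => ?_
  ring

lemma etaR_mul_self : Matrix.diagonal etaR * Matrix.diagonal etaR = 1 := by
  rw [Matrix.diagonal_mul_diagonal, ← Matrix.diagonal_one]
  congr 1; funext i; simp only [etaR]; split_ifs <;> norm_num

/-- From ΛᵀηΛ = η the matrix ηΛᵀη is a left inverse of Λ, hence also a right inverse. -/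
lemma lorentzMatrix_mul_transpose (A : SL2C) :
    lorentzMatrix A * Matrix.diagonal etaR * (lorentzMatrix A).transpose = Matrix.diagonal etaR := by
  have h : Matrix.diagonal etaR * (lorentzMatrix A).transpose * Matrix.diagonal etaR * lorentzMatrix A = 1 := by
    rw [mul_assoc, mul_assoc, ← mul_assoc (lorentzMatrix A).transpose, lorentzMatrix_transpose_mul,
      etaR_mul_self]
  have h2 := mul_eq_one_comm.1 h
  have h3 := congrArg (· * Matrix.diagonal etaR) h2
  simpa only [mul_assoc, etaR_mul_self, mul_one, one_mul] using h3

lemma sum_etaR_lorentzMatrix (A : SL2C) (n k : Fin 4) :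
    ∑ m, etaR m * (lorentzMatrix A n m * lorentzMatrix A k m) = if n = k then etaR n else 0 := by
  have h := congrFun (congrFun (lorentzMatrix_mul_transpose A) n) k
  rw [Matrix.mul_apply, Matrix.diagonal_apply] at h
  simp only [Matrix.mul_diagonal, Matrix.transpose_apply] at h
  rw [← h]
  refine Finset.sum_congr rfl fun m _ => ?_
  ring

lemma abs_det_lorentz (A : SL2C) : |(lorentzMatrix A).det| = 1 := by
  have h := congrArg Matrix.det (lorentzMatrix_mul_transpose A)
  rw [Matrix.det_mul, Matrix.det_mul, Matrix.det_transpose] at h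
  have h0 : (Matrix.diagonal etaR).det ≠ 0 := by
    rw [Matrix.det_diagonal]
    simp [etaR]
  have h1 : (lorentzMatrix A).det * (lorentzMatrix A).det = 1 := by
    apply mul_right_cancel₀ h0; linear_combination h
  rw [← abs_one, ← sq_eq_sq_iff_abs_eq_abs]
  linear_combination h1

open MeasureTheory in
lemma measurePreserving_lorentz (A : SL2C) :
    MeasurePreserving (lorentz A) (volume : Measure Spacetime) volume := by
  refine ⟨(lorentz A).continuous.measurable, ?_⟩
  have h : LinearMap.det (lorentz A : Spacetime →ₗ[ℝ] Spacetime) = (lorentzMatrix A).det :=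
    (LinearMap.det_toMatrix' _).symm
  have h2 : |LinearMap.det (lorentz A : Spacetime →ₗ[ℝ] Spacetime)| = 1 := by rw [h, abs_det_lorentz]
  have h3 := Measure.map_linearMap_addHaar_eq_smul_addHaar (μ := (volume : Measure Spacetime))
    (f := (lorentz A : Spacetime →ₗ[ℝ] Spacetime)) (by intro h0; rw [h0] at h2; simp at h2)
  rw [abs_inv, h2] at h3
  simpa using h3

lemma sigma_eq (m : Fin 4) : sigma m = etaR m • toHerm (unit m) := by
  fin_cases m <;> ext i j <;> fin_cases i <;> fin_cases j <;> simp [sigma, toHerm, unit, etaR]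

lemma toHerm_eq_sum (x : Spacetime) : toHerm x = ∑ m, x m • toHerm (unit m) := by
  conv_lhs => rw [show x = ∑ m, x m • unit m by
    ext i; simp [unit, Finset.sum_apply, Pi.single_apply]]
  rw [map_sum]
  simp only [map_smul]

lemma conj_sigma (A : SL2C) (m : Fin 4) : A.1 * sigma m * A.1.conjTranspose =
    ∑ k, (etaR m * lorentzMatrix A k m) • toHerm (unit k) := by
  rw [sigma_eq, mul_smul_comm, smul_mul_assoc, ← toHerm_lorentz, toHerm_eq_sum, Finset.smul_sum]
  simp only [lorentzMatrix_apply, smul_smul]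

/-- The σ^m form an invariant tensor with one vector and two spinor indices; this identity is behind
the Lorentz covariance of D and D̄. -/
lemma sum_lorentzMatrix_sigma (A : SL2C) (n : Fin 4) :
    ∑ m, lorentzMatrix A n m • (A.1 * sigma m * A.1.conjTranspose) = sigma n := by
  simp only [conj_sigma, Finset.smul_sum, smul_smul]
  rw [Finset.sum_comm]
  simp only [← Finset.sum_smul]
  have h : ∀ k, ∑ m, lorentzMatrix A n m * (etaR m * lorentzMatrix A k m) =
      if n = k then etaR n else 0 := fun k => by
    rw [← sum_etaR_lorentzMatrix A n k]
    refine Finset.sum_congr rfl fun m _ => ?_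
    ring
  simp only [h, ite_smul, zero_smul, Finset.sum_ite_eq, Finset.mem_univ, if_true, sigma_eq]

/-! ### Unipotent one-parameter subgroups -/

/-- Infinitesimal Lorentz transformations. -/
def lieLin (N : Matrix (Fin 2) (Fin 2) ℂ) : Spacetime →ₗ[ℝ] Spacetime where
  toFun x := ofHerm (N * toHerm x + toHerm x * N.conjTranspose)
  map_add' x y := by rw [← map_add]; congr 1; simp only [map_add, mul_add, add_mul]; abel
  map_smul' c x := by rw [RingHom.id_apply, ← map_smul]; congr 1; simp only [map_smul, mul_smul_comm, smul_mul_assoc, smul_add]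

lemma lieLin_add (M N : Matrix (Fin 2) (Fin 2) ℂ) (x : Spacetime) :
    lieLin (M + N) x = lieLin M x + lieLin N x := by
  change ofHerm _ = ofHerm _ + ofHerm _
  rw [← map_add]
  congr 1
  simp only [add_mul, Matrix.conjTranspose_add, mul_add]; abel

/-- Nilpotent `2 × 2` matrices. -/
def IsNil (N : Matrix (Fin 2) (Fin 2) ℂ) : Prop := N 0 0 + N 1 1 = 0 ∧ N 0 0 * N 1 1 - N 0 1 * N 1 0 = 0

/-- The unipotent element `1 + s N`. -/
def unip (N : Matrix (Fin 2) (Fin 2) ℂ) (hN : IsNil N) (s : ℝ) : SL2C :=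
  ⟨1 + (s : ℂ) • N, by
    rw [Matrix.det_fin_two]
    simp
    linear_combination (s : ℂ) * hN.1 + (s : ℂ) ^ 2 * hN.2⟩

lemma IsNil.mul_self {N : Matrix (Fin 2) (Fin 2) ℂ} (hN : IsNil N) : N * N = 0 := by
  obtain ⟨h1, h2⟩ := hN
  ext i j
  fin_cases i <;> fin_cases j <;> simp [Matrix.mul_apply, Fin.sum_univ_two]
  · linear_combination N 0 0 * h1 - h2
  · linear_combination N 0 1 * h1
  · linear_combination N 1 0 * h1
  · linear_combination N 1 1 * h1 - h2

lemma unip_mul {N : Matrix (Fin 2) (Fin 2) ℂ} (hN : IsNil N) (s t : ℝ) :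
    unip N hN s * unip N hN t = unip N hN (s + t) := by
  apply Subtype.ext
  change (1 + (s : ℂ) • N) * (1 + (t : ℂ) • N) = 1 + ((s + t : ℝ) : ℂ) • N
  rw [mul_add, add_mul, add_mul, smul_mul_smul_comm, hN.mul_self]
  simp [add_smul, add_assoc]

lemma unip_zero {N : Matrix (Fin 2) (Fin 2) ℂ} (hN : IsNil N) : unip N hN 0 = 1 := by
  apply Subtype.ext
  simp [unip]

lemma lorentz_unip {N : Matrix (Fin 2) (Fin 2) ℂ} (hN : IsNil N) (s : ℝ) (x : Spacetime) :
    lorentz (unip N hN s) x = x + s • lieLin N x + (s ^ 2) • ofHerm (N * toHerm x * N.conjTranspose) := by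
  have h : (1 + (s : ℂ) • N) * toHerm x * (1 + (s : ℂ) • N).conjTranspose = toHerm x +
      s • (N * toHerm x + toHerm x * N.conjTranspose) + (s ^ 2) • (N * toHerm x * N.conjTranspose) := by
    have h1 : ∀ M : Matrix (Fin 2) (Fin 2) ℂ, (s : ℂ) • M = s • M := fun M => Complex.coe_smul s M
    rw [h1, Matrix.conjTranspose_add, Matrix.conjTranspose_one, Matrix.conjTranspose_smul, star_trivial]
    simp only [add_mul, mul_add, one_mul, mul_one, smul_mul_assoc, mul_smul_comm, smul_add, pow_two, smul_smul]
    abel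
  rw [lorentz_apply]
  change ofHerm ((1 + (s : ℂ) • N) * toHerm x * (1 + (s : ℂ) • N).conjTranspose) = _
  rw [h, map_add, map_add, map_smul, map_smul, ofHerm_toHerm]
  rfl

/-- Upper triangular unipotents. -/
def upper (c : ℂ) : SL2C := ⟨!![1, c; 0, 1], by simp [Matrix.det_fin_two]⟩

/-- Lower triangular unipotents. -/
def lower (c : ℂ) : SL2C := ⟨!![1, 0; c, 1], by simp [Matrix.det_fin_two]⟩

lemma isNil_upper (c : ℂ) : IsNil !![0, c; 0, 0] := by simp [IsNil]
lemma isNil_lower (c : ℂ) : IsNil !![0, 0; c, 0] := by simp [IsNil]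

lemma upper_eq (c : ℂ) : upper c = unip _ (isNil_upper c) 1 := by
  apply Subtype.ext
  ext i j; fin_cases i <;> fin_cases j <;> simp [upper, unip]

lemma lower_eq (c : ℂ) : lower c = unip _ (isNil_lower c) 1 := by
  apply Subtype.ext
  ext i j; fin_cases i <;> fin_cases j <;> simp [lower, unip]

/-- A matrix with non-zero lower left entry is a product upper · lower · upper. If that entry
vanishes then the lower right one does not, and multiplication by a lower unipotent leads back to
the first case. -/
lemma SL2C_induction {P : SL2C → Prop} (hu : ∀ c, P (upper c)) (hl : ∀ c, P (lower c))
    (hm : ∀ A B, P A → P B → P (A * B)) (A : SL2C) : P A := by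
  have key : ∀ A : SL2C, A.1 1 0 ≠ 0 → P A := by
    intro A hc
    have hdet : A.1 0 0 * A.1 1 1 - A.1 0 1 * A.1 1 0 = 1 := by rw [← Matrix.det_fin_two, A.2]
    have h : A = upper ((A.1 0 0 - 1) / A.1 1 0) * lower (A.1 1 0) * upper ((A.1 1 1 - 1) / A.1 1 0) := by
      apply Subtype.ext
      change A.1 = !![1, _; 0, 1] * !![1, 0; _, 1] * !![1, _; 0, 1]
      ext i j
      fin_cases i <;> fin_cases j <;> simp [Matrix.mul_apply, Fin.sum_univ_two] <;> field_simp
      · ring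
      · linear_combination -hdet
      · ring
    rw [h]
    exact hm _ _ (hm _ _ (hu _) (hl _)) (hu _)
  by_cases hc : A.1 1 0 = 0
  · have hdet : A.1 0 0 * A.1 1 1 - A.1 0 1 * A.1 1 0 = 1 := by rw [← Matrix.det_fin_two, A.2]
    have h : A = (A * lower 1) * lower (-1) := by
      rw [mul_assoc]
      have : lower 1 * lower (-1) = 1 := by
        apply Subtype.ext
        change !![1, 0; (1:ℂ), 1] * !![1, 0; _, 1] = 1
        ext i j
        fin_cases i <;> fin_cases j <;> simp
      rw [this, mul_one]
    rw [h]
    refine hm _ _ (key _ ?_) (hl _)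
    change (A.1 * !![1, 0; (1:ℂ), 1]) 1 0 ≠ 0
    simp [Matrix.mul_apply, Fin.sum_univ_two, hc]
    intro h0
    rw [h0, hc] at hdet
    simp at hdet
  · exact key A hc

/-- Additive homomorphisms from `SL(2, ℂ)` to complex vector spaces vanish. -/
lemma SL2C_hom_eq_zero {W : Type} [AddCommGroup W] [Module ℂ W] (f : SL2C → W)
    (hf : ∀ A B, f (A * B) = f A + f B) (A : SL2C) : f A = 0 := by
  have h1 : f 1 = 0 := by
    have := hf 1 1
    rw [mul_one] at this
    exact left_eq_add.1 this
  -- Conjugation by diag(2, 1/2), or by its inverse for lower unipotents, multiplies the parameter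
  -- by 4, which is also what the fourth power does. An additive homomorphism thus satisfies 4f = f
  -- on unipotents.
  let h : SL2C := ⟨!![2, 0; 0, 1/2], by simp [Matrix.det_fin_two]⟩
  let h' : SL2C := ⟨!![1/2, 0; 0, 2], by simp [Matrix.det_fin_two]⟩
  have hh : f h + f h' = 0 := by
    rw [← hf, ← h1]
    congr 1
    apply Subtype.ext
    change !![(2:ℂ), 0; 0, 1/2] * !![1/2, 0; 0, 2] = 1
    ext i j; fin_cases i <;> fin_cases j <;> simp
  have three : ∀ w : W, w + w + w + w = w → w = 0 := by
    intro w hw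
    have h3 : (3 : ℂ) • w = 0 := by
      have h4 : (3 : ℂ) • w = (w + w + w + w) - w := by module
      rw [h4, hw, sub_self]
    exact (smul_eq_zero.1 h3).resolve_left (by norm_num)
  refine SL2C_induction (P := fun A => f A = 0) (fun c => ?_) (fun c => ?_)
    (fun A B hA hB => by rw [hf, hA, hB, add_zero]) A
  · apply three
    have e1 : upper c * upper c * upper c * upper c = h * upper c * h' := by
      apply Subtype.ext
      change !![1, c; 0, 1] * !![1, c; 0, 1] * !![1, c; 0, 1] * !![1, c; 0, 1] =
        !![(2:ℂ), 0; 0, 1/2] * !![1, c; 0, 1] * !![1/2, 0; 0, 2]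
      ext i j; fin_cases i <;> fin_cases j <;> simp; ring
    have e2 := congrArg f e1
    simp only [hf] at e2
    rw [e2, add_right_comm, hh, zero_add]
  · apply three
    have e1 : lower c * lower c * lower c * lower c = h' * lower c * h := by
      apply Subtype.ext
      change !![1, 0; c, 1] * !![1, 0; c, 1] * !![1, 0; c, 1] * !![1, 0; c, 1] =
        !![1/2, 0; 0, (2:ℂ)] * !![1, 0; c, 1] * !![2, 0; 0, 1/2]
      ext i j; fin_cases i <;> fin_cases j <;> simp; ring
    have e2 := congrArg f e1
    simp only [hf] at e2
    rw [e2, add_right_comm, add_comm (f h'), hh, zero_add]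

/-- The nilpotent matrices span the Lie algebra. -/
lemma pauli_of_nil {P : Matrix (Fin 2) (Fin 2) ℂ → Prop} (hP : ∀ N, IsNil N → P N)
    (hadd : ∀ M N, P M → P N → P (M + N)) (z : ℂ) :
    P !![0, z; z, 0] ∧ P !![0, z; -z, 0] ∧ P !![z, 0; 0, -z] := by
  refine ⟨?_, ?_, ?_⟩
  · have h := hadd _ _ (hP _ (isNil_upper z)) (hP _ (isNil_lower z))
    convert h using 1
    ext i j; fin_cases i <;> fin_cases j <;> simp
  · have h := hadd _ _ (hP _ (isNil_upper z)) (hP _ (isNil_lower (-z)))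
    convert h using 1
    ext i j; fin_cases i <;> fin_cases j <;> simp
  · have h := hadd _ _ (hadd _ _ (hP _ (isNil_upper z)) (hP _ (isNil_lower (-z))))
      (hP !![z, -z; z, -z] (by simp [IsNil]))
    convert h using 1
    ext i j; fin_cases i <;> fin_cases j <;> simp

end LorentzGroup

/-! ### The properties of coefficients -/

section Coefficients

variable {W V : Type} [AddCommGroup W] [Module ℂ W] [AddCommGroup V] [Module ℂ V]

/-- The infinitesimal action of the Lorentz group, where `X n` multiplies with `x^n`. -/
def lieOp (c : CoeffOps W V) (X : Fin 4 → Module.End ℂ W) (N : Matrix (Fin 2) (Fin 2) ℂ) (w : W) : W :=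
  ∑ m, ∑ n, ((lieLin N (unit n) m : ℝ) : ℂ) • X n (c.d m w)

/-- The properties of functions and distributions which are used below. -/
structure Good (c : CoeffOps W V) (X : Fin 4 → Module.End ℂ W) : Prop where
  d_comm : ∀ m n w, c.d m (c.d n w) = c.d n (c.d m w)
  d_X : ∀ m n w, c.d m (X n w) = X n (c.d m w) + if m = n then w else 0
  act_mul : ∀ A B w, c.act A (c.act B w) = c.act (B * A) w
  d_act : ∀ A m w, c.d m (c.act A w) = ∑ n, (lorentzMatrix A n m : ℂ) • c.act A (c.d n w)
  -- Since N² = 0, the element 1 + sN acts on bispinors by a quadratic polynomial in s. Phrased like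
  -- this, the generator can be read off without a topology on W.
  inf : ∀ (N : Matrix (Fin 2) (Fin 2) ℂ) (hN : IsNil N) (w u₁ u₂ : W),
    (∀ s : ℝ, c.act (unip N hN s) w = w + (s : ℂ) • u₁ + (s : ℂ) ^ 2 • u₂) → lieOp c X N w = u₁
  -- The second clause, that independence of the other coordinates is inherited, lets
  -- `exists_potential` treat the coordinates one at a time.
  prim : ∀ m w, ∃ u, c.d m u = w ∧ ∀ n, n ≠ m → c.d n w = 0 → c.d n u = 0
  const : ∀ w, (∀ m, c.d m w = 0) → IsLorentzInvariant c w
  d2_comm : ∀ a b m n v, c.d2 a m (c.d2 b n v) = c.d2 b n (c.d2 a m v)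
  d2_act2 : ∀ A a m v, c.d2 a m (c.act2 A v) = ∑ n, (lorentzMatrix A n m : ℂ) • c.act2 A (c.d2 a n v)
  act2_neg_one : ∀ v, c.act2 (-1) v = v
  d2_diff_fst : ∀ m w, c.d2 0 m (c.diff w) = c.diff (c.d m w)
  d2_diff_snd : ∀ m w, c.d2 1 m (c.diff w) = -c.diff (c.d m w)
  act2_diff : ∀ A w, c.act2 A (c.diff w) = c.diff (c.act A w)
  diff_injective : Function.Injective c.diff
  exists_diff : ∀ v, (∀ m, c.d2 0 m v + c.d2 1 m v = 0) → ∃ w, c.diff w = v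
  exists_box : ∀ w, IsLorentzInvariant c w → ∃ u, IsBoxInverse c w u

end Coefficients

/-! ### Components of infinitesimal Lorentz transformations -/

section Components

variable {W V : Type} [AddCommGroup W] [Module ℂ W] [AddCommGroup V] [Module ℂ V]

lemma lieOp_add_matrix (c : CoeffOps W V) (X : Fin 4 → Module.End ℂ W)
    (M N : Matrix (Fin 2) (Fin 2) ℂ) (w : W) : lieOp c X (M + N) w = lieOp c X M w + lieOp c X N w := by
  unfold lieOp
  simp only [lieLin_add, Pi.add_apply, Complex.ofReal_add, add_smul, Finset.sum_add_distrib]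

lemma lieLin_unit (N : Matrix (Fin 2) (Fin 2) ℂ) (n m : Fin 4) : lieLin N (unit n) m =
    ofHerm !![N 0 0 * toHerm (unit n) 0 0 + N 0 1 * toHerm (unit n) 1 0 +
        (toHerm (unit n) 0 0 * star (N 0 0) + toHerm (unit n) 0 1 * star (N 0 1)),
      N 0 0 * toHerm (unit n) 0 1 + N 0 1 * toHerm (unit n) 1 1 +
        (toHerm (unit n) 0 0 * star (N 1 0) + toHerm (unit n) 0 1 * star (N 1 1));
      N 1 0 * toHerm (unit n) 0 0 + N 1 1 * toHerm (unit n) 1 0 +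
        (toHerm (unit n) 1 0 * star (N 0 0) + toHerm (unit n) 1 1 * star (N 0 1)),
      N 1 0 * toHerm (unit n) 0 1 + N 1 1 * toHerm (unit n) 1 1 +
        (toHerm (unit n) 1 0 * star (N 1 0) + toHerm (unit n) 1 1 * star (N 1 1))] m := by
  refine congrFun (congrArg ofHerm ?_) m
  ext i j
  rw [Matrix.add_apply, Matrix.mul_apply, Matrix.mul_apply, Fin.sum_univ_two, Fin.sum_univ_two]
  fin_cases i <;> fin_cases j <;> rfl

lemma lieOp_boost₁ (c : CoeffOps W V) (X : Fin 4 → Module.End ℂ W) (w : W) :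
    lieOp c X !![0, 1; 1, 0] w = (2 : ℂ) • (X 1 (c.d 0 w) + X 0 (c.d 1 w)) := by
  simp only [lieOp, Fin.sum_univ_four, lieLin_unit]
  simp [toHerm, ofHerm, unit]
  module

lemma lieOp_boost₂ (c : CoeffOps W V) (X : Fin 4 → Module.End ℂ W) (w : W) :
    lieOp c X !![0, -Complex.I; -(-Complex.I), 0] w = (2 : ℂ) • (X 2 (c.d 0 w) + X 0 (c.d 2 w)) := by
  simp only [lieOp, Fin.sum_univ_four, lieLin_unit]
  simp [toHerm, ofHerm, unit]
  module

lemma lieOp_boost₃ (c : CoeffOps W V) (X : Fin 4 → Module.End ℂ W) (w : W) :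
    lieOp c X !![1, 0; 0, -1] w = (2 : ℂ) • (X 3 (c.d 0 w) + X 0 (c.d 3 w)) := by
  simp only [lieOp, Fin.sum_univ_four, lieLin_unit]
  simp [toHerm, ofHerm, unit]
  module

lemma lieOp_rot₁ (c : CoeffOps W V) (X : Fin 4 → Module.End ℂ W) (w : W) :
    lieOp c X !![0, Complex.I; Complex.I, 0] w = (2 : ℂ) • (X 3 (c.d 2 w) - X 2 (c.d 3 w)) := by
  simp only [lieOp, Fin.sum_univ_four, lieLin_unit]
  simp [toHerm, ofHerm, unit]
  module

lemma lieOp_rot₂ (c : CoeffOps W V) (X : Fin 4 → Module.End ℂ W) (w : W) :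
    lieOp c X !![0, 1; -1, 0] w = (2 : ℂ) • (X 1 (c.d 3 w) - X 3 (c.d 1 w)) := by
  simp only [lieOp, Fin.sum_univ_four, lieLin_unit]
  simp [toHerm, ofHerm, unit]
  module

lemma lieOp_rot₃ (c : CoeffOps W V) (X : Fin 4 → Module.End ℂ W) (w : W) :
    lieOp c X !![Complex.I, 0; 0, -Complex.I] w = (2 : ℂ) • (X 2 (c.d 1 w) - X 1 (c.d 2 w)) := by
  simp only [lieOp, Fin.sum_univ_four, lieLin_unit]
  simp [toHerm, ofHerm, unit]
  module

/-- The three boosts and three rotations are sums of nilpotents by `pauli_of_nil`, so each of them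
annihilates w; each one is the relation for one pair of indices. -/
lemma lieOp_components {c : CoeffOps W V} {X : Fin 4 → Module.End ℂ W} {w : W}
    (h : ∀ N, IsNil N → lieOp c X N w = 0) (m n : Fin 4) :
    eta m • X m (c.d n w) = eta n • X n (c.d m w) := by
  have hp := pauli_of_nil (P := fun N => lieOp c X N w = 0) h
    (fun M N hM hN => by rw [lieOp_add_matrix, hM, hN, add_zero])
  have two : ∀ {u : W}, (2 : ℂ) • u = 0 → u = 0 := fun hu =>
    (smul_eq_zero.1 hu).resolve_left two_ne_zero
  have b1 := two ((lieOp_boost₁ c X w).symm.trans (hp 1).1)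
  have b2 := two ((lieOp_boost₂ c X w).symm.trans (hp (-Complex.I)).2.1)
  have b3 := two ((lieOp_boost₃ c X w).symm.trans (hp 1).2.2)
  have r1 := two ((lieOp_rot₁ c X w).symm.trans (hp Complex.I).1)
  have r2 := two ((lieOp_rot₂ c X w).symm.trans (hp 1).2.1)
  have r3 := two ((lieOp_rot₃ c X w).symm.trans (hp Complex.I).2.2)
  fin_cases m <;> fin_cases n <;> simp [eta]
  · exact neg_eq_of_add_eq_zero_left b1
  · exact neg_eq_of_add_eq_zero_left b2
  · exact neg_eq_of_add_eq_zero_left b3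
  · exact eq_neg_of_add_eq_zero_left b1
  · exact (sub_eq_zero.1 r3).symm
  · exact sub_eq_zero.1 r2
  · exact eq_neg_of_add_eq_zero_left b2
  · exact sub_eq_zero.1 r3
  · exact (sub_eq_zero.1 r1).symm
  · exact eq_neg_of_add_eq_zero_left b3
  · exact (sub_eq_zero.1 r2).symm
  · exact sub_eq_zero.1 r1

lemma lieLin_antisymm (N : Matrix (Fin 2) (Fin 2) ℂ) (hN : N 0 0 + N 1 1 = 0) (m n : Fin 4) :
    lieLin N (unit n) m * etaR n = -(lieLin N (unit m) n * etaR m) := by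
  have h1 : N 1 1 = -N 0 0 := by linear_combination hN
  simp only [lieLin_unit]
  fin_cases m <;> fin_cases n <;>
    simp [toHerm, ofHerm, unit, etaR, h1] <;> ring

/-- An infinitesimal Lorentz transformation is antisymmetric once an index is lowered, whereas x_n
∂_m w is symmetric by hypothesis. Their contraction equals its own negative. -/
lemma lieOp_eq_zero_of_components {c : CoeffOps W V} {X : Fin 4 → Module.End ℂ W} {w : W}
    (h : ∀ m n, eta m • X m (c.d n w) = eta n • X n (c.d m w))
    (N : Matrix (Fin 2) (Fin 2) ℂ) (hN : IsNil N) : lieOp c X N w = 0 := by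
  have e : ∀ n, eta n * eta n = 1 := fun n => by unfold eta; split_ifs <;> norm_num
  have h1 : lieOp c X N w = ∑ m, ∑ n, ((lieLin N (unit n) m * etaR n : ℝ) : ℂ) •
      (eta n • X n (c.d m w)) := by
    unfold lieOp
    refine Finset.sum_congr rfl fun m _ => Finset.sum_congr rfl fun n _ => ?_
    rw [smul_smul, Complex.ofReal_mul, ← eta_eq, mul_assoc, e, mul_one]
  have h2 : lieOp c X N w = -lieOp c X N w := by
    conv_lhs => rw [h1, Finset.sum_comm]
    rw [h1, ← Finset.sum_neg_distrib]
    refine Finset.sum_congr rfl fun n _ => ?_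
    rw [← Finset.sum_neg_distrib]
    refine Finset.sum_congr rfl fun m _ => ?_
    rw [lieLin_antisymm N hN.1 m n, h n m, Complex.ofReal_neg, neg_smul]
  have h3 : (2 : ℂ) • lieOp c X N w = 0 := by
    rw [two_smul]; nth_rw 1 [h2]; exact neg_add_cancel _
  exact (smul_eq_zero.1 h3).resolve_left two_ne_zero

/-- Closed one-forms are exact. -/
lemma exists_potential {d : Fin 4 → Module.End ℂ W} (hc : ∀ m n w, d m (d n w) = d n (d m w))
    (hp : ∀ m w, ∃ u, d m u = w ∧ ∀ n, n ≠ m → d n w = 0 → d n u = 0) (v : Fin 4 → W)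
    (hv : ∀ m n, d m (v n) = d n (v m)) : ∃ u, ∀ m, d m u = v m := by
  have key : ∀ k : ℕ, k ≤ 4 → ∃ u, ∀ m : Fin 4, m.1 < k → d m u = v m := by
    intro k
    induction k with
    | zero => exact fun _ => ⟨0, fun m hm => absurd hm (Nat.not_lt_zero _)⟩
    | succ k ih =>
      intro hk
      obtain ⟨u, hu⟩ := ih (by omega)
      let j : Fin 4 := ⟨k, by omega⟩
      -- By closedness the defect in direction j is annihilated by the earlier derivatives. Its
      -- primitive r inherits this, so the correction does not disturb the directions already
      -- treated.
      obtain ⟨r, hr1, hr2⟩ := hp j (v j - d j u)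
      refine ⟨u + r, fun m hm => ?_⟩
      rw [map_add]
      rcases Nat.lt_succ_iff_lt_or_eq.1 hm with h | h
      · have hne : m ≠ j := fun h' => by rw [h'] at h; exact lt_irrefl _ h
        rw [hr2 m hne, add_zero, hu m h]
        rw [map_sub, hv m j, hc m j, hu m h, sub_self]
      · have : m = j := Fin.ext h
        rw [this, hr1]; abel
  obtain ⟨u, hu⟩ := key 4 le_rfl
  exact ⟨u, fun m => hu m m.2⟩

end Components

/-! ### Smooth functions -/

section SmoothGood

variable {E E' : Type} [NormedAddCommGroup E] [NormedSpace ℝ E]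
  [NormedAddCommGroup E'] [NormedSpace ℝ E']

lemma Smooth.contDiff (f : Smooth E) : ContDiff ℝ ∞ f.1 := f.2

lemma Smooth.hasFDerivAt (f : Smooth E) (x : E) : HasFDerivAt f.1 (fderiv ℝ f.1 x) x :=
  ((Smooth.contDiff f).differentiable (by simp) x).hasFDerivAt

lemma smoothDeriv_apply (v : E) (f : Smooth E) (x : E) : (smoothDeriv v f).1 x = fderiv ℝ f.1 x v := rfl

lemma smoothDeriv_comm (v w : E) (f : Smooth E) :
    smoothDeriv v (smoothDeriv w f) = smoothDeriv w (smoothDeriv v f) := by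
  apply Subtype.ext; funext x
  have hs : IsSymmSndFDerivAt ℝ f.1 x := ((Smooth.contDiff f).contDiffAt).isSymmSndFDerivAt (by
    simpa [minSmoothness_of_isRCLikeNormedField] using natCast_le_infty 2)
  have hd : ∀ v w : E, (smoothDeriv v (smoothDeriv w f)).1 x = fderiv ℝ (fderiv ℝ f.1) x v w := by
    intro v w
    have h1 : HasFDerivAt (fderiv ℝ f.1) (fderiv ℝ (fderiv ℝ f.1) x) x :=
      (((Smooth.contDiff f).fderiv_right (m := ∞) (by simp)).differentiable (by simp) x).hasFDerivAt
    have h2 := h1.clm_apply (hasFDerivAt_const w x)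
    have h3 : fderiv ℝ (smoothDeriv w f).1 x = _ := h2.fderiv
    rw [smoothDeriv_apply, h3]
    simp
  rw [hd, hd, hs.eq]

lemma smoothDeriv_eq_of_hasDerivAt {v : E} {f : Smooth E} {x : E} {c : ℂ}
    (h : HasDerivAt (fun s : ℝ => f.1 (x + s • v)) c 0) : (smoothDeriv v f).1 x = c := by
  have h1 : HasDerivAt (fun s : ℝ => x + s • v) v 0 := by
    simpa using ((hasDerivAt_id (0:ℝ)).smul_const v).const_add x
  have h2 : HasFDerivAt f.1 (fderiv ℝ f.1 x) (x + (0:ℝ) • v) := by simpa using Smooth.hasFDerivAt f x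
  exact (h2.comp_hasDerivAt (0:ℝ) h1).unique h

lemma smoothDeriv_smoothComp (v : E) (L : E →L[ℝ] E') (f : Smooth E') :
    smoothDeriv v (smoothComp L f) = smoothComp L (smoothDeriv (L v) f) := by
  apply Subtype.ext; funext x
  have h := (Smooth.hasFDerivAt f (L x)).comp x L.hasFDerivAt
  have h2 : fderiv ℝ (smoothComp L f).1 x = _ := h.fderiv
  rw [smoothDeriv_apply, h2]; rfl

lemma smoothDeriv_add_dir (v w : E) (f : Smooth E) :
    smoothDeriv (v + w) f = smoothDeriv v f + smoothDeriv w f := by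
  apply Subtype.ext; funext x; exact map_add (fderiv ℝ f.1 x) v w

lemma smoothDeriv_smul_dir (c : ℝ) (v : E) (f : Smooth E) :
    smoothDeriv (c • v) f = (c : ℂ) • smoothDeriv v f := by
  apply Subtype.ext; funext x;
  rw [smoothDeriv_apply, map_smul]
  exact (Complex.coe_smul c _).symm

lemma smoothDeriv_neg_dir (v : E) (f : Smooth E) : smoothDeriv (-v) f = -smoothDeriv v f := by
  apply Subtype.ext; funext x; exact map_neg (fderiv ℝ f.1 x) v

lemma smoothDeriv_zero_dir (f : Smooth E) : smoothDeriv (0 : E) f = 0 := by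
  apply Subtype.ext; funext x; exact map_zero (fderiv ℝ f.1 x)

lemma smoothDeriv_sum_dir {ι : Type} (s : Finset ι) (v : ι → E) (f : Smooth E) :
    smoothDeriv (∑ i ∈ s, v i) f = ∑ i ∈ s, smoothDeriv (v i) f := by
  classical
  induction s using Finset.induction_on with
  | empty => simp [smoothDeriv_zero_dir]
  | insert i s hi ih => rw [Finset.sum_insert hi, Finset.sum_insert hi, smoothDeriv_add_dir, ih]

lemma Smooth.eq_of_smoothDeriv_eq_zero {f : Smooth E} {v : E} (h : smoothDeriv v f = 0) (x : E) (s : ℝ) :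
    f.1 (x + s • v) = f.1 x := by
  have hd : ∀ s : ℝ, HasDerivAt (fun s : ℝ => f.1 (x + s • v)) 0 s := by
    intro s
    have h1 : HasDerivAt (fun s : ℝ => x + s • v) v s := by
      simpa using ((hasDerivAt_id s).smul_const v).const_add x
    have h2 := (Smooth.hasFDerivAt f (x + s • v)).comp_hasDerivAt s h1
    exact h2.congr_deriv (congrFun (congrArg Subtype.val h) (x + s • v))
  have := is_const_of_deriv_eq_zero (fun s => (hd s).differentiableAt) (fun s => (hd s).deriv) s 0
  simpa using this

/-- Multiplication by the coordinate `x^n`. -/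
def smoothX (n : Fin 4) : Module.End ℂ (Smooth Spacetime) where
  toFun f := ⟨fun x => (x n : ℂ) * f.1 x, by
    have h : ContDiff ℝ ∞ fun x : Spacetime => (x n : ℂ) :=
      Complex.ofRealCLM.contDiff.comp (by fun_prop)
    exact h.mul (Smooth.contDiff f)⟩
  map_add' f g := by apply Subtype.ext; funext x; exact mul_add _ _ _
  map_smul' c f := by apply Subtype.ext; funext x; exact mul_left_comm _ _ _

lemma smoothDeriv_smoothX (m n : Fin 4) (f : Smooth Spacetime) : smoothDeriv (unit m) (smoothX n f) =
    smoothX n (smoothDeriv (unit m) f) + if m = n then f else 0 := by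
  apply Subtype.ext; funext x
  have h1 : HasFDerivAt (fun x : Spacetime => (x n : ℂ))
      (Complex.ofRealCLM.comp (ContinuousLinearMap.proj n)) x :=
    (Complex.ofRealCLM.comp (ContinuousLinearMap.proj n : Spacetime →L[ℝ] ℝ)).hasFDerivAt
  have h2 := h1.mul (Smooth.hasFDerivAt f x)
  have h3 : fderiv ℝ (smoothX n f).1 x = _ := h2.fderiv
  rw [smoothDeriv_apply, h3]
  change (x n : ℂ) * fderiv ℝ f.1 x (unit m) + f.1 x * ((unit m n : ℝ) : ℂ) =
    (x n : ℂ) * fderiv ℝ f.1 x (unit m) + _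
  congr 1
  by_cases h : m = n
  · simp [h, unit]
  · have h' : n ≠ m := fun h'' => h h''.symm
    simp [h, h', unit]

/-- Integration starts from the hyperplane x^m = 0. Writing the integral as x^m times one over [0,
1] gives smoothness; the form with variable upper limit gives the derivative. -/
lemma smooth_exists_primitive (m : Fin 4) (f : Smooth Spacetime) : ∃ u, smoothDeriv (unit m) u = f ∧
    ∀ n, n ≠ m → smoothDeriv (unit n) f = 0 → smoothDeriv (unit n) u = 0 := by
  have hc : ContDiff ℝ ∞ fun x : Spacetime => (x m : ℂ) :=
      Complex.ofRealCLM.contDiff.comp (by fun_prop)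
  let u : Smooth Spacetime := smoothX m ⟨fun x => ∫ τ in (0:ℝ)..1,
    f.1 (x + ((τ - 1) * x m) • unit m), contDiff_integral_param
      (F := fun z : ℝ × Spacetime => f.1 (z.2 + ((z.1 - 1) * z.2 m) • unit m))
      ((Smooth.contDiff f).comp (by fun_prop)) 0 1⟩
  have hu : ∀ x, u.1 x = ∫ t in (0:ℝ)..(x m), f.1 ((x - x m • unit m) + t • unit m) := by
    intro x
    have h := intervalIntegral.smul_integral_comp_mul_left (a := 0) (b := 1)
      (fun t => f.1 ((x - x m • unit m) + t • unit m)) (x m)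
    simp only [mul_zero, mul_one] at h
    rw [← h]
    change (x m : ℂ) * _ = _
    rw [← smul_eq_mul, Complex.coe_smul]
    congr 1
    refine intervalIntegral.integral_congr fun τ _ => ?_
    refine congrArg f.1 ?_
    module
  have hcont : ∀ y, Continuous fun t : ℝ => f.1 (y + t • unit m) := fun y =>
    (Smooth.contDiff f).continuous.comp (by fun_prop)
  refine ⟨u, ?_, fun n hn h0 => ?_⟩
  · apply Subtype.ext; funext x
    apply smoothDeriv_eq_of_hasDerivAt
    have h1 : ∀ s : ℝ, u.1 (x + s • unit m) = ∫ t in (0:ℝ)..(x m + s),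
        f.1 ((x - x m • unit m) + t • unit m) := by
      intro s
      rw [hu]
      have e1 : (x + s • unit m) m = x m + s := by simp [unit]
      have e2 : x + s • unit m - (x m + s) • unit m = x - x m • unit m := by module
      rw [e1, e2]
    simp only [h1]
    have h2 := intervalIntegral.integral_hasDerivAt_right (a := 0) (b := x m)
      ((hcont (x - x m • unit m)).intervalIntegrable _ _)
      (hcont _).stronglyMeasurable.stronglyMeasurableAtFilter (hcont (x - x m • unit m)).continuousAt
    have h3 : x - x m • unit m + x m • unit m = x := by module
    rw [h3] at h2
    have h2' : HasDerivAt (fun b => ∫ t in (0:ℝ)..b, f.1 ((x - x m • unit m) + t • unit m)) (f.1 x)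
      (x m + 0) := by rw [add_zero]; exact h2
    exact HasDerivAt.comp_const_add (x m) 0 h2'
  · apply Subtype.ext; funext x
    apply smoothDeriv_eq_of_hasDerivAt
    have h1 : ∀ s : ℝ, u.1 (x + s • unit n) = u.1 x := by
      intro s
      rw [hu, hu]
      have e1 : (x + s • unit n) m = x m := by simp [unit, hn.symm]
      rw [e1]
      refine intervalIntegral.integral_congr fun t _ => ?_
      refine Eq.trans (congrArg f.1 ?_) (Smooth.eq_of_smoothDeriv_eq_zero h0 _ s)
      module
    simp only [h1]
    exact hasDerivAt_const _ _

lemma sum_unit (x : Spacetime) : ∑ n, x n • unit n = x := by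
  ext i; simp [unit, Finset.sum_apply, Pi.single_apply]

/-- Both expressions for the transformed function are differentiated at s = 0, pointwise and by the
chain rule. -/
lemma smooth_inf (N : Matrix (Fin 2) (Fin 2) ℂ) (hN : IsNil N) (w u₁ u₂ : Smooth Spacetime)
    (h : ∀ s : ℝ, smoothOps.act (unip N hN s) w = w + (s : ℂ) • u₁ + (s : ℂ) ^ 2 • u₂) :
    lieOp smoothOps smoothX N w = u₁ := by
  apply Subtype.ext; funext x
  have h1 : ∀ s : ℝ, w.1 (lorentz (unip N hN s) x) = w.1 x + (s : ℂ) * u₁.1 x + (s : ℂ) ^ 2 * u₂.1 x :=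
    fun s => congrFun (congrArg Subtype.val (h s)) x
  have h2 : HasDerivAt (fun s : ℝ => lorentz (unip N hN s) x) (lieLin N x) 0 := by
    simp only [lorentz_unip]
    have a1 := ((hasDerivAt_id (0:ℝ)).smul_const (lieLin N x)).const_add x
    have a2 := ((hasDerivAt_pow 2 (0:ℝ)).smul_const (ofHerm (N * toHerm x * N.conjTranspose)))
    exact (a1.add a2).congr_deriv (by simp)
  have h3 : HasFDerivAt w.1 (fderiv ℝ w.1 x) (lorentz (unip N hN 0) x) := by
    rw [unip_zero, lorentz_one]; exact Smooth.hasFDerivAt w x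
  have h4 := h3.comp_hasDerivAt (0:ℝ) h2
  have h5 : HasDerivAt (fun s : ℝ => w.1 x + (s : ℂ) * u₁.1 x + (s : ℂ) ^ 2 * u₂.1 x) (u₁.1 x) 0 := by
    have a0 : HasDerivAt (fun s : ℝ => (s : ℂ)) 1 0 := Complex.ofRealCLM.hasDerivAt
    have a1 := (a0.mul_const (u₁.1 x)).const_add (w.1 x)
    have a2 := ((a0.pow 2).mul_const (u₂.1 x))
    exact (a1.add a2).congr_deriv (by simp)
  have h6 : (fun s : ℝ => w.1 x + (s : ℂ) * u₁.1 x + (s : ℂ) ^ 2 * u₂.1 x) =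
    w.1 ∘ fun s : ℝ => lorentz (unip N hN s) x := by funext s; exact (h1 s).symm
  rw [h6] at h5
  rw [← h4.unique h5]
  have h7 : lieLin N x = ∑ m, ∑ n, (lieLin N (unit n) m * x n) • unit m := by
    conv_lhs => rw [← sum_unit (lieLin N x)]
    refine Finset.sum_congr rfl fun m _ => ?_
    rw [← Finset.sum_smul]
    congr 1
    conv_lhs => rw [← sum_unit x]
    simp [map_sum, Finset.sum_apply, mul_comm]
  rw [h7]
  simp only [map_sum, map_smul, lieOp]
  simp only [Submodule.coe_sum, Finset.sum_apply]
  refine Finset.sum_congr rfl fun m _ => Finset.sum_congr rfl fun n _ => ?_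
  change ((lieLin N (unit n) m : ℝ) : ℂ) * ((x n : ℂ) * fderiv ℝ w.1 x (unit m)) = _
  rw [← Complex.coe_smul]
  simp [mul_assoc]

end SmoothGood

/-! ### The wave equation with smooth invariant source, and the properties of smooth coefficients -/

section SmoothBox

lemma lorentz_unit (A : SL2C) (m : Fin 4) :
    lorentz A (unit m) = ∑ n, lorentzMatrix A n m • unit n := by
  conv_lhs => rw [← sum_unit (lorentz A (unit m))]
  simp only [lorentzMatrix_apply]

lemma lorentz2_apply (A : SL2C) (p : Spacetime2) : lorentz2 A p = (lorentz A p.1, lorentz A p.2) := rfl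

lemma lorentz2_unit2 (A : SL2C) (a : Fin 2) (m : Fin 4) :
    lorentz2 A (unit2 a m) = ∑ n, lorentzMatrix A n m • unit2 a n := by
  rw [lorentz2_apply]
  unfold unit2
  split_ifs with h
  · apply Prod.ext
    · simp [Prod.fst_sum, lorentz_unit]
    · simp [Prod.snd_sum]
  · apply Prod.ext
    · simp [Prod.fst_sum]
    · simp [Prod.snd_sum, lorentz_unit]

lemma smoothOps_d (m : Fin 4) : smoothOps.d m = smoothDeriv (unit m) := rfl

lemma Smooth.eq_of_forall_deriv_eq_zero {f : Smooth Spacetime} (h : ∀ m, smoothOps.d m f = 0)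
    (x : Spacetime) : f.1 x = f.1 0 := by
  have h4 : x = 0 + x 0 • unit 0 + x 1 • unit 1 + x 2 • unit 2 + x 3 • unit 3 := by
    ext i; fin_cases i <;> simp [unit]
  rw [h4, Smooth.eq_of_smoothDeriv_eq_zero (h 3), Smooth.eq_of_smoothDeriv_eq_zero (h 2),
    Smooth.eq_of_smoothDeriv_eq_zero (h 1), Smooth.eq_of_smoothDeriv_eq_zero (h 0)]

lemma smooth_d_act (A : SL2C) (m : Fin 4) (w : Smooth Spacetime) : smoothOps.d m (smoothOps.act A w) =
    ∑ n, (lorentzMatrix A n m : ℂ) • smoothOps.act A (smoothOps.d n w) := by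
  change smoothDeriv (unit m) (smoothComp _ w) = _
  rw [smoothDeriv_smoothComp]
  change smoothComp _ (smoothDeriv (lorentz A (unit m)) w) = _
  rw [lorentz_unit, smoothDeriv_sum_dir, map_sum]
  simp only [smoothDeriv_smul_dir, map_smul]
  rfl

/-- `∫₀¹ τ³ G(τ x) dτ`, a solution of `(x · ∂ + 4) k = G`. -/
def radialMean (G : Smooth Spacetime) : Smooth Spacetime :=
  ⟨fun x => ∫ τ in (0:ℝ)..1, τ ^ 3 • G.1 (τ • x), contDiff_integral_param
    (F := fun z : ℝ × Spacetime => z.1 ^ 3 • G.1 (z.1 • z.2))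
    ((contDiff_fst.pow 3).smul ((Smooth.contDiff G).comp (contDiff_fst.smul contDiff_snd))) 0 1⟩

lemma radialMean_apply (G : Smooth Spacetime) (x : Spacetime) :
    (radialMean G).1 x = ∫ τ in (0:ℝ)..1, τ ^ 3 • G.1 (τ • x) := rfl

/-- Substitution gives s⁴ k(s x) = ∫₀ˢ t³ G(t x) dt for the mean k; the claim is its derivative at s
= 1. -/
lemma radialMean_euler (G : Smooth Spacetime) (x : Spacetime) :
    fderiv ℝ (radialMean G).1 x x + 4 * (radialMean G).1 x = G.1 x := by
  have h1 : ∀ s : ℝ, s ^ 4 • (radialMean G).1 (s • x) = ∫ t in (0:ℝ)..s, t ^ 3 • G.1 (t • x) := by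
    intro s
    have h := intervalIntegral.smul_integral_comp_mul_left (a := 0) (b := 1)
      (fun t => t ^ 3 • G.1 (t • x)) s
    simp only [mul_zero, mul_one] at h
    rw [← h, radialMean_apply, ← intervalIntegral.integral_smul, ← intervalIntegral.integral_smul]
    refine intervalIntegral.integral_congr fun τ _ => ?_
    rw [smul_smul, smul_smul, smul_smul, mul_comm τ s]
    congr 1
    ring
  have hc : Continuous fun t : ℝ => t ^ 3 • G.1 (t • x) :=
    (by fun_prop : Continuous fun t : ℝ => t ^ 3).smul ((Smooth.contDiff G).continuous.comp (by fun_prop))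
  have h2 := intervalIntegral.integral_hasDerivAt_right (a := 0) (b := 1) (hc.intervalIntegrable _ _)
    hc.stronglyMeasurable.stronglyMeasurableAtFilter hc.continuousAt
  rw [← funext h1] at h2
  have h3 : HasDerivAt (fun s : ℝ => s • x) x 1 := by simpa using (hasDerivAt_id (1:ℝ)).smul_const x
  have h4 : HasFDerivAt (radialMean G).1 (fderiv ℝ (radialMean G).1 x) ((1:ℝ) • x) := by
    rw [one_smul]; exact Smooth.hasFDerivAt _ x
  have h5 := (hasDerivAt_pow 4 (1:ℝ)).smul (h4.comp_hasDerivAt (1:ℝ) h3)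
  have h6 := h5.unique h2
  simp at h6
  exact h6

lemma eta_mul_eta (m : Fin 4) : eta m * eta m = 1 := by
  unfold eta; split_ifs <;> norm_num

/-- For the invariant mean k the one-form x_m k is closed, because x_m ∂_n k is symmetric in m and
n. A potential H has □H = ∂_m(x^m k) = x·∂k + 4k = G. -/
theorem smooth_exists_box (G : Smooth Spacetime) (hG : IsLorentzInvariant smoothOps G) :
    ∃ H, IsBoxInverse smoothOps G H := by
  let k := radialMean G
  have hG' : ∀ A x, G.1 (lorentz A x) = G.1 x := fun A x => congrFun (congrArg Subtype.val (hG A)) x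
  have hk : ∀ A x, k.1 (lorentz A x) = k.1 x := by
    intro A x
    refine intervalIntegral.integral_congr fun τ _ => ?_
    rw [← map_smul, hG']
  have hk' : ∀ A, smoothOps.act A k = k := fun A => Subtype.ext (funext fun x => hk A x)
  have hL := lieOp_components (c := smoothOps) (X := smoothX) (w := k) fun N hN =>
    smooth_inf N hN k 0 0 fun s => by rw [hk']; simp
  obtain ⟨H, hH⟩ := exists_potential (d := smoothOps.d) (fun m n w => smoothDeriv_comm _ _ w)
    smooth_exists_primitive (fun m => eta m • smoothX m k) (by
      intro m n
      rw [map_smul, map_smul, smoothOps_d, smoothOps_d, smoothDeriv_smoothX, smoothDeriv_smoothX,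
        smul_add, smul_add]
      congr 1
      · exact hL n m
      · by_cases h : m = n
        · simp [h]
        · have h' : n ≠ m := fun h'' => h h''.symm
          simp [h, h'])
  refine ⟨H, fun A => ?_, ?_⟩
  · have h1 : ∀ m, smoothOps.d m (smoothOps.act A H - H) = 0 := by
      intro m
      rw [map_sub, smooth_d_act, hH, sub_eq_zero]
      simp only [hH]
      apply Subtype.ext; funext x
      have h2 : ∀ n, (lorentzMatrix A n m : ℂ) • smoothOps.act A (eta n • smoothX n k) =
          ((lorentzMatrix A n m : ℂ) * eta n) • smoothOps.act A (smoothX n k) := by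
        intro n; rw [map_smul, smul_smul]
      simp only [h2]
      rw [Submodule.coe_sum, Finset.sum_apply]
      have h3 : ∀ n, (((lorentzMatrix A n m : ℂ) * eta n) • smoothOps.act A (smoothX n k)).1 x =
          ((etaR n * (lorentz A (unit m) n * lorentz A x n) : ℝ) : ℂ) * k.1 x := by
        intro n
        change ((lorentzMatrix A n m : ℂ) * eta n) * ((lorentz A x n : ℂ) * k.1 (lorentz A x)) = _
        rw [hk, eta_eq, lorentzMatrix_apply]
        push_cast
        ring
      simp only [h3]
      rw [← Finset.sum_mul, ← Complex.ofReal_sum]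
      have h4 : ∑ n, etaR n * (lorentz A (unit m) n * lorentz A x n) = etaR m * x m := by
        change mink (lorentz A (unit m)) (lorentz A x) = _
        rw [mink_lorentz]
        simp [mink, unit, Pi.single_apply]
      rw [h4]
      change _ = eta m * ((x m : ℂ) * k.1 x)
      rw [eta_eq]
      push_cast
      ring
    apply Subtype.ext; funext x
    have h5 := Smooth.eq_of_forall_deriv_eq_zero h1 x
    have h6 : (smoothOps.act A H - H).1 x = H.1 (lorentz A x) - H.1 x := rfl
    have h7 : (smoothOps.act A H - H).1 0 = H.1 (lorentz A 0) - H.1 0 := rfl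
    rw [h6, h7, map_zero, sub_self, sub_eq_zero] at h5
    exact h5
  · unfold box
    rw [LinearMap.sum_apply]
    have h1 : ∀ m, (eta m • (smoothOps.d m * smoothOps.d m)) H = smoothX m (smoothOps.d m k) + k := by
      intro m
      change eta m • smoothOps.d m (smoothOps.d m H) = _
      rw [hH, map_smul, smul_smul, eta_mul_eta, one_smul, smoothOps_d, smoothDeriv_smoothX, if_pos rfl]
    simp only [h1]
    apply Subtype.ext; funext x
    rw [← radialMean_euler G x]
    have h2 : fderiv ℝ k.1 x x = ∑ m, (x m : ℂ) * fderiv ℝ k.1 x (unit m) := by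
      conv_lhs => rw [← sum_unit x]
      rw [map_sum, sum_unit]
      refine Finset.sum_congr rfl fun m _ => ?_
      rw [map_smul]
      exact (Complex.coe_smul _ _).symm
    rw [h2, Submodule.coe_sum, Finset.sum_apply]
    change ∑ m, ((x m : ℂ) * fderiv ℝ k.1 x (unit m) + k.1 x) = _
    rw [Finset.sum_add_distrib]
    simp
    rfl

lemma smooth_exists_diff (v : Smooth Spacetime2)
    (hv : ∀ m, smoothOps.d2 0 m v + smoothOps.d2 1 m v = 0) : ∃ w, smoothOps.diff w = v := by
  have hd : ∀ m, smoothDeriv ((unit m, unit m) : Spacetime2) v = 0 := by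
    intro m
    rw [← hv m]
    have : ((unit m, unit m) : Spacetime2) = unit2 0 m + unit2 1 m := by simp [unit2]
    rw [this, smoothDeriv_add_dir]
    rfl
  have hI : ∀ p, v.1 p = v.1 (p.1 - p.2, 0) := by
    intro p
    have h4 : p = (p.1 - p.2, 0) + p.2 0 • (unit 0, unit 0) + p.2 1 • (unit 1, unit 1) +
        p.2 2 • (unit 2, unit 2) + p.2 3 • (unit 3, unit 3) := by
      ext i <;> fin_cases i <;> simp [unit]
    conv_lhs => rw [h4]
    rw [Smooth.eq_of_smoothDeriv_eq_zero (hd 3), Smooth.eq_of_smoothDeriv_eq_zero (hd 2),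
      Smooth.eq_of_smoothDeriv_eq_zero (hd 1), Smooth.eq_of_smoothDeriv_eq_zero (hd 0)]
  refine ⟨smoothComp (ContinuousLinearMap.inl ℝ Spacetime Spacetime) v, ?_⟩
  apply Subtype.ext; funext p
  exact (hI p).symm

lemma unit2_zero (m : Fin 4) : unit2 0 m = (unit m, 0) := by simp [unit2]
lemma unit2_one (m : Fin 4) : unit2 1 m = (0, unit m) := by simp [unit2]

theorem good_smoothOps : Good smoothOps smoothX where
  d_comm _ _ w := smoothDeriv_comm _ _ w
  d_X := smoothDeriv_smoothX
  act_mul A B w := Subtype.ext (funext fun x => congrArg w.1 (lorentz_mul B A x))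
  d_act := smooth_d_act
  inf := smooth_inf
  prim := smooth_exists_primitive
  const w h A := Subtype.ext (funext fun x => by
    change w.1 (lorentz A x) = w.1 x
    rw [Smooth.eq_of_forall_deriv_eq_zero h, Smooth.eq_of_forall_deriv_eq_zero h x])
  d2_comm _ _ _ _ v := smoothDeriv_comm _ _ v
  d2_act2 A a m v := by
    change smoothDeriv (unit2 a m) (smoothComp _ v) = _
    rw [smoothDeriv_smoothComp]
    change smoothComp _ (smoothDeriv (lorentz2 A (unit2 a m)) v) = _
    rw [lorentz2_unit2, smoothDeriv_sum_dir, map_sum]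
    simp only [smoothDeriv_smul_dir, map_smul]
    rfl
  act2_neg_one v := Subtype.ext (funext fun x => congrArg v.1
    (Prod.ext (lorentz_neg_one x.1) (lorentz_neg_one x.2)))
  d2_diff_fst m w := by
    change smoothDeriv (unit2 0 m) (smoothComp _ w) = _
    rw [smoothDeriv_smoothComp, unit2_zero]
    change smoothComp _ (smoothDeriv (unit m - 0) w) = _
    rw [sub_zero]; rfl
  d2_diff_snd m w := by
    change smoothDeriv (unit2 1 m) (smoothComp _ w) = _
    rw [smoothDeriv_smoothComp, unit2_one]
    change smoothComp _ (smoothDeriv (0 - unit m) w) = _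
    rw [zero_sub, smoothDeriv_neg_dir, map_neg]; rfl
  act2_diff A w := Subtype.ext (funext fun p => by
    change w.1 (lorentz A p.1 - lorentz A p.2) = w.1 (lorentz A (p.1 - p.2))
    rw [map_sub])
  diff_injective f g h := Subtype.ext (funext fun x => by
    have := congrFun (congrArg Subtype.val h) (x, 0)
    change f.1 (x - 0) = g.1 (x - 0) at this
    rwa [sub_zero] at this)
  exists_diff := smooth_exists_diff
  exists_box := smooth_exists_box

end SmoothBox

/-! ### Lorentz transformations of distributions -/

section DistLorentz

variable {E : Type} [NormedAddCommGroup E] [NormedSpace ℝ E]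

lemma testComp_apply (e : E ≃L[ℝ] E) (φ : Test E) (x : E) : testComp e φ x = φ (e x) := rfl

lemma distComp_apply (e : E ≃L[ℝ] E) (T : ScalarDist E) (φ : Test E) :
    distComp e T φ = T (testComp e.symm φ) := rfl

lemma tderiv_testComp (v : E) (e : E ≃L[ℝ] E) (φ : Test E) :
    tderiv v (testComp e φ) = testComp e (tderiv (e v) φ) := by
  ext x
  have h : HasFDerivAt (testComp e φ) ((fderiv ℝ φ (e x)).comp (e : E →L[ℝ] E)) x :=
    (Test.hasFDerivAt φ (e x)).comp x e.hasFDerivAt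
  rw [tderiv_apply, h.fderiv]; rfl

lemma distDeriv_distComp (v : E) (e : E ≃L[ℝ] E) (T : ScalarDist E) :
    distDeriv v (distComp e T) = distComp e (distDeriv (e v) T) := by
  ext φ
  rw [distDeriv_apply, distComp_apply, distComp_apply, distDeriv_apply, tderiv_testComp]
  congr 3
  simp

lemma distDeriv_zero_dir (T : ScalarDist E) : distDeriv (0 : E) T = 0 := by
  rw [← zero_smul ℝ (0 : E), distDeriv_smul_dir, Complex.ofReal_zero]; exact zero_smul ℂ (distDeriv (0 : E) T)

lemma distDeriv_sum_dir {ι : Type} (s : Finset ι) (v : ι → E) (T : ScalarDist E) :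
    distDeriv (∑ i ∈ s, v i) T = ∑ i ∈ s, distDeriv (v i) T := by
  classical
  induction s using Finset.induction_on with
  | empty => simp [distDeriv_zero_dir]
  | insert i s hi ih => rw [Finset.sum_insert hi, Finset.sum_insert hi, distDeriv_add_dir, ih]

lemma ScalarDist.sum_apply {ι : Type} (s : Finset ι) (T : ι → ScalarDist E) (φ : Test E) :
    (∑ i ∈ s, T i) φ = ∑ i ∈ s, T i φ := by
  classical
  induction s using Finset.induction_on with
  | empty => simp
  | insert i s hi ih =>
    rw [Finset.sum_insert hi, Finset.sum_insert hi, ← ih]; rfl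

lemma ScalarDist.smul_apply (c : ℂ) (T : ScalarDist E) (φ : Test E) : (c • T) φ = c * T φ := rfl

lemma ScalarDist.add_apply (S T : ScalarDist E) (φ : Test E) : (S + T) φ = S φ + T φ := rfl

lemma ScalarDist.map_sum' {ι : Type} (s : Finset ι) (T : ScalarDist E) (φ : ι → Test E) :
    T (∑ i ∈ s, φ i) = ∑ i ∈ s, T (φ i) := map_sum (show Test E →L[ℝ] ℂ from T) φ s

lemma Test.sum_apply {ι : Type} (s : Finset ι) (φ : ι → Test E) (x : E) :
    (∑ i ∈ s, φ i) x = ∑ i ∈ s, φ i x := by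
  classical
  induction s using Finset.induction_on with
  | empty => simp
  | insert i s hi ih =>
    rw [Finset.sum_insert hi, Finset.sum_insert hi, ← ih]; rfl

/-- Multiplication of distributions by the coordinate `x^n`. -/
def distX (n : Fin 4) : Module.End ℂ (ScalarDist Spacetime) :=
  mulDist (fun x : Spacetime => x n) (by fun_prop)

/-- Multiplication of test functions by the coordinate `x^n`. -/
def testX (n : Fin 4) : Test Spacetime →ₗ[ℝ] Test Spacetime :=
  mulTest (fun x : Spacetime => x n) (by fun_prop)

lemma testX_apply (n : Fin 4) (φ : Test Spacetime) (x : Spacetime) : testX n φ x = x n * φ x :=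
  mulTest_apply ..

lemma distX_apply (n : Fin 4) (T : ScalarDist Spacetime) (φ : Test Spacetime) :
    distX n T φ = T (testX n φ) := rfl

lemma unit_apply (m n : Fin 4) : unit m n = if m = n then 1 else 0 := by
  by_cases h : m = n
  · simp [unit, h]
  · simp [unit, h, Ne.symm h]

lemma tderiv_testX (m n : Fin 4) (φ : Test Spacetime) :
    tderiv (unit m) (testX n φ) = testX n (tderiv (unit m) φ) + if m = n then φ else 0 := by
  ext x
  have h1 : HasFDerivAt (fun x : Spacetime => x n) (ContinuousLinearMap.proj n) x :=
    (ContinuousLinearMap.proj n : Spacetime →L[ℝ] ℝ).hasFDerivAt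
  have h : tderiv (unit m) (testX n φ) x = _ := tderiv_mulTest _ _ _ _ _
  rw [h, h1.fderiv]
  have h2 : (testX n (tderiv (unit m) φ) + if m = n then φ else 0) x =
      x n * tderiv (unit m) φ x + (if m = n then φ else 0 : Test Spacetime) x := by
    rw [← testX_apply]; rfl
  have h3 : (ContinuousLinearMap.proj n : Spacetime →L[ℝ] ℝ) (unit m) = unit m n := rfl
  rw [h2, h3, unit_apply]
  split_ifs
  · ring
  · rw [zero_mul, zero_add]; exact (add_zero _).symm

lemma distDeriv_distX (m n : Fin 4) (T : ScalarDist Spacetime) : distDeriv (unit m) (distX n T) =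
    distX n (distDeriv (unit m) T) + if m = n then T else 0 := by
  ext φ
  rw [distDeriv_apply, distX_apply, ScalarDist.add_apply, distX_apply, distDeriv_apply, tderiv_testX]
  split_ifs
  · rw [T.map_add']; ring
  · rw [add_zero]; exact (add_zero _).symm

/-- The infinitesimal Lorentz transformation of a test function. -/
def lieTest (N : Matrix (Fin 2) (Fin 2) ℂ) (φ : Test Spacetime) : Test Spacetime :=
  ∑ m, ∑ n, (lieLin N (unit n) m) • testX n (tderiv (unit m) φ)

lemma lieLin_eq_sum (N : Matrix (Fin 2) (Fin 2) ℂ) (x : Spacetime) :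
    lieLin N x = ∑ m, ∑ n, (lieLin N (unit n) m * x n) • unit m := by
  conv_lhs => rw [← sum_unit (lieLin N x)]
  refine Finset.sum_congr rfl fun m _ => ?_
  rw [← Finset.sum_smul]
  congr 1
  conv_lhs => rw [← sum_unit x]
  simp [map_sum, Finset.sum_apply, mul_comm]

lemma lieTest_apply (N : Matrix (Fin 2) (Fin 2) ℂ) (φ : Test Spacetime) (x : Spacetime) :
    lieTest N φ x = fderiv ℝ φ x (lieLin N x) := by
  rw [lieLin_eq_sum]
  simp only [map_sum, map_smul, lieTest, Test.sum_apply]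
  refine Finset.sum_congr rfl fun m _ => Finset.sum_congr rfl fun n _ => ?_
  change lieLin N (unit n) m * testX n _ x = _
  rw [testX_apply, tderiv_apply, smul_eq_mul, mul_assoc]

/-- Transposing x^n ∂_m produces, besides the sign, a term δ_mn. These terms drop out because the
generator has zero diagonal. -/
lemma lieOp_distX (N : Matrix (Fin 2) (Fin 2) ℂ) (hN : IsNil N) (T : ScalarDist Spacetime)
    (φ : Test Spacetime) : lieOp distOps distX N T φ = -T (lieTest N φ) := by
  have h0 : ∀ m, lieLin N (unit m) m = 0 := fun m => by
    have h := lieLin_antisymm N hN.1 m m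
    have h1 : etaR m ≠ 0 := by unfold etaR; split_ifs <;> norm_num
    have h2 : lieLin N (unit m) m * etaR m = 0 := by linarith
    exact (mul_eq_zero.1 h2).resolve_right h1
  unfold lieOp lieTest
  rw [ScalarDist.sum_apply, T.map_sum', ← Finset.sum_neg_distrib]
  refine Finset.sum_congr rfl fun m _ => ?_
  rw [ScalarDist.sum_apply, T.map_sum', ← Finset.sum_neg_distrib]
  refine Finset.sum_congr rfl fun n _ => ?_
  have h1 : distOps.d m T = distDeriv (unit m) T := rfl
  rw [ScalarDist.smul_apply, distX_apply, h1, distDeriv_apply, tderiv_testX, T.map_smul_real,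
    T.map_add', Complex.real_smul]
  by_cases h : m = n
  · subst h; rw [h0]; simp
  · rw [if_neg h, T.map_zero']; ring

lemma unip_inv {N : Matrix (Fin 2) (Fin 2) ℂ} (hN : IsNil N) (s : ℝ) :
    (unip N hN s)⁻¹ = unip N hN (-s) := by
  rw [inv_eq_iff_mul_eq_one, unip_mul, add_neg_cancel, unip_zero]

lemma lorentz_unip' {N : Matrix (Fin 2) (Fin 2) ℂ} (hN : IsNil N) (s : ℝ) (x : Spacetime) :
    lorentz (unip N hN s) x = x + s • (lieLin N).toContinuousLinearMap x +
      (s ^ 2) • (lorentz (unip N hN 1) x - x - (lieLin N).toContinuousLinearMap x) := by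
  have h := lorentz_unip hN 1 x
  have h1 : ofHerm (N * toHerm x * N.conjTranspose) = lorentz (unip N hN 1) x - x - lieLin N x := by
    rw [h, one_smul, one_pow, one_smul]; abel
  rw [lorentz_unip, h1]; rfl

lemma contDiff_lorentz_unip {N : Matrix (Fin 2) (Fin 2) ℂ} (hN : IsNil N) :
    ContDiff ℝ ∞ fun z : ℝ × Spacetime => lorentz (unip N hN z.1) z.2 := by
  rw [funext fun z : ℝ × Spacetime => lorentz_unip' hN z.1 z.2]
  fun_prop

lemma hasDerivAt_lorentz_unip {N : Matrix (Fin 2) (Fin 2) ℂ} (hN : IsNil N) (x : Spacetime) :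
    HasDerivAt (fun s : ℝ => lorentz (unip N hN s) x) (lieLin N x) 0 := by
  simp only [lorentz_unip]
  have a1 := ((hasDerivAt_id (0:ℝ)).smul_const (lieLin N x)).const_add x
  have a2 := ((hasDerivAt_pow 2 (0:ℝ)).smul_const (ofHerm (N * toHerm x * N.conjTranspose)))
  exact (a1.add a2).congr_deriv (by simp)

/-- The transforms of a test function under a bounded part of a unipotent subgroup. -/
def orbitFamily (N : Matrix (Fin 2) (Fin 2) ℂ) (hN : IsNil N) (φ : Test Spacetime) :
    TestFamily Spacetime where
  -- The group parameter is taken as a sine so that it stays in [-1, 1] for all real z.1. This gives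
  -- the whole family a common compact support.
  toFun z := φ (lorentz (unip N hN (-Real.sin z.1)) z.2)
  smooth := (Test.contDiff φ).comp ((contDiff_lorentz_unip hN).comp
    (f := fun z : ℝ × Spacetime => (-Real.sin z.1, z.2))
    ((Real.contDiff_sin.comp contDiff_fst).neg.prodMk contDiff_snd))
  K := (fun z : ℝ × Spacetime => lorentz (unip N hN z.1) z.2) '' (Set.Icc (-1) 1 ×ˢ tsupport φ)
  compact := (isCompact_Icc.prod φ.hasCompactSupport.isCompact).image
    (contDiff_lorentz_unip hN).continuous
  supp τ x hx := by
    refine image_eq_zero_of_notMem_tsupport fun h => hx ⟨(Real.sin τ, _),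
      ⟨⟨Real.neg_one_le_sin τ, Real.sin_le_one τ⟩, h⟩, ?_⟩
    simp only
    rw [lorentz_mul, unip_mul, add_neg_cancel, unip_zero, lorentz_one]

lemma orbitFamily_at (N : Matrix (Fin 2) (Fin 2) ℂ) (hN : IsNil N) (φ : Test Spacetime) (τ : ℝ)
    (T : ScalarDist Spacetime) :
    T ((orbitFamily N hN φ).at' τ) = distOps.act (unip N hN (Real.sin τ)) T φ := by
  change _ = T (testComp (lorentz (unip N hN (Real.sin τ))).symm φ)
  congr 1
  ext x
  rw [testComp_apply, lorentz_symm, unip_inv]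
  rfl

/-- The group law reduces the derivative at τ to the derivative at the identity, applied to the test
function already moved. -/
lemma orbitFamily_deriv (N : Matrix (Fin 2) (Fin 2) ℂ) (hN : IsNil N) (φ : Test Spacetime) (τ : ℝ) :
    (orbitFamily N hN φ).deriv.at' τ =
      (-Real.cos τ) • lieTest N (testComp (lorentz (unip N hN (-Real.sin τ))) φ) := by
  refine TestFamily.deriv_at_eq _ fun x => ?_
  set ψ := testComp (lorentz (unip N hN (-Real.sin τ))) φ with hψ
  have h1 : (fun t => (orbitFamily N hN φ).toFun (t, x)) =
      fun t => ψ (lorentz (unip N hN (Real.sin τ - Real.sin t)) x) := by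
    funext t
    rw [hψ, testComp_apply, lorentz_mul, unip_mul]
    change φ _ = φ _
    congr 4
    ring
  rw [h1]
  have h2 : HasDerivAt (fun t => Real.sin τ - Real.sin t) (-Real.cos τ) τ :=
    (Real.hasDerivAt_sin τ).const_sub _
  have h3 : HasDerivAt (fun s : ℝ => lorentz (unip N hN s) x) (lieLin N x) (Real.sin τ - Real.sin τ) := by
    rw [sub_self]; exact hasDerivAt_lorentz_unip hN x
  have h4 := h3.scomp τ h2
  have h5 : HasFDerivAt ψ (fderiv ℝ ψ x) (lorentz (unip N hN (Real.sin τ - Real.sin τ)) x) := by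
    rw [sub_self, unip_zero, lorentz_one]; exact Test.hasFDerivAt ψ x
  have h6 := h5.comp_hasDerivAt τ h4
  refine h6.congr_deriv ?_
  change _ = -Real.cos τ * lieTest N ψ x
  rw [lieTest_apply, map_smul, smul_eq_mul]

/-- Both expressions for w on the orbit of φ are differentiated at τ = 0, where sin τ = 0 and its
derivative is 1, so that only u₁ survives. -/
lemma dist_inf (N : Matrix (Fin 2) (Fin 2) ℂ) (hN : IsNil N) (w u₁ u₂ : ScalarDist Spacetime)
    (h : ∀ s : ℝ, distOps.act (unip N hN s) w = w + (s : ℂ) • u₁ + (s : ℂ) ^ 2 • u₂) :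
    lieOp distOps distX N w = u₁ := by
  ext φ
  have h1 := w.hasDerivAt (orbitFamily N hN φ) 0
  have h2 : ∀ τ, w ((orbitFamily N hN φ).at' τ) =
      w φ + (Real.sin τ : ℂ) * u₁ φ + (Real.sin τ : ℂ) ^ 2 * u₂ φ := fun τ => by
    rw [orbitFamily_at, h]; rfl
  rw [funext h2] at h1
  have a0 : HasDerivAt (fun τ : ℝ => ((Real.sin τ : ℝ) : ℂ)) 1 0 := by
    have := (Real.hasDerivAt_sin 0).ofReal_comp
    simpa using this
  have a1 := (a0.mul_const (u₁ φ)).const_add (w φ)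
  have a2 := ((a0.pow 2).mul_const (u₂ φ))
  have h3 := h1.unique (a1.add a2)
  rw [orbitFamily_deriv] at h3
  have h4 : testComp (lorentz (unip N hN (-Real.sin 0))) φ = φ := by
    ext x
    rw [testComp_apply, Real.sin_zero, neg_zero, unip_zero, lorentz_one]
  rw [h4, w.map_smul_real] at h3
  rw [lieOp_distX N hN]
  simpa using h3

lemma dist_act_apply (A : SL2C) (T : ScalarDist Spacetime) (φ : Test Spacetime) :
    distOps.act A T φ = T (testComp (lorentz A).symm φ) := rfl

lemma dist_act_mul (A B : SL2C) (T : ScalarDist Spacetime) :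
    distOps.act A (distOps.act B T) = distOps.act (B * A) T := by
  ext φ
  have h : testComp (lorentz B).symm (testComp (lorentz A).symm φ) = testComp (lorentz (B * A)).symm φ := by
    ext x
    rw [testComp_apply, testComp_apply, testComp_apply, lorentz_symm, lorentz_symm, lorentz_symm,
      lorentz_mul, mul_inv_rev]
  rw [dist_act_apply, dist_act_apply, dist_act_apply, h]

/-- Infinitesimally invariant distributions are invariant. -/
theorem dist_invariant_of_lieOp {T : ScalarDist Spacetime}
    (h : ∀ N, IsNil N → lieOp distOps distX N T = 0) : IsLorentzInvariant distOps T := by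
  have key : ∀ N (hN : IsNil N), distOps.act (unip N hN 1) T = T := by
    intro N hN
    ext φ
    -- The two endpoints π/2 and 0 correspond to the parameters 1 and 0 of the unipotent subgroup.
    have h1 := T.eq_of_deriv_eq_zero (orbitFamily N hN φ) (fun τ => by
      rw [orbitFamily_deriv, T.map_smul_real]
      have h2 := lieOp_distX N hN T (testComp (lorentz (unip N hN (-Real.sin τ))) φ)
      rw [h N hN] at h2
      have h3 := neg_eq_zero.1 h2.symm
      rw [h3, smul_zero]) (Real.pi / 2) 0
    rw [orbitFamily_at, orbitFamily_at, Real.sin_pi_div_two, Real.sin_zero, unip_zero] at h1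
    rw [h1]
    change T (testComp (lorentz 1).symm φ) = T φ
    congr 1
    ext x
    rw [testComp_apply, lorentz_symm, inv_one, lorentz_one]
  refine SL2C_induction (fun c => ?_) (fun c => ?_) (fun A B hA hB => ?_)
  · rw [upper_eq]; exact key _ _
  · rw [lower_eq]; exact key _ _
  · rw [← dist_act_mul, hA, hB]

lemma dist_lieOp_of_invariant {T : ScalarDist Spacetime} (h : IsLorentzInvariant distOps T)
    (N : Matrix (Fin 2) (Fin 2) ℂ) (hN : IsNil N) : lieOp distOps distX N T = 0 :=
  dist_inf N hN T 0 0 fun s => by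
    have e : ∀ c : ℂ, c • (0 : ScalarDist Spacetime) = 0 := fun c => by
      ext φ; exact mul_zero c
    rw [h, e, e, add_zero, add_zero]

/-- The substitution y ↦ Λy, which is measure preserving because |det Λ| = 1. -/
lemma marg_testComp (A : SL2C) (φ : Test Spacetime2) :
    marg (testComp (lorentz2 A) φ) = testComp (lorentz A) (marg φ) := by
  ext x
  rw [testComp_apply, marg_apply, marg_apply]
  have h := (measurePreserving_lorentz A).integral_comp
    (lorentz A).toHomeomorph.measurableEmbedding (fun y => φ (lorentz A x + y, y))
  rw [← h]
  refine MeasureTheory.integral_congr_ae (Filter.Eventually.of_forall fun y => ?_)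
  change φ (lorentz A (x + y), lorentz A y) = φ (lorentz A x + lorentz A y, lorentz A y)
  rw [map_add]

theorem good_distOps (hbox : ∀ G, IsLorentzInvariant distOps G → ∃ H, IsBoxInverse distOps G H) :
    Good distOps distX where
  d_comm _ _ w := distDeriv_comm _ _ w
  d_X := distDeriv_distX
  act_mul := dist_act_mul
  d_act A m w := by
    change distDeriv (unit m) (distComp _ w) = _
    rw [distDeriv_distComp, lorentz_unit, distDeriv_sum_dir, map_sum]
    simp only [distDeriv_smul_dir, map_smul]
    rfl
  inf := dist_inf
  prim m w := by
    obtain ⟨U, h1, h2⟩ := ScalarDist.exists_primitive (l := (ContinuousLinearMap.proj m : Spacetime →L[ℝ] ℝ))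
      (e := unit m) (by simp [unit]) w
    exact ⟨U, h1, fun n hn h => h2 _ (by simp [unit, hn.symm]) h⟩
  const w h := dist_invariant_of_lieOp fun N _ => by
    refine Finset.sum_eq_zero fun m _ => Finset.sum_eq_zero fun n _ => ?_
    rw [h, map_zero, smul_zero]
  d2_comm _ _ _ _ v := distDeriv_comm _ _ v
  d2_act2 A a m v := by
    change distDeriv (unit2 a m) (distComp _ v) = _
    rw [distDeriv_distComp, lorentz2_unit2, distDeriv_sum_dir, map_sum]
    simp only [distDeriv_smul_dir, map_smul]
    rfl
  act2_neg_one v := by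
    ext φ
    change v (testComp (lorentz2 (-1)).symm φ) = v φ
    congr 1
    ext x
    rw [testComp_apply]
    congr 1
    change (lorentz (-1)⁻¹ x.1, lorentz (-1)⁻¹ x.2) = x
    rw [show (-1 : SL2C)⁻¹ = -1 by rw [inv_eq_iff_mul_eq_one]; simp, lorentz_neg_one, lorentz_neg_one]
  d2_diff_fst m w := by
    change distDeriv (unit2 0 m) (distDiff w) = _
    rw [unit2_zero, distDeriv_distDiff_fst]; rfl
  d2_diff_snd m w := by
    change distDeriv (unit2 1 m) (distDiff w) = _
    rw [unit2_one, distDeriv_distDiff_snd]; rfl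
  act2_diff A w := by
    ext φ
    change w (marg (testComp (lorentz2 A⁻¹) φ)) = w (testComp (lorentz A⁻¹) (marg φ))
    rw [marg_testComp]
  diff_injective := distDiff_injective
  exists_diff v hv := by
    refine exists_distDiff_eq v fun m => ?_
    rw [← hv m]
    have : ((unit m, unit m) : Spacetime2) = unit2 0 m + unit2 1 m := by simp [unit2]
    rw [this, distDeriv_add_dir]
    rfl
  exists_box := hbox

end DistLorentz

/-! ### Rotations and spherical means -/

section Rotations

lemma fderiv_eq_sum (φ : Test Spacetime) (y v : Spacetime) :
    fderiv ℝ φ y v = v 0 * tderiv (unit 0) φ y + v 1 * tderiv (unit 1) φ y +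
      v 2 * tderiv (unit 2) φ y + v 3 * tderiv (unit 3) φ y := by
  conv_lhs => rw [← sum_unit v]
  rw [map_sum, Fin.sum_univ_four]
  simp only [map_smul, smul_eq_mul, tderiv_apply]

/-- The square of the spatial norm. -/
def nsq (x : Spacetime) : ℝ := x 1 ^ 2 + x 2 ^ 2 + x 3 ^ 2

lemma norm_le_of_nsq {x y : Spacetime} {C : ℝ} (h0 : y 0 = x 0) (h : nsq y = nsq x) (hy : ‖y‖ ≤ C) :
    ‖x‖ ≤ 2 * C := by
  have hC : 0 ≤ C := (norm_nonneg _).trans hy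
  have hyi : ∀ i, |y i| ≤ C := fun i => (norm_le_pi_norm y i).trans hy
  have hsq : ∀ i, y i ^ 2 ≤ C ^ 2 := fun i => sq_le_sq' (abs_le.1 (hyi i)).1 (abs_le.1 (hyi i)).2
  have hn : nsq x ≤ (2 * C) ^ 2 := by
    rw [← h, nsq]; nlinarith [hsq 1, hsq 2, hsq 3, sq_nonneg C]
  refine (pi_norm_le_iff_of_nonneg (by positivity)).2 fun i => ?_
  rw [Real.norm_eq_abs]
  unfold nsq at hn
  fin_cases i
  · change |x 0| ≤ _
    rw [← h0]; linarith [hyi 0]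
  · change |x 1| ≤ _
    exact abs_le_of_sq_le_sq (by nlinarith [sq_nonneg (x 2), sq_nonneg (x 3)]) (by positivity)
  · change |x 2| ≤ _
    exact abs_le_of_sq_le_sq (by nlinarith [sq_nonneg (x 1), sq_nonneg (x 3)]) (by positivity)
  · change |x 3| ≤ _
    exact abs_le_of_sq_le_sq (by nlinarith [sq_nonneg (x 2), sq_nonneg (x 1)]) (by positivity)

/-- Rotations around the third axis. -/
def rotZ (z : ℝ × Spacetime) : Spacetime :=
  ![z.2 0, Real.cos z.1 * z.2 1 - Real.sin z.1 * z.2 2,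
    Real.sin z.1 * z.2 1 + Real.cos z.1 * z.2 2, z.2 3]

/-- Rotations around the first axis. -/
def rotX (z : ℝ × Spacetime) : Spacetime :=
  ![z.2 0, z.2 1, Real.cos z.1 * z.2 2 - Real.sin z.1 * z.2 3,
    Real.sin z.1 * z.2 2 + Real.cos z.1 * z.2 3]

lemma contDiff_rotZ : ContDiff ℝ ∞ rotZ := by
  refine contDiff_pi.2 fun i => ?_
  fin_cases i <;> simp [rotZ] <;> fun_prop

lemma contDiff_rotX : ContDiff ℝ ∞ rotX := by
  refine contDiff_pi.2 fun i => ?_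
  fin_cases i <;> simp [rotX] <;> fun_prop

lemma nsq_rotZ (τ : ℝ) (x : Spacetime) : nsq (rotZ (τ, x)) = nsq x := by
  simp [nsq, rotZ]
  linear_combination (x 1 ^ 2 + x 2 ^ 2) * Real.sin_sq_add_cos_sq τ

lemma nsq_rotX (τ : ℝ) (x : Spacetime) : nsq (rotX (τ, x)) = nsq x := by
  simp [nsq, rotX]
  linear_combination (x 2 ^ 2 + x 3 ^ 2) * Real.sin_sq_add_cos_sq τ

/-- A smooth family of transformations which preserve time and spatial norm. -/
structure IsRot (R : ℝ × Spacetime → Spacetime) : Prop where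
  smooth : ContDiff ℝ ∞ R
  time : ∀ z, R z 0 = z.2 0
  nsq : ∀ z, nsq (R z) = nsq z.2

lemma isRot_rotZ : IsRot rotZ := ⟨contDiff_rotZ, fun _ => rfl, fun z => nsq_rotZ z.1 z.2⟩
lemma isRot_rotX : IsRot rotX := ⟨contDiff_rotX, fun _ => rfl, fun z => nsq_rotX z.1 z.2⟩

lemma IsRot.exists_compact {R : ℝ × Spacetime → Spacetime} (hR : IsRot R) {K : Set Spacetime}
    (hK : IsCompact K) : ∃ K', IsCompact K' ∧ ∀ τ x, R (τ, x) ∈ K → x ∈ K' := by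
  obtain ⟨C, hC⟩ := hK.isBounded.exists_norm_le
  refine ⟨Metric.closedBall 0 (2 * C), isCompact_closedBall _ _, fun τ x hx => ?_⟩
  rw [mem_closedBall_zero_iff]
  exact norm_le_of_nsq (hR.time _) (hR.nsq _) (hC _ hx)

lemma IsRot.proper {R : ℝ × Spacetime → Spacetime} (hR : IsRot R) (a b : ℝ) (w : ℝ × Spacetime → ℝ) :
    ProperData a b w R := fun _ hK =>
  (hR.exists_compact hK).imp fun _ h => ⟨h.1, fun τ _ x _ hx => h.2 τ x hx⟩

/-- The mean of a test function over rotations with weight `w`. -/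
def rotMean {R : ℝ × Spacetime → Spacetime} (hR : IsRot R) (b : ℝ) (w : ℝ → ℝ)
    (hw : ContDiff ℝ ∞ w) : Test Spacetime →ₗ[ℝ] Test Spacetime :=
  paramOp 0 b (fun z => w z.1) R (hw.comp contDiff_fst) hR.smooth (hR.proper _ _ _)

lemma rotMean_apply {R : ℝ × Spacetime → Spacetime} (hR : IsRot R) (b : ℝ) (w : ℝ → ℝ)
    (hw : ContDiff ℝ ∞ w) (φ : Test Spacetime) (x : Spacetime) :
    rotMean hR b w hw φ x = ∫ τ in (0:ℝ)..b, w τ * φ (R (τ, x)) := rfl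

/-- The rotated test functions. -/
def rotFamily {R : ℝ × Spacetime → Spacetime} (hR : IsRot R) (φ : Test Spacetime) :
    TestFamily Spacetime where
  toFun z := φ (R z)
  smooth := (Test.contDiff φ).comp hR.smooth
  K := (hR.exists_compact φ.hasCompactSupport.isCompact).choose
  compact := (hR.exists_compact φ.hasCompactSupport.isCompact).choose_spec.1
  supp τ x hx := image_eq_zero_of_notMem_tsupport fun h =>
    hx ((hR.exists_compact φ.hasCompactSupport.isCompact).choose_spec.2 τ x h)

/-- The partial means over rotations. -/
def rotMeanFamily {R : ℝ × Spacetime → Spacetime} (hR : IsRot R) (w : ℝ → ℝ)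
    (hw : ContDiff ℝ ∞ w) (φ : Test Spacetime) : TestFamily Spacetime where
  toFun z := ∫ τ in (0:ℝ)..z.1, w τ * φ (R (τ, z.2))
  smooth := contDiff_integral_param_upper (F := fun z : ℝ × Spacetime => w z.1 * φ (R z))
    ((hw.comp contDiff_fst).mul ((Test.contDiff φ).comp hR.smooth))
  K := (rotFamily hR φ).K
  compact := (rotFamily hR φ).compact
  supp τ x hx := by
    have h : ∀ τ, φ (R (τ, x)) = 0 := fun τ => (rotFamily hR φ).supp τ x hx
    simp [h]

lemma rotMeanFamily_deriv {R : ℝ × Spacetime → Spacetime} (hR : IsRot R) (w : ℝ → ℝ)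
    (hw : ContDiff ℝ ∞ w) (φ : Test Spacetime) (τ : ℝ) :
    (rotMeanFamily hR w hw φ).deriv.at' τ = w τ • (rotFamily hR φ).at' τ := by
  refine TestFamily.deriv_at_eq _ fun x => ?_
  have hc : Continuous fun τ => w τ * φ (R (τ, x)) :=
    hw.continuous.mul ((Test.contDiff φ).continuous.comp (hR.smooth.continuous.comp (by fun_prop)))
  exact intervalIntegral.integral_hasDerivAt_right (hc.intervalIntegrable _ _)
    hc.stronglyMeasurable.stronglyMeasurableAtFilter hc.continuousAt

/-- A distribution invariant under rotations does not see means. -/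
lemma ScalarDist.apply_rotMean {T : ScalarDist Spacetime} {R : ℝ × Spacetime → Spacetime} (hR : IsRot R)
    {φ : Test Spacetime} (hT : ∀ τ, T ((rotFamily hR φ).at' τ) = T φ) (b : ℝ) (w : ℝ → ℝ)
    (hw : ContDiff ℝ ∞ w) : T (rotMean hR b w hw φ) = (∫ τ in (0:ℝ)..b, w τ : ℝ) * T φ := by
  have h1 : ∀ τ, HasDerivAt (fun τ => T ((rotMeanFamily hR w hw φ).at' τ)) ((w τ : ℂ) * T φ) τ := by
    intro τ
    refine (T.hasDerivAt (rotMeanFamily hR w hw φ) τ).congr_deriv ?_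
    rw [rotMeanFamily_deriv, T.map_smul_real, hT, Complex.real_smul]
  have h2 := intervalIntegral.integral_eq_sub_of_hasDerivAt (a := 0) (b := b) (fun τ _ => h1 τ)
    ((Complex.continuous_ofReal.comp hw.continuous).mul continuous_const |>.intervalIntegrable _ _)
  rw [intervalIntegral.integral_mul_const, intervalIntegral.integral_ofReal] at h2
  have h3 : (rotMeanFamily hR w hw φ).at' b = rotMean hR b w hw φ := rfl
  have h4 : (rotMeanFamily hR w hw φ).at' 0 = 0 := by
    ext x
    change ∫ τ in (0:ℝ)..0, w τ * φ (R (τ, x)) = 0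
    rw [intervalIntegral.integral_same]
  rw [h2, h3, h4, T.map_zero', sub_zero]

/-- The angular momentum operators `x_i ∂_j - x_j ∂_i`. -/
def ang (i j : Fin 4) : Test Spacetime →ₗ[ℝ] Test Spacetime :=
  testX i ∘ₗ tderiv (unit j) - testX j ∘ₗ tderiv (unit i)

lemma ang_apply (i j : Fin 4) (φ : Test Spacetime) (x : Spacetime) :
    ang i j φ x = x i * tderiv (unit j) φ x - x j * tderiv (unit i) φ x := by
  rw [← testX_apply, ← testX_apply]; rfl

lemma hasDerivAt_rotZ (τ : ℝ) (x : Spacetime) : HasDerivAt (fun τ => rotZ (τ, x))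
    ![0, -(rotZ (τ, x) 2), rotZ (τ, x) 1, 0] τ := by
  refine hasDerivAt_pi.2 fun i => ?_
  have hs := Real.hasDerivAt_sin τ
  have hc := Real.hasDerivAt_cos τ
  fin_cases i
  · exact hasDerivAt_const _ _
  · exact ((hc.mul_const (x 1)).sub (hs.mul_const (x 2))).congr_deriv (by simp [rotZ]; ring)
  · exact ((hs.mul_const (x 1)).add (hc.mul_const (x 2))).congr_deriv (by simp [rotZ]; ring)
  · exact hasDerivAt_const _ _

lemma hasDerivAt_rotX (τ : ℝ) (x : Spacetime) : HasDerivAt (fun τ => rotX (τ, x))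
    ![0, 0, -(rotX (τ, x) 3), rotX (τ, x) 2] τ := by
  refine hasDerivAt_pi.2 fun i => ?_
  have hs := Real.hasDerivAt_sin τ
  have hc := Real.hasDerivAt_cos τ
  fin_cases i
  · exact hasDerivAt_const _ _
  · exact hasDerivAt_const _ _
  · exact ((hc.mul_const (x 2)).sub (hs.mul_const (x 3))).congr_deriv (by simp [rotX]; ring)
  · exact ((hs.mul_const (x 2)).add (hc.mul_const (x 3))).congr_deriv (by simp [rotX]; ring)

lemma rotZ_add (τ : ℝ) (x : Spacetime) (s : ℝ) (v : Spacetime) :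
    rotZ (τ, x + s • v) = rotZ (τ, x) + s • rotZ (τ, v) := by
  ext i; fin_cases i <;> simp [rotZ] <;> ring

lemma rotX_add (τ : ℝ) (x : Spacetime) (s : ℝ) (v : Spacetime) :
    rotX (τ, x + s • v) = rotX (τ, x) + s • rotX (τ, v) := by
  ext i; fin_cases i <;> simp [rotX] <;> ring

lemma tderiv_comp_linear {R : Spacetime → Spacetime}
    (hR : ∀ x (s : ℝ) v, R (x + s • v) = R x + s • R v) {φ ψ : Test Spacetime}
    (h : ∀ x, ψ x = φ (R x)) (v x : Spacetime) : tderiv v ψ x = fderiv ℝ φ (R x) (R v) := by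
  apply tderiv_eq_of_hasDerivAt
  simp only [h, hR]
  have h1 : HasDerivAt (fun s : ℝ => R x + s • R v) (R v) 0 := by
    simpa using ((hasDerivAt_id (0:ℝ)).smul_const (R v)).const_add (R x)
  have h2 := Test.hasDerivAt_comp φ h1
  rwa [zero_smul, add_zero] at h2

lemma rotFamily_rotZ_deriv (φ : Test Spacetime) (τ : ℝ) :
    (rotFamily isRot_rotZ φ).deriv.at' τ = ang 1 2 ((rotFamily isRot_rotZ φ).at' τ) := by
  refine TestFamily.deriv_at_eq _ fun x => ?_
  refine (Test.hasDerivAt_comp φ (hasDerivAt_rotZ τ x)).congr_deriv ?_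
  rw [ang_apply, tderiv_comp_linear (R := fun x => rotZ (τ, x)) (rotZ_add τ) (φ := φ) (ψ := (rotFamily isRot_rotZ φ).at' τ) (fun _ => rfl),
    tderiv_comp_linear (R := fun x => rotZ (τ, x)) (rotZ_add τ) (φ := φ) (ψ := (rotFamily isRot_rotZ φ).at' τ) (fun _ => rfl), tderiv_apply,
    fderiv_eq_sum, fderiv_eq_sum, fderiv_eq_sum]
  simp [rotZ, unit]
  ring

lemma rotFamily_rotX_deriv (φ : Test Spacetime) (τ : ℝ) :
    (rotFamily isRot_rotX φ).deriv.at' τ = ang 2 3 ((rotFamily isRot_rotX φ).at' τ) := by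
  refine TestFamily.deriv_at_eq _ fun x => ?_
  refine (Test.hasDerivAt_comp φ (hasDerivAt_rotX τ x)).congr_deriv ?_
  rw [ang_apply, tderiv_comp_linear (R := fun x => rotX (τ, x)) (rotX_add τ) (φ := φ) (ψ := (rotFamily isRot_rotX φ).at' τ) (fun _ => rfl),
    tderiv_comp_linear (R := fun x => rotX (τ, x)) (rotX_add τ) (φ := φ) (ψ := (rotFamily isRot_rotX φ).at' τ) (fun _ => rfl), tderiv_apply,
    fderiv_eq_sum, fderiv_eq_sum, fderiv_eq_sum]
  simp [rotX, unit]
  ring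

/-- The mean over rotations around the third axis. -/
def zMean : Test Spacetime →ₗ[ℝ] Test Spacetime :=
  rotMean isRot_rotZ (2 * Real.pi) (fun _ => 1) contDiff_const

lemma zMean_apply (φ : Test Spacetime) (x : Spacetime) :
    zMean φ x = ∫ α in (0:ℝ)..2 * Real.pi, φ (rotZ (α, x)) := by
  simp [zMean, rotMean_apply]

/-- The mean over half turns around the first axis with weight `w`. -/
def xMean (w : ℝ → ℝ) (hw : ContDiff ℝ ∞ w) : Test Spacetime →ₗ[ℝ] Test Spacetime :=
  rotMean isRot_rotX Real.pi w hw

lemma xMean_apply (w : ℝ → ℝ) (hw : ContDiff ℝ ∞ w) (φ : Test Spacetime) (x : Spacetime) :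
    xMean w hw φ x = ∫ β in (0:ℝ)..Real.pi, w β * φ (rotX (β, x)) := rfl

lemma ScalarDist.apply_zMean {T : ScalarDist Spacetime} (hT : ∀ φ, T (ang 1 2 φ) = 0) (φ : Test Spacetime) :
    T (zMean φ) = (2 * Real.pi : ℝ) * T φ := by
  have h0 : (rotFamily isRot_rotZ φ).at' 0 = φ := by
    ext x
    change φ (rotZ (0, x)) = φ x
    congr 1
    ext i; fin_cases i <;> simp [rotZ]
  have h := T.apply_rotMean isRot_rotZ (φ := φ) (fun τ => by
    rw [T.eq_of_deriv_eq_zero (rotFamily isRot_rotZ φ) (fun τ => by rw [rotFamily_rotZ_deriv, hT]) τ 0, h0])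
    (2 * Real.pi) (fun _ => 1) contDiff_const
  have h1 : ∫ _τ in (0:ℝ)..2 * Real.pi, (1:ℝ) = 2 * Real.pi := by simp
  rw [h1] at h
  exact h

/-- The weight sin is the density of Haar measure in Euler angles; the factor 2 is its integral over
[0, π]. -/
lemma ScalarDist.apply_xMean {T : ScalarDist Spacetime} (hT : ∀ φ, T (ang 2 3 φ) = 0) (φ : Test Spacetime) :
    T (xMean Real.sin Real.contDiff_sin φ) = 2 * T φ := by
  have h0 : (rotFamily isRot_rotX φ).at' 0 = φ := by
    ext x
    change φ (rotX (0, x)) = φ x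
    congr 1
    ext i; fin_cases i <;> simp [rotX]
  have h := T.apply_rotMean isRot_rotX (φ := φ) (fun τ => by
    rw [T.eq_of_deriv_eq_zero (rotFamily isRot_rotX φ) (fun τ => by rw [rotFamily_rotX_deriv, hT]) τ 0, h0])
    Real.pi Real.sin Real.contDiff_sin
  have h1 : ∫ τ in (0:ℝ)..Real.pi, Real.sin τ = 2 := by
    rw [integral_sin]; simp; norm_num
  rw [h1] at h
  exact_mod_cast h

lemma zMean_rotZ (φ : Test Spacetime) (γ : ℝ) (x : Spacetime) :
    zMean φ (rotZ (γ, x)) = zMean φ x := by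
  rw [zMean_apply, zMean_apply]
  have h1 : ∀ α, rotZ (α, rotZ (γ, x)) = rotZ (α + γ, x) := by
    intro α
    ext i; fin_cases i <;> simp [rotZ, Real.cos_add, Real.sin_add] <;> ring
  simp only [h1]
  rw [intervalIntegral.integral_comp_add_right (fun α => φ (rotZ (α, x)))]
  have hp : Function.Periodic (fun α => φ (rotZ (α, x))) (2 * Real.pi) := by
    intro α
    simp [rotZ]
  rw [zero_add, add_comm, hp.intervalIntegral_add_eq γ 0, zero_add]

end Rotations

/-! ### Integrals over spheres around the time axis and their behaviour under derivatives -/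

section Spheres

/-- The integral of a divergence over a rectangle with matching boundary values vanishes. -/
lemma integral_div_eq_zero {f g f' g' : ℝ × ℝ → ℝ} {a b c d : ℝ} (hf : ContDiff ℝ ∞ f)
    (hg : ContDiff ℝ ∞ g) (hf' : ∀ x y, HasDerivAt (fun x => f (x, y)) (f' (x, y)) x)
    (hg' : ∀ x y, HasDerivAt (fun y => g (x, y)) (g' (x, y)) y) (hab : ∀ y, f (a, y) = f (b, y))
    (hcd : ∀ x, g (x, c) = g (x, d)) :
    ∫ x in a..b, ∫ y in c..d, (f' (x, y) + g' (x, y)) = 0 := by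
  have ef : ∀ z : ℝ × ℝ, f' z = fderiv ℝ f z (1, 0) := fun z => by
    have h1 : HasDerivAt (fun x : ℝ => (x, z.2)) ((1:ℝ), (0:ℝ)) z.1 :=
      (hasDerivAt_id z.1).prodMk (hasDerivAt_const _ _)
    exact (hf' z.1 z.2).unique
      ((hf.differentiable (by simp) z).hasFDerivAt.comp_hasDerivAt z.1 h1)
  have eg : ∀ z : ℝ × ℝ, g' z = fderiv ℝ g z (0, 1) := fun z => by
    have h1 : HasDerivAt (fun y : ℝ => (z.1, y)) ((0:ℝ), (1:ℝ)) z.2 :=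
      (hasDerivAt_const _ _).prodMk (hasDerivAt_id z.2)
    exact (hg' z.1 z.2).unique
      ((hg.differentiable (by simp) z).hasFDerivAt.comp_hasDerivAt z.2 h1)
  have cf : Continuous f' := by
    rw [funext ef]
    exact (hf.continuous_fderiv (by simp)).clm_apply continuous_const
  have cg : Continuous g' := by
    rw [funext eg]
    exact (hg.continuous_fderiv (by simp)).clm_apply continuous_const
  have hsw : ContDiff ℝ ∞ fun z : ℝ × ℝ => f (z.2, z.1) := hf.comp (by fun_prop)
  have hJ : ∀ x, HasDerivAt (fun x => ∫ y in c..d, f (x, y)) (∫ y in c..d, f' (x, y)) x := by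
    intro x
    refine (hasFDerivAt_integral_param _ (hsw.of_le (by simp)) c d x).hasDerivAt.congr_deriv ?_
    rw [ContinuousLinearMap.intervalIntegral_apply]
    · refine intervalIntegral.integral_congr fun y _ => ?_
      have h1 : HasDerivAt (fun x : ℝ => (y, x)) ((0:ℝ), (1:ℝ)) x :=
        (hasDerivAt_const _ _).prodMk (hasDerivAt_id x)
      have h2 := ((hsw.differentiable (by simp) (y, x)).hasFDerivAt.comp_hasDerivAt x h1)
      exact h2.unique (hf' x y)
    · refine Continuous.intervalIntegrable ?_ _ _
      exact ((hsw.continuous_fderiv (by simp)).comp (by fun_prop)).clm_comp continuous_const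
  have h1 : ∀ x, ∫ y in c..d, (f' (x, y) + g' (x, y)) = ∫ y in c..d, f' (x, y) := by
    intro x
    have cf' : Continuous fun y => f' (x, y) := cf.comp (by fun_prop)
    have cg' : Continuous fun y => g' (x, y) := cg.comp (by fun_prop)
    rw [intervalIntegral.integral_add (cf'.intervalIntegrable _ _) (cg'.intervalIntegrable _ _),
      intervalIntegral.integral_eq_sub_of_hasDerivAt (fun y _ => hg' x y)
        (cg'.intervalIntegrable _ _), hcd, sub_self, add_zero]
  simp only [h1]
  have cJ : Continuous fun x => ∫ y in c..d, f' (x, y) :=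
    intervalIntegral.continuous_parametric_intervalIntegral_of_continuous' (by exact cf) c d
  rw [intervalIntegral.integral_eq_sub_of_hasDerivAt (fun x _ => hJ x) (cJ.intervalIntegrable _ _)]
  simp only [hab, sub_self]

/-- The points `(t, 0, 0, r)`. -/
def axis (z : ℝ × ℝ) : Spacetime := ![z.1, 0, 0, z.2]

lemma contDiff_axis : ContDiff ℝ ∞ axis := by
  refine contDiff_pi.2 fun i => ?_
  fin_cases i <;> simp [axis] <;> fun_prop

/-- The restriction of test functions to the points `(t, 0, 0, r)`. -/
def axisOp : Test Spacetime →ₗ[ℝ] Test (ℝ × ℝ) :=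
  mulCompOp (fun _ => 1) axis contDiff_const contDiff_axis fun K hK => by
    obtain ⟨C, hC⟩ := hK.isBounded.exists_norm_le
    refine ⟨Metric.closedBall 0 C, isCompact_closedBall _ _, fun x _ hx => ?_⟩
    rw [mem_closedBall_zero_iff]
    have h := hC _ hx
    exact norm_prod_le_iff.2 ⟨(norm_le_pi_norm (axis x) 0).trans h,
      (norm_le_pi_norm (axis x) 3).trans h⟩

lemma axisOp_apply (φ : Test Spacetime) (z : ℝ × ℝ) : axisOp φ z = φ (axis z) :=
  (mulCompOp_apply ..).trans (one_mul _)

/-- The points of the spheres around the time axis. -/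
def spherePt (z : ℝ × ℝ) (β α : ℝ) : Spacetime := rotZ (α, rotX (β, axis z))

lemma spherePt_eq (z : ℝ × ℝ) (β α : ℝ) : spherePt z β α =
    ![z.1, z.2 * Real.sin α * Real.sin β, -(z.2 * Real.cos α * Real.sin β), z.2 * Real.cos β] := by
  ext i; fin_cases i <;> simp [spherePt, rotZ, rotX, axis] <;> ring

/-- The integrals over spheres with a weight depending on the polar angle. -/
def sph (w : ℝ → ℝ) (hw : ContDiff ℝ ∞ w) : Test Spacetime →ₗ[ℝ] Test (ℝ × ℝ) :=
  axisOp ∘ₗ xMean w hw ∘ₗ zMean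

variable (w : ℝ → ℝ) (hw : ContDiff ℝ ∞ w)

lemma rotMean_isBounded {R : ℝ × Spacetime → Spacetime} (hR : IsRot R) (b : ℝ) :
    IsBoundedOp (rotMean hR b w hw) := paramOp_isBounded ..

lemma sph_isBounded : IsBoundedOp (sph w hw) :=
  (mulCompOp_isBounded ..).comp ((rotMean_isBounded w hw isRot_rotX _).comp
    (rotMean_isBounded _ _ isRot_rotZ _))

lemma sph_eq (φ : Test Spacetime) (z : ℝ × ℝ) : sph w hw φ z = xMean w hw (zMean φ) (axis z) :=
  axisOp_apply _ _

lemma sph_apply (φ : Test Spacetime) (z : ℝ × ℝ) : sph w hw φ z =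
    ∫ β in (0:ℝ)..Real.pi, w β * ∫ α in (0:ℝ)..2 * Real.pi, φ (spherePt z β α) := by
  rw [sph_eq, xMean_apply]
  simp only [zMean_apply]
  rfl

lemma sph_mul {w' f : ℝ → ℝ} {hw' : ContDiff ℝ ∞ w'} {φ ψ : Test Spacetime} {z : ℝ × ℝ} {c : ℝ}
    (h : ∀ β α, ψ (spherePt z β α) = c * f β * φ (spherePt z β α)) (hf : ∀ β, w' β = w β * f β) :
    sph w hw ψ z = c * sph w' hw' φ z := by
  rw [sph_apply, sph_apply, ← intervalIntegral.integral_const_mul]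
  refine intervalIntegral.integral_congr fun β _ => ?_
  simp only [h, hf, intervalIntegral.integral_const_mul]
  ring

/-- The spatial Euler field. -/
def euler : Test Spacetime →ₗ[ℝ] Test Spacetime :=
  testX 1 ∘ₗ tderiv (unit 1) + testX 2 ∘ₗ tderiv (unit 2) + testX 3 ∘ₗ tderiv (unit 3)

lemma euler_apply' (φ : Test Spacetime) (x : Spacetime) : euler φ x =
    x 1 * tderiv (unit 1) φ x + x 2 * tderiv (unit 2) φ x + x 3 * tderiv (unit 3) φ x := by
  rw [← testX_apply, ← testX_apply, ← testX_apply]; rfl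

lemma euler_apply (φ : Test Spacetime) (x : Spacetime) :
    euler φ x = tderiv ![0, x 1, x 2, x 3] φ x := by
  rw [euler_apply', tderiv_apply ![0, x 1, x 2, x 3], fderiv_eq_sum]
  simp

lemma tderiv_rotMean_linear {R : ℝ × Spacetime → Spacetime} (hR : IsRot R) (b : ℝ)
    (hl : ∀ τ x (s : ℝ) v, R (τ, x + s • v) = R (τ, x) + s • R (τ, v)) (φ : Test Spacetime)
    (v x : Spacetime) :
    tderiv v (rotMean hR b w hw φ) x =
      ∫ τ in (0:ℝ)..b, w τ * tderiv (R (τ, v)) φ (R (τ, x)) := by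
  have h : tderiv v (rotMean hR b w hw φ) x = _ :=
    tderiv_paramOp v x (w' := fun _ => 0) (u := fun τ => R (τ, v))
      (fun τ => hasDerivAt_const (0:ℝ) (w τ)) (fun τ => by
        simp only [hl]
        simpa using ((hasDerivAt_id (0:ℝ)).smul_const (R (τ, v))).const_add (R (τ, x))) φ
  rw [h]
  simp

lemma tderiv_zMean (φ : Test Spacetime) (v x : Spacetime) : tderiv v (zMean φ) x =
    ∫ α in (0:ℝ)..2 * Real.pi, tderiv (rotZ (α, v)) φ (rotZ (α, x)) := by
  have h : tderiv v (zMean φ) x = _ :=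
    tderiv_rotMean_linear (fun _ => 1) contDiff_const isRot_rotZ _ rotZ_add φ v x
  simpa using h

lemma tderiv_xMean (φ : Test Spacetime) (v x : Spacetime) : tderiv v (xMean w hw φ) x =
    ∫ β in (0:ℝ)..Real.pi, w β * tderiv (rotX (β, v)) φ (rotX (β, x)) :=
  tderiv_rotMean_linear w hw isRot_rotX _ rotX_add φ v x

lemma tderiv_axisOp (φ : Test Spacetime) (v z : ℝ × ℝ) :
    tderiv v (axisOp φ) z = tderiv (axis v) φ (axis z) := by
  apply tderiv_eq_of_hasDerivAt
  simp only [axisOp_apply]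
  have h0 : ∀ s : ℝ, axis (z + s • v) = axis z + s • axis v := fun s => by
    ext i; fin_cases i <;> simp [axis]
  have h1 : HasDerivAt (fun s : ℝ => axis (z + s • v)) (axis v) 0 := by
    simp only [h0]
    simpa using ((hasDerivAt_id (0:ℝ)).smul_const (axis v)).const_add (axis z)
  have h2 := Test.hasDerivAt_comp φ h1
  rwa [zero_smul, add_zero] at h2

lemma tderiv_sph (φ : Test Spacetime) (v z : ℝ × ℝ) : tderiv v (sph w hw φ) z =
    ∫ β in (0:ℝ)..Real.pi, w β * ∫ α in (0:ℝ)..2 * Real.pi,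
      tderiv (spherePt v β α) φ (spherePt z β α) := by
  change tderiv v (axisOp (xMean w hw (zMean φ))) z = _
  rw [tderiv_axisOp, tderiv_xMean]
  simp only [tderiv_zMean]
  rfl

lemma tderiv_time_sph (φ : Test Spacetime) :
    tderiv ((1, 0) : ℝ × ℝ) (sph w hw φ) = sph w hw (tderiv (unit 0) φ) := by
  have h : ∀ β α, spherePt (1, 0) β α = unit 0 := fun β α => by
    rw [spherePt_eq]; ext i; fin_cases i <;> simp [unit]
  ext z
  rw [tderiv_sph, sph_apply]
  simp only [h]

lemma tderiv_radial_sph (φ : Test Spacetime) (z : ℝ × ℝ) :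
    z.2 * tderiv ((0, 1) : ℝ × ℝ) (sph w hw φ) z = sph w hw (euler φ) z := by
  have h : z.2 * tderiv ((0, 1) : ℝ × ℝ) (sph w hw φ) z = tderiv (0, z.2) (sph w hw φ) z := by
    have : ((0, z.2) : ℝ × ℝ) = z.2 • (0, 1) := by simp
    rw [this, tderiv_smul_dir]; rfl
  rw [h, tderiv_sph, sph_apply]
  have h' : ∀ β α, ![0, spherePt z β α 1, spherePt z β α 2, spherePt z β α 3] =
      spherePt (0, z.2) β α := fun β α => by
    rw [spherePt_eq, spherePt_eq]; ext i; fin_cases i <;> simp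
  simp only [euler_apply, h']

lemma contDiff_spherePt (z : ℝ × ℝ) : ContDiff ℝ ∞ fun y : ℝ × ℝ => spherePt z y.1 y.2 := by
  refine contDiff_pi.2 fun i => ?_
  simp only [spherePt_eq]
  fin_cases i <;> simp <;> fun_prop

lemma zMean_ang (φ : Test Spacetime) : zMean (ang 1 2 φ) = 0 := by
  ext x
  rw [zMean_apply]
  have hd : ∀ α, HasDerivAt (fun α => φ (rotZ (α, x))) (ang 1 2 φ (rotZ (α, x))) α := by
    intro α
    refine (Test.hasDerivAt_comp φ (hasDerivAt_rotZ α x)).congr_deriv ?_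
    rw [ang_apply, tderiv_apply ![_, _, _, _], fderiv_eq_sum]
    simp; ring
  rw [intervalIntegral.integral_eq_sub_of_hasDerivAt (fun α _ => hd α)]
  · have : rotZ (2 * Real.pi, x) = rotZ (0, x) := by simp [rotZ]
    rw [this, sub_self]; rfl
  · exact ((Test.contDiff _).continuous.comp
      (contDiff_rotZ.continuous.comp (by fun_prop))).intervalIntegrable _ _

lemma sph_ang_one_two (φ : Test Spacetime) : sph w hw (ang 1 2 φ) = 0 := by
  change axisOp (xMean w hw (zMean (ang 1 2 φ))) = 0
  rw [zMean_ang, map_zero, map_zero]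

/-- Integrals over spheres. -/
abbrev sphS : Test Spacetime →ₗ[ℝ] Test (ℝ × ℝ) := sph Real.sin Real.contDiff_sin

/-- Integrals over spheres, weighted with the cosine of the polar angle. -/
abbrev sphC : Test Spacetime →ₗ[ℝ] Test (ℝ × ℝ) :=
  sph (fun β => Real.sin β * Real.cos β) (Real.contDiff_sin.mul Real.contDiff_cos)

/-- In polar coordinates the rotation about the first axis is tangent to the sphere and divergence
free with respect to the area element sin β. The weighted integrand is thus a divergence in (β, α),
with boundary terms killed by sin β = 0 and by periodicity in α. -/
lemma sphS_ang_two_three (φ : Test Spacetime) : sphS (ang 2 3 φ) = 0 := by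
  ext z
  change sphS (ang 2 3 φ) z = 0
  rw [sph_apply]
  have hs := contDiff_spherePt z
  have hφ : ContDiff ℝ ∞ fun y : ℝ × ℝ => φ (spherePt z y.1 y.2) := (Test.contDiff φ).comp hs
  have h1 : ∀ β α, HasDerivAt (fun β => spherePt z β α) ![0, z.2 * Real.sin α * Real.cos β,
      -(z.2 * Real.cos α * Real.cos β), z.2 * -Real.sin β] β := by
    intro β α
    refine hasDerivAt_pi.2 fun i => ?_
    simp only [spherePt_eq]
    fin_cases i
    · exact hasDerivAt_const _ _
    · exact (Real.hasDerivAt_sin β).const_mul _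
    · exact ((Real.hasDerivAt_sin β).const_mul _).neg
    · exact (Real.hasDerivAt_cos β).const_mul _
  have h2 : ∀ β α, HasDerivAt (fun α => spherePt z β α) ![0, z.2 * Real.cos α * Real.sin β,
      -(z.2 * -Real.sin α * Real.sin β), 0] α := by
    intro β α
    refine hasDerivAt_pi.2 fun i => ?_
    simp only [spherePt_eq]
    fin_cases i
    · exact hasDerivAt_const _ _
    · exact ((Real.hasDerivAt_sin α).const_mul _).mul_const _
    · exact (((Real.hasDerivAt_cos α).const_mul _).mul_const _).neg
    · exact hasDerivAt_const _ _
  have key := integral_div_eq_zero (a := 0) (b := Real.pi) (c := 0) (d := 2 * Real.pi)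
    (f := fun y => Real.sin y.1 * Real.cos y.2 * φ (spherePt z y.1 y.2))
    (g := fun y => Real.cos y.1 * -Real.sin y.2 * φ (spherePt z y.1 y.2))
    (f' := fun y => Real.cos y.1 * Real.cos y.2 * φ (spherePt z y.1 y.2) +
      Real.sin y.1 * Real.cos y.2 * tderiv ![0, z.2 * Real.sin y.2 * Real.cos y.1,
      -(z.2 * Real.cos y.2 * Real.cos y.1), z.2 * -Real.sin y.1] φ (spherePt z y.1 y.2))
    (g' := fun y => Real.cos y.1 * -Real.cos y.2 * φ (spherePt z y.1 y.2) +
      Real.cos y.1 * -Real.sin y.2 * tderiv ![0, z.2 * Real.cos y.2 * Real.sin y.1,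
      -(z.2 * -Real.sin y.2 * Real.sin y.1), 0] φ (spherePt z y.1 y.2))
    (ContDiff.mul (by fun_prop) hφ) (ContDiff.mul (by fun_prop) hφ)
    (fun β α => ((Real.hasDerivAt_sin β).mul_const (Real.cos α)).mul (Test.hasDerivAt_comp φ (h1 β α)))
    (fun β α => ((Real.hasDerivAt_sin α).neg.const_mul (Real.cos β)).mul (Test.hasDerivAt_comp φ (h2 β α)))
    (fun α => by simp) (fun β => by simp [spherePt_eq])
  change _ = (0:ℝ)
  refine Eq.trans ?_ key
  refine intervalIntegral.integral_congr fun β _ => ?_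
  dsimp only
  rw [← intervalIntegral.integral_const_mul]
  refine intervalIntegral.integral_congr fun α _ => ?_
  rw [ang_apply, tderiv_apply (![_, _, _, _] : Spacetime), tderiv_apply (![_, _, _, _] : Spacetime),
    fderiv_eq_sum, fderiv_eq_sum]
  simp [spherePt_eq]
  linear_combination (- z.2 * Real.sin β * Real.cos β * tderiv (unit 2) φ ![z.1, z.2 * Real.sin α * Real.sin β, -(z.2 * Real.cos α * Real.sin β), z.2 * Real.cos β]) * (- Real.sin_sq_add_cos_sq α)

lemma tderiv_ang (i j k : Fin 4) (φ : Test Spacetime) (x : Spacetime) :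
    tderiv (unit k) (ang i j φ) x = x i * tderiv (unit k) (tderiv (unit j) φ) x +
      (if k = i then tderiv (unit j) φ x else 0) -
      (x j * tderiv (unit k) (tderiv (unit i) φ) x + (if k = j then tderiv (unit i) φ x else 0)) := by
  have e1 : ang i j φ = testX i (tderiv (unit j) φ) - testX j (tderiv (unit i) φ) := rfl
  rw [e1, map_sub, tderiv_testX, tderiv_testX, ← testX_apply, ← testX_apply]
  split_ifs <;> rfl

/-- The third rotation generator is the commutator of the other two, whose images are annihilated.
-/
lemma sphS_ang_one_three (φ : Test Spacetime) : sphS (ang 1 3 φ) = 0 := by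
  have h : ang 1 3 φ = ang 1 2 (ang 2 3 φ) - ang 2 3 (ang 1 2 φ) := by
    ext x
    change _ = ang 1 2 (ang 2 3 φ) x - ang 2 3 (ang 1 2 φ) x
    rw [ang_apply, ang_apply, ang_apply]
    rw [tderiv_ang, tderiv_ang, tderiv_ang, tderiv_ang, tderiv_comm (unit 1) (unit 2), tderiv_comm (unit 1) (unit 3),
      tderiv_comm (unit 2) (unit 3)]
    simp
    ring
  rw [h, map_sub, sphS_ang_two_three, sph_ang_one_two, sub_self]

end Spheres

/-! ### Averages over all rotations, Darboux's equation, and boosts in radial form -/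

section SphereMeans

lemma ang_zMean (φ : Test Spacetime) : ang 1 2 (zMean φ) = 0 := by
  ext x
  have h1 := Test.hasDerivAt_comp (zMean φ) (hasDerivAt_rotZ 0 x)
  simp only [zMean_rotZ] at h1
  have h2 := h1.unique (hasDerivAt_const _ _)
  rw [tderiv_apply, fderiv_eq_sum] at h2
  have h3 : rotZ (0, x) = x := by ext i; fin_cases i <;> simp [rotZ]
  rw [h3] at h2
  rw [ang_apply]
  simp at h2
  change _ = (0:ℝ)
  linarith

lemma exists_polar (x y : ℝ) : ∃ r θ : ℝ, x = r * Real.cos θ ∧ y = r * Real.sin θ :=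
  ⟨‖(⟨x, y⟩ : ℂ)‖, Complex.arg ⟨x, y⟩, (Complex.norm_mul_cos_arg ⟨x, y⟩).symm,
    (Complex.norm_mul_sin_arg ⟨x, y⟩).symm⟩

/-- The triple mean is an average over all rotations in Euler angles with Haar density, so it is
rotation invariant, and in particular constant along meridians. Analytically: modulo the rotation of
F = `zMean φ` about the third axis, which vanishes, the derivative is the integral of a divergence
in the angles (α, β). -/
lemma tderiv_mean_meridian (φ : Test Spacetime) (t r a : ℝ) :
    tderiv ![0, r * Real.cos a, 0, r * -Real.sin a] (zMean (xMean Real.sin Real.contDiff_sin (zMean φ)))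
      ![t, r * Real.sin a, 0, r * Real.cos a] = 0 := by
  set F := zMean φ with hF
  let y : ℝ × ℝ → Spacetime := fun z => ![t, r * Real.sin a * Real.cos z.1,
    Real.cos z.2 * (r * Real.sin a * Real.sin z.1) - Real.sin z.2 * (r * Real.cos a),
    Real.sin z.2 * (r * Real.sin a * Real.sin z.1) + Real.cos z.2 * (r * Real.cos a)]
  let y₁ : ℝ × ℝ → Spacetime := fun z => ![0, r * Real.sin a * -Real.sin z.1,
    Real.cos z.2 * (r * Real.sin a * Real.cos z.1),
    Real.sin z.2 * (r * Real.sin a * Real.cos z.1)]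
  let y₂ : ℝ × ℝ → Spacetime := fun z => ![0, 0,
    -Real.sin z.2 * (r * Real.sin a * Real.sin z.1) - Real.cos z.2 * (r * Real.cos a),
    Real.cos z.2 * (r * Real.sin a * Real.sin z.1) + -Real.sin z.2 * (r * Real.cos a)]
  have hy : ContDiff ℝ ∞ y := by
    refine contDiff_pi.2 fun i => ?_
    fin_cases i <;> simp [y] <;> fun_prop
  have hFy : ContDiff ℝ ∞ fun z => F (y z) := (Test.contDiff F).comp hy
  have h1 : ∀ α β, HasDerivAt (fun α => y (α, β)) (y₁ (α, β)) α := by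
    intro α β
    refine hasDerivAt_pi.2 fun i => ?_
    fin_cases i
    · exact hasDerivAt_const _ _
    · exact (Real.hasDerivAt_cos α).const_mul _
    · exact (((Real.hasDerivAt_sin α).const_mul (r * Real.sin a)).const_mul (Real.cos β)).sub_const
        (Real.sin β * (r * Real.cos a))
    · exact (((Real.hasDerivAt_sin α).const_mul (r * Real.sin a)).const_mul (Real.sin β)).add_const
        (Real.cos β * (r * Real.cos a))
  have h2 : ∀ α β, HasDerivAt (fun β => y (α, β)) (y₂ (α, β)) β := by
    intro α β
    refine hasDerivAt_pi.2 fun i => ?_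
    fin_cases i
    · exact hasDerivAt_const _ _
    · exact hasDerivAt_const β (r * Real.sin a * Real.cos α)
    · exact ((Real.hasDerivAt_cos β).mul_const (r * Real.sin a * Real.sin α)).sub
        ((Real.hasDerivAt_sin β).mul_const (r * Real.cos a))
    · exact ((Real.hasDerivAt_sin β).mul_const (r * Real.sin a * Real.sin α)).add
        ((Real.hasDerivAt_cos β).mul_const (r * Real.cos a))
  have key := integral_div_eq_zero (a := 0) (b := 2 * Real.pi) (c := 0) (d := Real.pi)
    (f := fun z => -Real.cos z.1 * Real.cos z.2 * F (y z))
    (g := fun z => -Real.sin z.1 * Real.sin z.2 * F (y z))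
    (f' := fun z => - -Real.sin z.1 * Real.cos z.2 * F (y z) +
      -Real.cos z.1 * Real.cos z.2 * tderiv (y₁ z) F (y z))
    (g' := fun z => -Real.sin z.1 * Real.cos z.2 * F (y z) +
      -Real.sin z.1 * Real.sin z.2 * tderiv (y₂ z) F (y z))
    (ContDiff.mul (by fun_prop) hFy) (ContDiff.mul (by fun_prop) hFy)
    (fun α β => ((Real.hasDerivAt_cos α).neg.mul_const (Real.cos β)).mul (Test.hasDerivAt_comp F (h1 α β)))
    (fun α β => ((Real.hasDerivAt_sin β).const_mul (-Real.sin α)).mul (Test.hasDerivAt_comp F (h2 α β)))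
    (fun β => by simp [y]) (fun β => by simp)
  rw [tderiv_zMean]
  refine Eq.trans ?_ key
  refine intervalIntegral.integral_congr fun α _ => ?_
  try dsimp only
  rw [tderiv_xMean]
  refine intervalIntegral.integral_congr fun β _ => ?_
  have e1 : rotX (β, rotZ (α, ![t, r * Real.sin a, 0, r * Real.cos a])) = y (α, β) := by
    ext i; fin_cases i <;> simp [rotX, rotZ, y] <;> first | (left; ring) | ring
  have e2 : rotX (β, rotZ (α, ![0, r * Real.cos a, 0, r * -Real.sin a])) =
      ![0, r * Real.cos a * Real.cos α, Real.cos β * (r * Real.cos a * Real.sin α) + Real.sin β * (r * Real.sin a),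
        Real.sin β * (r * Real.cos a * Real.sin α) - Real.cos β * (r * Real.sin a)] := by
    ext i; fin_cases i <;> simp [rotX, rotZ] <;> first | (left; ring) | ring
  have e3 : ang 1 2 F (y (α, β)) = 0 := by rw [hF, ang_zMean]; rfl
  rw [ang_apply] at e3
  try dsimp only
  rw [e1, e2, tderiv_apply (![_, _, _, _] : Spacetime), tderiv_apply (y₁ _), tderiv_apply (y₂ _), fderiv_eq_sum, fderiv_eq_sum,
    fderiv_eq_sum]
  generalize tderiv (unit 0) F (y (α, β)) = F0 at *
  generalize tderiv (unit 1) F (y (α, β)) = F1 at *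
  generalize tderiv (unit 2) F (y (α, β)) = F2 at *
  generalize tderiv (unit 3) F (y (α, β)) = F3 at *
  simp [y, y₁, y₂] at e3 ⊢
  have s1 := Real.sin_sq_add_cos_sq α
  have s2 := Real.sin_sq_add_cos_sq β
  linear_combination Real.cos α * e3 +
    (r * Real.sin a * Real.sin β * Real.sin β * F2 - Real.sin β * Real.cos β * r * Real.sin a * F3) * (-s1) +
    F2 * r * Real.sin a * Real.cos α ^ 2 * s2

/-- On the axis the triple mean is 2π times the spherical integral of φ, hence zero. Constancy along
meridians and invariance about the axis carry this to every point by polar coordinates. -/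
lemma mean_eq_zero {φ : Test Spacetime} (hφ : sphS φ = 0) :
    zMean (xMean Real.sin Real.contDiff_sin (zMean φ)) = 0 := by
  set V := zMean (xMean Real.sin Real.contDiff_sin (zMean φ)) with hV
  have h0 : ∀ z, V (axis z) = 0 := by
    intro z
    have h1 : ∀ α, rotZ (α, axis z) = axis z := fun α => by
      ext i; fin_cases i <;> simp [rotZ, axis]
    have h2 : sphS φ z = 0 := by rw [hφ]; rfl
    rw [hV, zMean_apply]
    simp only [h1]
    rw [← sph_eq, h2]
    simp
  have h1 : ∀ t r a, V ![t, r * Real.sin a, 0, r * Real.cos a] = 0 := by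
    intro t r a
    have hd : ∀ a, HasDerivAt (fun a => V ![t, r * Real.sin a, 0, r * Real.cos a]) 0 a := by
      intro a
      have h2 : HasDerivAt (fun a => (![t, r * Real.sin a, 0, r * Real.cos a] : Spacetime))
          ![0, r * Real.cos a, 0, r * -Real.sin a] a := by
        refine hasDerivAt_pi.2 fun i => ?_
        fin_cases i
        · exact hasDerivAt_const _ _
        · exact (Real.hasDerivAt_sin a).const_mul _
        · exact hasDerivAt_const _ _
        · exact (Real.hasDerivAt_cos a).const_mul _
      exact (Test.hasDerivAt_comp V h2).congr_deriv (tderiv_mean_meridian φ t r a)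
    have h3 := is_const_of_deriv_eq_zero (fun a => (hd a).differentiableAt) (fun a => (hd a).deriv) a 0
    rw [h3]
    have h4 : (![t, r * Real.sin 0, 0, r * Real.cos 0] : Spacetime) = axis (t, r) := by
      ext i; fin_cases i <;> simp [axis]
    rw [h4, h0]
  ext x
  obtain ⟨ρ, γ, h2, h3⟩ := exists_polar (x 1) (x 2)
  obtain ⟨r, a, h4, h5⟩ := exists_polar (x 3) ρ
  have h6 : x = rotZ (γ, ![x 0, r * Real.sin a, 0, r * Real.cos a]) := by
    ext i; fin_cases i <;> simp [rotZ]
    · rw [← h5, h2]; ring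
    · rw [← h5, h3]; ring
    · exact h4
  rw [h6, hV, zMean_rotZ, ← hV, h1]; rfl

/-- A rotation invariant distribution depends on a test function only through its integrals over
spheres. -/
lemma ScalarDist.apply_eq_zero_of_sphS {T : ScalarDist Spacetime} (h12 : ∀ φ, T (ang 1 2 φ) = 0)
    (h23 : ∀ φ, T (ang 2 3 φ) = 0) {φ : Test Spacetime} (hφ : sphS φ = 0) : T φ = 0 := by
  have h := ScalarDist.apply_zMean h12 (xMean Real.sin Real.contDiff_sin (zMean φ))
  rw [mean_eq_zero hφ, T.map_zero', ScalarDist.apply_xMean h23, ScalarDist.apply_zMean h12] at h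
  simpa [Real.pi_ne_zero] using h.symm

/-- Multiplication by `r`. -/
def mulR : Test (ℝ × ℝ) →ₗ[ℝ] Test (ℝ × ℝ) := mulTest (fun z => z.2) contDiff_snd

lemma mulTest_isBounded {E : Type} [NormedAddCommGroup E] [NormedSpace ℝ E] [FiniteDimensional ℝ E]
    (w : E → ℝ) (hw : ContDiff ℝ ∞ w) : IsBoundedOp (mulTest w hw) := mulCompOp_isBounded ..

lemma mulR_isBounded : IsBoundedOp mulR := mulTest_isBounded _ _

lemma mulR_apply (ψ : Test (ℝ × ℝ)) (z : ℝ × ℝ) : mulR ψ z = z.2 * ψ z := mulTest_apply ..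

lemma tderiv_radial_mulR (ψ : Test (ℝ × ℝ)) :
    tderiv ((0, 1) : ℝ × ℝ) (mulR ψ) = ψ + mulR (tderiv (0, 1) ψ) := by
  ext z
  have h1 : HasFDerivAt (fun z : ℝ × ℝ => z.2) (ContinuousLinearMap.snd ℝ ℝ ℝ) z := hasFDerivAt_snd
  have h : tderiv ((0, 1) : ℝ × ℝ) (mulR ψ) z = _ := tderiv_mulTest _ _ _ _ _
  rw [h, h1.fderiv, ← mulR_apply]
  change 1 * ψ z + _ = ψ z + _
  rw [one_mul, mulR_apply]

lemma tderiv_time_mulR (ψ : Test (ℝ × ℝ)) :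
    tderiv ((1, 0) : ℝ × ℝ) (mulR ψ) = mulR (tderiv (1, 0) ψ) := by
  ext z
  have h1 : HasFDerivAt (fun z : ℝ × ℝ => z.2) (ContinuousLinearMap.snd ℝ ℝ ℝ) z := hasFDerivAt_snd
  have h : tderiv ((1, 0) : ℝ × ℝ) (mulR ψ) z = _ := tderiv_mulTest _ _ _ _ _
  rw [h, h1.fderiv, mulR_apply]
  simp

lemma Test.ext_of_snd_ne {φ ψ : Test (ℝ × ℝ)} (h : ∀ z : ℝ × ℝ, z.2 ≠ 0 → φ z = ψ z) : φ = ψ := by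
  have hd : Dense {z : ℝ × ℝ | z.2 ≠ 0} := by
    have := (dense_univ (X := ℝ)).prod (dense_compl_singleton (0:ℝ))
    refine this.mono fun z hz => hz.2
  exact DFunLike.coe_injective (Continuous.ext_on hd (Test.contDiff φ).continuous
    (Test.contDiff ψ).continuous fun z hz => h z hz)

lemma sphS_radial (φ : Test Spacetime) : sphS (euler φ) = mulR (tderiv (0, 1) (sphS φ)) := by
  ext z; rw [mulR_apply, tderiv_radial_sph]

lemma sphC_radial (φ : Test Spacetime) : sphC (euler φ) = mulR (tderiv (0, 1) (sphC φ)) := by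
  ext z; rw [mulR_apply, tderiv_radial_sph]

lemma sphS_testX_three (φ : Test Spacetime) : sphS (testX 3 φ) = mulR (sphC φ) := by
  ext z
  rw [mulR_apply]
  refine sph_mul _ _ (f := Real.cos) (fun β α => ?_) fun β => rfl
  rw [testX_apply, spherePt_eq]; rfl

lemma sph_testX_zero (w : ℝ → ℝ) (hw : ContDiff ℝ ∞ w) (φ : Test Spacetime) (z : ℝ × ℝ) :
    sph w hw (testX 0 φ) z = z.1 * sph w hw φ z := by
  refine sph_mul _ _ (f := fun _ => 1) (fun β α => ?_) fun β => (mul_one _).symm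
  rw [testX_apply, mul_one, spherePt_eq]; rfl

/-- Multiplication by the square of the spatial norm. -/
def mulNsq : Test Spacetime →ₗ[ℝ] Test Spacetime :=
  testX 1 ∘ₗ testX 1 + testX 2 ∘ₗ testX 2 + testX 3 ∘ₗ testX 3

lemma mulNsq_apply (φ : Test Spacetime) (x : Spacetime) : mulNsq φ x = nsq x * φ x := by
  change testX 1 (testX 1 φ) x + testX 2 (testX 2 φ) x + testX 3 (testX 3 φ) x = _
  simp only [testX_apply, nsq]; ring

lemma nsq_spherePt (z : ℝ × ℝ) (β α : ℝ) : nsq (spherePt z β α) = z.2 ^ 2 := by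
  rw [spherePt, nsq_rotZ, nsq_rotX]; simp [nsq, axis]

lemma sphS_mulNsq (φ : Test Spacetime) : sphS (mulNsq φ) = mulR (mulR (sphS φ)) := by
  ext z
  rw [mulR_apply, mulR_apply, ← mul_assoc]
  refine sph_mul _ _ (f := fun _ => 1) (fun β α => ?_) fun β => (mul_one _).symm
  rw [mulNsq_apply, nsq_spherePt]; ring

/-- The spatial Laplacian. -/
def lap : Test Spacetime →ₗ[ℝ] Test Spacetime :=
  tderiv (unit 1) ∘ₗ tderiv (unit 1) + tderiv (unit 2) ∘ₗ tderiv (unit 2) +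
    tderiv (unit 3) ∘ₗ tderiv (unit 3)

lemma lap_apply (φ : Test Spacetime) (x : Spacetime) : lap φ x =
  tderiv (unit 1) (tderiv (unit 1) φ) x + tderiv (unit 2) (tderiv (unit 2) φ) x +
    tderiv (unit 3) (tderiv (unit 3) φ) x := rfl

lemma tderiv_euler (k : Fin 4) (φ : Test Spacetime) (x : Spacetime) :
    tderiv (unit k) (euler φ) x = x 1 * tderiv (unit k) (tderiv (unit 1) φ) x +
      x 2 * tderiv (unit k) (tderiv (unit 2) φ) x + x 3 * tderiv (unit k) (tderiv (unit 3) φ) x +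
      (if k = 0 then 0 else tderiv (unit k) φ x) := by
  have e1 : euler φ = testX 1 (tderiv (unit 1) φ) + testX 2 (tderiv (unit 2) φ) +
    testX 3 (tderiv (unit 3) φ) := rfl
  have e2 : ∀ (P : Prop) [Decidable P] (ψ : Test Spacetime), (if P then ψ else 0 : Test Spacetime) x =
      if P then ψ x else 0 := fun P _ ψ => by split_ifs <;> rfl
  have e3 : ∀ a b : Test Spacetime, (a + b) x = a x + b x := fun _ _ => rfl
  rw [e1, map_add, map_add, tderiv_testX, tderiv_testX, tderiv_testX]
  simp only [e3, e2, testX_apply]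
  fin_cases k <;> simp <;> ring

/-- The Laplacian in polar form, multiplied by |x|² to avoid division: |x|²Δ = E² + E + L², with E
the spatial Euler field and L² the sum of the squared rotation generators. Spherical integration
kills L². -/
lemma mulNsq_lap (φ : Test Spacetime) : mulNsq (lap φ) = euler (euler φ) + euler φ +
    (ang 1 2 (ang 1 2 φ) + ang 1 3 (ang 1 3 φ) + ang 2 3 (ang 2 3 φ)) := by
  ext x
  have e3 : ∀ a b : Test Spacetime, (a + b) x = a x + b x := fun _ _ => rfl
  simp only [e3]
  rw [mulNsq_apply, lap_apply, euler_apply' (euler φ), euler_apply', ang_apply 1 2, ang_apply 1 3, ang_apply 2 3]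
  simp only [tderiv_ang, tderiv_euler]
  rw [tderiv_comm (unit 2) (unit 1), tderiv_comm (unit 3) (unit 1), tderiv_comm (unit 3) (unit 2)]
  simp [nsq]
  ring

/-- The spherical mean `φ ↦ r ∫ φ(t, r n)`. -/
def radAvg : Test Spacetime →ₗ[ℝ] Test (ℝ × ℝ) := mulR ∘ₗ sphS

lemma radAvg_isBounded : IsBoundedOp radAvg := mulR_isBounded.comp (sph_isBounded _ _)

lemma radAvg_eq (φ : Test Spacetime) : radAvg φ = mulR (sphS φ) := rfl

lemma mulR_injective {φ ψ : Test (ℝ × ℝ)} (h : mulR φ = mulR ψ) : φ = ψ := by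
  refine Test.ext_of_snd_ne fun z hz => ?_
  have h1 := DFunLike.congr_fun h z
  rw [mulR_apply, mulR_apply] at h1
  exact mul_left_cancel₀ hz h1

/-- Darboux's equation. -/
lemma radAvg_lap (φ : Test Spacetime) :
    radAvg (lap φ) = tderiv (0, 1) (tderiv (0, 1) (radAvg φ)) := by
  -- One further factor r allows the polar identity for |x|²Δ to be used; it can be cancelled
  -- because test functions are determined on the dense set r ≠ 0.
  apply mulR_injective
  have h1 := congrArg sphS (mulNsq_lap φ)
  rw [sphS_mulNsq] at h1
  rw [radAvg_eq, radAvg_eq, h1]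
  simp only [map_add, sph_ang_one_two, sphS_ang_one_three, sphS_ang_two_three, sphS_radial,
    tderiv_radial_mulR]
  module

/-- The splitting of |x|²∂₃ into a radial part, a multiplication and rotation generators applied
last; the latter integrate to zero over spheres. -/
lemma mulNsq_deriv (φ : Test Spacetime) : mulNsq (tderiv (unit 3) φ) = testX 3 (euler φ) +
    ((2:ℝ) • testX 3 φ + ang 1 3 (testX 1 φ) + ang 2 3 (testX 2 φ)) := by
  ext x
  have e3 : ∀ a b : Test Spacetime, (a + b) x = a x + b x := fun _ _ => rfl
  have e4 : ∀ (c : ℝ) (a : Test Spacetime), (c • a) x = c * a x := fun _ _ => rfl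
  have e2 : ∀ (P : Prop) [Decidable P] (ψ : Test Spacetime), (if P then ψ else 0 : Test Spacetime) x =
      if P then ψ x else 0 := fun P _ ψ => by split_ifs <;> rfl
  simp only [e3, e4]
  rw [mulNsq_apply, testX_apply, testX_apply, euler_apply', ang_apply, ang_apply]
  simp only [tderiv_testX, e3, e2, testX_apply]
  simp [nsq]
  ring

lemma radAvg_deriv (φ : Test Spacetime) :
    radAvg (tderiv (unit 3) φ) = mulR (tderiv (0, 1) (sphC φ)) + (2:ℝ) • sphC φ := by
  apply mulR_injective
  have h1 := congrArg sphS (mulNsq_deriv φ)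
  rw [sphS_mulNsq] at h1
  rw [radAvg_eq, h1]
  simp only [map_add, map_smul, sphS_ang_one_three, sphS_ang_two_three, sphS_testX_three, sphC_radial]
  module

/-- The infinitesimal boost in the direction of the `i`-th axis. -/
def boost (i : Fin 4) : Test Spacetime →ₗ[ℝ] Test Spacetime :=
  testX i ∘ₗ tderiv (unit 0) + testX 0 ∘ₗ tderiv (unit i)

/-- Only `sphC φ` enters, and it is odd in r. The right-hand side is the operator to which
`apply_eq_zero_of_boostOp` applies. -/
lemma radAvg_boost (φ : Test Spacetime) (z : ℝ × ℝ) : radAvg (boost 3 φ) z =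
    z.2 ^ 2 * tderiv (1, 0) (sphC φ) z + z.1 * (z.2 * tderiv (0, 1) (sphC φ) z + 2 * sphC φ z) := by
  have h1 : boost 3 φ = testX 3 (tderiv (unit 0) φ) + testX 0 (tderiv (unit 3) φ) := rfl
  have h2 := DFunLike.congr_fun (radAvg_deriv φ) z
  have h3 : radAvg (boost 3 φ) z = radAvg (testX 3 (tderiv (unit 0) φ)) z +
      radAvg (testX 0 (tderiv (unit 3) φ)) z := by rw [h1, map_add]; rfl
  have h4 : radAvg (testX 0 (tderiv (unit 3) φ)) z = z.1 * radAvg (tderiv (unit 3) φ) z := by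
    rw [radAvg_eq, radAvg_eq, mulR_apply, mulR_apply, sph_testX_zero]; ring
  have h5 : (mulR (tderiv (0, 1) (sphC φ)) + (2:ℝ) • sphC φ) z =
      mulR (tderiv (0, 1) (sphC φ)) z + 2 * sphC φ z := rfl
  rw [h3, h4, h2, h5, radAvg_eq, sphS_testX_three, mulR_apply, mulR_apply, mulR_apply, ← tderiv_time_sph]
  ring

/-- Reversing r is the substitution β ↦ π - β, followed by a half turn about the third axis, which
`zMean` does not see. -/
lemma sph_neg (w : ℝ → ℝ) (hw : ContDiff ℝ ∞ w) (φ : Test Spacetime) (t r : ℝ) :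
    sph w hw φ (t, -r) = ∫ β in (0:ℝ)..Real.pi, w (Real.pi - β) * zMean φ (rotX (β, axis (t, r))) := by
  rw [sph_eq, xMean_apply]
  have h := intervalIntegral.integral_comp_sub_left (a := 0) (b := Real.pi)
    (fun β => w (Real.pi - β) * zMean φ (rotX (β, axis (t, r)))) Real.pi
  rw [sub_self, sub_zero] at h
  rw [← h]
  refine intervalIntegral.integral_congr fun β _ => ?_
  try dsimp only
  rw [sub_sub_cancel, ← zMean_rotZ φ Real.pi (rotX (Real.pi - β, _))]
  congr 2
  ext i; fin_cases i <;> simp [rotX, rotZ, axis]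

lemma sphS_neg (φ : Test Spacetime) (t r : ℝ) : sphS φ (t, -r) = sphS φ (t, r) := by
  rw [sph_neg, sph_eq, xMean_apply]
  simp only [Real.sin_pi_sub]

lemma sphC_neg (φ : Test Spacetime) (t r : ℝ) : sphC φ (t, -r) = -sphC φ (t, r) := by
  rw [sph_neg, sph_eq, xMean_apply, ← intervalIntegral.integral_neg]
  simp only [Real.sin_pi_sub, Real.cos_pi_sub, mul_neg, neg_mul]

lemma radAvg_neg (φ : Test Spacetime) (t r : ℝ) : radAvg φ (t, -r) = -radAvg φ (t, r) := by
  rw [radAvg_eq, mulR_apply, mulR_apply, sphS_neg]; ring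

end SphereMeans

/-! ### Reduction of rotation invariant distributions to two dimensions -/

section Radial

lemma abs_le_of_nsq {x : Spacetime} {C : ℝ} (hC : 0 ≤ C) (h : nsq x ≤ C ^ 2) :
    |x 1| ≤ C ∧ |x 2| ≤ C ∧ |x 3| ≤ C := by
  unfold nsq at h
  exact ⟨abs_le_of_sq_le_sq (by nlinarith [sq_nonneg (x 2), sq_nonneg (x 3)]) hC,
    abs_le_of_sq_le_sq (by nlinarith [sq_nonneg (x 1), sq_nonneg (x 3)]) hC,
    abs_le_of_sq_le_sq (by nlinarith [sq_nonneg (x 1), sq_nonneg (x 2)]) hC⟩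

lemma contDiff_nsq : ContDiff ℝ ∞ nsq := by
  unfold nsq; fun_prop

/-- A smooth function on the line, vanishing for large arguments. -/
structure Weight where
  /-- the function -/
  toFun : ℝ → ℝ
  smooth : ContDiff ℝ ∞ toFun
  /-- the bound -/
  C : ℝ
  nonneg : 0 ≤ C
  eq_zero : ∀ s, C ^ 2 < s → toFun s = 0

/-- The derivative of a weight. -/
def Weight.deriv (ρ : Weight) : Weight where
  toFun := _root_.deriv ρ.toFun
  smooth := ContDiff.deriv' (n := ∞) (by exact_mod_cast ρ.smooth)
  C := ρ.C
  nonneg := ρ.nonneg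
  eq_zero s hs := by
    have h : ρ.toFun =ᶠ[nhds s] fun _ => 0 := by
      filter_upwards [lt_mem_nhds hs] with u hu using ρ.eq_zero u hu
    rw [h.deriv_eq]; simp

/-- A weight which is `1` on `[-(n+1)², (n+1)²]`. -/
def Weight.cut (n : ℕ) : Weight where
  toFun s := cutoff (s / ((n:ℝ) + 1) ^ 2)
  smooth := cutoff_contDiff.comp (by fun_prop)
  C := 2 * ((n:ℝ) + 1)
  nonneg := by positivity
  eq_zero s hs := by
    apply cutoff_eq_zero
    rw [abs_of_nonneg, le_div_iff₀ (by positivity)]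
    · nlinarith [sq_nonneg ((n:ℝ) + 1)]
    · exact div_nonneg ((sq_nonneg _).trans hs.le) (by positivity)

lemma Weight.cut_eq_one (n : ℕ) {s : ℝ} (h : |s| ≤ ((n:ℝ) + 1) ^ 2) : (Weight.cut n).toFun s = 1 := by
  apply cutoff_eq_one
  rw [abs_div, abs_of_nonneg (sq_nonneg ((n:ℝ) + 1))]
  exact div_le_one_of_le₀ h (by positivity)

lemma Weight.deriv_cut_eq_zero (n : ℕ) {s : ℝ} (h : |s| ≤ (n:ℝ) ^ 2) :
    (Weight.cut n).deriv.toFun s = 0 := by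
  have h1 : (Weight.cut n).toFun =ᶠ[nhds s] fun _ => 1 := by
    have h2 : |s| < ((n:ℝ) + 1) ^ 2 := by nlinarith [Nat.cast_nonneg (α := ℝ) n]
    filter_upwards [(continuous_abs.tendsto s).eventually (gt_mem_nhds h2)] with u hu
      using Weight.cut_eq_one n (le_of_lt hu)
  change _root_.deriv (Weight.cut n).toFun s = 0
  rw [h1.deriv_eq]; simp

/-- Test functions of `(x⁰, x³)` as test functions on space-time, cut off by a weight. -/
def lift (ρ : Weight) : Test (ℝ × ℝ) →ₗ[ℝ] Test Spacetime :=
  mulCompOp (fun x => ρ.toFun (nsq x)) (fun x => (x 0, x 3)) (ρ.smooth.comp contDiff_nsq)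
    (by fun_prop) fun K hK => by
    obtain ⟨C, hC⟩ := hK.isBounded.exists_norm_le
    refine ⟨Metric.closedBall 0 (max C ρ.C), isCompact_closedBall _ _, fun x hx hxK => ?_⟩
    have h1 : nsq x ≤ ρ.C ^ 2 := not_lt.1 fun h => hx (ρ.eq_zero _ h)
    obtain ⟨h2, h3, h4⟩ := abs_le_of_nsq ρ.nonneg h1
    have h5 : |x 0| ≤ C := (norm_prod_le_iff.1 (hC _ hxK)).1
    rw [mem_closedBall_zero_iff]
    refine (pi_norm_le_iff_of_nonneg (le_max_of_le_right ρ.nonneg)).2 fun i => ?_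
    fin_cases i
    · exact le_max_of_le_left h5
    · exact le_max_of_le_right h2
    · exact le_max_of_le_right h3
    · exact le_max_of_le_right h4

lemma lift_isBounded (ρ : Weight) : IsBoundedOp (lift ρ) := mulCompOp_isBounded ..

lemma lift_apply (ρ : Weight) (η : Test (ℝ × ℝ)) (x : Spacetime) :
    lift ρ η x = ρ.toFun (nsq x) * η (x 0, x 3) := mulCompOp_apply ..

/-- Archimedes: on a sphere the coordinate x³ = r cos β is uniformly distributed, so the integrand
is an exact derivative in β and only the poles x³ = ±r contribute. -/
lemma radAvg_lift (ρ : Weight) (η : Test (ℝ × ℝ)) (z : ℝ × ℝ) :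
    radAvg (lift ρ (tderiv (0, 1) η)) z =
      2 * Real.pi * ρ.toFun (z.2 ^ 2) * (η (z.1, z.2) - η (z.1, -z.2)) := by
  rw [radAvg_eq, mulR_apply, sph_apply]
  have h1 : ∀ β α, lift ρ (tderiv (0, 1) η) (spherePt z β α) =
      ρ.toFun (z.2 ^ 2) * tderiv (0, 1) η (z.1, z.2 * Real.cos β) := by
    intro β α
    rw [lift_apply, nsq_spherePt, spherePt_eq]; rfl
  have h2 : ∀ β, HasDerivAt (fun β => η (z.1, z.2 * Real.cos β))
      (-(z.2 * (Real.sin β * tderiv (0, 1) η (z.1, z.2 * Real.cos β)))) β := by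
    intro β
    have h3 : HasDerivAt (fun β => (z.1, z.2 * Real.cos β)) ((0:ℝ), z.2 * -Real.sin β) β :=
      (hasDerivAt_const _ _).prodMk ((Real.hasDerivAt_cos β).const_mul _)
    refine (Test.hasDerivAt_comp η h3).congr_deriv ?_
    have h4 : ((0:ℝ), z.2 * -Real.sin β) = (z.2 * -Real.sin β) • ((0:ℝ), (1:ℝ)) := by simp
    rw [h4, tderiv_smul_dir]
    change (z.2 * -Real.sin β) * _ = _
    ring
  have h5 : Continuous fun β => -(z.2 * (Real.sin β * tderiv (0, 1) η (z.1, z.2 * Real.cos β))) :=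
    (continuous_const.mul (Real.continuous_sin.mul ((Test.contDiff _).continuous.comp (by fun_prop)))).neg
  have h6 := intervalIntegral.integral_eq_sub_of_hasDerivAt (a := 0) (b := Real.pi) (fun β _ => h2 β)
    (h5.intervalIntegrable _ _)
  rw [intervalIntegral.integral_neg, intervalIntegral.integral_const_mul] at h6
  simp only [h1, intervalIntegral.integral_const, smul_eq_mul]
  have h7 : ∀ β, Real.sin β * ((2 * Real.pi - 0) * (ρ.toFun (z.2 ^ 2) * tderiv (0, 1) η (z.1, z.2 * Real.cos β))) =
    (2 * Real.pi * ρ.toFun (z.2 ^ 2)) * (Real.sin β * tderiv (0, 1) η (z.1, z.2 * Real.cos β)) := fun β => by ring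
  simp only [h7]
  rw [intervalIntegral.integral_const_mul]
  simp only [Real.cos_pi, Real.cos_zero, mul_neg, mul_one] at h6
  linear_combination (-(2 * Real.pi * ρ.toFun (z.2 ^ 2))) * h6

/-- Multiplication by `t`. -/
def mulT : Test (ℝ × ℝ) →ₗ[ℝ] Test (ℝ × ℝ) := mulTest (fun z => z.1) contDiff_fst

lemma mulT_apply (ψ : Test (ℝ × ℝ)) (z : ℝ × ℝ) : mulT ψ z = z.1 * ψ z := mulTest_apply ..

lemma tderiv_radial_mulT (ψ : Test (ℝ × ℝ)) :
    tderiv ((0, 1) : ℝ × ℝ) (mulT ψ) = mulT (tderiv (0, 1) ψ) := by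
  ext z
  have h1 : HasFDerivAt (fun z : ℝ × ℝ => z.1) (ContinuousLinearMap.fst ℝ ℝ ℝ) z := hasFDerivAt_fst
  have h : tderiv ((0, 1) : ℝ × ℝ) (mulT ψ) z = _ := tderiv_mulTest _ _ _ _ _
  rw [h, h1.fderiv, mulT_apply]
  simp

/-- The boost of the plane. -/
def planeBoost : Test (ℝ × ℝ) →ₗ[ℝ] Test (ℝ × ℝ) :=
  mulT ∘ₗ tderiv (0, 1) + mulR ∘ₗ tderiv (1, 0)

/-- The second order operator on the plane which detects boost invariance. -/
def boostOp : Test (ℝ × ℝ) →ₗ[ℝ] Test (ℝ × ℝ) := planeBoost ∘ₗ tderiv (0, 1) - tderiv (1, 0)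

lemma boostOp_apply (η : Test (ℝ × ℝ)) : boostOp η = mulT (tderiv (0, 1) (tderiv (0, 1) η)) +
    mulR (tderiv (1, 0) (tderiv (0, 1) η)) - tderiv (1, 0) η := rfl

/-- This identity explains the form of `boostOp`. The plane distribution is g(η) = T(lift ∂_r η), so
g(boostOp η) is T of a lifted boost of ∂_r²η. -/
lemma tderiv_boostOp (η : Test (ℝ × ℝ)) :
    tderiv (0, 1) (boostOp η) = planeBoost (tderiv (0, 1) (tderiv (0, 1) η)) := by
  have h : planeBoost (tderiv (0, 1) (tderiv (0, 1) η)) =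
    mulT (tderiv (0, 1) (tderiv (0, 1) (tderiv (0, 1) η))) +
      mulR (tderiv (1, 0) (tderiv (0, 1) (tderiv (0, 1) η))) := rfl
  rw [h, boostOp_apply]
  simp only [map_add, map_sub, tderiv_radial_mulR, tderiv_radial_mulT]
  rw [tderiv_comm (0, 1) (1, 0) η, tderiv_comm (0, 1) (1, 0)]
  abel

/-- With χ = ∂_r η the right-hand side is the expression in `radAvg_boost`. -/
lemma boostOp_mulR (η : Test (ℝ × ℝ)) : boostOp (mulR η) =
    mulR (mulR (tderiv (1, 0) (tderiv (0, 1) η))) + mulT (mulR (tderiv (0, 1) (tderiv (0, 1) η))) +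
      (2:ℝ) • mulT (tderiv (0, 1) η) := by
  rw [boostOp_apply]
  simp only [map_add, tderiv_radial_mulR, tderiv_time_mulR]
  module

lemma tderiv_lift (ρ : Weight) (η : Test (ℝ × ℝ)) (v x : Spacetime) : tderiv v (lift ρ η) x =
    ρ.deriv.toFun (nsq x) * (2 * (x 1 * v 1 + x 2 * v 2 + x 3 * v 3)) * η (x 0, x 3) +
      ρ.toFun (nsq x) * tderiv (v 0, v 3) η (x 0, x 3) := by
  apply tderiv_eq_of_hasDerivAt
  simp only [lift_apply]
  have hi : ∀ i, HasDerivAt (fun s : ℝ => (x + s • v) i) (v i) 0 := fun i => by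
    simpa using ((hasDerivAt_id (0:ℝ)).mul_const (v i)).const_add (x i)
  have hn : HasDerivAt (fun s : ℝ => nsq (x + s • v)) (2 * (x 1 * v 1 + x 2 * v 2 + x 3 * v 3)) 0 := by
    have h := (((hi 1).pow 2).add ((hi 2).pow 2)).add ((hi 3).pow 2)
    refine h.congr_deriv ?_
    simp; ring
  have hρ : HasDerivAt ρ.toFun (ρ.deriv.toFun (nsq x)) (nsq (x + (0:ℝ) • v)) := by
    rw [zero_smul, add_zero]
    exact (ρ.smooth.differentiable (by simp) _).hasDerivAt
  have h := (hρ.comp (0:ℝ) hn).mul (Test.hasDerivAt_comp η ((hi 0).prodMk (hi 3)))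
  refine h.congr_deriv ?_
  simp

/-- A boost moves the spatial norm, so the weight is differentiated too; the extra term lives where
the cutoff is not locally constant. -/
lemma boost_lift (ρ : Weight) (η : Test (ℝ × ℝ)) : boost 3 (lift ρ η) =
    lift ρ (planeBoost η) + lift ρ.deriv ((2:ℝ) • mulT (mulR η)) := by
  ext x
  change testX 3 (tderiv (unit 0) (lift ρ η)) x + testX 0 (tderiv (unit 3) (lift ρ η)) x =
    lift ρ (planeBoost η) x + lift ρ.deriv ((2:ℝ) • mulT (mulR η)) x
  rw [testX_apply, testX_apply, tderiv_lift, tderiv_lift, lift_apply, lift_apply]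
  have h1 : planeBoost η (x 0, x 3) = mulT (tderiv (0, 1) η) (x 0, x 3) +
    mulR (tderiv (1, 0) η) (x 0, x 3) := rfl
  have h2 : ((2:ℝ) • mulT (mulR η)) (x 0, x 3) = 2 * mulT (mulR η) (x 0, x 3) := rfl
  rw [h1, h2, mulT_apply, mulT_apply, mulR_apply, mulR_apply]
  simp [unit]
  ring

lemma Test.exists_ball (φ : Test (ℝ × ℝ)) :
    ∃ n : ℕ, SuppIn (Metric.closedBall 0 n) φ := by
  obtain ⟨K, hK, hφ⟩ := φ.exists_suppIn
  obtain ⟨r, hr⟩ := hK.isBounded.subset_closedBall 0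
  obtain ⟨n, hn⟩ := exists_nat_ge r
  exact ⟨n, hφ.mono (hr.trans (Metric.closedBall_subset_closedBall hn))⟩

lemma SuppIn.eq_zero_of_snd {n : ℕ} {φ : Test (ℝ × ℝ)} (h : SuppIn (Metric.closedBall 0 n) φ) {t r : ℝ}
    (hr : (n:ℝ) < |r|) : φ (t, r) = 0 := by
  refine h _ fun h' => ?_
  rw [mem_closedBall_zero_iff] at h'
  exact absurd ((norm_prod_le_iff.1 h').2) (not_le.2 hr)

variable {T : ScalarDist Spacetime}

lemma ScalarDist.apply_eq_of_radAvg (h12 : ∀ φ, T (ang 1 2 φ) = 0) (h23 : ∀ φ, T (ang 2 3 φ) = 0)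
    {φ ψ : Test Spacetime} (h : radAvg φ = radAvg ψ) : T φ = T ψ := by
  have h1 : sphS (φ - ψ) = 0 := by
    rw [map_sub, mulR_injective h, sub_self]
  have h2 := ScalarDist.apply_eq_zero_of_sphS h12 h23 h1
  rwa [T.map_sub', sub_eq_zero] at h2

lemma sq_le_of_abs_le {n : ℕ} {r : ℝ} (h : |r| ≤ n) : |r ^ 2| ≤ (n:ℝ) ^ 2 := by
  rw [abs_pow]; exact pow_le_pow_left₀ (abs_nonneg _) h 2

/-- Rotation invariant distributions are determined by distributions on the plane. -/
lemma ScalarDist.exists_plane (h12 : ∀ φ, T (ang 1 2 φ) = 0) (h23 : ∀ φ, T (ang 2 3 φ) = 0)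
    (hb : ∀ φ, T (boost 3 φ) = 0) :
    ∃ g : ScalarDist (ℝ × ℝ), (∀ φ, g (radAvg φ) = (4 * Real.pi : ℝ) * T φ) ∧ ∀ η, g (boostOp η) = 0 := by
  have hone : ∀ (n k : ℕ) (r : ℝ), n ≤ k → |r| ≤ n → (Weight.cut k).toFun (r ^ 2) = 1 := by
    intro n k r hk hr
    refine Weight.cut_eq_one k ((sq_le_of_abs_le hr).trans ?_)
    have : (n:ℝ) ≤ k := by exact_mod_cast hk
    nlinarith [Nat.cast_nonneg (α := ℝ) n]
  obtain ⟨g, hg⟩ := ScalarDist.exists_glue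
    -- This is η ↦ T(lift ∂_r η). For a function T = f(t, |x|) it is 2π r f(t, |r|). By
    -- `radAvg_lift` the value does not change with the cutoff once that is 1 on the support of η.
    (fun n => -distDeriv (0, 1) (distTranspose (lift (Weight.cut n)) (lift_isBounded _) T)) (by
      intro m n hmn φ hφ
      change -(distDeriv _ _ φ) = -(distDeriv _ _ φ)
      rw [distDeriv_apply, distDeriv_apply, distTranspose_apply, distTranspose_apply,
        ScalarDist.apply_eq_of_radAvg h12 h23]
      ext z
      rw [radAvg_lift, radAvg_lift]
      by_cases hz : |z.2| ≤ m
      · rw [hone m m _ le_rfl hz, hone m n _ hmn hz]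
      · rw [hφ.eq_zero_of_snd (not_le.1 hz), hφ.eq_zero_of_snd (by rw [abs_neg]; exact not_le.1 hz)]
        simp)
  have hg' : ∀ (n : ℕ) φ, SuppIn (Metric.closedBall 0 (n:ℝ)) φ → g φ = T (lift (Weight.cut n) (tderiv (0, 1) φ)) := by
    intro n φ hφ
    rw [hg n φ hφ]
    change -(distDeriv _ _ φ) = _
    rw [distDeriv_apply, distTranspose_apply, neg_neg]
  refine ⟨g, fun φ => ?_, fun η => ?_⟩
  -- As `radAvg φ` is odd in r, the two terms in `radAvg_lift` add up and 2π becomes 4π.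
  · obtain ⟨n, hn⟩ := (radAvg φ).exists_ball
    rw [hg' n _ hn, ← Complex.real_smul, ← T.map_smul_real]
    apply ScalarDist.apply_eq_of_radAvg h12 h23
    ext z
    rw [radAvg_lift, radAvg_neg, map_smul]
    change _ = 4 * Real.pi * radAvg φ z
    by_cases hz : |z.2| ≤ n
    · rw [hone n n _ le_rfl hz]; ring
    · have : radAvg φ z = 0 := hn.eq_zero_of_snd (t := z.1) (not_le.1 hz)
      rw [this]; simp
  · obtain ⟨n, hn⟩ := η.exists_ball
    have hd : ∀ (v : ℝ × ℝ) (φ : Test (ℝ × ℝ)), SuppIn (Metric.closedBall 0 (n:ℝ)) φ →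
        SuppIn (Metric.closedBall 0 (n:ℝ)) (tderiv v φ) := fun v φ h => h.tderiv Metric.isClosed_closedBall v
    have hR : ∀ (φ : Test (ℝ × ℝ)), SuppIn (Metric.closedBall 0 (n:ℝ)) φ →
        SuppIn (Metric.closedBall 0 (n:ℝ)) (mulR φ) := fun φ h x hx => by rw [mulR_apply, h x hx, mul_zero]
    have hT : ∀ (φ : Test (ℝ × ℝ)), SuppIn (Metric.closedBall 0 (n:ℝ)) φ →
        SuppIn (Metric.closedBall 0 (n:ℝ)) (mulT φ) := fun φ h x hx => by rw [mulT_apply, h x hx, mul_zero]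
    have hs : SuppIn (Metric.closedBall 0 (n:ℝ)) (boostOp η) :=
      ((hT _ (hd _ _ (hd _ _ hn))).add (hR _ (hd _ _ (hd _ _ hn)))).sub (hd _ _ hn)
    rw [hg' n _ hs, tderiv_boostOp]
    have h1 := hb (lift (Weight.cut n) (tderiv (0, 1) (tderiv (0, 1) η)))
    rw [boost_lift, T.map_add'] at h1
    -- The cutoff error is a lift of an exact r-derivative, so `radAvg_lift` evaluates it by the
    -- derivative of the cutoff on the support of η, where it is zero.
    have h2 : (2:ℝ) • mulT (mulR (tderiv (0, 1) (tderiv (0, 1) η))) =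
        tderiv (0, 1) ((2:ℝ) • mulT (mulR (tderiv (0, 1) η) - η)) := by
      rw [map_smul, tderiv_radial_mulT, map_sub, tderiv_radial_mulR, add_sub_cancel_left]
    have h3 : SuppIn (Metric.closedBall 0 (n:ℝ)) ((2:ℝ) • mulT (mulR (tderiv (0, 1) η) - η)) :=
      (hT _ ((hR _ (hd _ _ hn)).sub hn)).smul 2
    rw [h2] at h1
    have h4 : T (lift (Weight.cut n).deriv (tderiv (0, 1) ((2:ℝ) • mulT (mulR (tderiv (0, 1) η) - η)))) = T 0 := by
      apply ScalarDist.apply_eq_of_radAvg h12 h23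
      ext z
      rw [radAvg_lift, map_zero]
      change _ = (0:ℝ)
      by_cases hz : |z.2| ≤ n
      · rw [Weight.deriv_cut_eq_zero n (sq_le_of_abs_le hz)]; simp
      · rw [h3.eq_zero_of_snd (not_le.1 hz), h3.eq_zero_of_snd (by rw [abs_neg]; exact not_le.1 hz)]
        simp
    rwa [h4, T.map_zero', add_zero] at h1

end Radial

/-! ### The wave equation -/

section Wave

section Abstract

variable {W : Type} [AddCommGroup W] [Module ℂ W]

/-- The boost operator in light cone coordinates. -/
def coneOp (dp dq P Q : Module.End ℂ W) (w : W) : W :=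
  P (dp (dp w)) + dp w + dp w + (Q (dq (dq w)) + dq w + dq w) - P (dp (dq w)) - Q (dp (dq w))

/-- `coneOp` commutes with ∂_p∂_q. Any solution h₀ of ∂_p∂_q h₀ = g therefore has m = coneOp h₀ with
∂_p∂_q m = 0, a sum of a function of p and one of q. Each summand is cancelled by a solution of the
homogeneous equation in the same variable. -/
lemma exists_cone_solution {dp dq P Q : Module.End ℂ W} (hc : ∀ w, dq (dp w) = dp (dq w))
    (hpP : ∀ w, dp (P w) = P (dp w) + w) (hqP : ∀ w, dq (P w) = P (dq w))
    (hpQ : ∀ w, dp (Q w) = Q (dp w)) (hqQ : ∀ w, dq (Q w) = Q (dq w) + w)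
    (hp : ∀ f, ∃ u, dp u = f ∧ (dq f = 0 → dq u = 0)) (hq : ∀ f, ∃ u, dq u = f ∧ (dp f = 0 → dp u = 0))
    (dP : ∀ f, ∃ u, P u = f ∧ (dq f = 0 → dq u = 0)) (dQ : ∀ f, ∃ u, Q u = f ∧ (dp f = 0 → dp u = 0))
    {g : W} (hg : coneOp dp dq P Q g = 0) : ∃ h, dp (dq h) = g ∧ coneOp dp dq P Q h = 0 := by
  obtain ⟨u, hu, -⟩ := hp g
  obtain ⟨h₀, hh₀, -⟩ := hq u
  set m := coneOp dp dq P Q h₀ with hm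
  have h1 : dp (dq m) = 0 := by
    have : dp (dq m) = coneOp dp dq P Q (dp (dq h₀)) := by
      simp only [hm, coneOp, map_add, map_sub, hpP, hqP, hpQ, hqQ, hc]
      abel
    rw [this, hh₀, hu, hg]
  -- Splitting of m: a q-primitive of ∂_q m is independent of p, and the difference m - m₂ is
  -- independent of q.
  obtain ⟨m₂, hm₂, hm₂'⟩ := hq (dq m)
  replace hm₂' := hm₂' h1
  have hm₁ : dq (m - m₂) = 0 := by rw [map_sub, hm₂, sub_self]
  -- On functions of p alone the operator is p F'' + 2F' = (p F)''. It is inverted by two primitives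
  -- followed by a division by p.
  obtain ⟨k₁, a₁, b₁⟩ := hp (m - m₂)
  obtain ⟨k₂, a₂, b₂⟩ := hp k₁
  obtain ⟨F₁, a₃, b₃⟩ := dP k₂
  replace b₃ := b₃ (b₂ (b₁ hm₁))
  obtain ⟨l₁, c₁, e₁⟩ := hq m₂
  obtain ⟨l₂, c₂, e₂⟩ := hq l₁
  obtain ⟨F₂, c₃, e₃⟩ := dQ l₂
  replace e₃ := e₃ (e₂ (e₁ hm₂'))
  refine ⟨h₀ - F₁ - F₂, ?_, ?_⟩
  · rw [map_sub, map_sub, map_sub, map_sub, b₃, ← hc F₂, e₃, hh₀, hu, map_zero, map_zero, sub_zero, sub_zero]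
  · have f₁ : m - m₂ = P (dp (dp F₁)) + dp F₁ + dp F₁ := by
      rw [← a₁, ← a₂, ← a₃]
      simp only [hpP, map_add]
    have f₂ : m₂ = Q (dq (dq F₂)) + dq F₂ + dq F₂ := by
      rw [← c₁, ← c₂, ← c₃]
      simp only [hqQ, map_add]
    have f₃ : coneOp dp dq P Q (h₀ - F₁ - F₂) = m - (P (dp (dp F₁)) + dp F₁ + dp F₁) -
        (Q (dq (dq F₂)) + dq F₂ + dq F₂) := by
      rw [hm]
      simp only [coneOp, map_sub, b₃, e₃, ← hc F₂, map_zero]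
      abel
    rw [f₃, ← f₁, ← f₂]
    abel

end Abstract

/-- The light cone coordinates of the plane. -/
def coneP : ℝ × ℝ →L[ℝ] ℝ := ContinuousLinearMap.fst ℝ ℝ ℝ + ContinuousLinearMap.snd ℝ ℝ ℝ

/-- The second light cone coordinate of the plane. -/
def coneQ : ℝ × ℝ →L[ℝ] ℝ := ContinuousLinearMap.fst ℝ ℝ ℝ - ContinuousLinearMap.snd ℝ ℝ ℝ

/-- The light cone directions of the plane. -/
def dirP : ℝ × ℝ := (1 / 2, 1 / 2)

/-- The second light cone direction of the plane. -/
def dirQ : ℝ × ℝ := (1 / 2, -1 / 2)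

lemma coneP_dirP : coneP dirP = 1 := by
  change (1 / 2 : ℝ) + 1 / 2 = 1; norm_num
lemma coneP_dirQ : coneP dirQ = 0 := by
  change (1 / 2 : ℝ) + -1 / 2 = 0; norm_num
lemma coneQ_dirP : coneQ dirP = 0 := by
  change (1 / 2 : ℝ) - 1 / 2 = 0; norm_num
lemma coneQ_dirQ : coneQ dirQ = 1 := by
  change (1 / 2 : ℝ) - -1 / 2 = 1; norm_num

section Linear

variable {E : Type} [NormedAddCommGroup E] [NormedSpace ℝ E] [FiniteDimensional ℝ E] (l : E →L[ℝ] ℝ)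

lemma distDeriv_mulDist_of_eq_zero {v : E} (h : l v = 0) (T : ScalarDist E) :
    distDeriv v (mulDist l l.contDiff T) = mulDist l l.contDiff (distDeriv v T) := by
  rw [distDeriv_mulDist]
  have : mulDist (fun x => fderiv ℝ l x v)
      (by simp only [l.fderiv]; exact contDiff_const) T = 0 := by
    ext φ
    have h1 : mulTest (fun x => fderiv ℝ l x v)
      (by simp only [l.fderiv]; exact contDiff_const) φ = 0 := by
      ext x
      rw [mulTest_apply, l.fderiv, h, zero_mul]; rfl
    rw [mulDist_apply, h1, T.map_zero']; rfl
  rw [this, add_zero]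

lemma distDeriv_mulDist_of_eq_one {v : E} (h : l v = 1) (T : ScalarDist E) :
    distDeriv v (mulDist l l.contDiff T) = mulDist l l.contDiff (distDeriv v T) + T := by
  rw [distDeriv_mulDist]
  congr 1
  ext φ
  have h1 : mulTest (fun x => fderiv ℝ l x v)
    (by simp only [l.fderiv]; exact contDiff_const) φ = φ := by
    ext x
    rw [mulTest_apply, l.fderiv, h, one_mul]
  rw [mulDist_apply, h1]

end Linear

lemma tderiv_dirP (φ : Test (ℝ × ℝ)) :
    tderiv dirP φ = (1 / 2 : ℝ) • (tderiv (1, 0) φ + tderiv (0, 1) φ) := by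
  rw [← tderiv_add_dir, ← tderiv_smul_dir]
  congr 2; ext <;> simp [dirP]

lemma tderiv_dirQ (φ : Test (ℝ × ℝ)) :
    tderiv dirQ φ = (1 / 2 : ℝ) • (tderiv (1, 0) φ - tderiv (0, 1) φ) := by
  have h : dirQ = (1 / 2 : ℝ) • ((1, 0) + (-1 : ℝ) • (0, 1)) := by ext <;> simp [dirQ]; norm_num
  rw [h, tderiv_smul_dir, tderiv_add_dir, tderiv_smul_dir]
  module

lemma mulTest_coneP (φ : Test (ℝ × ℝ)) : mulTest coneP coneP.contDiff φ = mulT φ + mulR φ := by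
  ext z
  change _ = mulT φ z + mulR φ z
  rw [mulTest_apply, mulT_apply, mulR_apply, ← add_mul]; rfl

lemma mulTest_coneQ (φ : Test (ℝ × ℝ)) : mulTest coneQ coneQ.contDiff φ = mulT φ - mulR φ := by
  ext z
  change _ = mulT φ z - mulR φ z
  rw [mulTest_apply, mulT_apply, mulR_apply, ← sub_mul]; rfl

lemma tderiv_time_mulT (ψ : Test (ℝ × ℝ)) :
    tderiv ((1, 0) : ℝ × ℝ) (mulT ψ) = ψ + mulT (tderiv (1, 0) ψ) := by
  ext z
  have h1 : HasFDerivAt (fun z : ℝ × ℝ => z.1) (ContinuousLinearMap.fst ℝ ℝ ℝ) z := hasFDerivAt_fst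
  have h : tderiv ((1, 0) : ℝ × ℝ) (mulT ψ) z = _ := tderiv_mulTest _ _ _ _ _
  rw [h, h1.fderiv, ← mulT_apply]
  change 1 * ψ z + _ = ψ z + _
  rw [one_mul, mulT_apply]

lemma ScalarDist.sub_apply' {E : Type} [NormedAddCommGroup E] [NormedSpace ℝ E] (S T : ScalarDist E)
    (φ : Test E) : (S - T) φ = S φ - T φ := rfl

/-- Integration by parts: the transpose of `boostOp` is t∂_r² + r∂_r∂_t + 2∂_t, rewritten with p = t
+ r and q = t - r. -/
lemma coneOp_apply (g : ScalarDist (ℝ × ℝ)) (η : Test (ℝ × ℝ)) :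
    coneOp (distDeriv dirP) (distDeriv dirQ) (mulDist coneP coneP.contDiff)
      (mulDist coneQ coneQ.contDiff) g η = g (boostOp η) := by
  have h : boostOp η = tderiv dirP (tderiv dirP (mulTest coneP coneP.contDiff η)) - tderiv dirP η - tderiv dirP η +
      (tderiv dirQ (tderiv dirQ (mulTest coneQ coneQ.contDiff η)) - tderiv dirQ η - tderiv dirQ η) -
      tderiv dirQ (tderiv dirP (mulTest coneP coneP.contDiff η)) -
      tderiv dirQ (tderiv dirP (mulTest coneQ coneQ.contDiff η)) := by
    rw [boostOp_apply]
    simp only [tderiv_dirP, tderiv_dirQ, mulTest_coneP, mulTest_coneQ, map_add, map_sub, map_smul,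
      tderiv_time_mulT, tderiv_time_mulR, tderiv_radial_mulR, tderiv_radial_mulT,
      tderiv_comm (0, 1) (1, 0) η]
    module
  rw [h]
  simp only [g.map_add', g.map_sub']
  simp only [coneOp, ScalarDist.add_apply, ScalarDist.sub_apply', mulDist_apply, distDeriv_apply, neg_neg]
  ring

lemma exists_plane_wave {g : ScalarDist (ℝ × ℝ)} (hg : ∀ η, g (boostOp η) = 0) :
    ∃ h : ScalarDist (ℝ × ℝ), (∀ η, h (tderiv (0, 1) (tderiv (0, 1) η)) - h (tderiv (1, 0) (tderiv (1, 0) η)) = g η) ∧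
      ∀ η, h (boostOp η) = 0 := by
  have hg' : coneOp (distDeriv dirP) (distDeriv dirQ) (mulDist coneP coneP.contDiff)
      (mulDist coneQ coneQ.contDiff) g = 0 := by
    ext η; rw [coneOp_apply, hg]; rfl
  obtain ⟨h, h1, h2⟩ := exists_cone_solution (dp := distDeriv dirP) (dq := distDeriv dirQ)
    (P := mulDist coneP coneP.contDiff) (Q := mulDist coneQ coneQ.contDiff)
    (fun w => distDeriv_comm _ _ w)
    (distDeriv_mulDist_of_eq_one _ coneP_dirP) (distDeriv_mulDist_of_eq_zero _ coneP_dirQ)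
    (distDeriv_mulDist_of_eq_zero _ coneQ_dirP) (distDeriv_mulDist_of_eq_one _ coneQ_dirQ)
    (fun f => (ScalarDist.exists_primitive coneP_dirP f).imp fun _ h => ⟨h.1, h.2 _ coneP_dirQ⟩)
    (fun f => (ScalarDist.exists_primitive coneQ_dirQ f).imp fun _ h => ⟨h.1, h.2 _ coneQ_dirP⟩)
    (fun f => (ScalarDist.exists_div coneP_dirP f).imp fun _ h => ⟨h.1, h.2 _ coneP_dirQ⟩)
    (fun f => (ScalarDist.exists_div coneQ_dirQ f).imp fun _ h => ⟨h.1, h.2 _ coneQ_dirP⟩) hg'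
  -- The factor is due to ∂_p∂_q = (∂_t² - ∂_r²)/4.
  refine ⟨(-1 / 4 : ℂ) • h, fun η => ?_, fun η => ?_⟩
  · rw [ScalarDist.smul_apply, ScalarDist.smul_apply, ← h1, distDeriv_apply, distDeriv_apply, neg_neg]
    have h3 : tderiv dirQ (tderiv dirP η) =
        (1 / 4 : ℝ) • (tderiv (1, 0) (tderiv (1, 0) η) - tderiv (0, 1) (tderiv (0, 1) η)) := by
      simp only [tderiv_dirP, tderiv_dirQ, map_add, map_smul, tderiv_comm (0, 1) (1, 0) η]
      module
    rw [h3, h.map_smul_real, h.map_sub', Complex.real_smul]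
    push_cast
    ring
  · rw [ScalarDist.smul_apply, ← coneOp_apply, h2]
    exact mul_zero _

/-- Boost invariant distributions on the plane. -/
lemma apply_eq_zero_of_boostOp {h : ScalarDist (ℝ × ℝ)} (hh : ∀ η, h (boostOp η) = 0) {χ : Test (ℝ × ℝ)}
    (hχ : ∀ t r, χ (t, -r) = -χ (t, r)) :
    h (mulR (mulR (tderiv (1, 0) χ)) + mulT (mulR (tderiv (0, 1) χ)) + (2:ℝ) • mulT χ) = 0 := by
  set R := mulDist (fun z : ℝ × ℝ => z.2) contDiff_snd
  set S := mulDist (fun z : ℝ × ℝ => z.1) contDiff_fst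
  set u : ScalarDist (ℝ × ℝ) := -distDeriv (1, 0) (R (R h)) - distDeriv (0, 1) (R (S h)) + (2 : ℂ) • S h with hu
  have hu' : ∀ χ, u χ = h (mulR (mulR (tderiv (1, 0) χ)) + mulT (mulR (tderiv (0, 1) χ)) + (2:ℝ) • mulT χ) := by
    intro χ
    have h1 : u χ = -(distDeriv (1, 0) (R (R h)) χ) - distDeriv (0, 1) (R (S h)) χ + 2 * S h χ := rfl
    rw [h1, distDeriv_apply, distDeriv_apply, h.map_add', h.map_add', h.map_smul_real, neg_neg, sub_neg_eq_add,
      Complex.real_smul]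
    push_cast
    rfl
  -- By `boostOp_mulR`, u(∂_r η) = h(boostOp(rη)) = 0. So u is independent of r and sees a test
  -- function only through its integral over r, which is zero for odd ones.
  have h1 : distDeriv (0, 1) u = 0 := by
    ext η
    rw [distDeriv_apply, hu', ← boostOp_mulR, hh, neg_zero]; rfl
  have hl : (ContinuousLinearMap.snd ℝ ℝ ℝ) (0, 1) = 1 := rfl
  obtain ⟨ψ, h2, h3⟩ := ScalarDist.apply_eq_of_distDeriv_eq_zero hl h1 χ
  rw [← hu', h3]
  have h4 : ψ = 0 := by
    ext z
    rw [h2]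
    have h5 : ∫ τ : ℝ, χ (z + τ • (0, 1)) = 0 := by
      have e : ∀ τ : ℝ, z + τ • ((0, 1) : ℝ × ℝ) = (z.1, z.2 + τ) := fun τ => by ext <;> simp
      simp only [e]
      rw [MeasureTheory.integral_add_left_eq_self (fun τ => χ (z.1, τ))]
      have h6 := MeasureTheory.integral_neg_eq_self (fun τ => χ (z.1, τ)) MeasureTheory.volume
      simp only [hχ, MeasureTheory.integral_neg] at h6
      linarith
    rw [h5, mul_zero]; rfl
  rw [h4, u.map_zero']

lemma tderiv_boost (i k : Fin 4) (φ : Test Spacetime) (x : Spacetime) :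
    tderiv (unit k) (boost i φ) x = x i * tderiv (unit k) (tderiv (unit 0) φ) x +
      (if k = i then tderiv (unit 0) φ x else 0) +
      (x 0 * tderiv (unit k) (tderiv (unit i) φ) x + (if k = 0 then tderiv (unit i) φ x else 0)) := by
  have e1 : boost i φ = testX i (tderiv (unit 0) φ) + testX 0 (tderiv (unit i) φ) := rfl
  rw [e1, map_add, tderiv_testX, tderiv_testX, ← testX_apply, ← testX_apply]
  split_ifs <;> rfl

lemma boost_apply (i : Fin 4) (φ : Test Spacetime) (x : Spacetime) :
    boost i φ x = x i * tderiv (unit 0) φ x + x 0 * tderiv (unit i) φ x := by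
  rw [← testX_apply, ← testX_apply]; rfl

/-- Two rotations and one boost generate the Lorentz algebra by commutators, so invariance needs to
be tested on these three only. -/
lemma boost_eq_comm {i : Fin 4} (hi : i = 1 ∨ i = 2) (φ : Test Spacetime) :
    boost i φ = ang i 3 (boost 3 φ) - boost 3 (ang i 3 φ) := by
  ext x
  change _ = ang i 3 (boost 3 φ) x - boost 3 (ang i 3 φ) x
  rw [boost_apply, ang_apply, boost_apply]
  simp only [tderiv_ang, tderiv_boost]
  rw [tderiv_comm (unit 3) (unit 0), tderiv_comm (unit i) (unit 0), tderiv_comm (unit i) (unit 3)]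
  rcases hi with rfl | rfl <;> simp <;> ring

lemma ang_one_three (φ : Test Spacetime) :
    ang 1 3 φ = ang 1 2 (ang 2 3 φ) - ang 2 3 (ang 1 2 φ) := by
  ext x
  change _ = ang 1 2 (ang 2 3 φ) x - ang 2 3 (ang 1 2 φ) x
  rw [ang_apply, ang_apply, ang_apply]
  rw [tderiv_ang, tderiv_ang, tderiv_ang, tderiv_ang, tderiv_comm (unit 1) (unit 2),
    tderiv_comm (unit 1) (unit 3), tderiv_comm (unit 2) (unit 3)]
  simp
  ring

lemma distX_distDeriv_apply (m n : Fin 4) (T : ScalarDist Spacetime) (φ : Test Spacetime) :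
    distX m (distDeriv (unit n) T) φ = -(T (testX m (tderiv (unit n) φ)) + if n = m then T φ else 0) := by
  rw [distX_apply, distDeriv_apply, tderiv_testX, T.map_add']
  split_ifs
  · rfl
  · rw [T.map_zero']

/-- Invariance of a distribution under the generators of rotations and boosts. -/
lemma dist_invariant_of_generators {T : ScalarDist Spacetime} (h12 : ∀ φ, T (ang 1 2 φ) = 0)
    (h23 : ∀ φ, T (ang 2 3 φ) = 0) (hb : ∀ φ, T (boost 3 φ) = 0) : IsLorentzInvariant distOps T := by
  have h13 : ∀ φ, T (ang 1 3 φ) = 0 := fun φ => by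
    rw [ang_one_three, T.map_sub', h12, h23, sub_zero]
  have b1 : ∀ φ, T (boost 1 φ) = 0 := fun φ => by
    rw [boost_eq_comm (Or.inl rfl), T.map_sub', h13, hb, sub_zero]
  have b2 : ∀ φ, T (boost 2 φ) = 0 := fun φ => by
    rw [boost_eq_comm (Or.inr rfl), T.map_sub', h23, hb, sub_zero]
  have ha : ∀ i j φ, T (ang i j φ) = 0 → T (testX i (tderiv (unit j) φ)) = T (testX j (tderiv (unit i) φ)) := by
    intro i j φ h
    have e : ang i j φ = testX i (tderiv (unit j) φ) - testX j (tderiv (unit i) φ) := rfl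
    rwa [e, T.map_sub', sub_eq_zero] at h
  have hb' : ∀ i φ, T (boost i φ) = 0 → T (testX i (tderiv (unit 0) φ)) = -T (testX 0 (tderiv (unit i) φ)) := by
    intro i φ h
    have e : boost i φ = testX i (tderiv (unit 0) φ) + testX 0 (tderiv (unit i) φ) := rfl
    rwa [e, T.map_add', ← eq_neg_iff_add_eq_zero] at h
  refine dist_invariant_of_lieOp (lieOp_eq_zero_of_components fun m n => ?_)
  ext φ
  change eta m • (distX m (distDeriv (unit n) T) φ) = eta n • (distX n (distDeriv (unit m) T) φ)
  rw [distX_distDeriv_apply, distX_distDeriv_apply]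
  have a12 := ha 1 2 φ (h12 φ)
  have a13 := ha 1 3 φ (h13 φ)
  have a23 := ha 2 3 φ (h23 φ)
  have c1 := hb' 1 φ (b1 φ)
  have c2 := hb' 2 φ (b2 φ)
  have c3 := hb' 3 φ (hb φ)
  fin_cases m <;> fin_cases n <;> simp [eta, a12, a13, a23, c1, c2, c3]

lemma dist_generators_of_invariant {T : ScalarDist Spacetime} (h : IsLorentzInvariant distOps T) :
    (∀ φ, T (ang 1 2 φ) = 0) ∧ (∀ φ, T (ang 2 3 φ) = 0) ∧ ∀ φ, T (boost 3 φ) = 0 := by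
  have hc : ∀ m n φ, eta m • (distX m (distDeriv (unit n) T) φ) = eta n • (distX n (distDeriv (unit m) T) φ) :=
    fun m n φ => congrArg (fun S : ScalarDist Spacetime => S φ)
      (lieOp_components (dist_lieOp_of_invariant h) m n)
  simp only [distX_distDeriv_apply] at hc
  have ha : ∀ i j φ, ang i j φ = testX i (tderiv (unit j) φ) - testX j (tderiv (unit i) φ) := fun i j φ => rfl
  have hb : ∀ φ, boost 3 φ = testX 3 (tderiv (unit 0) φ) + testX 0 (tderiv (unit 3) φ) := fun φ => rfl
  refine ⟨fun φ => ?_, fun φ => ?_, fun φ => ?_⟩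
  · have := hc 1 2 φ
    simp [eta] at this
    rw [ha, T.map_sub', this, sub_self]
  · have := hc 2 3 φ
    simp [eta] at this
    rw [ha, T.map_sub', this, sub_self]
  · have := hc 3 0 φ
    simp [eta] at this
    rw [hb, T.map_add', ← this, add_neg_cancel]

lemma radAvg_ang_one_two (φ : Test Spacetime) : radAvg (ang 1 2 φ) = 0 := by
  rw [radAvg_eq, sph_ang_one_two, map_zero]

lemma radAvg_ang_two_three (φ : Test Spacetime) : radAvg (ang 2 3 φ) = 0 := by
  rw [radAvg_eq, sphS_ang_two_three, map_zero]

/-- The wave equation with an invariant distribution as source has an invariant solution. -/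
theorem dist_exists_box (G : ScalarDist Spacetime) (hG : IsLorentzInvariant distOps G) :
    ∃ H, IsBoxInverse distOps G H := by
  obtain ⟨h12, h23, hb⟩ := dist_generators_of_invariant hG
  obtain ⟨g, hg, hg'⟩ := ScalarDist.exists_plane h12 h23 hb
  obtain ⟨h, hh, hh'⟩ := exists_plane_wave hg'
  -- The plane solution is pulled back along the spherical mean. The factor k undoes the 4π in the
  -- relation between g and G.
  set H₀ := distTranspose radAvg radAvg_isBounded h with hH₀
  have hH₀' : ∀ φ, H₀ φ = h (radAvg φ) := fun φ => distTranspose_apply ..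
  set k : ℂ := (((4 * Real.pi : ℝ) : ℂ))⁻¹ with hk
  have hk' : k * ((4 * Real.pi : ℝ) : ℂ) = 1 := inv_mul_cancel₀ (by
    exact_mod_cast (by positivity : (4 * Real.pi : ℝ) ≠ 0))
  have hH : ∀ φ, (k • H₀) φ = k * h (radAvg φ) := fun φ => by rw [ScalarDist.smul_apply, hH₀']
  refine ⟨k • H₀, dist_invariant_of_generators (fun φ => ?_) (fun φ => ?_) (fun φ => ?_), ?_⟩
  · rw [hH, radAvg_ang_one_two, h.map_zero', mul_zero]
  · rw [hH, radAvg_ang_two_three, h.map_zero', mul_zero]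
  · have e : radAvg (boost 3 φ) = mulR (mulR (tderiv (1, 0) (sphC φ))) +
        mulT (mulR (tderiv (0, 1) (sphC φ))) + (2:ℝ) • mulT (sphC φ) := by
      ext z
      change _ = mulR (mulR (tderiv (1, 0) (sphC φ))) z +
        mulT (mulR (tderiv (0, 1) (sphC φ))) z + 2 * mulT (sphC φ) z
      rw [radAvg_boost, mulR_apply, mulR_apply, mulT_apply, mulR_apply, mulT_apply]
      ring
    rw [hH, e, apply_eq_zero_of_boostOp hh' (sphC_neg φ), mul_zero]
  · ext φ
    have hd : ∀ m, distDeriv (unit m) (distDeriv (unit m) (k • H₀)) φ =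
        k * h (radAvg (tderiv (unit m) (tderiv (unit m) φ))) := fun m => by
      rw [distDeriv_apply, distDeriv_apply, neg_neg, hH]
    have e1 : box distOps (k • H₀) φ = ∑ m, eta m * distDeriv (unit m) (distDeriv (unit m) (k • H₀)) φ := by
      rw [box, LinearMap.sum_apply, ScalarDist.sum_apply]; rfl
    have e2 : radAvg (tderiv (unit 0) (tderiv (unit 0) φ)) = tderiv (1, 0) (tderiv (1, 0) (radAvg φ)) := by
      rw [radAvg_eq, ← tderiv_time_sph, ← tderiv_time_sph, ← tderiv_time_mulR, ← tderiv_time_mulR, radAvg_eq]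
    have e3 := hh (radAvg φ)
    have e4 : radAvg (lap φ) = radAvg (tderiv (unit 1) (tderiv (unit 1) φ)) +
      radAvg (tderiv (unit 2) (tderiv (unit 2) φ)) + radAvg (tderiv (unit 3) (tderiv (unit 3) φ)) := by
      rw [← map_add, ← map_add]; rfl
    rw [← radAvg_lap, e4, h.map_add', h.map_add', ← e2, hg] at e3
    rw [e1, Fin.sum_univ_four, hd, hd, hd, hd]
    simp [eta]
    linear_combination k * e3 + G φ * hk'

theorem good_dist : Good distOps distX := good_distOps dist_exists_box

end Wave

/-! ### Operators on superfields -/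

section Operators

variable {W V : Type} [AddCommGroup W] [Module ℂ W] [AddCommGroup V] [Module ℂ V]

variable (V) in
/-- Multiplication by an odd coordinate. -/
abbrev th (i : OddIndex) : Module.End ℂ (Superfield V) := mulOp V (gen i)

@[simp] lemma mulOp_tmul (g h : Grassmann) (v : V) : mulOp V g (h ⊗ₜ v) = (g * h) ⊗ₜ v := rfl

@[simp] lemma evenDeriv_tmul (c : CoeffOps W V) (a : Fin 2) (m : Fin 4) (g : Grassmann) (v : V) :
    evenDeriv c a m (g ⊗ₜ v) = g ⊗ₜ c.d2 a m v := rfl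

lemma oddDeriv_tmul (i : OddIndex) (g : Grassmann) (v : V) : oddDeriv V i (g ⊗ₜ v) =
    (CliffordAlgebra.contractLeft (LinearMap.proj i : Module.Dual ℂ (OddIndex → ℂ)) g : Grassmann) ⊗ₜ v := rfl

lemma mulOp_mul (g h : Grassmann) (x : Superfield V) : mulOp V (g * h) x = mulOp V g (mulOp V h x) := by
  induction x using TensorProduct.induction_on with
  | zero => simp
  | add x y hx hy => simp only [map_add, hx, hy]
  | tmul k v => simp [mul_assoc]

lemma mulOp_add (g h : Grassmann) (x : Superfield V) : mulOp V (g + h) x = mulOp V g x + mulOp V h x := by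
  induction x using TensorProduct.induction_on with
  | zero => simp
  | add x y hx hy => simp only [map_add, hx, hy]; abel
  | tmul k v => simp [add_mul, TensorProduct.add_tmul]

lemma mulOp_smul (r : ℂ) (g : Grassmann) (x : Superfield V) : mulOp V (r • g) x = r • mulOp V g x := by
  induction x using TensorProduct.induction_on with
  | zero => simp
  | add x y hx hy => simp only [map_add, hx, hy, smul_add]
  | tmul k v => simp [TensorProduct.smul_tmul']

lemma th_th_self (i : OddIndex) (x : Superfield V) : th V i (th V i x) = 0 := by
  rw [← mulOp_mul]
  have : gen i * gen i = 0 := ExteriorAlgebra.ι_sq_zero _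
  rw [this]
  have h := mulOp_smul 0 (0 : Grassmann) x
  simpa using h

lemma th_th (i j : OddIndex) (x : Superfield V) : th V i (th V j x) = -th V j (th V i x) := by
  rw [← mulOp_mul, ← mulOp_mul, ← add_eq_zero_iff_eq_neg, ← mulOp_add]
  have : gen i * gen j + gen j * gen i = 0 := ExteriorAlgebra.ι_add_mul_swap _ _
  rw [this]
  have h := mulOp_smul 0 (0 : Grassmann) x
  simpa using h

lemma oddDeriv_th (i j : OddIndex) (x : Superfield V) :
    oddDeriv V i (th V j x) = (if i = j then x else 0) - th V j (oddDeriv V i x) := by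
  induction x using TensorProduct.induction_on with
  | zero => simp
  | add x y hx hy =>
    simp only [map_add, hx, hy]
    split_ifs <;> abel
  | tmul k v =>
    rw [mulOp_tmul, oddDeriv_tmul, oddDeriv_tmul, mulOp_tmul]
    have h : CliffordAlgebra.contractLeft (LinearMap.proj i : Module.Dual ℂ (OddIndex → ℂ)) (gen j * k : Grassmann) =
        (if i = j then (1:ℂ) else 0) • k - gen j *
          (CliffordAlgebra.contractLeft (LinearMap.proj i : Module.Dual ℂ (OddIndex → ℂ)) k : Grassmann) := by
      have h1 := CliffordAlgebra.contractLeft_ι_mul (Q := (0 : QuadraticForm ℂ (OddIndex → ℂ)))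
        (LinearMap.proj i : Module.Dual ℂ (OddIndex → ℂ)) (Pi.single j 1) k
      have h2 : (LinearMap.proj i : Module.Dual ℂ (OddIndex → ℂ)) (Pi.single j 1) = if i = j then 1 else 0 := by
        simp [Pi.single_apply]
      rw [h2] at h1
      exact h1
    rw [h, TensorProduct.sub_tmul]
    split_ifs <;> simp

lemma oddDeriv_oddDeriv (i j : OddIndex) (x : Superfield V) :
    oddDeriv V i (oddDeriv V j x) = -oddDeriv V j (oddDeriv V i x) := by
  induction x using TensorProduct.induction_on with
  | zero => simp
  | add x y hx hy =>
    simp only [map_add, hx, hy]; abel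
  | tmul k v =>
    simp only [oddDeriv_tmul]
    rw [CliffordAlgebra.contractLeft_comm, TensorProduct.neg_tmul]

lemma oddDeriv_self (i : OddIndex) (x : Superfield V) : oddDeriv V i (oddDeriv V i x) = 0 := by
  induction x using TensorProduct.induction_on with
  | zero => simp
  | add x y hx hy => simp only [map_add, hx, hy, add_zero]
  | tmul k v =>
    simp only [oddDeriv_tmul]
    rw [CliffordAlgebra.contractLeft_contractLeft, TensorProduct.zero_tmul]

lemma evenDeriv_th (c : CoeffOps W V) (a : Fin 2) (m : Fin 4) (i : OddIndex) (x : Superfield V) :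
    evenDeriv c a m (th V i x) = th V i (evenDeriv c a m x) := by
  induction x using TensorProduct.induction_on with
  | zero => simp
  | add x y hx hy => simp only [map_add, hx, hy]
  | tmul k v => rfl

lemma evenDeriv_oddDeriv (c : CoeffOps W V) (a : Fin 2) (m : Fin 4) (i : OddIndex) (x : Superfield V) :
    evenDeriv c a m (oddDeriv V i x) = oddDeriv V i (evenDeriv c a m x) := by
  induction x using TensorProduct.induction_on with
  | zero => simp
  | add x y hx hy => simp only [map_add, hx, hy]
  | tmul k v => rfl

variable (V) in
/-- The constant term of a superfield. -/
def aug : Superfield V →ₗ[ℂ] V :=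
  (TensorProduct.lid ℂ V).toLinearMap ∘ₗ
    (ExteriorAlgebra.algebraMapInv (R := ℂ) (M := OddIndex → ℂ)).toLinearMap.rTensor V

lemma aug_tmul (g : Grassmann) (v : V) :
    aug V (g ⊗ₜ v) = (ExteriorAlgebra.algebraMapInv (R := ℂ) (M := OddIndex → ℂ) g) • v := rfl

variable (V) in
/-- Superfields without odd coordinates. -/
def vac : V →ₗ[ℂ] Superfield V := TensorProduct.mk ℂ Grassmann V 1

lemma vac_apply (v : V) : vac V v = (1 : Grassmann) ⊗ₜ v := rfl

@[simp] lemma aug_vac (v : V) : aug V (vac V v) = v := by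
  rw [vac_apply, aug_tmul, map_one, one_smul]

lemma aug_th (i : OddIndex) (x : Superfield V) : aug V (th V i x) = 0 := by
  induction x using TensorProduct.induction_on with
  | zero => simp
  | add x y hx hy => simp only [map_add, hx, hy, add_zero]
  | tmul k v =>
    have : ExteriorAlgebra.algebraMapInv (R := ℂ) (gen i) = 0 := by
      simp [gen, ExteriorAlgebra.algebraMapInv]
    rw [mulOp_tmul, aug_tmul, map_mul, this, zero_mul, zero_smul]

lemma oddDeriv_vac (i : OddIndex) (v : V) : oddDeriv V i (vac V v) = 0 := by
  rw [vac_apply, oddDeriv_tmul, CliffordAlgebra.contractLeft_one, TensorProduct.zero_tmul]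

lemma aug_evenDeriv (c : CoeffOps W V) (a : Fin 2) (m : Fin 4) (x : Superfield V) :
    aug V (evenDeriv c a m x) = c.d2 a m (aug V x) := by
  induction x using TensorProduct.induction_on with
  | zero => simp
  | add x y hx hy => simp only [map_add, hx, hy]
  | tmul k v => simp [aug_tmul]

variable (V) in
/-- The projection to the terms without the odd coordinates in `l`. -/
def vacProj (l : List OddIndex) : Module.End ℂ (Superfield V) :=
  (l.map fun i => oddDeriv V i * th V i).prod

lemma vacProj_cons (i : OddIndex) (l : List OddIndex) (x : Superfield V) :
    vacProj V (i :: l) x = oddDeriv V i (th V i (vacProj V l x)) := by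
  simp [vacProj]

lemma vacProj_of_oddDeriv {l : List OddIndex} {x : Superfield V} (h : ∀ i ∈ l, oddDeriv V i x = 0) :
    vacProj V l x = x := by
  induction l with
  | nil => rfl
  | cons i l ih =>
    rw [vacProj_cons, ih fun j hj => h j (List.mem_cons_of_mem _ hj), oddDeriv_th, if_pos rfl,
      h i List.mem_cons_self, map_zero, sub_zero]

lemma vacProj_th_aux (l : List OddIndex) (j : OddIndex) (x : Superfield V) :
    ∃ y, vacProj V l (th V j x) = th V j y := by
  induction l with
  | nil => exact ⟨x, rfl⟩
  | cons i l ih =>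
    obtain ⟨y, hy⟩ := ih
    rw [vacProj_cons, hy]
    by_cases h : i = j
    · exact ⟨0, by rw [h, th_th_self, map_zero, map_zero]⟩
    · exact ⟨oddDeriv V i (th V i y), by
        rw [th_th, map_neg, oddDeriv_th, if_neg h, zero_sub, neg_neg]⟩

lemma vacProj_th {l : List OddIndex} {j : OddIndex} (hj : j ∈ l) (x : Superfield V) :
    vacProj V l (th V j x) = 0 := by
  induction l with
  | nil => simp at hj
  | cons i l ih =>
    rw [vacProj_cons]
    by_cases h : j = i
    · obtain ⟨y, hy⟩ := vacProj_th_aux l j x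
      rw [hy, h, th_th_self, map_zero]
    · rw [ih ((List.mem_cons.1 hj).resolve_left h), map_zero, map_zero]

/-- Each factor ∂_i θ_i kills whatever contains θ_i and fixes whatever does not; over all labels
only the constant term survives. -/
lemma vacProj_eq_vac {l : List OddIndex} (hl : ∀ i, i ∈ l) (x : Superfield V) :
    vacProj V l x = vac V (aug V x) := by
  induction x using TensorProduct.induction_on with
  | zero => simp
  | add x y hx hy => simp only [map_add, hx, hy]
  | tmul k v =>
    induction k using CliffordAlgebra.left_induction with
    | algebraMap r =>
      have h1 : (algebraMap ℂ Grassmann r) ⊗ₜ[ℂ] v = vac V (r • v) := by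
        rw [vac_apply, Algebra.algebraMap_eq_smul_one, TensorProduct.smul_tmul]
      rw [h1, aug_vac]
      exact vacProj_of_oddDeriv fun i _ => oddDeriv_vac i _
    | add k l hk hl =>
      rw [TensorProduct.add_tmul]
      simp only [map_add, hk, hl]
    | ι_mul k u hk =>
      have h1 : (ExteriorAlgebra.ι ℂ u * k) ⊗ₜ[ℂ] v = ∑ j, u j • th V j (k ⊗ₜ v) := by
        have h2 : ExteriorAlgebra.ι ℂ u = ∑ j, u j • gen j := by
          conv_lhs => rw [← Finset.univ_sum_single u]
          rw [map_sum]
          refine Finset.sum_congr rfl fun j _ => ?_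
          rw [gen, ← map_smul, ← Pi.single_smul, smul_eq_mul, mul_one]
        rw [h2, Finset.sum_mul, TensorProduct.sum_tmul]
        refine Finset.sum_congr rfl fun j _ => ?_
        rw [smul_mul_assoc, mulOp_tmul, TensorProduct.smul_tmul']
      change vacProj V l ((ExteriorAlgebra.ι ℂ u * k) ⊗ₜ[ℂ] v) = vac V (aug V ((ExteriorAlgebra.ι ℂ u * k) ⊗ₜ[ℂ] v))
      rw [h1]
      simp only [map_sum, map_smul, vacProj_th (hl _), aug_th, map_zero]

/-- The coefficients of a superfield, by iterated differentiation. -/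
def comp : List OddIndex → Superfield V →ₗ[ℂ] V
  | [] => aug V
  | i :: s => comp s ∘ₗ oddDeriv V i

@[simp] lemma comp_nil (x : Superfield V) : comp [] x = aug V x := rfl
@[simp] lemma comp_cons (i : OddIndex) (s : List OddIndex) (x : Superfield V) :
    comp (i :: s) x = comp s (oddDeriv V i x) := rfl

/-- Induction on the labels on which x may depend. The derivative in the first label depends on
fewer labels and vanishes by induction; then x itself does not depend on that label. -/
lemma eq_zero_of_comp (l : List OddIndex) : ∀ x : Superfield V, (∀ j, j ∉ l → oddDeriv V j x = 0) →
    (∀ s, s.Sublist l → comp s x = 0) → x = 0 := by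
  induction l with
  | nil =>
    intro x h1 h2
    have h3 : aug V x = 0 := h2 [] (List.Sublist.refl _)
    have h4 := vacProj_eq_vac (l := Finset.univ.toList) (fun i => by simp) x
    rw [h3, map_zero, vacProj_of_oddDeriv fun i _ => h1 i (by simp)] at h4
    exact h4
  | cons i l ih =>
    intro x h1 h2
    have h3 : oddDeriv V i x = 0 := by
      refine ih _ (fun j hj => ?_) fun s hs => h2 (i :: s) (hs.cons_cons i)
      by_cases h : j = i
      · rw [h, oddDeriv_self]
      · rw [oddDeriv_oddDeriv, h1 j (by simp [h, hj]), map_zero, neg_zero]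
    refine ih x (fun j hj => ?_) fun s hs => h2 s (hs.trans (List.sublist_cons_self i l))
    by_cases h : j = i
    · rw [h, h3]
    · exact h1 j (by simp [h, hj])

lemma oddDeriv_vacProj {l : List OddIndex} {i : OddIndex} (h : i ∉ l) (x : Superfield V) :
    oddDeriv V i (vacProj V l x) = vacProj V l (oddDeriv V i x) := by
  induction l with
  | nil => rfl
  | cons j l ih =>
    rw [vacProj_cons, vacProj_cons, oddDeriv_oddDeriv, oddDeriv_th, if_neg (fun e => h (by simp [e])), zero_sub,
      map_neg, neg_neg, ih fun e => h (by simp [e])]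

lemma th_vacProj {l : List OddIndex} {i : OddIndex} (h : i ∉ l) (x : Superfield V) :
    th V i (vacProj V l x) = vacProj V l (th V i x) := by
  induction l with
  | nil => rfl
  | cons j l ih =>
    have hji : j ≠ i := fun e => h (by simp [e])
    rw [vacProj_cons, vacProj_cons, ← ih fun e => h (by simp [e]), th_th j i, map_neg,
      oddDeriv_th j i, if_neg hji, zero_sub, neg_neg]

lemma oddDeriv_vacProj_of_mem {l : List OddIndex} {i : OddIndex} (h : i ∈ l) (x : Superfield V) :
    oddDeriv V i (vacProj V l x) = 0 := by
  induction l with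
  | nil => simp at h
  | cons j l ih =>
    rw [vacProj_cons]
    by_cases hji : i = j
    · rw [hji, oddDeriv_self]
    · rw [oddDeriv_oddDeriv, oddDeriv_th, if_neg hji, ih ((List.mem_cons.1 h).resolve_left hji)]
      simp

lemma aug_vacProj (l : List OddIndex) (x : Superfield V) : aug V (vacProj V l x) = aug V x := by
  induction l with
  | nil => rfl
  | cons j l ih => rw [vacProj_cons, oddDeriv_th, if_pos rfl, map_sub, aug_th, sub_zero, ih]

lemma comp_vacProj {l s : List OddIndex} (h : ∀ i ∈ s, i ∉ l) (x : Superfield V) :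
    comp s (vacProj V l x) = comp s x := by
  induction s generalizing x with
  | nil => exact aug_vacProj l x
  | cons i s ih =>
    rw [comp_cons, oddDeriv_vacProj (h i List.mem_cons_self),
      ih fun j hj => h j (List.mem_cons_of_mem _ hj), comp_cons]

/-- If `x` is annihilated by operators conjugate to the odd coordinates in `l` then it is determined
by its terms without these coordinates. -/
lemma eq_zero_of_vacProj {q : OddIndex → Module.End ℂ (Superfield V)} (l : List OddIndex) (hl : l.Nodup)
    (hq : ∀ i ∈ l, ∀ j ∈ l, ∀ x, q i (th V j x) = (if i = j then x else 0) - th V j (q i x)) :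
    ∀ x : Superfield V, (∀ i ∈ l, q i x = 0) → vacProj V l x = 0 → x = 0 := by
  induction l with
  | nil => exact fun x _ h => h
  | cons i l ih =>
    intro x h1 h2
    have hi := (List.nodup_cons.1 hl).1
    -- Multiplication by θ_i and θ_i ∂_i θ_i = θ_i turn the hypothesis into one about θ_i x and the
    -- shorter list. Once θ_i x = 0 is known, the anticommutator of q_i and θ_i applied to x returns
    -- x = 0.
    have h3 : th V i (vacProj V l x) = 0 := by
      have h4 := congrArg (th V i) h2
      rw [vacProj_cons, oddDeriv_th, if_pos rfl, map_sub, th_th_self, sub_zero, map_zero] at h4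
      exact h4
    rw [th_vacProj hi] at h3
    have h5 : th V i x = 0 := by
      refine ih (List.nodup_cons.1 hl).2 (fun a ha b hb => hq a (List.mem_cons_of_mem _ ha) b
        (List.mem_cons_of_mem _ hb)) _ (fun j hj => ?_) h3
      rw [hq j (List.mem_cons_of_mem _ hj) i List.mem_cons_self, if_neg (fun e : j = i => hi (e ▸ hj)),
        h1 j (List.mem_cons_of_mem _ hj), map_zero, sub_zero]
    have h6 := hq i List.mem_cons_self i List.mem_cons_self x
    rw [h5, if_pos rfl, h1 i List.mem_cons_self, map_zero, map_zero, sub_zero] at h6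
    exact h6.symm

/-- The derivative `σ^m ∂_m` in the variable `x_a`, on superfields. -/
def slash (c : CoeffOps W V) (a α β : Fin 2) : Module.End ℂ (Superfield V) :=
  ∑ m, sigma m α β • evenDeriv c a m

/-- The derivative `σ^m ∂_m` in the variable `x_a`, on coefficients. -/
def slash2 (c : CoeffOps W V) (a α β : Fin 2) : Module.End ℂ V := ∑ m, sigma m α β • c.d2 a m

/-- The derivative `σ^m ∂_m` on functions of one point. -/
def slash1 (c : CoeffOps W V) (α β : Fin 2) : Module.End ℂ W := ∑ m, sigma m α β • c.d m

variable (c : CoeffOps W V)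

lemma slash_apply (a α β : Fin 2) (x : Superfield V) :
    slash c a α β x = ∑ m, sigma m α β • evenDeriv c a m x := by simp [slash]

lemma slash2_apply (a α β : Fin 2) (v : V) : slash2 c a α β v = ∑ m, sigma m α β • c.d2 a m v := by
  simp [slash2]

lemma slash1_apply (α β : Fin 2) (w : W) : slash1 c α β w = ∑ m, sigma m α β • c.d m w := by
  simp [slash1]

lemma slash_th (a α β : Fin 2) (i : OddIndex) (x : Superfield V) :
    slash c a α β (th V i x) = th V i (slash c a α β x) := by
  simp only [slash_apply, map_sum, map_smul, evenDeriv_th]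

lemma slash_oddDeriv (a α β : Fin 2) (i : OddIndex) (x : Superfield V) :
    slash c a α β (oddDeriv V i x) = oddDeriv V i (slash c a α β x) := by
  simp only [slash_apply, map_sum, map_smul, evenDeriv_oddDeriv]

lemma aug_slash (a α β : Fin 2) (x : Superfield V) :
    aug V (slash c a α β x) = slash2 c a α β (aug V x) := by
  simp only [slash_apply, slash2_apply, map_sum, map_smul, aug_evenDeriv]

lemma slash_vac (a α β : Fin 2) (v : V) : slash c a α β (vac V v) = vac V (slash2 c a α β v) := by
  simp only [slash_apply, slash2_apply, map_sum, map_smul]; rfl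

lemma Q_apply (a α : Fin 2) (x : Superfield V) : Q c a α x = oddDeriv V (a, Sum.inl α) x -
    Complex.I • ∑ β, th V (a, Sum.inr β) (slash c a α β x) := by
  simp only [Q, LinearMap.sub_apply, LinearMap.smul_apply, LinearMap.sum_apply, slash_apply, map_sum, map_smul]
  rw [Finset.sum_comm]; rfl

lemma QBar_apply (a α : Fin 2) (x : Superfield V) : QBar c a α x = -oddDeriv V (a, Sum.inr α) x +
    Complex.I • ∑ β, th V (a, Sum.inl β) (slash c a β α x) := by
  simp only [QBar, LinearMap.add_apply, LinearMap.neg_apply, LinearMap.smul_apply, LinearMap.sum_apply, slash_apply, map_sum, map_smul]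
  rw [Finset.sum_comm]; rfl

lemma Q_th (a α : Fin 2) (i : OddIndex) (x : Superfield V) : Q c a α (th V i x) =
    (if (a, Sum.inl α) = i then x else 0) - th V i (Q c a α x) := by
  have h : ∀ β, th V (a, Sum.inr β) (th V i (slash c a α β x)) =
    -th V i (th V (a, Sum.inr β) (slash c a α β x)) := fun β => th_th ..
  simp only [Q_apply, oddDeriv_th, slash_th, h, map_sub, map_smul, map_sum,
    Finset.sum_neg_distrib, smul_neg]
  abel

lemma QBar_th (a α : Fin 2) (i : OddIndex) (x : Superfield V) : QBar c a α (th V i x) =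
    -(if (a, Sum.inr α) = i then x else 0) - th V i (QBar c a α x) := by
  have h : ∀ β, th V (a, Sum.inl β) (th V i (slash c a β α x)) =
    -th V i (th V (a, Sum.inl β) (slash c a β α x)) := fun β => th_th ..
  simp only [QBar_apply, oddDeriv_th, slash_th, h, map_add, map_neg, map_smul, map_sum,
    Finset.sum_neg_distrib, smul_neg]
  abel

lemma D_apply (α : Fin 2) (x : Superfield V) : D c α x = oddDeriv V (0, Sum.inl α) x +
    Complex.I • ∑ β, th V (0, Sum.inr β) (slash c 0 α β x) := by
  simp only [D, LinearMap.add_apply, LinearMap.smul_apply, LinearMap.sum_apply, slash_apply, map_sum, map_smul]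
  rw [Finset.sum_comm]; rfl

lemma DBar_apply (α : Fin 2) (x : Superfield V) : DBar c α x = -oddDeriv V (0, Sum.inr α) x -
    Complex.I • ∑ β, th V (0, Sum.inl β) (slash c 0 β α x) := by
  simp only [DBar, LinearMap.sub_apply, LinearMap.neg_apply, LinearMap.smul_apply, LinearMap.sum_apply, slash_apply, map_sum, map_smul]
  rw [Finset.sum_comm]; rfl

/-- The labels of the odd coordinates of a point. -/
def ptLabels (a : Fin 2) : List OddIndex := [(a, Sum.inl 0), (a, Sum.inl 1), (a, Sum.inr 0), (a, Sum.inr 1)]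

lemma mem_ptLabels (i : OddIndex) : i ∈ ptLabels 0 ↔ i ∉ ptLabels 1 := by
  rcases i with ⟨a, α | α⟩ <;> fin_cases a <;> fin_cases α <;> simp [ptLabels]

/-- A supersymmetric two-point function is determined by its value at `θ₂ = 0`. -/
lemma susy_eq_zero {x : Superfield V} (h1 : ∀ α, (Q c 0 α + Q c 1 α) x = 0)
    (h2 : ∀ α, (QBar c 0 α + QBar c 1 α) x = 0) (h3 : ∀ s, s.Sublist (ptLabels 0) → comp s x = 0) : x = 0 := by
  -- The total charges, with the sign of the dotted ones reversed, have the same anticommutators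
  -- with θ₂, θ̄₂ as the odd derivatives in these coordinates.
  let q : OddIndex → Module.End ℂ (Superfield V) := fun i =>
    match i with
    | (_, Sum.inl α) => Q c 0 α + Q c 1 α
    | (_, Sum.inr α) => -(QBar c 0 α + QBar c 1 α)
  refine eq_zero_of_vacProj (q := q) (ptLabels 1) (by simp [ptLabels]) ?_ x ?_ ?_
  · rintro ⟨a, α⟩ hi ⟨b, β⟩ hj x
    have ha : a = 1 := by
      fin_cases a
      · simp [ptLabels] at hi
      · rfl
    have hb : b = 1 := by
      fin_cases b
      · simp [ptLabels] at hj
      · rfl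
    subst ha hb
    rcases α with α | α
    · have e : ((0, Sum.inl α) : OddIndex) ≠ (1, β) := by simp
      simp only [q, LinearMap.add_apply, Q_th, if_neg e, map_add]
      abel
    · have e : ((0, Sum.inr α) : OddIndex) ≠ (1, β) := by simp
      simp only [q, LinearMap.add_apply, LinearMap.neg_apply, QBar_th, if_neg e, map_add, map_neg]
      abel
  · rintro ⟨a, α | α⟩ -
    · exact h1 α
    · change -((QBar c 0 α + QBar c 1 α) x) = 0
      rw [h2, neg_zero]
  · refine eq_zero_of_comp (ptLabels 0) _ (fun j hj => ?_) fun s hs => ?_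
    · refine oddDeriv_vacProj_of_mem ?_ x
      by_contra h
      exact hj ((mem_ptLabels j).2 h)
    · rw [comp_vacProj (fun i hi => (mem_ptLabels i).1 (hs.subset hi)), h3 s hs]

end Operators

section Covariance

variable {W V : Type} [AddCommGroup W] [Module ℂ W] [AddCommGroup V] [Module ℂ V]

/-! ### Supersymmetry -/

section Susy

variable {c : CoeffOps W V} {X : Fin 4 → Module.End ℂ W} (hc : Good c X)
include hc

lemma Good.slash2_comm (a b α β γ δ : Fin 2) (v : V) :
    slash2 c a α β (slash2 c b γ δ v) = slash2 c b γ δ (slash2 c a α β v) := by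
  simp only [slash2_apply, map_sum, map_smul, Finset.smul_sum]
  rw [Finset.sum_comm]
  refine Finset.sum_congr rfl fun m _ => Finset.sum_congr rfl fun n _ => ?_
  rw [hc.d2_comm, smul_comm]

lemma Good.slash_comm (a b α β γ δ : Fin 2) (x : Superfield V) :
    slash c a α β (slash c b γ δ x) = slash c b γ δ (slash c a α β x) := by
  have h : ∀ m n (x : Superfield V), evenDeriv c a m (evenDeriv c b n x) = evenDeriv c b n (evenDeriv c a m x) := by
    intro m n x
    induction x using TensorProduct.induction_on with
    | zero => simp
    | add x y hx hy => simp only [map_add, hx, hy]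
    | tmul k v => simp [hc.d2_comm a b]
  simp only [slash_apply, map_sum, map_smul, Finset.smul_sum]
  rw [Finset.sum_comm]
  refine Finset.sum_congr rfl fun m _ => Finset.sum_congr rfl fun n _ => ?_
  rw [h, smul_comm]

lemma Good.slash_Q (a b α β γ : Fin 2) (x : Superfield V) :
    slash c b β γ (Q c a α x) = Q c a α (slash c b β γ x) := by
  simp only [Q_apply, map_sub, map_smul, map_sum, slash_oddDeriv, slash_th, hc.slash_comm b a]

lemma Good.slash_QBar (a b α β γ : Fin 2) (x : Superfield V) :
    slash c b β γ (QBar c a α x) = QBar c a α (slash c b β γ x) := by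
  simp only [QBar_apply, map_add, map_neg, map_smul, map_sum, slash_oddDeriv, slash_th, hc.slash_comm b a]

omit hc in
lemma Q_oddDeriv (a α : Fin 2) (i : OddIndex) (x : Superfield V) : Q c a α (oddDeriv V i x) =
    -oddDeriv V i (Q c a α x) - Complex.I • ∑ β, if i = (a, Sum.inr β) then slash c a α β x else 0 := by
  have h : ∀ β, th V (a, Sum.inr β) (oddDeriv V i (slash c a α β x)) =
      (if i = (a, Sum.inr β) then slash c a α β x else 0) - oddDeriv V i (th V (a, Sum.inr β) (slash c a α β x)) := by
    intro β; rw [oddDeriv_th]; abel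
  simp only [Q_apply, slash_oddDeriv, h, map_sub, map_smul, map_sum, Finset.sum_sub_distrib, smul_sub]
  rw [oddDeriv_oddDeriv]
  abel

omit hc in
lemma QBar_oddDeriv (a α : Fin 2) (i : OddIndex) (x : Superfield V) : QBar c a α (oddDeriv V i x) =
    -oddDeriv V i (QBar c a α x) + Complex.I • ∑ β, if i = (a, Sum.inl β) then slash c a β α x else 0 := by
  have h : ∀ β, th V (a, Sum.inl β) (oddDeriv V i (slash c a β α x)) =
      (if i = (a, Sum.inl β) then slash c a β α x else 0) - oddDeriv V i (th V (a, Sum.inl β) (slash c a β α x)) := by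
    intro β; rw [oddDeriv_th]; abel
  simp only [QBar_apply, slash_oddDeriv, h, map_add, map_neg, map_smul, map_sum, Finset.sum_sub_distrib, smul_sub]
  rw [oddDeriv_oddDeriv]
  abel

lemma Good.Q_D (a α β : Fin 2) (x : Superfield V) : Q c a α (D c β x) = -D c β (Q c a α x) := by
  simp only [D_apply, map_add, map_smul, map_sum, Q_oddDeriv, Q_th, hc.slash_Q]
  simp
  abel

/-- At the same point Q and D̄ each contribute a term σ^m ∂_m to the anticommutator, and the terms
cancel; the sign change from Q to D is made for this. At different points there is no such term. -/
lemma Good.Q_DBar (a α β : Fin 2) (x : Superfield V) : Q c a α (DBar c β x) = -DBar c β (Q c a α x) := by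
  simp only [DBar_apply, map_sub, map_neg, map_smul, map_sum, Q_oddDeriv, Q_th, hc.slash_Q]
  fin_cases a
  · simp [Finset.sum_sub_distrib, smul_sub]
    abel
  · simp
    abel

lemma Good.QBar_D (a α β : Fin 2) (x : Superfield V) : QBar c a α (D c β x) = -D c β (QBar c a α x) := by
  simp only [D_apply, map_add, map_smul, map_sum, QBar_oddDeriv, QBar_th, hc.slash_QBar]
  fin_cases a
  · simp [Finset.sum_sub_distrib, smul_sub]
    abel
  · simp
    abel

lemma Good.QBar_DBar (a α β : Fin 2) (x : Superfield V) : QBar c a α (DBar c β x) = -DBar c β (QBar c a α x) := by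
  simp only [DBar_apply, map_sub, map_neg, map_smul, map_sum, QBar_oddDeriv, QBar_th, hc.slash_QBar]
  simp
  abel

/-- The supersymmetry generators anticommute to translations. -/
lemma Good.Q_QBar (a α β : Fin 2) (x : Superfield V) :
    Q c a α (QBar c a β x) + QBar c a β (Q c a α x) = (2 * Complex.I) • slash c a α β x := by
  have h : QBar c a β (Q c a α x) = QBar c a β (oddDeriv V (a, Sum.inl α) x) -
      Complex.I • ∑ γ, QBar c a β (th V (a, Sum.inr γ) (slash c a α γ x)) := by
    rw [Q_apply]; simp only [map_sub, map_smul, map_sum]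
  have h' : oddDeriv V (a, Sum.inl α) (QBar c a β x) = Q c a α (QBar c a β x) +
      Complex.I • ∑ γ, th V (a, Sum.inr γ) (QBar c a β (slash c a α γ x)) := by
    rw [Q_apply]; simp only [hc.slash_QBar]; abel
  rw [h]
  simp only [QBar_oddDeriv, QBar_th, h']
  simp [Finset.sum_sub_distrib, smul_sub]
  module

/-- Multiplication by the components of `θ₁ - θ₂`. -/
def zt (V : Type) [AddCommGroup V] [Module ℂ V] (s : Fin 2 ⊕ Fin 2) : Module.End ℂ (Superfield V) :=
  th V (0, s) - th V (1, s)

omit hc in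
lemma zt_apply (s : Fin 2 ⊕ Fin 2) (x : Superfield V) : zt V s x = th V (0, s) x - th V (1, s) x := rfl

omit hc in
lemma zt_eq_mulOp (s : Fin 2 ⊕ Fin 2) (x : Superfield V) : zt V s x = mulOp V (gen (0, s) - gen (1, s)) x := by
  have h := mulOp_add (gen (0, s)) ((-1 : ℂ) • gen (1, s)) x
  rw [mulOp_smul] at h
  rw [zt_apply, sub_eq_add_neg (gen (0, s)), ← neg_one_smul ℂ (gen (1, s)), h]
  module

omit hc in
lemma zt_zt (s t : Fin 2 ⊕ Fin 2) (x : Superfield V) : zt V s (zt V t x) = -zt V t (zt V s x) := by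
  simp only [zt_apply, map_sub]
  rw [th_th (0, t) (0, s), th_th (0, t) (1, s), th_th (1, t) (0, s), th_th (1, t) (1, s)]
  abel

omit hc in
lemma zt_zt_self (s : Fin 2 ⊕ Fin 2) (x : Superfield V) : zt V s (zt V s x) = 0 := by
  simp only [zt_apply, map_sub, th_th_self]
  rw [th_th (0, s) (1, s)]
  abel

omit hc in
-- The constant is -2 · 2: either δ-function sums the two orderings of its pair of anticommuting
-- differences, with opposite overall signs for ζ² and ζ̄².
lemma deltaKernel_eq (H : W) : deltaKernel c H = (-4 : ℂ) •
    zt V (Sum.inl 0) (zt V (Sum.inl 1) (zt V (Sum.inr 0) (zt V (Sum.inr 1) (vac V (c.diff H))))) := by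
  have h1 : deltaKernel c H = mulOp V deltaTheta (mulOp V deltaThetaBar (vac V (c.diff H))) := by
    rw [← mulOp_mul, vac_apply, mulOp_tmul, mul_one]; rfl
  have h2 : ∀ x : Superfield V, mulOp V deltaTheta x = (-2 : ℂ) • zt V (Sum.inl 0) (zt V (Sum.inl 1) x) := by
    intro x
    have e : deltaTheta = (-1 : ℂ) • ((gen (0, Sum.inl 0) - gen (1, Sum.inl 0)) * (gen (0, Sum.inl 1) - gen (1, Sum.inl 1))) +
        (1 : ℂ) • ((gen (0, Sum.inl 1) - gen (1, Sum.inl 1)) * (gen (0, Sum.inl 0) - gen (1, Sum.inl 0))) := by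
      simp [deltaTheta, eps, theta]
    rw [e, mulOp_add, mulOp_smul, mulOp_smul, mulOp_mul, mulOp_mul]
    simp only [← zt_eq_mulOp]
    rw [zt_zt (Sum.inl 1) (Sum.inl 0)]
    module
  have h3 : ∀ x : Superfield V, mulOp V deltaThetaBar x = (2 : ℂ) • zt V (Sum.inr 0) (zt V (Sum.inr 1) x) := by
    intro x
    have e : deltaThetaBar = (-1 : ℂ) • ((gen (0, Sum.inr 1) - gen (1, Sum.inr 1)) * (gen (0, Sum.inr 0) - gen (1, Sum.inr 0))) +
        (1 : ℂ) • ((gen (0, Sum.inr 0) - gen (1, Sum.inr 0)) * (gen (0, Sum.inr 1) - gen (1, Sum.inr 1))) := by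
      simp [deltaThetaBar, eps, thetaBar]
    rw [e, mulOp_add, mulOp_smul, mulOp_smul, mulOp_mul, mulOp_mul]
    simp only [← zt_eq_mulOp]
    rw [zt_zt (Sum.inr 1) (Sum.inr 0)]
    module
  rw [h1, h2, h3]
  simp only [map_smul, smul_smul]
  congr 1
  norm_num

lemma Good.slash2_diff (a α β : Fin 2) (H : W) :
    slash2 c a α β (c.diff H) = (if a = 0 then (1 : ℂ) else -1) • c.diff (slash1 c α β H) := by
  rw [slash2_apply, slash1_apply, map_sum, Finset.smul_sum]
  refine Finset.sum_congr rfl fun m _ => ?_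
  fin_cases a
  · simp [hc.d2_diff_fst]
  · simp [hc.d2_diff_snd]

omit hc in
lemma Q_zt (α : Fin 2) (s : Fin 2 ⊕ Fin 2) (x : Superfield V) :
    (Q c 0 α + Q c 1 α) (zt V s x) = -zt V s ((Q c 0 α + Q c 1 α) x) := by
  simp only [zt_apply, LinearMap.add_apply, map_sub, map_add, Q_th]
  simp
  abel

omit hc in
lemma QBar_zt (α : Fin 2) (s : Fin 2 ⊕ Fin 2) (x : Superfield V) :
    (QBar c 0 α + QBar c 1 α) (zt V s x) = -zt V s ((QBar c 0 α + QBar c 1 α) x) := by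
  simp only [zt_apply, LinearMap.add_apply, map_sub, map_add, QBar_th]
  simp
  abel

lemma Good.Q_vac (α : Fin 2) (H : W) : (Q c 0 α + Q c 1 α) (vac V (c.diff H)) =
    -Complex.I • ∑ β, zt V (Sum.inr β) (vac V (c.diff (slash1 c α β H))) := by
  simp only [LinearMap.add_apply, Q_apply, oddDeriv_vac, slash_vac, hc.slash2_diff, zt_apply, map_smul]
  simp [Finset.sum_sub_distrib]
  module

lemma Good.QBar_vac (α : Fin 2) (H : W) : (QBar c 0 α + QBar c 1 α) (vac V (c.diff H)) =
    Complex.I • ∑ β, zt V (Sum.inl β) (vac V (c.diff (slash1 c β α H))) := by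
  simp only [LinearMap.add_apply, QBar_apply, oddDeriv_vac, slash_vac, hc.slash2_diff, zt_apply, map_smul]
  simp [Finset.sum_sub_distrib]
  module

/-- The total charge anticommutes with θ₁ - θ₂ and θ̄₁ - θ̄₂. Acting on H(x₁ - x₂) it produces only
terms with a factor θ̄₁ - θ̄₂, which the product of all differences annihilates. -/
lemma Good.Q_deltaKernel (α : Fin 2) (H : W) : (Q c 0 α + Q c 1 α) (deltaKernel c H) = 0 := by
  rw [deltaKernel_eq, map_smul, Q_zt, Q_zt, Q_zt, Q_zt, hc.Q_vac]
  simp only [map_neg, map_smul, Fin.sum_univ_two, map_add, zt_zt_self,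
    zt_zt (Sum.inr 1) (Sum.inr 0), map_zero]
  simp

lemma Good.QBar_deltaKernel (α : Fin 2) (H : W) : (QBar c 0 α + QBar c 1 α) (deltaKernel c H) = 0 := by
  rw [deltaKernel_eq, map_smul, QBar_zt, QBar_zt, QBar_zt, QBar_zt, hc.QBar_vac]
  simp only [map_neg, map_smul, Fin.sum_univ_two, map_add, zt_zt (Sum.inr _) (Sum.inl _), zt_zt_self,
    zt_zt (Sum.inl 1) (Sum.inl 0), map_zero]
  simp

end Susy

/-! ### Lorentz covariance -/

section Lorentz

variable {c : CoeffOps W V}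

lemma superLorentz_tmul (A : SL2C) (g : Grassmann) (v : V) :
    superLorentz c A (g ⊗ₜ v) = (ExteriorAlgebra.map (spinLin A) g) ⊗ₜ c.act2 A v := rfl

lemma superLorentz_vac (A : SL2C) (v : V) : superLorentz c A (vac V v) = vac V (c.act2 A v) := by
  rw [vac_apply, superLorentz_tmul, map_one]; rfl

lemma superLorentz_mulOp (A : SL2C) (g : Grassmann) (x : Superfield V) :
    superLorentz c A (mulOp V g x) = mulOp V (ExteriorAlgebra.map (spinLin A) g) (superLorentz c A x) := by
  induction x using TensorProduct.induction_on with
  | zero => simp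
  | add x y hx hy => simp only [map_add, hx, hy]
  | tmul k v => rw [mulOp_tmul, superLorentz_tmul, superLorentz_tmul, mulOp_tmul, map_mul]

lemma map_spinLin_inl (A : SL2C) (a α : Fin 2) :
    ExteriorAlgebra.map (spinLin A) (gen (a, Sum.inl α)) = ∑ β, (A⁻¹).1 β α • gen (a, Sum.inl β) := by
  have h : spinLin A (Pi.single (a, Sum.inl α) 1) = ∑ β, (A⁻¹).1 β α • Pi.single (a, Sum.inl β) (1:ℂ) := by
    ext ⟨b, γ | γ⟩
    · fin_cases a <;> fin_cases b <;> fin_cases α <;> fin_cases γ <;> simp [spinLin, Pi.single_apply]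
    · simp [spinLin]
  simp only [gen, ExteriorAlgebra.map_apply_ι, h, map_sum, map_smul]

lemma map_spinLin_inr (A : SL2C) (a α : Fin 2) :
    ExteriorAlgebra.map (spinLin A) (gen (a, Sum.inr α)) = ∑ β, star ((A⁻¹).1 β α) • gen (a, Sum.inr β) := by
  have h : spinLin A (Pi.single (a, Sum.inr α) 1) = ∑ β, star ((A⁻¹).1 β α) • Pi.single (a, Sum.inr β) (1:ℂ) := by
    ext ⟨b, γ | γ⟩
    · simp [spinLin]
    · fin_cases a <;> fin_cases b <;> fin_cases α <;> fin_cases γ <;> simp [spinLin, Pi.single_apply]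
  simp only [gen, ExteriorAlgebra.map_apply_ι, h, map_sum, map_smul]

lemma superLorentz_th_inl (A : SL2C) (a α : Fin 2) (x : Superfield V) :
    superLorentz c A (th V (a, Sum.inl α) x) = ∑ β, (A⁻¹).1 β α • th V (a, Sum.inl β) (superLorentz c A x) := by
  rw [superLorentz_mulOp, map_spinLin_inl, Fin.sum_univ_two, mulOp_add, mulOp_smul, mulOp_smul, Fin.sum_univ_two]

lemma superLorentz_th_inr (A : SL2C) (a α : Fin 2) (x : Superfield V) :
    superLorentz c A (th V (a, Sum.inr α) x) =
      ∑ β, star ((A⁻¹).1 β α) • th V (a, Sum.inr β) (superLorentz c A x) := by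
  rw [superLorentz_mulOp, map_spinLin_inr, Fin.sum_univ_two, mulOp_add, mulOp_smul, mulOp_smul, Fin.sum_univ_two]

/-- The chain rule for odd derivatives under a linear substitution, by induction on products: both
sides obey the same graded Leibniz rule. -/
lemma contractLeft_map (f : (OddIndex → ℂ) →ₗ[ℂ] (OddIndex → ℂ)) (d : Module.Dual ℂ (OddIndex → ℂ)) (g : Grassmann) :
    (CliffordAlgebra.contractLeft d (ExteriorAlgebra.map f g) : Grassmann) =
      ExteriorAlgebra.map f (CliffordAlgebra.contractLeft (d ∘ₗ f) g : Grassmann) := by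
  induction g using CliffordAlgebra.left_induction with
  | algebraMap r =>
    have h1 : ExteriorAlgebra.map f (algebraMap ℂ Grassmann r) = algebraMap ℂ Grassmann r := AlgHom.commutes _ _
    have h2 : (CliffordAlgebra.contractLeft d (algebraMap ℂ Grassmann r) : Grassmann) = 0 :=
      CliffordAlgebra.contractLeft_algebraMap _ _ _
    have h3 : (CliffordAlgebra.contractLeft (d ∘ₗ f) (algebraMap ℂ Grassmann r) : Grassmann) = 0 :=
      CliffordAlgebra.contractLeft_algebraMap _ _ _
    exact (congrArg _ h1).trans (h2.trans (by rw [← map_zero (ExteriorAlgebra.map f), ← h3]))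
  | add x y hx hy =>
    have h1 : ExteriorAlgebra.map f (x + y : Grassmann) = ExteriorAlgebra.map f x + ExteriorAlgebra.map f y :=
      map_add _ _ _
    refine (congrArg _ h1).trans ((map_add _ _ _).trans ((congrArg₂ _ hx hy).trans ?_))
    exact ((congrArg (ExteriorAlgebra.map f) (map_add _ x y)).trans (map_add _ _ _)).symm
  | ι_mul x u hx =>
    have h1 : ExteriorAlgebra.map f ((ExteriorAlgebra.ι ℂ u * x : Grassmann)) =
        ExteriorAlgebra.ι ℂ (f u) * ExteriorAlgebra.map f x := by
      rw [map_mul, ExteriorAlgebra.map_apply_ι]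
    have h2 : (CliffordAlgebra.contractLeft d (ExteriorAlgebra.ι ℂ (f u) * ExteriorAlgebra.map f x : Grassmann) : Grassmann) =
        d (f u) • ExteriorAlgebra.map f x - ExteriorAlgebra.ι ℂ (f u) *
          (CliffordAlgebra.contractLeft d (ExteriorAlgebra.map f x) : Grassmann) :=
      CliffordAlgebra.contractLeft_ι_mul _ _ _
    have h3 : (CliffordAlgebra.contractLeft (d ∘ₗ f) (ExteriorAlgebra.ι ℂ u * x : Grassmann) : Grassmann) =
        d (f u) • x - ExteriorAlgebra.ι ℂ u * (CliffordAlgebra.contractLeft (d ∘ₗ f) x : Grassmann) :=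
      CliffordAlgebra.contractLeft_ι_mul _ _ _
    refine (congrArg _ h1).trans (h2.trans ?_)
    refine Eq.trans ?_ (congrArg (ExteriorAlgebra.map f) h3).symm
    rw [hx, map_sub, map_smul, map_mul, ExteriorAlgebra.map_apply_ι]

lemma oddDeriv_superLorentz_aux (A : SL2C) (i : OddIndex) (r : Fin 2 → ℂ) (j : Fin 2 → OddIndex)
    (h : (LinearMap.proj i : Module.Dual ℂ (OddIndex → ℂ)) ∘ₗ spinLin A = ∑ α, r α • LinearMap.proj (j α))
    (x : Superfield V) :
    oddDeriv V i (superLorentz c A x) = ∑ α, r α • superLorentz c A (oddDeriv V (j α) x) := by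
  induction x using TensorProduct.induction_on with
  | zero => simp
  | add x y hx hy => simp only [map_add, hx, hy, smul_add, Finset.sum_add_distrib]
  | tmul k v =>
    simp only [superLorentz_tmul, oddDeriv_tmul]
    rw [contractLeft_map, h]
    simp only [map_sum, map_smul, LinearMap.sum_apply, LinearMap.smul_apply, TensorProduct.sum_tmul,
      TensorProduct.smul_tmul']

lemma oddDeriv_inl_superLorentz (A : SL2C) (a β : Fin 2) (x : Superfield V) :
    oddDeriv V (a, Sum.inl β) (superLorentz c A x) =
      ∑ α, (A⁻¹).1 β α • superLorentz c A (oddDeriv V (a, Sum.inl α) x) := by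
  refine oddDeriv_superLorentz_aux A _ _ _ (LinearMap.ext fun u => ?_) x
  simp [spinLin]

lemma oddDeriv_inr_superLorentz (A : SL2C) (a β : Fin 2) (x : Superfield V) :
    oddDeriv V (a, Sum.inr β) (superLorentz c A x) =
      ∑ α, star ((A⁻¹).1 β α) • superLorentz c A (oddDeriv V (a, Sum.inr α) x) := by
  refine oddDeriv_superLorentz_aux A _ _ _ (LinearMap.ext fun u => ?_) x
  simp [spinLin]

lemma aug_superLorentz (A : SL2C) (x : Superfield V) : aug V (superLorentz c A x) = c.act2 A (aug V x) := by
  induction x using TensorProduct.induction_on with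
  | zero => simp
  | add x y hx hy => simp only [map_add, hx, hy]
  | tmul k v =>
    have h : ∀ g : Grassmann, ExteriorAlgebra.algebraMapInv (R := ℂ) (ExteriorAlgebra.map (spinLin A) g) =
        ExteriorAlgebra.algebraMapInv (R := ℂ) g := by
      intro g
      have h1 : (ExteriorAlgebra.algebraMapInv (R := ℂ) (M := OddIndex → ℂ)).comp (ExteriorAlgebra.map (spinLin A)) =
          ExteriorAlgebra.algebraMapInv := by
        ext u
        simp [ExteriorAlgebra.algebraMapInv]
      exact congrArg (fun f => f g) h1
    rw [superLorentz_tmul, aug_tmul, aug_tmul, h, map_smul]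

/-- Invariance of σ^m solved for A⁻¹. It converts the transformation of ∂_m into one of the two
spinor indices of σ^m ∂_m. -/
lemma inv_mul_sigma (A : SL2C) (n : Fin 4) (β γ : Fin 2) :
    ∑ m, (lorentzMatrix A n m : ℂ) * sigma m β γ =
      ∑ α, ∑ δ, (A⁻¹).1 β α * star ((A⁻¹).1 γ δ) * sigma n α δ := by
  have h := sum_lorentzMatrix_sigma A n
  have hA : (A⁻¹).1 * A.1 = 1 := by
    rw [← Matrix.SpecialLinearGroup.coe_mul, inv_mul_cancel, Matrix.SpecialLinearGroup.coe_one]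
  have hA' : A.1.conjTranspose * (A⁻¹).1.conjTranspose = 1 := by
    rw [← Matrix.conjTranspose_mul, hA, Matrix.conjTranspose_one]
  have h1 : ∑ m, lorentzMatrix A n m • sigma m = (A⁻¹).1 * sigma n * (A⁻¹).1.conjTranspose := by
    rw [← h, Finset.mul_sum, Finset.sum_mul]
    refine Finset.sum_congr rfl fun m _ => ?_
    rw [mul_smul_comm, smul_mul_assoc]
    congr 1
    have h2 : (A⁻¹).1 * (A.1 * sigma m * A.1.conjTranspose) * (A⁻¹).1.conjTranspose =
        ((A⁻¹).1 * A.1) * sigma m * (A.1.conjTranspose * (A⁻¹).1.conjTranspose) := by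
      simp only [mul_assoc]
    rw [h2, hA, hA', one_mul, mul_one]
  have h2 := congrFun (congrFun h1 β) γ
  simp only [Matrix.sum_apply, Matrix.smul_apply, Matrix.mul_apply, Fin.sum_univ_two, Matrix.conjTranspose_apply,
    Complex.real_smul] at h2
  rw [h2]
  simp only [Fin.sum_univ_two]
  ring

variable {X : Fin 4 → Module.End ℂ W} (hc : Good c X)
include hc

lemma Good.evenDeriv_superLorentz (A : SL2C) (a : Fin 2) (m : Fin 4) (x : Superfield V) :
    evenDeriv c a m (superLorentz c A x) =
      ∑ n, (lorentzMatrix A n m : ℂ) • superLorentz c A (evenDeriv c a n x) := by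
  induction x using TensorProduct.induction_on with
  | zero => simp
  | add x y hx hy => simp only [map_add, hx, hy, smul_add, Finset.sum_add_distrib]
  | tmul k v =>
    simp only [superLorentz_tmul, evenDeriv_tmul, hc.d2_act2, TensorProduct.tmul_sum, TensorProduct.tmul_smul]

lemma Good.slash_superLorentz (A : SL2C) (a β γ : Fin 2) (x : Superfield V) :
    slash c a β γ (superLorentz c A x) =
      ∑ α, ∑ δ, ((A⁻¹).1 β α * star ((A⁻¹).1 γ δ)) • superLorentz c A (slash c a α δ x) := by
  simp only [slash_apply, hc.evenDeriv_superLorentz, map_sum, map_smul, Finset.smul_sum, smul_smul]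
  rw [Finset.sum_comm]
  have h : ∀ n, ∑ m, (sigma m β γ * (lorentzMatrix A n m : ℂ)) • superLorentz c A (evenDeriv c a n x) =
      ∑ α, ∑ δ, ((A⁻¹).1 β α * star ((A⁻¹).1 γ δ) * sigma n α δ) • superLorentz c A (evenDeriv c a n x) := by
    intro n
    simp only [← Finset.sum_smul]
    rw [← inv_mul_sigma]
    simp only [mul_comm]
  simp only [h]
  rw [Finset.sum_comm]
  refine Finset.sum_congr rfl fun α _ => ?_
  rw [Finset.sum_comm]

lemma Good.D_superLorentz (A : SL2C) (β : Fin 2) (x : Superfield V) :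
    D c β (superLorentz c A x) = ∑ α, (A⁻¹).1 β α • superLorentz c A (D c α x) := by
  simp only [D_apply, oddDeriv_inl_superLorentz, hc.slash_superLorentz, map_add, map_smul, superLorentz_th_inr, Fin.sum_univ_two]
  module

lemma Good.DBar_superLorentz (A : SL2C) (β : Fin 2) (x : Superfield V) :
    DBar c β (superLorentz c A x) = ∑ α, star ((A⁻¹).1 β α) • superLorentz c A (DBar c α x) := by
  simp only [DBar_apply, oddDeriv_inr_superLorentz, hc.slash_superLorentz, map_sub, map_neg, map_smul, map_add,
    superLorentz_th_inl, Fin.sum_univ_two]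
  module

omit hc in
lemma DSq_apply (x : Superfield V) : DSq c x = D c 1 (D c 0 x) - D c 0 (D c 1 x) := by
  simp [DSq, eps]; abel

omit hc in
lemma DBarSq_apply (x : Superfield V) : DBarSq c x = DBar c 0 (DBar c 1 x) - DBar c 1 (DBar c 0 x) := by
  simp [DBarSq, eps]; abel

omit hc in
lemma DDBarSqD_apply (x : Superfield V) :
    DDBarSqD c x = D c 1 (DBarSq c (D c 0 x)) - D c 0 (DBarSq c (D c 1 x)) := by
  simp [DDBarSqD, eps]; abel

omit hc in
lemma det_inv_eq (A : SL2C) : (A⁻¹).1 0 0 * (A⁻¹).1 1 1 - (A⁻¹).1 0 1 * (A⁻¹).1 1 0 = 1 := by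
  rw [← Matrix.det_fin_two]; exact (A⁻¹).2

omit hc in
lemma star_det_inv_eq (A : SL2C) : star ((A⁻¹).1 0 0) * star ((A⁻¹).1 1 1) - star ((A⁻¹).1 0 1) * star ((A⁻¹).1 1 0) = 1 := by
  have h := congrArg star (det_inv_eq A)
  simpa [mul_comm] using h

/-- An antisymmetric product of two spinors is multiplied by the determinant of the spinor matrix,
which is 1. -/
lemma Good.DSq_superLorentz (A : SL2C) (x : Superfield V) :
    DSq c (superLorentz c A x) = superLorentz c A (DSq c x) := by
  have h := det_inv_eq A
  simp only [DSq_apply, hc.D_superLorentz, map_sub, map_smul, Fin.sum_univ_two, map_add]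
  linear_combination (norm := module) h • (superLorentz c A (D c 1 (D c 0 x)) - superLorentz c A (D c 0 (D c 1 x)))

lemma Good.DBarSq_superLorentz (A : SL2C) (x : Superfield V) :
    DBarSq c (superLorentz c A x) = superLorentz c A (DBarSq c x) := by
  have h := star_det_inv_eq A
  simp only [DBarSq_apply, hc.DBar_superLorentz, map_sub, map_smul, Fin.sum_univ_two, map_add]
  linear_combination (norm := module) h • (superLorentz c A (DBar c 0 (DBar c 1 x)) - superLorentz c A (DBar c 1 (DBar c 0 x)))

lemma Good.DDBarSqD_superLorentz (A : SL2C) (x : Superfield V) :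
    DDBarSqD c (superLorentz c A x) = superLorentz c A (DDBarSqD c x) := by
  have h := det_inv_eq A
  simp only [DDBarSqD_apply, hc.D_superLorentz, hc.DBarSq_superLorentz, map_sub, map_smul, Fin.sum_univ_two, map_add]
  linear_combination (norm := module) h • (superLorentz c A (D c 1 (DBarSq c (D c 0 x))) -
    superLorentz c A (D c 0 (DBarSq c (D c 1 x))))

lemma Good.superLorentz_deltaKernel (A : SL2C) {H : W} (hH : IsLorentzInvariant c H) :
    superLorentz c A (deltaKernel c H) = deltaKernel c H := by
  have h := det_inv_eq A
  have h' := star_det_inv_eq A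
  have h1 : ∀ α x, superLorentz c A (zt V (Sum.inl α) x) = ∑ β, (A⁻¹).1 β α • zt V (Sum.inl β) (superLorentz c A x) := by
    intro α x
    simp only [zt_apply, map_sub, superLorentz_th_inl, smul_sub, Finset.sum_sub_distrib]
  have h2 : ∀ α x, superLorentz c A (zt V (Sum.inr α) x) = ∑ β, star ((A⁻¹).1 β α) • zt V (Sum.inr β) (superLorentz c A x) := by
    intro α x
    simp only [zt_apply, map_sub, superLorentz_th_inr, smul_sub, Finset.sum_sub_distrib]
  have h3 : ∀ x, superLorentz c A (zt V (Sum.inl 0) (zt V (Sum.inl 1) x)) =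
      zt V (Sum.inl 0) (zt V (Sum.inl 1) (superLorentz c A x)) := by
    intro x
    simp only [h1, map_smul, map_add, Fin.sum_univ_two, zt_zt_self, zt_zt (Sum.inl 1) (Sum.inl 0)]
    linear_combination (norm := module) h • zt V (Sum.inl 0) (zt V (Sum.inl 1) (superLorentz c A x))
  have h4 : ∀ x, superLorentz c A (zt V (Sum.inr 0) (zt V (Sum.inr 1) x)) =
      zt V (Sum.inr 0) (zt V (Sum.inr 1) (superLorentz c A x)) := by
    intro x
    simp only [h2, map_smul, map_add, Fin.sum_univ_two, zt_zt_self, zt_zt (Sum.inr 1) (Sum.inr 0)]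
    linear_combination (norm := module) h' • zt V (Sum.inr 0) (zt V (Sum.inr 1) (superLorentz c A x))
  rw [deltaKernel_eq, map_smul, h3, h4, superLorentz_vac, hc.act2_diff, hH]

end Lorentz

end Covariance

/-! ### Components of invariant kernels -/

section Components

variable {W V : Type} [AddCommGroup W] [Module ℂ W] [AddCommGroup V] [Module ℂ V] {c : CoeffOps W V}

lemma oddDeriv_zt (i : OddIndex) (s : Fin 2 ⊕ Fin 2) (x : Superfield V) : oddDeriv V i (zt V s x) =
    (if i = (0, s) then x else 0) - (if i = (1, s) then x else 0) - zt V s (oddDeriv V i x) := by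
  simp only [zt_apply, map_sub, oddDeriv_th]
  abel

lemma aug_zt (s : Fin 2 ⊕ Fin 2) (x : Superfield V) : aug V (zt V s x) = 0 := by
  rw [zt_apply, map_sub, aug_th, aug_th, sub_zero]

variable (c) in
lemma oddDeriv_D (i : OddIndex) (α : Fin 2) (x : Superfield V) : oddDeriv V i (D c α x) =
    (Complex.I • ∑ β, if i = (0, Sum.inr β) then slash c 0 α β x else 0) - D c α (oddDeriv V i x) := by
  simp only [D_apply, map_add, map_smul, map_sum, oddDeriv_th, slash_oddDeriv, Finset.sum_sub_distrib, smul_sub]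
  rw [oddDeriv_oddDeriv]
  abel

variable (c) in
lemma oddDeriv_DBar (i : OddIndex) (α : Fin 2) (x : Superfield V) : oddDeriv V i (DBar c α x) =
    -(Complex.I • ∑ β, if i = (0, Sum.inl β) then slash c 0 β α x else 0) - DBar c α (oddDeriv V i x) := by
  simp only [DBar_apply, map_sub, map_neg, map_smul, map_sum, oddDeriv_th, slash_oddDeriv,
    Finset.sum_sub_distrib, smul_sub]
  rw [oddDeriv_oddDeriv]
  abel

lemma aug_D (α : Fin 2) (x : Superfield V) : aug V (D c α x) = aug V (oddDeriv V (0, Sum.inl α) x) := by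
  simp only [D_apply, map_add, map_smul, map_sum, aug_th, Finset.sum_const_zero, smul_zero, add_zero]

lemma aug_DBar (α : Fin 2) (x : Superfield V) : aug V (DBar c α x) = -aug V (oddDeriv V (0, Sum.inr α) x) := by
  simp only [DBar_apply, map_sub, map_neg, map_smul, map_sum, aug_th, Finset.sum_const_zero, smul_zero, sub_zero]

/-! #### Components of chiral and antichiral superfields -/

/-- D_α x = 0 replaces ∂_α by -i θ̄ σ^m ∂_m. Every component in the list is thereby reduced to the
lowest one, and two undotted derivatives leave a factor θ̄θ̄ without constant term. -/
lemma comp_antichiral {x : Superfield V} (hx : ∀ α, D c α x = 0) :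
    comp [(0, Sum.inl 0), (0, Sum.inl 1)] x = 0 ∧
    (∀ α β, comp [(0, Sum.inl α), (0, Sum.inr β)] x = -Complex.I • slash2 c 0 α β (aug V x)) ∧
    comp [(0, Sum.inl 0), (0, Sum.inl 1), (0, Sum.inr 0), (0, Sum.inr 1)] x =
      slash2 c 0 0 0 (slash2 c 0 1 1 (aug V x)) - slash2 c 0 0 1 (slash2 c 0 1 0 (aug V x)) := by
  have h : ∀ α, oddDeriv V (0, Sum.inl α) x = -Complex.I • ∑ β, th V (0, Sum.inr β) (slash c 0 α β x) := by
    intro α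
    have := hx α
    rw [D_apply, add_eq_zero_iff_eq_neg] at this
    rw [this]; module
  refine ⟨?_, fun α β => ?_, ?_⟩
  · simp [h, oddDeriv_th, aug_th]
  · fin_cases α <;> fin_cases β <;> simp [h, oddDeriv_th, aug_th, aug_slash]
  · simp [h, oddDeriv_th, aug_th, aug_slash, ← slash_oddDeriv, slash_th, smul_smul]
    abel

lemma comp_chiral {x : Superfield V} (hx : ∀ α, DBar c α x = 0) :
    comp [(0, Sum.inr 0), (0, Sum.inr 1)] x = 0 ∧
    (∀ α β, comp [(0, Sum.inl α), (0, Sum.inr β)] x = Complex.I • slash2 c 0 α β (aug V x)) ∧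
    comp [(0, Sum.inl 0), (0, Sum.inl 1), (0, Sum.inr 0), (0, Sum.inr 1)] x =
      slash2 c 0 0 0 (slash2 c 0 1 1 (aug V x)) - slash2 c 0 1 0 (slash2 c 0 0 1 (aug V x)) := by
  have h : ∀ α, oddDeriv V (0, Sum.inr α) x = -Complex.I • ∑ β, th V (0, Sum.inl β) (slash c 0 β α x) := by
    intro α
    have := hx α
    rw [DBar_apply, sub_eq_zero] at this
    have h := congrArg Neg.neg this
    rw [neg_neg] at h
    rw [h]; module
  refine ⟨?_, fun α β => ?_, ?_⟩
  · simp [h, oddDeriv_th, aug_th]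
  · rw [comp_cons, comp_cons, comp_nil, oddDeriv_oddDeriv]
    fin_cases α <;> fin_cases β <;> simp [h, oddDeriv_th, aug_th, aug_slash]
  -- Moving the pair of dotted derivatives past the pair of undotted ones is an even permutation.
  · have h1 : ∀ x : Superfield V, comp [(0, Sum.inl 0), (0, Sum.inl 1), (0, Sum.inr 0), (0, Sum.inr 1)] x =
        comp [(0, Sum.inr 0), (0, Sum.inr 1), (0, Sum.inl 0), (0, Sum.inl 1)] x := by
      intro x
      simp only [comp_cons, comp_nil]
      rw [oddDeriv_oddDeriv (0, Sum.inr 0) (0, Sum.inl 1), oddDeriv_oddDeriv (0, Sum.inr 0) (0, Sum.inl 0)]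
      simp only [map_neg, neg_neg]
      rw [oddDeriv_oddDeriv (0, Sum.inr 1) (0, Sum.inl 1), oddDeriv_oddDeriv (0, Sum.inr 1) (0, Sum.inl 0)]
      simp only [map_neg, neg_neg]
    rw [h1]
    simp [h, oddDeriv_th, aug_th, aug_slash, ← slash_oddDeriv, slash_th, smul_smul]
    abel

/-! #### The algebra of covariant derivatives -/

section Good

variable {X : Fin 4 → Module.End ℂ W} (hc : Good c X)
include hc

lemma Good.slash_D (α β γ : Fin 2) (x : Superfield V) : slash c 0 β γ (D c α x) = D c α (slash c 0 β γ x) := by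
  simp only [D_apply, map_add, map_smul, map_sum, slash_oddDeriv, slash_th, hc.slash_comm 0 0]

lemma Good.slash_DBar (α β γ : Fin 2) (x : Superfield V) :
    slash c 0 β γ (DBar c α x) = DBar c α (slash c 0 β γ x) := by
  simp only [DBar_apply, map_sub, map_neg, map_smul, map_sum, slash_oddDeriv, slash_th, hc.slash_comm 0 0]

omit hc in
lemma D_th (α : Fin 2) (i : OddIndex) (x : Superfield V) : D c α (th V i x) =
    (if (0, Sum.inl α) = i then x else 0) - th V i (D c α x) := by
  have h : ∀ β, th V (0, Sum.inr β) (th V i (slash c 0 α β x)) =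
    -th V i (th V (0, Sum.inr β) (slash c 0 α β x)) := fun β => th_th ..
  simp only [D_apply, oddDeriv_th, slash_th, h, map_add, map_smul, map_sum, Finset.sum_neg_distrib]
  module

omit hc in
lemma DBar_th (α : Fin 2) (i : OddIndex) (x : Superfield V) : DBar c α (th V i x) =
    -(if (0, Sum.inr α) = i then x else 0) - th V i (DBar c α x) := by
  have h : ∀ β, th V (0, Sum.inl β) (th V i (slash c 0 β α x)) =
    -th V i (th V (0, Sum.inl β) (slash c 0 β α x)) := fun β => th_th ..
  simp only [DBar_apply, oddDeriv_th, slash_th, h, map_sub, map_neg, map_smul, map_sum, Finset.sum_neg_distrib]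
  module

lemma Good.D_D (α β : Fin 2) (x : Superfield V) : D c α (D c β x) = -D c β (D c α x) := by
  rw [D_apply c α]
  simp only [hc.slash_D, oddDeriv_D]
  simp only [D_apply c α, map_add, map_smul, map_sum, D_th]
  simp
  abel

lemma Good.DBar_DBar (α β : Fin 2) (x : Superfield V) : DBar c α (DBar c β x) = -DBar c β (DBar c α x) := by
  rw [DBar_apply c α]
  simp only [hc.slash_DBar, oddDeriv_DBar]
  simp only [DBar_apply c α, map_sub, map_neg, map_smul, map_sum, DBar_th]
  simp
  abel

lemma Good.DBar_D (α β : Fin 2) (x : Superfield V) :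
    DBar c β (D c α x) = -D c α (DBar c β x) - (2 * Complex.I) • slash c 0 α β x := by
  rw [DBar_apply c β]
  simp only [hc.slash_D, oddDeriv_D]
  simp only [DBar_apply c β, map_sub, map_neg, map_smul, map_sum, D_th]
  simp [Finset.sum_sub_distrib, smul_sub]
  module

lemma Good.D_D_self (α : Fin 2) (x : Superfield V) : D c α (D c α x) = 0 := by
  have h : (2 : ℂ) • D c α (D c α x) = 0 := by
    rw [two_smul]; nth_rw 1 [hc.D_D]; exact neg_add_cancel _
  exact (smul_eq_zero.1 h).resolve_left two_ne_zero

lemma Good.DBar_DBar_self (α : Fin 2) (x : Superfield V) : DBar c α (DBar c α x) = 0 := by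
  have h : (2 : ℂ) • DBar c α (DBar c α x) = 0 := by
    rw [two_smul]; nth_rw 1 [hc.DBar_DBar]; exact neg_add_cancel _
  exact (smul_eq_zero.1 h).resolve_left two_ne_zero

lemma Good.DSq_eq (x : Superfield V) : DSq c x = (-2 : ℂ) • D c 0 (D c 1 x) := by
  rw [DSq_apply, hc.D_D 1 0]; module

lemma Good.DBarSq_eq (x : Superfield V) : DBarSq c x = (2 : ℂ) • DBar c 0 (DBar c 1 x) := by
  rw [DBarSq_apply, hc.DBar_DBar 1 0]; module

lemma Good.D_DSq (α : Fin 2) (x : Superfield V) : D c α (DSq c x) = 0 := by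
  rw [hc.DSq_eq, map_smul]
  fin_cases α
  · simp [hc.D_D_self]
  · simp [hc.D_D 1 0, hc.D_D_self]

lemma Good.DBar_DBarSq (α : Fin 2) (x : Superfield V) : DBar c α (DBarSq c x) = 0 := by
  rw [hc.DBarSq_eq, map_smul]
  fin_cases α
  · simp [hc.DBar_DBar_self]
  · simp [hc.DBar_DBar 1 0, hc.DBar_DBar_self]

/-- The completeness relation of the superspin projectors. -/
lemma Good.DDBarSqD_eq (x : Superfield V) : DDBarSqD c x = (1 / 2 : ℂ) • (DSq c (DBarSq c x) + DBarSq c (DSq c x)) +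
    (8 : ℂ) • (slash c 0 0 0 (slash c 0 1 1 x) - slash c 0 0 1 (slash c 0 1 0 x)) := by
  have hI : Complex.I * Complex.I = -1 := Complex.I_mul_I
  simp only [DDBarSqD_apply, hc.DSq_eq, hc.DBarSq_eq, map_smul, hc.DBar_D, map_sub, map_neg, ← hc.slash_D, ← hc.slash_DBar,
    hc.D_D 1 0, hc.slash_comm 0 0 1, smul_sub, smul_neg, smul_smul]
  match_scalars <;> first | ring1 | linear_combination (-8) * hI | linear_combination 8 * hI

end Good

/-! #### The components of the delta kernel -/

section Delta

variable (H : W)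

lemma aug_deltaKernel : aug V (deltaKernel c H) = 0 := by
  simp [deltaKernel_eq, aug_zt]

/-- Two derivatives leave at least two of the four odd differences in every term. -/
lemma aug_oddDeriv₂_deltaKernel (i j : OddIndex) : aug V (oddDeriv V i (oddDeriv V j (deltaKernel c H))) = 0 := by
  simp only [deltaKernel_eq, oddDeriv_zt, map_smul, map_sub, apply_ite (oddDeriv V _), apply_ite (aug V), apply_ite (zt V _), map_zero,
    aug_zt, sub_zero, ite_self, smul_zero]

lemma comp_full_deltaKernel :
    aug V (oddDeriv V (0, Sum.inr 1) (oddDeriv V (0, Sum.inr 0)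
      (oddDeriv V (0, Sum.inl 1) (oddDeriv V (0, Sum.inl 0) (deltaKernel c H))))) = (-4 : ℂ) • c.diff H := by
  simp [deltaKernel_eq, oddDeriv_zt, oddDeriv_vac]

lemma comp_full_deltaKernel' :
    aug V (oddDeriv V (0, Sum.inl 1) (oddDeriv V (0, Sum.inl 0)
      (oddDeriv V (0, Sum.inr 1) (oddDeriv V (0, Sum.inr 0) (deltaKernel c H))))) = (-4 : ℂ) • c.diff H := by
  simp [deltaKernel_eq, oddDeriv_zt, oddDeriv_vac]

variable {X : Fin 4 → Module.End ℂ W} (hc : Good c X)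
include hc

lemma Good.aug_DSq_deltaKernel : aug V (DSq c (deltaKernel c H)) = 0 := by
  simp [hc.DSq_eq, aug_D, oddDeriv_D, aug_oddDeriv₂_deltaKernel]

lemma Good.aug_DBarSq_deltaKernel : aug V (DBarSq c (deltaKernel c H)) = 0 := by
  simp [hc.DBarSq_eq, aug_DBar, oddDeriv_DBar, aug_oddDeriv₂_deltaKernel]

lemma Good.comp_DSq_deltaKernel :
    comp [(0, Sum.inr 0), (0, Sum.inr 1)] (DSq c (deltaKernel c H)) = (-8 : ℂ) • c.diff H := by
  simp [hc.DSq_eq, aug_D, oddDeriv_D, aug_slash, ← slash_oddDeriv, hc.slash_D, aug_oddDeriv₂_deltaKernel, aug_deltaKernel, comp_full_deltaKernel']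
  module

lemma Good.comp_DBarSq_deltaKernel :
    comp [(0, Sum.inl 0), (0, Sum.inl 1)] (DBarSq c (deltaKernel c H)) = (8 : ℂ) • c.diff H := by
  simp [hc.DBarSq_eq, aug_DBar, oddDeriv_DBar, aug_slash, ← slash_oddDeriv, hc.slash_DBar, aug_oddDeriv₂_deltaKernel, aug_deltaKernel, comp_full_deltaKernel]
  module

/-- The terms with σ^m ∂_m involve components of degree below four, which vanish. The remaining full
derivative gives 16 = (-2) · 2 · (-4), from D², D̄² and the kernel. -/
lemma Good.aug_DSq_DBarSq_deltaKernel : aug V (DSq c (DBarSq c (deltaKernel c H))) = (16 : ℂ) • c.diff H := by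
  simp [hc.DSq_eq, hc.DBarSq_eq, aug_D, aug_DBar, oddDeriv_D, oddDeriv_DBar, aug_slash, ← slash_oddDeriv, hc.slash_DBar, aug_oddDeriv₂_deltaKernel, aug_deltaKernel, comp_full_deltaKernel]
  module

lemma Good.aug_DBarSq_DSq_deltaKernel : aug V (DBarSq c (DSq c (deltaKernel c H))) = (16 : ℂ) • c.diff H := by
  simp [hc.DSq_eq, hc.DBarSq_eq, aug_D, aug_DBar, oddDeriv_D, oddDeriv_DBar, aug_slash, ← slash_oddDeriv, hc.slash_D, aug_oddDeriv₂_deltaKernel, aug_deltaKernel, comp_full_deltaKernel']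
  module

end Delta

end Components

section Invariance

variable {W V : Type} [AddCommGroup W] [Module ℂ W] [AddCommGroup V] [Module ℂ V] {c : CoeffOps W V}

/-! ### Invariant superfields -/

lemma IsInvariant.add {x y : Superfield V} (hx : IsInvariant c x) (hy : IsInvariant c y) : IsInvariant c (x + y) where
  susy α := by rw [map_add, hx.susy, hy.susy, add_zero]
  susyBar α := by rw [map_add, hx.susyBar, hy.susyBar, add_zero]
  lorentz A := by rw [map_add, hx.lorentz, hy.lorentz]

lemma IsInvariant.smul {x : Superfield V} (r : ℂ) (hx : IsInvariant c x) : IsInvariant c (r • x) where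
  susy α := by rw [map_smul, hx.susy, smul_zero]
  susyBar α := by rw [map_smul, hx.susyBar, smul_zero]
  lorentz A := by rw [map_smul, hx.lorentz]

lemma IsInvariant.sub {x y : Superfield V} (hx : IsInvariant c x) (hy : IsInvariant c y) : IsInvariant c (x - y) where
  susy α := by rw [map_sub, hx.susy, hy.susy, sub_zero]
  susyBar α := by rw [map_sub, hx.susyBar, hy.susyBar, sub_zero]
  lorentz A := by rw [map_sub, hx.lorentz, hy.lorentz]

section Good

variable {X : Fin 4 → Module.End ℂ W} (hc : Good c X)
include hc

lemma Good.invariant_deltaKernel {H : W} (hH : IsLorentzInvariant c H) : IsInvariant c (deltaKernel c H) where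
  susy α := hc.Q_deltaKernel α H
  susyBar α := hc.QBar_deltaKernel α H
  lorentz A := hc.superLorentz_deltaKernel A hH

lemma Good.susy_D (α β : Fin 2) (x : Superfield V) :
    (Q c 0 α + Q c 1 α) (D c β x) = -D c β ((Q c 0 α + Q c 1 α) x) := by
  simp only [LinearMap.add_apply, hc.Q_D, map_add]; abel

lemma Good.susy_DBar (α β : Fin 2) (x : Superfield V) :
    (Q c 0 α + Q c 1 α) (DBar c β x) = -DBar c β ((Q c 0 α + Q c 1 α) x) := by
  simp only [LinearMap.add_apply, hc.Q_DBar, map_add]; abel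

lemma Good.susyBar_D (α β : Fin 2) (x : Superfield V) :
    (QBar c 0 α + QBar c 1 α) (D c β x) = -D c β ((QBar c 0 α + QBar c 1 α) x) := by
  simp only [LinearMap.add_apply, hc.QBar_D, map_add]; abel

lemma Good.susyBar_DBar (α β : Fin 2) (x : Superfield V) :
    (QBar c 0 α + QBar c 1 α) (DBar c β x) = -DBar c β ((QBar c 0 α + QBar c 1 α) x) := by
  simp only [LinearMap.add_apply, hc.QBar_DBar, map_add]; abel

lemma Good.invariant_DSq {x : Superfield V} (hx : IsInvariant c x) : IsInvariant c (DSq c x) where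
  susy α := by simp only [DSq_apply, map_sub, hc.susy_D, hx.susy, map_zero, neg_zero, sub_zero]
  susyBar α := by simp only [DSq_apply, map_sub, hc.susyBar_D, hx.susyBar, map_zero, neg_zero, sub_zero]
  lorentz A := by rw [← hc.DSq_superLorentz, hx.lorentz]

lemma Good.invariant_DBarSq {x : Superfield V} (hx : IsInvariant c x) : IsInvariant c (DBarSq c x) where
  susy α := by simp only [DBarSq_apply, map_sub, hc.susy_DBar, hx.susy, map_zero, neg_zero, sub_zero]
  susyBar α := by
    simp only [DBarSq_apply, map_sub, hc.susyBar_DBar, hx.susyBar, map_zero, neg_zero, sub_zero]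
  lorentz A := by rw [← hc.DBarSq_superLorentz, hx.lorentz]

lemma Good.invariant_DDBarSqD {x : Superfield V} (hx : IsInvariant c x) : IsInvariant c (DDBarSqD c x) where
  susy α := by
    simp only [DDBarSqD_apply, DBarSq_apply, map_sub, hc.susy_D, hc.susy_DBar, hx.susy, map_zero, neg_zero,
      sub_zero]
  susyBar α := by
    simp only [DDBarSqD_apply, DBarSq_apply, map_sub, hc.susyBar_D, hc.susyBar_DBar, hx.susyBar, map_zero,
      neg_zero, sub_zero]
  lorentz A := by rw [← hc.DDBarSqD_superLorentz, hx.lorentz]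

/-! ### Translation invariance -/

lemma Good.Q_QBar_of_ne {a b : Fin 2} (hab : a ≠ b) (α β : Fin 2) (x : Superfield V) :
    Q c a α (QBar c b β x) = -QBar c b β (Q c a α x) := by
  simp only [QBar_apply, map_add, map_neg, map_smul, map_sum, Q_oddDeriv, Q_th, hc.slash_Q]
  simp [hab, hab.symm]
  abel

omit hc in
-- The four matrices σ^m form a basis of the 2 × 2 matrices; each case below is one row of the
-- inverse.
lemma eq_zero_of_sigma {M : Type} [AddCommGroup M] [Module ℂ M] {y : Fin 4 → M}
    (h : ∀ α β, ∑ m, sigma m α β • y m = 0) (m : Fin 4) : y m = 0 := by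
  have hI : Complex.I * Complex.I = -1 := Complex.I_mul_I
  have h00 := h 0 0
  have h01 := h 0 1
  have h10 := h 1 0
  have h11 := h 1 1
  simp [Fin.sum_univ_four, sigma] at h00 h01 h10 h11
  fin_cases m
  · change y 0 = 0
    linear_combination (norm := module) (-1 / 2 : ℂ) • h00 - (1 / 2 : ℂ) • h11
  · change y 1 = 0
    linear_combination (norm := module) (1 / 2 : ℂ) • h01 + (1 / 2 : ℂ) • h10
  · change y 2 = 0
    linear_combination (norm := (match_scalars <;> first | ring1 | linear_combination -hI | linear_combination hI))
      (Complex.I / 2 : ℂ) • h01 - (Complex.I / 2 : ℂ) • h10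
  · change y 3 = 0
    linear_combination (norm := module) (1 / 2 : ℂ) • h00 - (1 / 2 : ℂ) • h11

omit hc in
lemma comp_slash (s : List OddIndex) (a α β : Fin 2) (x : Superfield V) :
    comp s (slash c a α β x) = slash2 c a α β (comp s x) := by
  induction s generalizing x with
  | nil => exact aug_slash c a α β x
  | cons i s ih => rw [comp_cons, comp_cons, ← slash_oddDeriv, ih]

/-- The anticommutator of the total charges is 2i σ^m (∂/∂x₁^m + ∂/∂x₂^m), because charges at
different points anticommute. It annihilates F, and the σ^m are independent. -/
lemma Good.comp_translation {x : Superfield V} (hx : IsInvariant c x) (s : List OddIndex) : ∃ w, c.diff w = comp s x := by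
  refine hc.exists_diff _ fun m => ?_
  refine eq_zero_of_sigma (y := fun m => c.d2 0 m (comp s x) + c.d2 1 m (comp s x)) (fun α β => ?_) m
  have h : (Q c 0 α + Q c 1 α) ((QBar c 0 β + QBar c 1 β) x) + (QBar c 0 β + QBar c 1 β) ((Q c 0 α + Q c 1 α) x) =
      (2 * Complex.I) • (slash c 0 α β x + slash c 1 α β x) := by
    rw [smul_add, ← hc.Q_QBar, ← hc.Q_QBar]
    simp only [LinearMap.add_apply, map_add, hc.Q_QBar_of_ne (show (0 : Fin 2) ≠ 1 by decide),
      hc.Q_QBar_of_ne (show (1 : Fin 2) ≠ 0 by decide)]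
    abel
  rw [hx.susy, hx.susyBar, map_zero, map_zero, add_zero] at h
  have h' := (smul_eq_zero.1 h.symm).resolve_left (mul_ne_zero two_ne_zero Complex.I_ne_zero)
  have h'' := congrArg (comp s) h'
  rw [map_add, comp_slash, comp_slash, map_zero, slash2_apply, slash2_apply, ← Finset.sum_add_distrib] at h''
  simpa only [smul_add] using h''

/-! ### Lorentz covariance of the components -/

omit hc in
lemma oddDeriv_superLorentz_neg_one (i : OddIndex) (x : Superfield V) :
    oddDeriv V i (superLorentz c (-1) x) = -superLorentz c (-1) (oddDeriv V i x) := by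
  have h : ((-1 : SL2C)⁻¹).1 = -1 := by
    rw [inv_neg, inv_one]; simp
  rcases i with ⟨a, α | α⟩
  · rw [oddDeriv_inl_superLorentz, h]
    fin_cases α <;> simp <;> module
  · rw [oddDeriv_inr_superLorentz, h]
    fin_cases α <;> simp <;> module

lemma Good.comp_superLorentz_neg_one (s : List OddIndex) (x : Superfield V) :
    comp s (superLorentz c (-1) x) = (-1 : ℂ) ^ s.length • comp s x := by
  induction s generalizing x with
  | nil => rw [comp_nil, aug_superLorentz, hc.act2_neg_one]; simp
  | cons i s ih =>
    rw [comp_cons, oddDeriv_superLorentz_neg_one, map_neg, ih, comp_cons, List.length_cons, pow_succ]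
    module

/-- The central element -1 leaves both points fixed and multiplies a component of degree n by (-1)ⁿ.
-/
lemma Good.comp_odd {x : Superfield V} (hx : IsInvariant c x) {s : List OddIndex} (hs : Odd s.length) : comp s x = 0 := by
  have h := hc.comp_superLorentz_neg_one s x
  rw [hx.lorentz, hs.neg_one_pow] at h
  have h2 : (2 : ℂ) • comp s x = 0 := by
    linear_combination (norm := module) h
  exact (smul_eq_zero.1 h2).resolve_left two_ne_zero

lemma Good.invariant_of_diff {w : W} {v : V} (hw : c.diff w = v) (hv : ∀ A, v = c.act2 A v) : IsLorentzInvariant c w := by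
  intro A
  apply hc.diff_injective
  rw [← hc.act2_diff, hw, ← hv]

omit hc in
lemma aug_invariant {x : Superfield V} (hx : IsInvariant c x) (A : SL2C) : comp [] x = c.act2 A (comp [] x) := by
  conv_lhs => rw [← hx.lorentz A]
  rw [comp_nil, aug_superLorentz, comp_nil]

omit hc in
lemma oddDeriv_inl_inl_superLorentz (A : SL2C) (x : Superfield V) :
    oddDeriv V (0, Sum.inl 1) (oddDeriv V (0, Sum.inl 0) (superLorentz c A x)) =
      superLorentz c A (oddDeriv V (0, Sum.inl 1) (oddDeriv V (0, Sum.inl 0) x)) := by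
  have h := det_inv_eq A
  simp only [oddDeriv_inl_superLorentz, map_smul, Fin.sum_univ_two, map_add, oddDeriv_self,
    oddDeriv_oddDeriv (0, Sum.inl 0) (0, Sum.inl 1), map_zero, map_neg]
  linear_combination (norm := module) h • superLorentz c A (oddDeriv V (0, Sum.inl 1) (oddDeriv V (0, Sum.inl 0) x))

omit hc in
lemma oddDeriv_inr_inr_superLorentz (A : SL2C) (x : Superfield V) :
    oddDeriv V (0, Sum.inr 1) (oddDeriv V (0, Sum.inr 0) (superLorentz c A x)) =
      superLorentz c A (oddDeriv V (0, Sum.inr 1) (oddDeriv V (0, Sum.inr 0) x)) := by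
  have h := star_det_inv_eq A
  simp only [oddDeriv_inr_superLorentz, map_smul, Fin.sum_univ_two, map_add, oddDeriv_self,
    oddDeriv_oddDeriv (0, Sum.inr 0) (0, Sum.inr 1), map_zero, map_neg]
  linear_combination (norm := module) h • superLorentz c A (oddDeriv V (0, Sum.inr 1) (oddDeriv V (0, Sum.inr 0) x))

omit hc in
lemma comp_inl_inl_invariant {x : Superfield V} (hx : IsInvariant c x) (A : SL2C) :
    comp [(0, Sum.inl 0), (0, Sum.inl 1)] x = c.act2 A (comp [(0, Sum.inl 0), (0, Sum.inl 1)] x) := by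
  conv_lhs => rw [← hx.lorentz A]
  simp only [comp_cons, comp_nil, oddDeriv_inl_inl_superLorentz, aug_superLorentz]

omit hc in
lemma comp_inr_inr_invariant {x : Superfield V} (hx : IsInvariant c x) (A : SL2C) :
    comp [(0, Sum.inr 0), (0, Sum.inr 1)] x = c.act2 A (comp [(0, Sum.inr 0), (0, Sum.inr 1)] x) := by
  conv_lhs => rw [← hx.lorentz A]
  simp only [comp_cons, comp_nil, oddDeriv_inr_inr_superLorentz, aug_superLorentz]

omit hc in
lemma comp_full_invariant {x : Superfield V} (hx : IsInvariant c x) (A : SL2C) :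
    comp [(0, Sum.inl 0), (0, Sum.inl 1), (0, Sum.inr 0), (0, Sum.inr 1)] x =
      c.act2 A (comp [(0, Sum.inl 0), (0, Sum.inl 1), (0, Sum.inr 0), (0, Sum.inr 1)] x) := by
  conv_lhs => rw [← hx.lorentz A]
  simp only [comp_cons, comp_nil, oddDeriv_inl_inl_superLorentz, oddDeriv_inr_inr_superLorentz, aug_superLorentz]

omit hc in
lemma comp_inl_inr_covariant {x : Superfield V} (hx : IsInvariant c x) (A : SL2C) (α β : Fin 2) :
    comp [(0, Sum.inl α), (0, Sum.inr β)] x = ∑ γ, ∑ δ, ((A⁻¹).1 α γ * star ((A⁻¹).1 β δ)) •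
      c.act2 A (comp [(0, Sum.inl γ), (0, Sum.inr δ)] x) := by
  conv_lhs => rw [← hx.lorentz A]
  simp only [comp_cons, comp_nil, oddDeriv_inl_superLorentz, map_sum, map_smul, oddDeriv_inr_superLorentz,
    aug_superLorentz, Finset.smul_sum, smul_smul]

end Good

end Invariance

section Vector

variable {W V : Type} [AddCommGroup W] [Module ℂ W] [AddCommGroup V] [Module ℂ V] {c : CoeffOps W V}

/-! ### Covariant vectors -/

/-- The bispinor `σ^m v_m` of a vector. -/
def bispinor (v : Fin 4 → W) (α β : Fin 2) : W := ∑ m, sigma m α β • v m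

lemma exists_bispinor (w : Fin 2 → Fin 2 → W) : ∃ v, ∀ α β, bispinor v α β = w α β := by
  refine ⟨![(-1 / 2 : ℂ) • (w 0 0 + w 1 1), (1 / 2 : ℂ) • (w 0 1 + w 1 0), (Complex.I / 2) • (w 0 1 - w 1 0),
    (1 / 2 : ℂ) • (w 0 0 - w 1 1)], fun α β => ?_⟩
  unfold bispinor
  fin_cases α <;> fin_cases β <;> simp [Fin.sum_univ_four, sigma] <;> match_scalars <;>
    norm_num [Complex.ext_iff]

variable {X : Fin 4 → Module.End ℂ W}

-- Infinitesimal covariance of a bispinor, translated into vector indices: x_m ∂_n - x_n ∂_m acts on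
-- the components v_k by the matrices of the vector representation. Each boost and rotation is
-- contracted with σ and compared entry by entry.
set_option maxHeartbeats 1000000 in
lemma lieOp_bispinor {v : Fin 4 → W} (h : ∀ N, IsNil N → ∀ α β, lieOp c X N (bispinor v α β) =
      ∑ γ, N α γ • bispinor v γ β + ∑ δ, star (N β δ) • bispinor v α δ) (m n k : Fin 4) :
    eta m • X m (c.d n (v k)) - eta n • X n (c.d m (v k)) =
      (if n = k then eta k • v m else 0) - if m = k then eta k • v n else 0 := by
  have hp := pauli_of_nil (P := fun N => ∀ α β, lieOp c X N (bispinor v α β) =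
      ∑ γ, N α γ • bispinor v γ β + ∑ δ, star (N β δ) • bispinor v α δ) h (fun M N hM hN α β => by
    rw [lieOp_add_matrix, hM, hN]
    simp only [Matrix.add_apply, star_add, add_smul, Finset.sum_add_distrib]
    abel)
  have b1 : ∀ k, X 1 (c.d 0 (v k)) + X 0 (c.d 1 (v k)) - (-(if 0 = k then v 1 else 0) - if 1 = k then v 0 else 0) = 0 := by
    refine fun k => eq_zero_of_sigma (y := fun k => X 1 (c.d 0 (v k)) + X 0 (c.d 1 (v k)) -
      (-(if 0 = k then v 1 else 0) - if 1 = k then v 0 else 0)) (fun α β => ?_) k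
    have e := (lieOp_boost₁ c X _).symm.trans ((hp 1).1 α β)
    fin_cases α <;> fin_cases β <;> simp [bispinor, Fin.sum_univ_four, sigma] at e ⊢ <;>
      linear_combination (norm := (match_scalars <;> norm_num [Complex.ext_iff])) (1 / 2 : ℂ) • e
  have b2 : ∀ k, X 2 (c.d 0 (v k)) + X 0 (c.d 2 (v k)) - (-(if 0 = k then v 2 else 0) - if 2 = k then v 0 else 0) = 0 := by
    refine fun k => eq_zero_of_sigma (y := fun k => X 2 (c.d 0 (v k)) + X 0 (c.d 2 (v k)) -
      (-(if 0 = k then v 2 else 0) - if 2 = k then v 0 else 0)) (fun α β => ?_) k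
    have e := (lieOp_boost₂ c X _).symm.trans ((hp (-Complex.I)).2.1 α β)
    fin_cases α <;> fin_cases β <;> simp [bispinor, Fin.sum_univ_four, sigma] at e ⊢ <;>
      linear_combination (norm := (match_scalars <;> norm_num [Complex.ext_iff])) (1 / 2 : ℂ) • e
  have b3 : ∀ k, X 3 (c.d 0 (v k)) + X 0 (c.d 3 (v k)) - (-(if 0 = k then v 3 else 0) - if 3 = k then v 0 else 0) = 0 := by
    refine fun k => eq_zero_of_sigma (y := fun k => X 3 (c.d 0 (v k)) + X 0 (c.d 3 (v k)) -
      (-(if 0 = k then v 3 else 0) - if 3 = k then v 0 else 0)) (fun α β => ?_) k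
    have e := (lieOp_boost₃ c X _).symm.trans ((hp 1).2.2 α β)
    fin_cases α <;> fin_cases β <;> simp [bispinor, Fin.sum_univ_four, sigma] at e ⊢ <;>
      linear_combination (norm := (match_scalars <;> norm_num [Complex.ext_iff])) (1 / 2 : ℂ) • e
  have r1 : ∀ k, X 3 (c.d 2 (v k)) - X 2 (c.d 3 (v k)) - ((if 2 = k then v 3 else 0) - if 3 = k then v 2 else 0) = 0 := by
    refine fun k => eq_zero_of_sigma (y := fun k => X 3 (c.d 2 (v k)) - X 2 (c.d 3 (v k)) -
      ((if 2 = k then v 3 else 0) - if 3 = k then v 2 else 0)) (fun α β => ?_) k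
    have e := (lieOp_rot₁ c X _).symm.trans ((hp Complex.I).1 α β)
    fin_cases α <;> fin_cases β <;> simp [bispinor, Fin.sum_univ_four, sigma] at e ⊢ <;>
      linear_combination (norm := (match_scalars <;> norm_num [Complex.ext_iff])) (1 / 2 : ℂ) • e
  have r2 : ∀ k, X 1 (c.d 3 (v k)) - X 3 (c.d 1 (v k)) - ((if 3 = k then v 1 else 0) - if 1 = k then v 3 else 0) = 0 := by
    refine fun k => eq_zero_of_sigma (y := fun k => X 1 (c.d 3 (v k)) - X 3 (c.d 1 (v k)) -
      ((if 3 = k then v 1 else 0) - if 1 = k then v 3 else 0)) (fun α β => ?_) k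
    have e := (lieOp_rot₂ c X _).symm.trans ((hp 1).2.1 α β)
    fin_cases α <;> fin_cases β <;> simp [bispinor, Fin.sum_univ_four, sigma] at e ⊢ <;>
      linear_combination (norm := (match_scalars <;> norm_num [Complex.ext_iff])) (1 / 2 : ℂ) • e
  have r3 : ∀ k, X 2 (c.d 1 (v k)) - X 1 (c.d 2 (v k)) - ((if 1 = k then v 2 else 0) - if 2 = k then v 1 else 0) = 0 := by
    refine fun k => eq_zero_of_sigma (y := fun k => X 2 (c.d 1 (v k)) - X 1 (c.d 2 (v k)) -
      ((if 1 = k then v 2 else 0) - if 2 = k then v 1 else 0)) (fun α β => ?_) k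
    have e := (lieOp_rot₃ c X _).symm.trans ((hp Complex.I).2.2 α β)
    fin_cases α <;> fin_cases β <;> simp [bispinor, Fin.sum_univ_four, sigma] at e ⊢ <;>
      linear_combination (norm := (match_scalars <;> norm_num [Complex.ext_iff])) (1 / 2 : ℂ) • e
  have e : ∀ {k : Fin 4} (l : Fin 4) (u : W), l ≠ 0 → (if l = k then eta k • u else 0) = if l = k then u else 0 := by
    intro k l u hl
    split_ifs with h
    · rw [← h, eta, if_neg hl, one_smul]
    · rfl
  have e0 : ∀ {k : Fin 4} (u : W), (if 0 = k then eta k • u else 0) = -if 0 = k then u else 0 := by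
    intro k u
    split_ifs with h
    · rw [← h, eta, if_pos rfl]; module
    · rw [neg_zero]
  have b1 := b1 k
  have b2 := b2 k
  have b3 := b3 k
  have r1 := r1 k
  have r2 := r2 k
  have r3 := r3 k
  have hcase : ∀ m : Fin 4, m = 0 ∨ m = 1 ∨ m = 2 ∨ m = 3 := by decide
  have he0 : eta 0 = -1 := if_pos rfl
  have he1 : eta 1 = 1 := if_neg (by decide)
  have he2 : eta 2 = 1 := if_neg (by decide)
  have he3 : eta 3 = 1 := if_neg (by decide)
  clear h hp
  obtain rfl | rfl | rfl | rfl := hcase m <;> obtain rfl | rfl | rfl | rfl := hcase n <;>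
    simp only [e0, e 1 _ one_ne_zero, e 2 _ (show (2 : Fin 4) ≠ 0 by decide),
      e 3 _ (show (3 : Fin 4) ≠ 0 by decide), he0, he1, he2, he3, sub_self]
  · linear_combination (norm := module) -b1
  · linear_combination (norm := module) -b2
  · linear_combination (norm := module) -b3
  · linear_combination (norm := module) b1
  · linear_combination (norm := module) -r3
  · linear_combination (norm := module) r2
  · linear_combination (norm := module) b2
  · linear_combination (norm := module) r3
  · linear_combination (norm := module) -r1
  · linear_combination (norm := module) b3
  · linear_combination (norm := module) -r2
  · linear_combination (norm := module) r1

end Vector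

section Potential

variable {W V : Type} [AddCommGroup W] [Module ℂ W] [AddCommGroup V] [Module ℂ V] {c : CoeffOps W V}
  {X : Fin 4 → Module.End ℂ W} (hc : Good c X)
include hc

/-! ### Covariant vectors are gradients of invariants -/

lemma Good.act_bispinor {v : Fin 4 → W} (hv : ∀ A α β, bispinor v α β = ∑ γ, ∑ δ, ((A⁻¹).1 α γ * star ((A⁻¹).1 β δ)) •
      c.act A (bispinor v γ δ)) (A : SL2C) (α β : Fin 2) :
    c.act A (bispinor v α β) = ∑ γ, ∑ δ, (A.1 α γ * star (A.1 β δ)) • bispinor v γ δ := by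
  have h1 : ∀ α β, c.act 1 (bispinor v α β) = bispinor v α β := by
    intro α β
    have h : ((1 : SL2C)⁻¹).1 = 1 := by rw [inv_one]; rfl
    rw [hv 1 α β, h]
    fin_cases α <;> fin_cases β <;> simp [hc.act_mul]
  conv_lhs => rw [hv A⁻¹ α β]
  simp only [inv_inv, map_sum, map_smul, hc.act_mul, inv_mul_cancel, h1]

/-- The action of 1 + sN on both spinor indices is quadratic in s; its linear coefficient is the
generator by `Good.inf`. -/
lemma Good.lieOp_bispinor {v : Fin 4 → W} (hv : ∀ A α β, bispinor v α β =
      ∑ γ, ∑ δ, ((A⁻¹).1 α γ * star ((A⁻¹).1 β δ)) • c.act A (bispinor v γ δ))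
    (N : Matrix (Fin 2) (Fin 2) ℂ) (hN : IsNil N) (α β : Fin 2) : lieOp c X N (bispinor v α β) =
      ∑ γ, N α γ • bispinor v γ β + ∑ δ, star (N β δ) • bispinor v α δ := by
  refine hc.inf N hN _ _ (∑ γ, ∑ δ, (N α γ * star (N β δ)) • bispinor v γ δ) fun s => ?_
  rw [hc.act_bispinor hv]
  have h : (unip N hN s).1 = 1 + (s : ℂ) • N := rfl
  have hs : star (s : ℂ) = s := Complex.conj_ofReal s
  rw [h]
  simp only [Matrix.add_apply, Matrix.smul_apply, smul_eq_mul, star_add, star_mul', hs, Fin.sum_univ_two]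
  fin_cases α <;> fin_cases β <;> simp [-Complex.star_def, -RCLike.star_def, Matrix.one_apply] <;> module

/-- A third index m different from k and n is chosen. In the sum of ∂_k L_mn, ∂_m L_nk and ∂_n L_km,
applied to v_m, all terms with coordinates and derivatives cancel, so covariance leaves only the
curl in the directions k, n. -/
lemma Good.curl_eq_zero {v : Fin 4 → W} (hv : ∀ A α β, bispinor v α β =
      ∑ γ, ∑ δ, ((A⁻¹).1 α γ * star ((A⁻¹).1 β δ)) • c.act A (bispinor v γ δ)) (k n : Fin 4) :
    c.d k (v n) = c.d n (v k) := by
  by_cases hkn : k = n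
  · rw [hkn]
  obtain ⟨m, hmk, hmn⟩ : ∃ m : Fin 4, m ≠ k ∧ m ≠ n := by
    clear hv; revert k n; decide
  have L := SuperTwoPoint.lieOp_bispinor (X := X) (hc.lieOp_bispinor hv)
  have e1 := congrArg (c.d k) (L m n m)
  have e2 := congrArg (c.d m) (L n k m)
  have e3 := congrArg (c.d n) (L k m m)
  have hm : eta m * eta m = 1 := eta_mul_eta m
  simp only [if_neg hmn.symm, if_neg hmk.symm, if_true, map_sub, map_smul, map_zero, hc.d_X, if_neg hkn,
    if_neg (Ne.symm hkn), if_neg hmn, if_neg hmk, add_zero, hc.d_comm n m, hc.d_comm k m, hc.d_comm n k] at e1 e2 e3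
  have h : eta m • (eta m • (c.d k (v n) - c.d n (v k))) = 0 := by
    linear_combination (norm := module) eta m • e1 + eta m • e2 + eta m • e3
  rw [smul_smul, hm, one_smul] at h
  exact sub_eq_zero.1 h

/-- The difference of K and its transform has vanishing derivatives, hence is itself invariant. The
cocycle A ↦ act A K - K is therefore a homomorphism, and it vanishes by `SL2C_hom_eq_zero`. -/
lemma Good.isLorentzInvariant_of_deriv {K : W} (hK : ∀ A m, c.d m (c.act A K) = c.d m K) : IsLorentzInvariant c K := by
  have h0 : ∀ A, IsLorentzInvariant c (c.act A K - K) := fun A =>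
    hc.const _ fun m => by rw [map_sub, hK, sub_self]
  intro A
  refine sub_eq_zero.1 (SL2C_hom_eq_zero (fun A => c.act A K - K) (fun A B => ?_) A)
  have h := h0 A B
  rw [map_sub, hc.act_mul] at h
  linear_combination (norm := module) h

/-- A covariant vector is curl-free and so has a potential; covariance of the gradient is what
`Good.isLorentzInvariant_of_deriv` needs to make the potential invariant. -/
lemma Good.exists_slash1_eq {w : Fin 2 → Fin 2 → W} (hw : ∀ A α β, w α β =
      ∑ γ, ∑ δ, ((A⁻¹).1 α γ * star ((A⁻¹).1 β δ)) • c.act A (w γ δ)) :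
    ∃ K, IsLorentzInvariant c K ∧ ∀ α β, slash1 c α β K = w α β := by
  obtain ⟨v, hv⟩ := exists_bispinor w
  simp only [← hv] at hw
  obtain ⟨K, hK⟩ := exists_potential hc.d_comm hc.prim v (hc.curl_eq_zero hw)
  refine ⟨K, hc.isLorentzInvariant_of_deriv fun A m => ?_, fun α β => ?_⟩
  · refine sub_eq_zero.1 (eq_zero_of_sigma (y := fun m => c.d m (c.act A K) - c.d m K) (fun α β => ?_) m)
    simp only [smul_sub, Finset.sum_sub_distrib, hK]
    rw [sub_eq_zero]
    refine Eq.trans ?_ (hw A α β).symm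
    simp only [hc.d_act, hK, bispinor, Finset.smul_sum, map_sum, map_smul, smul_smul]
    rw [Finset.sum_comm]
    have h : ∀ n, ∑ m, (sigma m α β * (lorentzMatrix A n m : ℂ)) • c.act A (v n) =
        ∑ γ, ∑ δ, ((A⁻¹).1 α γ * star ((A⁻¹).1 β δ) * sigma n γ δ) • c.act A (v n) := by
      intro n
      simp only [← Finset.sum_smul]
      rw [← inv_mul_sigma]
      simp only [mul_comm]
    simp only [h]
    rw [Finset.sum_comm]
    refine Finset.sum_congr rfl fun α _ => ?_
    rw [Finset.sum_comm]
  · rw [← hv, slash1_apply, bispinor]; simp only [hK]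

/-! ### The d'Alembertian -/

omit hc in
lemma box_apply (w : W) : box c w = ∑ m, eta m • c.d m (c.d m w) := by simp [box]

/-- The analogue of `det_toHerm` for the commuting operators ∂_m in place of coordinates. -/
lemma Good.slash1_det (w : W) : slash1 c 0 0 (slash1 c 1 1 w) - slash1 c 0 1 (slash1 c 1 0 w) = -box c w := by
  simp only [slash1_apply, box_apply, Fin.sum_univ_four, map_add, map_smul, hc.d_comm 1 0, hc.d_comm 2 0,
    hc.d_comm 3 0, hc.d_comm 2 1, hc.d_comm 3 1, hc.d_comm 3 2]
  simp [sigma, eta]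
  match_scalars <;> norm_num [Complex.ext_iff]

lemma Good.slash2_det (w : W) : slash2 c 0 0 0 (slash2 c 0 1 1 (c.diff w)) -
    slash2 c 0 0 1 (slash2 c 0 1 0 (c.diff w)) = -c.diff (box c w) := by
  simp only [hc.slash2_diff, if_true, one_smul, ← map_sub, ← map_neg, hc.slash1_det]

lemma Good.slash2_det' (w : W) : slash2 c 0 0 0 (slash2 c 0 1 1 (c.diff w)) -
    slash2 c 0 1 0 (slash2 c 0 0 1 (c.diff w)) = -c.diff (box c w) := by
  rw [hc.slash2_comm 0 0 1 0, hc.slash2_det]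

lemma Good.box_invariant {w : W} (hw : IsLorentzInvariant c w) : IsLorentzInvariant c (box c w) := by
  intro A
  have h : ∀ m, c.d m (c.d m w) = ∑ n, ∑ k, ((lorentzMatrix A n m * lorentzMatrix A k m : ℝ) : ℂ) •
      c.act A (c.d k (c.d n w)) := by
    intro m
    conv_lhs => rw [← hw A]
    simp only [hc.d_act, map_sum, map_smul, Finset.smul_sum, smul_smul, Complex.ofReal_mul]
  conv_rhs => rw [box_apply]
  simp only [h, Finset.smul_sum, smul_smul]
  rw [Finset.sum_comm, box_apply, map_sum]
  refine Finset.sum_congr rfl fun n _ => ?_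
  rw [Finset.sum_comm]
  have h2 : ∀ k, ∑ m, eta m * ((lorentzMatrix A n m * lorentzMatrix A k m : ℝ) : ℂ) = if n = k then eta n else 0 := by
    intro k
    have := congrArg (fun r : ℝ => (r : ℂ)) (sum_etaR_lorentzMatrix A n k)
    simp only [Complex.ofReal_sum, apply_ite Complex.ofReal, Complex.ofReal_zero, ← eta_eq] at this
    rw [← this]
    refine Finset.sum_congr rfl fun m _ => ?_
    push_cast [eta_eq]
    ring
  simp only [← Finset.sum_smul, h2, ite_smul, zero_smul, Finset.sum_ite_eq, Finset.mem_univ, if_true, map_smul]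

end Potential

section Classification

variable {W V : Type} [AddCommGroup W] [Module ℂ W] [AddCommGroup V] [Module ℂ V] {c : CoeffOps W V}
  {X : Fin 4 → Module.End ℂ W} (hc : Good c X)
include hc

/-! ### Components of the kernels -/

lemma Good.comp_Pc (H : W) :
    comp [] ((1 / 16 : ℂ) • (DSq c * DBarSq c) (deltaKernel c H)) = c.diff H ∧
    (∀ α β, comp [(0, Sum.inl α), (0, Sum.inr β)] ((1 / 16 : ℂ) • (DSq c * DBarSq c) (deltaKernel c H)) =
      -Complex.I • c.diff (slash1 c α β H)) ∧
    comp [(0, Sum.inl 0), (0, Sum.inl 1), (0, Sum.inr 0), (0, Sum.inr 1)]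
      ((1 / 16 : ℂ) • (DSq c * DBarSq c) (deltaKernel c H)) = -c.diff (box c H) := by
  obtain ⟨-, h2, h3⟩ := comp_antichiral (c := c) (x := DSq c (DBarSq c (deltaKernel c H))) fun α => hc.D_DSq α _
  simp only [Module.End.mul_apply, map_smul, h2, h3, comp_nil, hc.aug_DSq_DBarSq_deltaKernel]
  refine ⟨by module, fun α β => ?_, ?_⟩
  · rw [hc.slash2_diff, if_pos rfl]; module
  · rw [← smul_sub, hc.slash2_det]; module

lemma Good.comp_Pa (H : W) :
    comp [] ((1 / 16 : ℂ) • (DBarSq c * DSq c) (deltaKernel c H)) = c.diff H ∧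
    (∀ α β, comp [(0, Sum.inl α), (0, Sum.inr β)] ((1 / 16 : ℂ) • (DBarSq c * DSq c) (deltaKernel c H)) =
      Complex.I • c.diff (slash1 c α β H)) ∧
    comp [(0, Sum.inl 0), (0, Sum.inl 1), (0, Sum.inr 0), (0, Sum.inr 1)]
      ((1 / 16 : ℂ) • (DBarSq c * DSq c) (deltaKernel c H)) = -c.diff (box c H) := by
  obtain ⟨-, h2, h3⟩ := comp_chiral (c := c) (x := DBarSq c (DSq c (deltaKernel c H))) fun α => hc.DBar_DBarSq α _
  simp only [Module.End.mul_apply, map_smul, h2, h3, comp_nil, hc.aug_DBarSq_DSq_deltaKernel]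
  refine ⟨by module, fun α β => ?_, ?_⟩
  · rw [hc.slash2_diff, if_pos rfl]; module
  · rw [← smul_sub, hc.slash2_det']; module

/-- By the completeness relation `Good.DDBarSqD_eq` this kernel is minus the sum of the chiral and
antichiral ones minus the determinant of σ^m ∂_m on the δ-kernel; the last term is visible in the
top component only. -/
lemma Good.comp_PT (H : W) :
    comp [] ((-1 / 8 : ℂ) • DDBarSqD c (deltaKernel c H)) = (-2 : ℂ) • c.diff H ∧
    (∀ α β, comp [(0, Sum.inl α), (0, Sum.inr β)] ((-1 / 8 : ℂ) • DDBarSqD c (deltaKernel c H)) = 0) ∧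
    comp [(0, Sum.inl 0), (0, Sum.inl 1), (0, Sum.inr 0), (0, Sum.inr 1)]
      ((-1 / 8 : ℂ) • DDBarSqD c (deltaKernel c H)) = (-2 : ℂ) • c.diff (box c H) := by
  have e : (-1 / 8 : ℂ) • DDBarSqD c (deltaKernel c H) =
      -((1 / 16 : ℂ) • (DSq c * DBarSq c) (deltaKernel c H) + (1 / 16 : ℂ) • (DBarSq c * DSq c) (deltaKernel c H)) -
        (slash c 0 0 0 (slash c 0 1 1 (deltaKernel c H)) - slash c 0 0 1 (slash c 0 1 0 (deltaKernel c H))) := by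
    rw [hc.DDBarSqD_eq]
    simp only [Module.End.mul_apply]
    module
  obtain ⟨a1, a2, a3⟩ := hc.comp_Pc H
  obtain ⟨b1, b2, b3⟩ := hc.comp_Pa H
  rw [e]
  refine ⟨?_, fun α β => ?_, ?_⟩
  · rw [map_sub, map_neg, map_add, a1, b1, map_sub]
    simp only [comp_slash]
    simp only [comp_nil, aug_deltaKernel, map_zero]
    module
  · rw [map_sub, map_neg, map_add, a2, b2, map_sub]
    simp only [comp_slash]
    simp only [comp_nil, comp_cons, aug_oddDeriv₂_deltaKernel, map_zero]
    module
  · rw [map_sub, map_neg, map_add, a3, b3, map_sub]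
    simp only [comp_slash]
    simp only [comp_nil, comp_cons, comp_full_deltaKernel, map_smul]
    rw [← smul_sub, hc.slash2_det]
    module

lemma Good.comp_PPlus (H : W) :
    comp [] (PPlus c H) = 0 ∧ (∀ α β, comp [(0, Sum.inl α), (0, Sum.inr β)] (PPlus c H) = 0) ∧
    comp [(0, Sum.inl 0), (0, Sum.inl 1), (0, Sum.inr 0), (0, Sum.inr 1)] (PPlus c H) = 0 ∧
    comp [(0, Sum.inl 0), (0, Sum.inl 1)] (PPlus c H) = 0 ∧
    comp [(0, Sum.inr 0), (0, Sum.inr 1)] (PPlus c H) = (-2 : ℂ) • c.diff H := by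
  obtain ⟨h1, h2, h3⟩ := comp_antichiral (c := c) (x := DSq c (deltaKernel c H)) fun α => hc.D_DSq α _
  simp only [PPlus, map_smul, h1, h2, h3, hc.comp_DSq_deltaKernel, comp_nil, hc.aug_DSq_deltaKernel, map_zero,
    smul_zero, sub_zero]
  refine ⟨trivial, fun _ _ => trivial, trivial, trivial, ?_⟩
  module

lemma Good.comp_PMinus (H : W) :
    comp [] (PMinus c H) = 0 ∧ (∀ α β, comp [(0, Sum.inl α), (0, Sum.inr β)] (PMinus c H) = 0) ∧
    comp [(0, Sum.inl 0), (0, Sum.inl 1), (0, Sum.inr 0), (0, Sum.inr 1)] (PMinus c H) = 0 ∧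
    comp [(0, Sum.inl 0), (0, Sum.inl 1)] (PMinus c H) = (2 : ℂ) • c.diff H ∧
    comp [(0, Sum.inr 0), (0, Sum.inr 1)] (PMinus c H) = 0 := by
  obtain ⟨h1, h2, h3⟩ := comp_chiral (c := c) (x := DBarSq c (deltaKernel c H)) fun α => hc.DBar_DBarSq α _
  simp only [PMinus, map_smul, h1, h2, h3, hc.comp_DBarSq_deltaKernel, comp_nil, hc.aug_DBarSq_deltaKernel, map_zero,
    smul_zero, sub_zero]
  refine ⟨trivial, fun _ _ => trivial, trivial, ?_, trivial⟩
  module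

/-! ### The classification -/

omit hc in
lemma IsLorentzInvariant.add {u w : W} (hu : IsLorentzInvariant c u) (hw : IsLorentzInvariant c w) :
    IsLorentzInvariant c (u + w) := fun A => by rw [map_add, hu, hw]

omit hc in
lemma IsLorentzInvariant.smul (r : ℂ) {u : W} (hu : IsLorentzInvariant c u) : IsLorentzInvariant c (r • u) :=
  fun A => by rw [map_smul, hu]

/-- The even sublists of the four labels at the first point are the empty one, the six pairs and the
full list. Odd ones vanish by parity, and supersymmetry removes the second point. -/
lemma Good.eq_zero_of_even_comp {x : Superfield V} (hx : IsInvariant c x) (h0 : comp [] x = 0)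
    (h1 : ∀ α β, comp [(0, Sum.inl α), (0, Sum.inr β)] x = 0)
    (h2 : comp [(0, Sum.inl 0), (0, Sum.inl 1), (0, Sum.inr 0), (0, Sum.inr 1)] x = 0)
    (h3 : comp [(0, Sum.inl 0), (0, Sum.inl 1)] x = 0) (h4 : comp [(0, Sum.inr 0), (0, Sum.inr 1)] x = 0) : x = 0 := by
  refine susy_eq_zero c hx.susy hx.susyBar fun s hs => ?_
  by_cases hodd : Odd s.length
  · exact hc.comp_odd hx hodd
  · have hs' := List.mem_sublists.2 hs
    simp only [ptLabels] at hs'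
    have hs2 : s = [] ∨ (∃ α β, s = [(0, Sum.inl α), (0, Sum.inr β)]) ∨
        s = [(0, Sum.inl 0), (0, Sum.inl 1), (0, Sum.inr 0), (0, Sum.inr 1)] ∨
        s = [(0, Sum.inl 0), (0, Sum.inl 1)] ∨ s = [(0, Sum.inr 0), (0, Sum.inr 1)] := by
      revert hodd
      fin_cases hs' <;> decide
    obtain rfl | ⟨α, β, rfl⟩ | rfl | rfl | rfl := hs2
    exacts [h0, h1 α β, h2, h3, h4]

lemma Good.isInvariant_Pc {H : W} (hH : IsLorentzInvariant c H) :
    IsInvariant c ((1 / 16 : ℂ) • (DSq c * DBarSq c) (deltaKernel c H)) :=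
  (hc.invariant_DSq (hc.invariant_DBarSq (hc.invariant_deltaKernel hH))).smul _

lemma Good.isInvariant_Pa {H : W} (hH : IsLorentzInvariant c H) :
    IsInvariant c ((1 / 16 : ℂ) • (DBarSq c * DSq c) (deltaKernel c H)) :=
  (hc.invariant_DBarSq (hc.invariant_DSq (hc.invariant_deltaKernel hH))).smul _

lemma Good.isInvariant_PT {H : W} (hH : IsLorentzInvariant c H) :
    IsInvariant c ((-1 / 8 : ℂ) • DDBarSqD c (deltaKernel c H)) :=
  (hc.invariant_DDBarSqD (hc.invariant_deltaKernel hH)).smul _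

lemma Good.isInvariant_PPlus {H : W} (hH : IsLorentzInvariant c H) : IsInvariant c (PPlus c H) :=
  (hc.invariant_DSq (hc.invariant_deltaKernel hH)).smul _

lemma Good.isInvariant_PMinus {H : W} (hH : IsLorentzInvariant c H) : IsInvariant c (PMinus c H) :=
  (hc.invariant_DBarSq (hc.invariant_deltaKernel hH)).smul _

/-- An invariant two-point function is a combination of the five kernels. -/
lemma Good.exists_kernels {F : Superfield V} (hF : IsInvariant c F) :
    ∃ Hc Ha HT Hp Hm : W, IsLorentzInvariant c Hc ∧ IsLorentzInvariant c Ha ∧ IsLorentzInvariant c HT ∧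
      IsLorentzInvariant c Hp ∧ IsLorentzInvariant c Hm ∧
      F = (1 / 16 : ℂ) • (DSq c * DBarSq c) (deltaKernel c Hc) + (1 / 16 : ℂ) • (DBarSq c * DSq c) (deltaKernel c Ha) +
        (-1 / 8 : ℂ) • DDBarSqD c (deltaKernel c HT) + PPlus c Hp + PMinus c Hm := by
  obtain ⟨u, hu⟩ := hc.comp_translation hF []
  obtain ⟨f, hf⟩ := hc.comp_translation hF [(0, Sum.inl 0), (0, Sum.inl 1), (0, Sum.inr 0), (0, Sum.inr 1)]
  choose w hw using fun α β => hc.comp_translation hF [(0, Sum.inl α), (0, Sum.inr β)]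
  have hui : IsLorentzInvariant c u := hc.invariant_of_diff hu (aug_invariant hF)
  have hfi : IsLorentzInvariant c f := hc.invariant_of_diff hf (comp_full_invariant hF)
  obtain ⟨K, hKi, hK⟩ := hc.exists_slash1_eq (w := w) fun A α β => by
    apply hc.diff_injective
    rw [hw, comp_inl_inr_covariant hF A]
    simp only [map_sum, map_smul, ← hc.act2_diff, hw]
  -- Solving the u- and w-slots gives H_c + H_a = u + 2T and H_c - H_a = iK. The top component of
  -- the three kernels is then -□u - 4□T, which has to equal f.
  obtain ⟨T, hTi, hT⟩ := hc.exists_box _ ((hfi.add (hc.box_invariant hui)).smul (-1 / 4))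
  have hci : IsLorentzInvariant c ((1 / 2 : ℂ) • u + T + (Complex.I / 2) • K) :=
    ((hui.smul _).add hTi).add (hKi.smul _)
  have hai : IsLorentzInvariant c ((1 / 2 : ℂ) • u + T + (-Complex.I / 2) • K) :=
    ((hui.smul _).add hTi).add (hKi.smul _)
  obtain ⟨c1, c2, c3⟩ := hc.comp_Pc ((1 / 2 : ℂ) • u + T + (Complex.I / 2) • K)
  obtain ⟨a1, a2, a3⟩ := hc.comp_Pa ((1 / 2 : ℂ) • u + T + (-Complex.I / 2) • K)
  obtain ⟨t1, t2, t3⟩ := hc.comp_PT T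
  have iFc := hc.isInvariant_Pc hci
  obtain ⟨Fc, hFc⟩ : ∃ x, x = (1 / 16 : ℂ) • (DSq c * DBarSq c) (deltaKernel c ((1 / 2 : ℂ) • u + T + (Complex.I / 2) • K)) := ⟨_, rfl⟩
  simp only [← hFc] at iFc c1 c2 c3
  have iFa := hc.isInvariant_Pa hai
  obtain ⟨Fa, hFa⟩ : ∃ x, x = (1 / 16 : ℂ) • (DBarSq c * DSq c) (deltaKernel c ((1 / 2 : ℂ) • u + T + (-Complex.I / 2) • K)) := ⟨_, rfl⟩
  simp only [← hFa] at iFa a1 a2 a3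
  have iFT := hc.isInvariant_PT hTi
  obtain ⟨FT, hFT⟩ : ∃ x, x = (-1 / 8 : ℂ) • DDBarSqD c (deltaKernel c T) := ⟨_, rfl⟩
  simp only [← hFT] at iFT t1 t2 t3
  -- The θθ and θ̄θ̄ components are read off after subtracting the three kernels, so the
  -- contributions of these kernels to them need not be known.
  have hG : IsInvariant c (F - (Fc + Fa + FT)) := hF.sub ((iFc.add iFa).add iFT)
  obtain ⟨p, hp⟩ := hc.comp_translation hG [(0, Sum.inl 0), (0, Sum.inl 1)]
  obtain ⟨q, hq⟩ := hc.comp_translation hG [(0, Sum.inr 0), (0, Sum.inr 1)]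
  have hpi : IsLorentzInvariant c ((1 / 2 : ℂ) • p) := (hc.invariant_of_diff hp (comp_inl_inl_invariant hG)).smul _
  have hqi : IsLorentzInvariant c ((-1 / 2 : ℂ) • q) := (hc.invariant_of_diff hq (comp_inr_inr_invariant hG)).smul _
  obtain ⟨p1, p2, p3, p4, p5⟩ := hc.comp_PPlus ((-1 / 2 : ℂ) • q)
  obtain ⟨m1, m2, m3, m4, m5⟩ := hc.comp_PMinus ((1 / 2 : ℂ) • p)
  refine ⟨_, _, T, _, _, hci, hai, hTi, hqi, hpi, ?_⟩
  rw [← hFc, ← hFa, ← hFT]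
  have key : F - (Fc + Fa + FT) - PPlus c ((-1 / 2 : ℂ) • q) - PMinus c ((1 / 2 : ℂ) • p) = 0 := by
    refine hc.eq_zero_of_even_comp ((hG.sub (hc.isInvariant_PPlus hqi)).sub (hc.isInvariant_PMinus hpi)) ?_
      (fun α β => ?_) ?_ ?_ ?_
    · simp only [map_sub, map_add, c1, a1, t1, p1, m1, ← hu, map_smul]
      module
    · simp only [map_sub, map_add, c2, a2, t2, p2, m2, ← hw, map_smul, hK]
      match_scalars <;> norm_num [Complex.ext_iff]
    · simp only [map_sub, map_add, c3, a3, t3, p3, m3, ← hf, map_smul, hT]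
      module
    · rw [map_sub, map_sub, p4, m4, ← hp, map_smul]
      module
    · rw [map_sub, map_sub, p5, m5, ← hq, map_smul]
      module
  linear_combination (norm := module) key

/-- The classification of invariant two-point functions, for coefficients with the properties `Good`. -/
theorem Good.isInvariant_iff (F : Superfield V) : IsInvariant c F ↔
    ∃ Gc Ga GT Hplus Hminus : W, IsLorentzInvariant c Gc ∧ IsLorentzInvariant c Ga ∧ IsLorentzInvariant c GT ∧
      IsLorentzInvariant c Hplus ∧ IsLorentzInvariant c Hminus ∧
      ∃ Fc Fa FT, IsPc c Gc Fc ∧ IsPa c Ga Fa ∧ IsPT c GT FT ∧ F = Fc + Fa + FT + PPlus c Hplus + PMinus c Hminus := by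
  constructor
  · intro hF
    obtain ⟨Hc, Ha, HT, Hp, Hm, hHc, hHa, hHT, hHp, hHm, h⟩ := hc.exists_kernels hF
    -- Any invariant H is an admissible □⁻¹ of G = □H, so the G_i are defined by the H_i that were
    -- found.
    exact ⟨box c Hc, box c Ha, box c HT, Hp, Hm, hc.box_invariant hHc, hc.box_invariant hHa, hc.box_invariant hHT,
      hHp, hHm, _, _, _, ⟨Hc, ⟨hHc, rfl⟩, rfl⟩, ⟨Ha, ⟨hHa, rfl⟩, rfl⟩, ⟨HT, ⟨hHT, rfl⟩, rfl⟩, h⟩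
  · rintro ⟨Gc, Ga, GT, Hp, Hm, -, -, -, hHp, hHm, Fc, Fa, FT, ⟨Hc, hc1, hFc⟩, ⟨Ha, ha1, hFa⟩, ⟨HT, ht1, hFT⟩, hF⟩
    have hc2 := hc.isInvariant_Pc hc1.1
    have ha2 := hc.isInvariant_Pa ha1.1
    have ht2 := hc.isInvariant_PT ht1.1
    rw [← hFc] at hc2
    rw [← hFa] at ha2
    rw [← hFT] at ht2
    rw [hF]
    exact (((hc2.add ha2).add ht2).add (hc.isInvariant_PPlus hHp)).add (hc.isInvariant_PMinus hHm)

end Classification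

end SuperTwoPoint

end

/-! ### The theorem for functions and for distributions -/

open SuperTwoPoint in
theorem theorem1 :
    -- functions
    ((∀ F : Superfield (Smooth Spacetime2), IsInvariant smoothOps F ↔
        ∃ Gc Ga GT Hplus Hminus : Smooth Spacetime,
          IsLorentzInvariant smoothOps Gc ∧ IsLorentzInvariant smoothOps Ga ∧
          IsLorentzInvariant smoothOps GT ∧ IsLorentzInvariant smoothOps Hplus ∧
          IsLorentzInvariant smoothOps Hminus ∧
          ∃ Fc Fa FT, IsPc smoothOps Gc Fc ∧ IsPa smoothOps Ga Fa ∧ IsPT smoothOps GT FT ∧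
            F = Fc + Fa + FT + PPlus smoothOps Hplus + PMinus smoothOps Hminus) ∧
      ∀ G : Smooth Spacetime, IsLorentzInvariant smoothOps G → ∃ H, IsBoxInverse smoothOps G H) ∧
    -- distributions
    ((∀ F : Superfield (ScalarDist Spacetime2), IsInvariant distOps F ↔
        ∃ Gc Ga GT Hplus Hminus : ScalarDist Spacetime,
          IsLorentzInvariant distOps Gc ∧ IsLorentzInvariant distOps Ga ∧
          IsLorentzInvariant distOps GT ∧ IsLorentzInvariant distOps Hplus ∧
          IsLorentzInvariant distOps Hminus ∧
          ∃ Fc Fa FT, IsPc distOps Gc Fc ∧ IsPa distOps Ga Fa ∧ IsPT distOps GT FT ∧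
            F = Fc + Fa + FT + PPlus distOps Hplus + PMinus distOps Hminus) ∧
      ∀ G : ScalarDist Spacetime, IsLorentzInvariant distOps G → ∃ H, IsBoxInverse distOps G H) := by
  exact ⟨⟨good_smoothOps.isInvariant_iff, good_smoothOps.exists_box⟩,
    ⟨good_dist.isInvariant_iff, good_dist.exists_box⟩⟩
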